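/- Let $3\le p<5$. Let $u:\mathbb R^3\times\mathbb R\to\mathbb R$ be a global radial solution of $\partial_t^2u-\Delta u=-|u|^{p-1}u$ with $(u,u_t)\in C(\mathbb R;\dot H^1\times L^2(\mathbb R^3))$, $u\in L^p_{loc}(\mathbb R;L^{2p}(\mathbb R^3))$ (the solution class of the local well-posedness theory) and finite energy $$E=\int_{\mathbb R^3}\Big(\tfrac12|\nabla u|^2+\tfrac12|u_t|^2+\tfrac1{p+1}|u|^{p+1}\Big)dx$$ at time $t=0$. Take the representative of $u$ that is continuous away from $x=0$, and for $r\ge 0$ put $w(r,t)=r\,u(x,t)$, $|x|=r$. Here $w_r+w_t$ and $w_r-w_t$ denote the derivatives of $w$ along the directions $(1,1)$ and $(1,-1)$ of the $(r,t)$ plane. For every $t$ they exist at $(|x|,t)$ for almost every $x\in\mathbb R^3$, with values $u+x\cdot\nabla u\pm|x|u_t$. A polygonal region is a bounded closed region $\Omega$ of the $(r,t)$ plane whose boundary $\Gamma$ consists of finitely many line segments, overlapping at most in endpoints, each parallel to the $t$-axis, the $r$-axis or one of the characteristic lines $t\pm r=0$; $\Gamma$ is oriented counterclockwise, i.e. with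 $\Omega$ on the left. (i) On every segment in $[0,\infty)\times\mathbb R$ of one of these directions that does not lie on the $t$-axis, $w_r+w_t$ exists almost everywhere unless the segment is parallel to $(1,-1)$, $w_r-w_t$ exists almost everywhere unless it is parallel to $(1,1)$, and the line integrals below converge absolutely. (On a segment parallel to $(1,-1)$ the terms $|w_r+w_t|^2$ cancel, and on a segment parallel to $(1,1)$ the terms $|w_r-w_t|^2$ cancel.) (ii) If $\Omega\subset(0,\infty)\times\mathbb R$ is a polygonal region, then $|w|^{p+1}/r^p$ is integrable on $\Omega$ and \begin{align} \pi\int_\Gamma\Big(|w_r+w_t|^2+\tfrac{2}{p+1}\tfrac{|w|^{p+1}}{r^{p-1}}\Big)dr+\Big(|w_r+w_t|^2-\tfrac{2}{p+1}\tfrac{|w|^{p+1}}{r^{p-1}}\Big)dt-\tfrac{2\pi(p-1)}{p+1}\iint_\Omega\tfrac{|w|^{p+1}}{r^p}\,dr\,dt&=0,\tag{1}\\ \pi\int_\Gamma\Big(|w_r-w_t|^2+\tfrac{2}{p+1}\tfrac{|w|^{p+1}}{r^{p-1}}\Big)dr+\Big(-|w_r-w_t|^2+\tfrac{2}{p+1}\tfrac{|w|^{p+1}}{r^{p-1}}\Big)dt+\tfrac{2\pi(p-1)}{p+1}\iint_\Omega\tfrac{|w|^{p+1}}{r^p}\,dr\,dt&=0.\tag{2}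 \end{align} (iii) There is exactly one finite nonnegative Borel measure $\mu$ on $\mathbb R$ with the following three properties. The function $t\mapsto\mu((-\infty,t])$ is continuous. One has $\mu(\mathbb R)\le C_pE$, with a constant $C_p$ depending only on $p$. For every polygonal region $\Omega\subset[0,\infty)\times\mathbb R$ the function $|w|^{p+1}/r^p$ is integrable on $\Omega$ and (1) and (2) hold, where $\pi$ times the line integral along a boundary segment on the $t$-axis from $(0,t_2)$ down to $(0,t_1)$ is understood as $-\pi\int_{t_1}^{t_2}1\,d\mu(t)$ in (1) and as $\pi\int_{t_1}^{t_2}1\,d\mu(t)$ in (2). In particular $\mu$ is determined by $u$ and does not depend on $\Omega$. -/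

import Mathlib

open Set Filter Topology MeasureTheory
open scoped ContDiff

namespace RadialWave

/-- Physical space `ℝ³`. -/
abbrev Space := EuclideanSpace ℝ (Fin 3)

/-- `u : ℝ³ × ℝ → ℝ` is a global radial solution, with finite energy, of the defocusing wave equation
`u_tt - Δ u = -|u|^(p-1) u`. The functions `Du` and `ut` are its spatial gradient and its time
derivative; both are weak derivatives and are determined by `u` up to null sets.

The space `Ḣ¹(ℝ³)` is the space of all functions in `L⁶(ℝ³)` whose weak gradient is in `L²(ℝ³)`.
The solution satisfies `(u, u_t) ∈ C(ℝ; Ḣ¹ × L²)`, it has the local space-time integrability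
`u ∈ L^p_loc(ℝ; L^{2p}(ℝ³))` of the local well-posedness theory (that is,
`|u|^(p-1) u ∈ L¹_loc(ℝ; L²(ℝ³))`), and its energy at the initial time is finite. A radial function
in `C(ℝ; Ḣ¹)` has a representative that is continuous away from `x = 0`; `u` is this one. -/
structure IsRadialSolution (p : ℝ) (u : Space → ℝ → ℝ) (Du : Space → ℝ → Space)
    (ut : Space → ℝ → ℝ) : Prop where
  radial : ∀ (t : ℝ) (x y : Space), ‖x‖ = ‖y‖ → u x t = u y t
  continuousOn : ContinuousOn (fun z : Space × ℝ => u z.1 z.2) {z | z.1 ≠ 0}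
  memLp_six : ∀ t, MemLp (fun x => u x t) 6 volume
  memLp_gradient : ∀ t, MemLp (fun x => Du x t) 2 volume
  memLp_timeDeriv : ∀ t, MemLp (fun x => ut x t) 2 volume
  weak_gradient : ∀ (t : ℝ) (φ : Space → ℝ), ContDiff ℝ ∞ φ → HasCompactSupport φ → ∀ e : Space,
    ∫ x, u x t * fderiv ℝ φ x e = - ∫ x, inner ℝ (Du x t) e * φ x
  weak_timeDeriv : ∀ φ : Space × ℝ → ℝ, ContDiff ℝ ∞ φ → HasCompactSupport φ →
    ∫ t, ∫ x, u x t * fderiv ℝ φ (x, t) (0, 1) = - ∫ t, ∫ x, ut x t * φ (x, t)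
  continuous_gradient : ∀ t,
    Tendsto (fun s => eLpNorm (fun x => Du x s - Du x t) 2 volume) (𝓝 t) (𝓝 0)
  continuous_timeDeriv : ∀ t,
    Tendsto (fun s => eLpNorm (fun x => ut x s - ut x t) 2 volume) (𝓝 t) (𝓝 0)
  strichartz : ∀ T : ℝ,
    ∫⁻ t in Icc (-T) T, eLpNorm (fun x => u x t) (ENNReal.ofReal (2 * p)) volume ^ p < ⊤
  finite_energy : MemLp (fun x => u x 0) (ENNReal.ofReal (p + 1)) volume
  equation : ∀ φ : Space × ℝ → ℝ, ContDiff ℝ ∞ φ → HasCompactSupport φ →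
    ∫ t, ∫ x, (ut x t * fderiv ℝ φ (x, t) (0, 1) - fderiv ℝ φ (x, t) (Du x t, 0)
      - |u x t| ^ (p - 1) * u x t * φ (x, t)) = 0

/-- The conserved energy of a solution, computed at the initial time `t = 0`. -/
noncomputable def energy (p : ℝ) (u : Space → ℝ → ℝ) (Du : Space → ℝ → Space)
    (ut : Space → ℝ → ℝ) : ℝ :=
  ∫ x, (1 / 2 * ‖Du x 0‖ ^ 2 + 1 / 2 * |ut x 0| ^ 2 + 1 / (p + 1) * |u x 0| ^ (p + 1))

/-- `w(r,t) = r u(x,t)` with `|x| = r`. A point of the plane is a pair `(r, t)`. -/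
noncomputable def reduced (u : Space → ℝ → ℝ) (z : ℝ × ℝ) : ℝ :=
  z.1 * u (EuclideanSpace.single 0 z.1) z.2

/-- `w_r + w_t`, as the derivative of `w` along the direction `(1,1)`: unlike `w_r` and `w_t`
separately it is defined almost everywhere on every segment that is not parallel to `(1,-1)`. -/
noncomputable def inwardDeriv (u : Space → ℝ → ℝ) (z : ℝ × ℝ) : ℝ :=
  lineDeriv ℝ (reduced u) z (1, 1)

/-- `w_r - w_t`, as the derivative of `w` along the direction `(1,-1)`. -/
noncomputable def outwardDeriv (u : Space → ℝ → ℝ) (z : ℝ × ℝ) : ℝ :=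
  lineDeriv ℝ (reduced u) z (1, -1)

/-- `2/(p+1) · |w|^(p+1) / r^(p-1)`. -/
noncomputable def potential (p : ℝ) (u : Space → ℝ → ℝ) (z : ℝ × ℝ) : ℝ :=
  2 / (p + 1) * (|reduced u z| ^ (p + 1) / z.1 ^ (p - 1))

/-- The bulk density `|w|^(p+1) / r^p`. -/
noncomputable def bulk (p : ℝ) (u : Space → ℝ → ℝ) (z : ℝ × ℝ) : ℝ :=
  |reduced u z| ^ (p + 1) / z.1 ^ p

/-- The pull-back of the inward form
`(|w_r+w_t|² + 2/(p+1)·|w|^(p+1)/r^(p-1)) dr + (|w_r+w_t|² - 2/(p+1)·|w|^(p+1)/r^(p-1)) dt`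
to the segment from `a` to `b`, parametrised by `s ∈ [0,1]`. -/
noncomputable def inwardForm (p : ℝ) (u : Space → ℝ → ℝ) (a b : ℝ × ℝ) (s : ℝ) : ℝ :=
  (inwardDeriv u (AffineMap.lineMap a b s) ^ 2 + potential p u (AffineMap.lineMap a b s))
      * (b.1 - a.1)
    + (inwardDeriv u (AffineMap.lineMap a b s) ^ 2 - potential p u (AffineMap.lineMap a b s))
      * (b.2 - a.2)

/-- The pull-back of the outward form
`(|w_r-w_t|² + 2/(p+1)·|w|^(p+1)/r^(p-1)) dr + (-|w_r-w_t|² + 2/(p+1)·|w|^(p+1)/r^(p-1)) dt`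
to the segment from `a` to `b`, parametrised by `s ∈ [0,1]`. -/
noncomputable def outwardForm (p : ℝ) (u : Space → ℝ → ℝ) (a b : ℝ × ℝ) (s : ℝ) : ℝ :=
  (outwardDeriv u (AffineMap.lineMap a b s) ^ 2 + potential p u (AffineMap.lineMap a b s))
      * (b.1 - a.1)
    + (-outwardDeriv u (AffineMap.lineMap a b s) ^ 2 + potential p u (AffineMap.lineMap a b s))
      * (b.2 - a.2)

/-- Line integral of the inward form over the oriented segment from `a` to `b`. -/
noncomputable def inwardLine (p : ℝ) (u : Space → ℝ → ℝ) (a b : ℝ × ℝ) : ℝ :=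
  ∫ s in (0 : ℝ)..1, inwardForm p u a b s

/-- Line integral of the outward form over the oriented segment from `a` to `b`. -/
noncomputable def outwardLine (p : ℝ) (u : Space → ℝ → ℝ) (a b : ℝ × ℝ) : ℝ :=
  ∫ s in (0 : ℝ)..1, outwardForm p u a b s

open Classical in
/-- Inward line integral in the closed half plane. On the `t`-axis it is read as the integral of `1`
against `μ`, so that going down from `(0,t₂)` to `(0,t₁)` gives `-∫_{t₁}^{t₂} 1 dμ`. -/
noncomputable def inwardLineAxis (p : ℝ) (u : Space → ℝ → ℝ) (μ : Measure ℝ) (a b : ℝ × ℝ) : ℝ :=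
  if a.1 = 0 ∧ b.1 = 0 then ∫ _ in a.2..b.2, (1 : ℝ) ∂μ else inwardLine p u a b

open Classical in
/-- Outward line integral in the closed half plane. On the `t`-axis, going down from `(0,t₂)` to
`(0,t₁)` gives `+∫_{t₁}^{t₂} 1 dμ`. -/
noncomputable def outwardLineAxis (p : ℝ) (u : Space → ℝ → ℝ) (μ : Measure ℝ) (a b : ℝ × ℝ) : ℝ :=
  if a.1 = 0 ∧ b.1 = 0 then - ∫ _ in a.2..b.2, (1 : ℝ) ∂μ else outwardLine p u a b

/-- The segment from `a` to `b` is non-degenerate and parallel to the `t`-axis, to the `r`-axis or to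
one of the characteristic lines `t + r = 0`, `t - r = 0`. -/
def IsAdmissibleSegment (a b : ℝ × ℝ) : Prop :=
  a ≠ b ∧ (a.1 = b.1 ∨ a.2 = b.2 ∨ a.2 + a.1 = b.2 + b.1 ∨ a.2 - a.1 = b.2 - b.1)

/-- `Ω` is a bounded closed region of the `(r,t)` plane whose boundary consists of the finitely many
admissible oriented segments in `Γ`, which overlap at most in endpoints and are oriented
counterclockwise, that is, with `Ω` on the left. The vector `(-(b.2 - a.2), b.1 - a.1)` is the left
normal of the segment from `a` to `b`. -/
structure IsPolygonalRegion (Ω : Set (ℝ × ℝ)) (Γ : Finset ((ℝ × ℝ) × (ℝ × ℝ))) : Prop where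
  isCompact : IsCompact Ω
  admissible : ∀ e ∈ Γ, IsAdmissibleSegment e.1 e.2
  frontier_eq : frontier Ω = ⋃ e ∈ Γ, segment ℝ e.1 e.2
  disjoint : ∀ e ∈ Γ, ∀ e' ∈ Γ, e ≠ e' →
    Disjoint (openSegment ℝ e.1 e.2) (openSegment ℝ e'.1 e'.2)
  left : ∀ e ∈ Γ, ∀ z ∈ openSegment ℝ e.1 e.2, ∀ᶠ s : ℝ in 𝓝[>] 0,
    z + s • (-(e.2.2 - e.1.2), e.2.1 - e.1.1) ∈ Ω ∧
    z - s • (-(e.2.2 - e.1.2), e.2.1 - e.1.1) ∉ Ω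

end RadialWave

namespace RadialWave

/-! In the characteristic coordinates r = a + b, t = a - b the function w = r u solves ∂_a ∂_b w = N
with N = |w|^(p-1) w / r^(p-1). Put D = w_r + w_t = ∂_a w and V = 2/(p+1) |w|^(p+1) / r^(p-1). On a
line a = const one has ∂_b (D²) = 2 D N. On a line b = const one has ∂_a V = 2 D N - 2(p-1)/(p+1)
|w|^(p+1) / r^p. The form in (1) is D² (dr + dt) + V (dr - dt) = 2 D² da + 2 V db. So each of its
two terms is integrated over Ω along its own family of characteristics; the terms 2 D N cancel and
the bulk term is left. Identity (2) is identity (1) for the time reversed function.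

The work lies in doing this at energy regularity and up to r = 0. Radial weak derivatives and a
Hardy-type identity put w_r and w_t into L²(dr) at each time (`exists_isSlice`). The distributional
equation becomes an exact identity for second differences (`mixed_difference`). Comparing it with
the data on a time slice shows that for almost every a the derivative D exists on the whole line a =
const and satisfies the transport equation there (`hasLineDerivAt_char`, `transport`). The
space-time bound says that N is in L¹ in time with values in L²(dr), locally in time; Minkowski's
inequality turns this into a majorant M(a) of |D| that is locally square integrable and does not
depend on b (`exists_majorant`). Hence D² is integrable on every segment along which a varies, and D
has a limit on the axis, the `trace`.

For V the bound w² ≤ C r gives V ≤ C r^((3-p)/2), which is integrable on segments because p < 5. It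
does not make V vanish on the axis. That follows, for almost every b, from |w| ≤ ∫ M and Lebesgue
differentiation (`tendsto_wavePotential`). The equation for V then controls the bulk term by |D N|,
since V ≥ 0 (`wavePotential_primitive`, `integrableOn_waveBulk_char`).

Polygonal regions are handled slice by slice: along a generic characteristic the indicator of Ω is a
sum of signed steps at the crossed edges (`indicator_slice`). This yields the flux identity in the
closed half plane, where an axis edge contributes the integral of the squared trace
(`IsWave.green`). Both families of characteristics have the same trace, because both represent w at
a point by the integral of the trace plus the integral of N over the same triangle
(`trace_timeReverse`). So μ with density trace(t/2)² serves (1) and (2). Its mass is bounded by the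
identity on triangles standing on t = 0, in which the discarded terms have a sign. The same
triangles determine μ on every interval, which is uniqueness. -/

/-! ### Weak derivatives and absolutely continuous functions on the line -/

/-- A smooth step from `0` to `1` across the interval `(c - ε, c + ε)`. -/
theorem exists_smooth_step (c ε : ℝ) (hε : 0 < ε) :
    ∃ S : ℝ → ℝ, ContDiff ℝ ∞ S ∧ (∀ x, 0 ≤ S x ∧ S x ≤ 1) ∧ (∀ x ≤ c - ε, S x = 0) ∧
      (∀ x, c + ε ≤ x → S x = 1) ∧ (∀ x, 0 ≤ deriv S x) ∧ (∫ x, deriv S x = 1) ∧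
      Continuous (deriv S) ∧ ∀ x, x ∉ Ioo (c - ε) (c + ε) → deriv S x = 0 := by
  let φ : ContDiffBump c := ⟨ε / 2, ε, by positivity, by linarith⟩
  set ψ : ℝ → ℝ := φ.normed volume with hψ
  have hψc : Continuous ψ := φ.continuous_normed
  have hsupp : ∀ x, x ∉ Ioo (c - ε) (c + ε) → ψ x = 0 := by
    intro x hx
    have : x ∉ Function.support ψ := by
      rw [hψ, φ.support_normed_eq, Real.ball_eq_Ioo]; exact hx
    simpa using this
  have hint : ∫ x, ψ x = 1 := φ.integral_normed
  have hnn : ∀ x, 0 ≤ ψ x := fun x => φ.nonneg_normed x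
  have hii : Integrable ψ := φ.integrable_normed
  let S : ℝ → ℝ := fun x => ∫ y in (c - ε)..x, ψ y
  have hd : ∀ x, HasDerivAt S (ψ x) x := fun x =>
    intervalIntegral.integral_hasDerivAt_right (hψc.intervalIntegrable _ _)
      (hψc.stronglyMeasurableAtFilter _ _) hψc.continuousAt
  have hderiv : deriv S = ψ := funext fun x => (hd x).deriv
  have h0 : ∀ x ≤ c - ε, S x = 0 := by
    intro x hx
    apply intervalIntegral.integral_zero_ae
    filter_upwards with y hy
    rw [uIoc_of_ge hx] at hy
    exact hsupp y (fun h => by linarith [h.1, hy.2])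
  have h1 : ∀ x, c + ε ≤ x → S x = 1 := by
    intro x hx
    change ∫ y in (c - ε)..x, ψ y = 1
    rw [← hint, intervalIntegral.integral_of_le (by linarith)]
    refine setIntegral_eq_integral_of_forall_compl_eq_zero fun y hy => hsupp y fun h => hy ?_
    exact ⟨h.1, by linarith [h.2]⟩
  have hmono : Monotone S := monotone_of_deriv_nonneg (fun x => (hd x).differentiableAt)
    (fun x => by rw [hderiv]; exact hnn x)
  refine ⟨S, ?_, fun x => ⟨?_, ?_⟩, h0, h1, fun x => ?_, ?_, ?_, fun x hx => ?_⟩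
  · rw [contDiff_infty_iff_deriv, hderiv]
    exact ⟨fun x => (hd x).differentiableAt, φ.contDiff_normed⟩
  · rw [← h0 (min x (c - ε)) (min_le_right _ _)]; exact hmono (min_le_left _ _)
  · rw [← h1 (max x (c + ε)) (le_max_right _ _)]; exact hmono (le_max_left _ _)
  · rw [hderiv]; exact hnn x
  · rw [hderiv]; exact hint
  · rw [hderiv]; exact hψc
  · rw [hderiv]; exact hsupp x hx

/-- A family of approximate identities `ψ n` concentrating at `c` reproduces the value at `c`. -/
theorem tendsto_integral_mul_approx {F : ℝ → ℝ} {c : ℝ} {ψ : ℕ → ℝ → ℝ} {ε : ℕ → ℝ}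
    (hε : Tendsto ε atTop (𝓝 0)) (hnn : ∀ n x, 0 ≤ ψ n x) (hint : ∀ n, ∫ x, ψ n x = 1)
    (hψ : ∀ n, Continuous (ψ n)) (hsupp : ∀ n x, x ∉ Ioo (c - ε n) (c + ε n) → ψ n x = 0)
    {I : Set ℝ} (hI : I ∈ 𝓝 c) (hF : ContinuousOn F I) :
    Tendsto (fun n => ∫ x, F x * ψ n x) atTop (𝓝 (F c)) := by
  rw [Metric.tendsto_atTop]
  intro η hη
  have hFc : ContinuousAt F c := hF.continuousAt hI
  obtain ⟨δ, hδ, hδI⟩ : ∃ δ > 0, Metric.closedBall c δ ⊆ I ∩ {x | dist (F x) (F c) < η / 2} :=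
    Metric.nhds_basis_closedBall.mem_iff.1
      (Filter.inter_mem hI (hFc (Metric.ball_mem_nhds _ (half_pos hη))))
  obtain ⟨N, hN⟩ := (hε.eventually (gt_mem_nhds hδ)).exists_forall_of_atTop
  refine ⟨N, fun n hn => ?_⟩
  have hεn : ε n < δ := hN n hn
  have hz : ∀ x, x ∉ Metric.closedBall c δ → ψ n x = 0 := by
    intro x hx
    refine hsupp n x fun h => hx ?_
    rw [Real.closedBall_eq_Icc]
    exact ⟨by linarith [h.1], by linarith [h.2]⟩
  -- A non-integrable function has integral 0 by convention, so the normalisation already forces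
  -- integrability.
  have hψint : Integrable (ψ n) := by
    by_contra h
    have := hint n
    rw [integral_undef h] at this
    norm_num at this
  have hFψ : Integrable (fun x => F x * ψ n x) := by
    have : IntegrableOn (fun x => F x * ψ n x) (Metric.closedBall c δ) :=
      ((hF.mono fun x hx => (hδI hx).1).mul (hψ n).continuousOn).integrableOn_compact
        (isCompact_closedBall c δ)
    rw [integrableOn_iff_integrable_of_support_subset] at this
    · exact this
    · intro x hx
      by_contra h
      exact hx (by simp [hz x h])
  have heq : (∫ x, F x * ψ n x) - F c = ∫ x, (F x - F c) * ψ n x := by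
    rw [show (fun x => (F x - F c) * ψ n x) = fun x => F x * ψ n x - F c * ψ n x from
      funext fun x => by ring, integral_sub hFψ (hψint.const_mul _), integral_const_mul, hint, mul_one]
  rw [Real.dist_eq, heq]
  calc |∫ x, (F x - F c) * ψ n x| ≤ ∫ x, η / 2 * ψ n x := by
        rw [← Real.norm_eq_abs]
        refine norm_integral_le_of_norm_le (hψint.const_mul _) (ae_of_all _ fun x => ?_)
        by_cases hx : x ∈ Metric.closedBall c δ
        · rw [norm_mul, Real.norm_of_nonneg (hnn n x)]
          exact mul_le_mul_of_nonneg_right (le_of_lt (hδI hx).2) (hnn n x)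
        · simp [hz x hx]
    _ = η / 2 := by rw [integral_const_mul, hint, mul_one]
    _ < η := by linarith

/-- The test function is the difference of two smooth steps centred at a and b. Its derivative is a
difference of approximate identities and picks out F(a) - F(b), while the function itself tends to
the indicator of (a, b]. -/
theorem du_bois_reymond_of_lt {I : Set ℝ} (hIo : IsOpen I) (hIc : OrdConnected I) {F H : ℝ → ℝ}
    (hF : ContinuousOn F I) (hH : LocallyIntegrableOn H I)
    (h : ∀ θ : ℝ → ℝ, ContDiff ℝ ∞ θ → HasCompactSupport θ → tsupport θ ⊆ I →
      ∫ x, F x * deriv θ x = - ∫ x, H x * θ x) {a b : ℝ} (ha : a ∈ I) (hb : b ∈ I) (hab : a < b) :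
    F b - F a = ∫ x in a..b, H x := by
  obtain ⟨δ1, hδ1, hA⟩ := Metric.nhds_basis_closedBall.mem_iff.1 (hIo.mem_nhds ha)
  obtain ⟨δ2, hδ2, hB⟩ := Metric.nhds_basis_closedBall.mem_iff.1 (hIo.mem_nhds hb)
  rw [Real.closedBall_eq_Icc] at hA hB
  set δ := min δ1 δ2 with hδ
  have hδ0 : 0 < δ := lt_min hδ1 hδ2
  have hsub : Icc (a - δ) (b + δ) ⊆ I :=
    hIc.out (hA ⟨by linarith [min_le_left δ1 δ2], by linarith⟩)
      (hB ⟨by linarith, by linarith [min_le_right δ1 δ2]⟩)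
  let ε : ℕ → ℝ := fun n => δ * (1 / ((n : ℝ) + 1))
  have hε0 : ∀ n, 0 < ε n := fun n => by positivity
  have hεδ : ∀ n, ε n ≤ δ := fun n => by
    have : 1 / ((n : ℝ) + 1) ≤ 1 := by
      rw [div_le_one (by positivity)]; linarith [n.cast_nonneg (α := ℝ)]
    calc ε n ≤ δ * 1 := mul_le_mul_of_nonneg_left this hδ0.le
      _ = δ := mul_one _
  have hεlim : Tendsto ε atTop (𝓝 0) := by
    simpa only [mul_zero] using (tendsto_one_div_add_atTop_nhds_zero_nat (𝕜 := ℝ)).const_mul δ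
  choose A hA1 hA2 hA3 hA4 hA5 hA6 hA7 hA8 using fun n => exists_smooth_step a (ε n) (hε0 n)
  choose B hB1 hB2 hB3 hB4 hB5 hB6 hB7 hB8 using fun n => exists_smooth_step b (ε n) (hε0 n)
  have hlimA := tendsto_integral_mul_approx hεlim hA5 hA6 hA7 hA8 (hIo.mem_nhds ha) hF
  have hlimB := tendsto_integral_mul_approx hεlim hB5 hB6 hB7 hB8 (hIo.mem_nhds hb) hF
  have hz : ∀ n x, x ∉ Icc (a - δ) (b + δ) → A n x - B n x = 0 := by
    intro n x hx
    rcases lt_or_ge x (a - δ) with h1 | h1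
    · rw [hA3 n x (by linarith [hεδ n]), hB3 n x (by linarith [hεδ n]), sub_zero]
    · have h2 : b + δ < x := by by_contra h2; exact hx ⟨h1, not_lt.1 h2⟩
      rw [hA4 n x (by linarith [hεδ n]), hB4 n x (by linarith [hεδ n]), sub_self]
  have hts : ∀ n, tsupport (fun x => A n x - B n x) ⊆ Icc (a - δ) (b + δ) := fun n =>
    closure_minimal (fun x hx => by by_contra h; exact hx (hz n x h)) isClosed_Icc
  have hHint : IntegrableOn H (Icc (a - δ) (b + δ)) :=
    hH.integrableOn_compact_subset hsub isCompact_Icc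
  have hFint : ∀ ψ : ℝ → ℝ, Continuous ψ → (∀ x, x ∉ Icc (a - δ) (b + δ) → ψ x = 0) →
      Integrable (fun x => F x * ψ x) := by
    intro ψ hψ hψ0
    rw [← integrableOn_iff_integrable_of_support_subset (s := Icc (a - δ) (b + δ))]
    · exact ((hF.mono hsub).mul hψ.continuousOn).integrableOn_compact isCompact_Icc
    · intro x hx
      by_contra h
      exact hx (by simp [hψ0 x h])
  have key : ∀ n, (∫ x, F x * deriv (A n) x) - (∫ x, F x * deriv (B n) x)
      = - ∫ x, H x * (A n x - B n x) := by
    intro n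
    rw [← h (fun x => A n x - B n x) ((hA1 n).sub (hB1 n))
      (HasCompactSupport.of_support_subset_isCompact isCompact_Icc
        ((subset_tsupport _).trans (hts n))) ((hts n).trans hsub), ← integral_sub]
    · congr 1; ext x
      rw [← mul_sub]; congr 1
      exact (deriv_fun_sub ((hA1 n).differentiable (by simp) x)
        ((hB1 n).differentiable (by simp) x)).symm
    · exact hFint _ (hA7 n) fun x hx => hA8 n x fun h => hx
        ⟨by linarith [h.1, hεδ n], by linarith [h.2, hεδ n]⟩
    · exact hFint _ (hB7 n) fun x hx => hB8 n x fun h => hx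
        ⟨by linarith [h.1, hεδ n], by linarith [h.2, hεδ n]⟩
  have hlimH : Tendsto (fun n => ∫ x, H x * (A n x - B n x)) atTop
      (𝓝 (∫ x, (Ioc a b).indicator H x)) := by
    refine tendsto_integral_of_dominated_convergence
      (fun x => (Icc (a - δ) (b + δ)).indicator (fun x => ‖H x‖) x) (fun n => ?_) ?_ ?_ ?_
    · have : AEStronglyMeasurable (fun x => (Icc (a - δ) (b + δ)).indicator H x * (A n x - B n x)) :=
        ((aestronglyMeasurable_indicator_iff measurableSet_Icc).2 hHint.aestronglyMeasurable).mul
          ((hA1 n).continuous.sub (hB1 n).continuous).aestronglyMeasurable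
      refine this.congr (ae_of_all _ fun x => ?_)
      by_cases hx : x ∈ Icc (a - δ) (b + δ)
      · simp only [indicator_of_mem hx]
      · simp only [indicator_of_notMem hx, hz n x hx, mul_zero]
    · exact (integrable_indicator_iff measurableSet_Icc).2 hHint.norm
    · intro n
      filter_upwards with x
      by_cases hx : x ∈ Icc (a - δ) (b + δ)
      · rw [indicator_of_mem hx, norm_mul]
        refine mul_le_of_le_one_right (norm_nonneg _) ?_
        rw [Real.norm_eq_abs, abs_le]
        constructor <;> linarith [(hA2 n x).1, (hA2 n x).2, (hB2 n x).1, (hB2 n x).2]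
      · rw [indicator_of_notMem hx, hz n x hx, mul_zero, norm_zero]
    · have hane : ∀ᵐ x : ℝ, x ≠ a ∧ x ≠ b := by
        filter_upwards [compl_mem_ae_iff.2 (measure_singleton a),
          compl_mem_ae_iff.2 (measure_singleton b)] with x h1 h2 using ⟨h1, h2⟩
      filter_upwards [hane] with x hx
      -- Away from its centre a step has reached its final value as soon as its width is smaller
      -- than the distance to the centre.
      have hstep : ∀ (c : ℝ) (S : ℕ → ℝ → ℝ), (∀ n, ∀ x ≤ c - ε n, S n x = 0) →
          (∀ n x, c + ε n ≤ x → S n x = 1) → x ≠ c →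
          ∀ᶠ n in atTop, S n x = if c < x then 1 else 0 := by
        intro c S h0 h1 hxc
        have hpos : 0 < |x - c| := abs_pos.2 (sub_ne_zero.2 hxc)
        filter_upwards [hεlim.eventually (gt_mem_nhds hpos)] with n hn
        split_ifs with hc
        · rw [abs_of_pos (by linarith)] at hn
          exact h1 n x (by linarith)
        · rw [abs_of_nonpos (by linarith)] at hn
          exact h0 n x (by linarith)
      refine tendsto_const_nhds.congr' ?_
      filter_upwards [hstep a A hA3 hA4 hx.1, hstep b B hB3 hB4 hx.2] with n h1 h2
      rw [h1, h2]
      by_cases h3 : a < x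
      · by_cases h4 : b < x
        · rw [indicator_of_notMem (fun h => by linarith [h.2])]; simp [h3, h4]
        · rw [indicator_of_mem (show x ∈ Ioc a b from ⟨h3, not_lt.1 h4⟩)]; simp [h3, h4]
      · have h4 : ¬ b < x := by linarith
        rw [indicator_of_notMem (fun h => h3 h.1)]; simp [h3, h4]
  have hlim := tendsto_nhds_unique (hlimA.sub hlimB) ((hlimH.neg).congr fun n => (key n).symm)
  rw [integral_indicator measurableSet_Ioc, ← intervalIntegral.integral_of_le hab.le] at hlim
  linarith

/-- A continuous function with a locally integrable weak derivative is a primitive of it. -/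
theorem du_bois_reymond {I : Set ℝ} (hIo : IsOpen I) (hIc : OrdConnected I) {F H : ℝ → ℝ}
    (hF : ContinuousOn F I) (hH : LocallyIntegrableOn H I)
    (h : ∀ θ : ℝ → ℝ, ContDiff ℝ ∞ θ → HasCompactSupport θ → tsupport θ ⊆ I →
      ∫ x, F x * deriv θ x = - ∫ x, H x * θ x) {a b : ℝ} (ha : a ∈ I) (hb : b ∈ I) :
    F b - F a = ∫ x in a..b, H x := by
  rcases lt_trichotomy a b with hab | rfl | hab
  · exact du_bois_reymond_of_lt hIo hIc hF hH h ha hb hab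
  · simp
  · rw [intervalIntegral.integral_symm, ← du_bois_reymond_of_lt hIo hIc hF hH h hb ha hab]; ring

theorem AbsolutelyContinuousOnInterval.congr' {F G : ℝ → ℝ} {a b : ℝ}
    (hF : AbsolutelyContinuousOnInterval F a b) (h : ∀ x ∈ uIcc a b, F x = G x) :
    AbsolutelyContinuousOnInterval G a b := by
  rw [absolutelyContinuousOnInterval_iff] at hF ⊢
  intro ε hε
  obtain ⟨δ, hδ, H⟩ := hF ε hε
  refine ⟨δ, hδ, fun E hE hlt => ?_⟩
  refine lt_of_eq_of_lt (Finset.sum_congr rfl fun i hi => ?_) (H E hE hlt)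
  rw [h _ (hE.1 i hi).1, h _ (hE.1 i hi).2]

/-- A primitive of an integrable function is absolutely continuous. -/
theorem absolutelyContinuous_of_integral {F f : ℝ → ℝ} {a b : ℝ} (hf : IntervalIntegrable f volume a b)
    (h : ∀ x ∈ uIcc a b, F x - F a = ∫ y in a..x, f y) : AbsolutelyContinuousOnInterval F a b := by
  have h1 := (hf.absolutelyContinuousOnInterval_intervalIntegral (c := a) left_mem_uIcc)
  have h2 : AbsolutelyContinuousOnInterval (fun _ : ℝ => F a) a b :=
    (LipschitzWith.const (F a)).lipschitzOnWith.absolutelyContinuousOnInterval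
  refine AbsolutelyContinuousOnInterval.congr' (h1.add h2) fun x hx => ?_
  simp only [Pi.add_apply]
  linarith [h x hx]

theorem hasDerivAt_of_integral {F f : ℝ → ℝ} {a b : ℝ} (hf : IntervalIntegrable f volume a b)
    (h : ∀ x ∈ uIcc a b, F x - F a = ∫ y in a..x, f y) :
    ∀ᵐ x, x ∈ Ioo (min a b) (max a b) → HasDerivAt F (f x) x := by
  filter_upwards [hf.ae_hasDerivAt_integral] with x hx hxm
  have h1 := (hx (Ioo_subset_Icc_self hxm) a left_mem_uIcc).add_const (F a)
  refine h1.congr_of_eventuallyEq ?_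
  filter_upwards [isOpen_Ioo.mem_nhds hxm] with y hy
  linarith [h y (Ioo_subset_Icc_self hy)]

theorem AbsolutelyContinuousOnInterval.lipschitz_comp {F φ : ℝ → ℝ} {a b : ℝ} {K : NNReal} {s : Set ℝ}
    (hF : AbsolutelyContinuousOnInterval F a b) (hφ : LipschitzOnWith K φ s)
    (h : ∀ x ∈ uIcc a b, F x ∈ s) : AbsolutelyContinuousOnInterval (fun x => φ (F x)) a b := by
  rw [absolutelyContinuousOnInterval_iff] at hF ⊢
  intro ε hε
  -- Dividing by K + 1 instead of K covers K = 0 and makes the last inequality strict.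
  obtain ⟨δ, hδ, H⟩ := hF (ε / (K + 1)) (by positivity)
  refine ⟨δ, hδ, fun E hE hlt => ?_⟩
  calc _ ≤ ∑ i ∈ Finset.range E.1, K * dist (F (E.2 i).1) (F (E.2 i).2) :=
        Finset.sum_le_sum fun i hi =>
          hφ.dist_le_mul _ (h _ (hE.1 i hi).1) _ (h _ (hE.1 i hi).2)
    _ = K * ∑ i ∈ Finset.range E.1, dist (F (E.2 i).1) (F (E.2 i).2) := by rw [Finset.mul_sum]
    _ ≤ K * (ε / (K + 1)) := by gcongr; exact (H E hE hlt).le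
    _ < (K + 1) * (ε / (K + 1)) := by gcongr; linarith
    _ = ε := by field_simp

/-- Products, squares and Lipschitz images of primitives are absolutely continuous, so below it is
enough to compute their derivatives almost everywhere. -/
theorem AbsolutelyContinuousOnInterval.ftc {F f : ℝ → ℝ} {a b : ℝ}
    (hF : AbsolutelyContinuousOnInterval F a b)
    (h : ∀ᵐ x, x ∈ Ioo (min a b) (max a b) → HasDerivAt F (f x) x) :
    IntervalIntegrable f volume a b ∧ ∫ x in a..b, f x = F b - F a := by
  have hae : ∀ᵐ x, x ∈ uIoc a b → deriv F x = f x := by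
    filter_upwards [h, compl_mem_ae_iff.2 (measure_singleton (max a b))] with x hx hne hxm
    exact (hx ⟨hxm.1, lt_of_le_of_ne hxm.2 hne⟩).deriv
  constructor
  · refine hF.intervalIntegrable_deriv.congr_ae ?_
    exact (ae_restrict_iff' measurableSet_uIoc).2 hae
  · rw [← hF.integral_deriv_eq_sub]
    exact (intervalIntegral.integral_congr_ae hae).symm

/-- Integration by parts of a primitive against a `C¹` function. -/
theorem integral_mul_deriv_of_integral {F f ρ ρ' : ℝ → ℝ} {a b : ℝ}
    (hf : IntervalIntegrable f volume a b) (h : ∀ x ∈ uIcc a b, F x - F a = ∫ y in a..x, f y)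
    (hρ : ∀ x, HasDerivAt ρ (ρ' x) x) (hρ' : Continuous ρ') :
    ∫ x in a..b, (f x * ρ x + F x * ρ' x) = F b * ρ b - F a * ρ a := by
  have hρ1 : ContDiff ℝ 1 ρ := by
    rw [contDiff_one_iff_deriv]
    refine ⟨fun x => (hρ x).differentiableAt, ?_⟩
    rwa [show deriv ρ = ρ' from funext fun x => (hρ x).deriv]
  have h1 : AbsolutelyContinuousOnInterval ρ a b := hρ1.contDiffOn.absolutelyContinuousOnInterval
  have h2 := absolutelyContinuous_of_integral hf h
  refine (AbsolutelyContinuousOnInterval.ftc (h2.mul h1) ?_).2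
  filter_upwards [hasDerivAt_of_integral hf h] with x hx hxm
  exact (hx hxm).mul (hρ x)

/-! ### Polar coordinates in ℝ³ -/

/-- The surface measure of the unit sphere of `ℝ³`. -/
noncomputable abbrev surface : Measure (Metric.sphere (0 : Space) 1) := (volume : Measure Space).toSphere

/-- The measure `r² dr` on the half line. -/
noncomputable def radialMeasure : Measure ℝ :=
  (volume.restrict (Ioi 0)).withDensity fun r => ENNReal.ofReal (r ^ 2)

/-- The area of the unit sphere. -/
noncomputable def sphereArea : ℝ := surface.real univ

theorem sphereArea_pos : 0 < sphereArea := by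
  have : surface univ ≠ 0 := by
    rw [Ne, Measure.measure_univ_eq_zero]; exact Measure.toSphere_ne_zero _
  exact ENNReal.toReal_pos this (measure_ne_top _ _)

instance : SFinite radialMeasure := by unfold radialMeasure; infer_instance

theorem measurable_radial_density : Measurable fun r : ℝ => ENNReal.ofReal (r ^ 2) := by fun_prop

/-- The homeomorphism of the punctured space with sphere times half line preserves the measures. The
origin is a null set and `radialMeasure` does not charge r ≤ 0, so both subtypes can be dropped. -/
theorem measurePreserving_polar :
    MeasurePreserving (fun q : Metric.sphere (0 : Space) 1 × ℝ => q.2 • (q.1 : Space))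
      (surface.prod radialMeasure) volume := by
  have h1 := ((volume : Measure Space).measurePreserving_homeomorphUnitSphereProd).symm
    (homeomorphUnitSphereProd Space).toMeasurableEquiv
  have h2 : MeasurePreserving (Subtype.val : ({0}ᶜ : Set Space) → Space)
      ((volume : Measure Space).comap (↑)) volume := by
    have := measurePreserving_subtype_coe (μa := (volume : Measure Space))
      (measurableSet_singleton (0 : Space)).compl
    rwa [restrict_compl_singleton] at this
  have h3 : MeasurePreserving (Subtype.val : Ioi (0 : ℝ) → ℝ)
      (Measure.volumeIoiPow (Module.finrank ℝ Space - 1)) radialMeasure := by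
    refine ⟨measurable_subtype_coe, ?_⟩
    ext s hs
    rw [Measure.map_apply measurable_subtype_coe hs, Measure.volumeIoiPow,
      withDensity_apply _ (measurable_subtype_coe hs), radialMeasure, withDensity_apply _ hs,
      setLIntegral_subtype measurableSet_Ioi _ (fun r : ℝ => ENNReal.ofReal (r ^ (Module.finrank ℝ Space - 1))),
      Subtype.image_preimage_coe, Measure.restrict_restrict hs, inter_comm]
    simp
  have h4 : MeasurePreserving (Prod.map id Subtype.val :
      Metric.sphere (0 : Space) 1 × Ioi (0 : ℝ) → Metric.sphere (0 : Space) 1 × ℝ)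
      (surface.prod (Measure.volumeIoiPow (Module.finrank ℝ Space - 1)))
      (surface.prod radialMeasure) := (MeasurePreserving.id surface).prod h3
  have h5 := h2.comp h1
  refine ⟨by fun_prop, ?_⟩
  rw [← h4.map_eq, Measure.map_map (by fun_prop) h4.measurable, ← h5.map_eq]
  rfl

theorem ae_radialMeasure_iff {Q : ℝ → Prop} :
    (∀ᵐ r ∂radialMeasure, Q r) ↔ ∀ᵐ r ∂(volume.restrict (Ioi (0 : ℝ))), Q r := by
  rw [radialMeasure, ae_withDensity_iff measurable_radial_density]
  constructor
  · intro h
    filter_upwards [h, ae_restrict_mem measurableSet_Ioi] with r hr hr0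
    exact hr (by simpa using (pow_pos (mem_Ioi.1 hr0) 2).ne')
  · intro h; filter_upwards [h] with r hr _ using hr

theorem norm_smul_sphere {r : ℝ} (hr : 0 < r) (e : Metric.sphere (0 : Space) 1) :
    ‖r • (e : Space)‖ = r := by
  rw [norm_smul, norm_eq_of_mem_sphere, mul_one, Real.norm_of_nonneg hr.le]

theorem ae_polar {Q : Space → Prop} (h : ∀ᵐ x, Q x) :
    ∀ᵐ q ∂(surface.prod (volume.restrict (Ioi (0 : ℝ)))), Q (q.2 • (q.1 : Space)) := by
  have h1 := measurePreserving_polar.quasiMeasurePreserving.ae h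
  have h2 : surface.prod (volume.restrict (Ioi (0 : ℝ))) ≪ surface.prod radialMeasure := by
    refine Measure.AbsolutelyContinuous.prod Measure.AbsolutelyContinuous.rfl ?_
    intro s hs
    rw [← compl_compl s, ← mem_ae_iff] at hs ⊢
    exact ae_radialMeasure_iff.1 hs
  exact h2.ae_le h1

/-- By Fubini some single direction is good for almost every radius; conversely a measurable null
set of radii pulls back to a null set under polar coordinates. Passing to a measurable null superset
removes any measurability condition on Q. -/
theorem ae_norm_iff {Q : ℝ → Prop} :
    (∀ᵐ x : Space, Q ‖x‖) ↔ ∀ᵐ r ∂(volume.restrict (Ioi (0 : ℝ))), Q r := by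
  constructor
  · intro h
    have h1 := Measure.ae_ae_of_ae_prod (ae_polar h)
    have : (ae surface).NeBot := ae_neBot.2 (Measure.toSphere_ne_zero _)
    obtain ⟨e, he⟩ := h1.exists
    filter_upwards [he, ae_restrict_mem measurableSet_Ioi] with r hr hr0
    rwa [norm_smul_sphere hr0] at hr
  · intro h
    rw [ae_iff]
    obtain ⟨t, ht, htm, ht0⟩ := exists_measurable_superset_of_null
      ((ae_iff.1 (ae_radialMeasure_iff.2 ((ae_restrict_mem measurableSet_Ioi).and h)) :
        radialMeasure {r | ¬ (r ∈ Ioi (0 : ℝ) ∧ Q r)} = 0))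
    refine measure_mono_null (t := norm ⁻¹' t) (fun x hx => ht fun h => hx h.2) ?_
    rw [← measurePreserving_polar.measure_preimage (measurable_norm htm).nullMeasurableSet]
    refine measure_mono_null (t := Prod.snd ⁻¹' (t ∪ Iic 0)) ?_ ?_
    · intro q hq
      by_cases h0 : q.2 ≤ 0
      · exact Or.inr h0
      · refine Or.inl ?_
        have : ‖q.2 • (q.1 : Space)‖ ∈ t := hq
        rwa [norm_smul_sphere (not_le.1 h0)] at this
    · refine Measure.quasiMeasurePreserving_snd.preimage_null ?_
      refine measure_union_null ht0 ?_
      have := ae_radialMeasure_iff.2 (ae_restrict_mem (μ := volume) (measurableSet_Ioi (a := (0 : ℝ))))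
      rw [ae_iff] at this
      simp only [mem_Ioi, not_lt] at this
      exact this

theorem lintegral_polar {F : Space → ENNReal} (hF : AEMeasurable F) :
    ∫⁻ x, F x = ∫⁻ q, ENNReal.ofReal (q.2 ^ 2) * F (q.2 • (q.1 : Space))
      ∂(surface.prod (volume.restrict (Ioi (0 : ℝ)))) := by
  rw [← measurePreserving_polar.map_eq] at hF 
  conv_lhs => rw [← measurePreserving_polar.map_eq]
  rw [lintegral_map' hF measurePreserving_polar.aemeasurable, radialMeasure,
    prod_withDensity_right measurable_radial_density]
  have : AEMeasurable (fun q : Metric.sphere (0 : Space) 1 × ℝ => F (q.2 • (q.1 : Space)))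
      (surface.prod (volume.restrict (Ioi (0 : ℝ)))) := by
    have h2 : surface.prod (volume.restrict (Ioi (0 : ℝ))) ≪ surface.prod radialMeasure := by
      refine Measure.AbsolutelyContinuous.prod Measure.AbsolutelyContinuous.rfl ?_
      intro s hs
      rw [← compl_compl s, ← mem_ae_iff] at hs ⊢
      exact ae_radialMeasure_iff.1 hs
    exact (hF.comp_aemeasurable measurePreserving_polar.aemeasurable).mono_ac h2
  rw [lintegral_withDensity_eq_lintegral_mul₀ (by fun_prop) this]
  rfl

theorem lintegral_norm {φ : ℝ → ENNReal} (hφ : Measurable φ) :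
    ∫⁻ x : Space, φ ‖x‖ = ENNReal.ofReal sphereArea *
      ∫⁻ r in Ioi (0 : ℝ), ENNReal.ofReal (r ^ 2) * φ r := by
  rw [lintegral_polar (by fun_prop), lintegral_prod _ (by fun_prop), sphereArea, ofReal_measureReal, mul_comm,
    ← lintegral_const]
  refine lintegral_congr fun e => ?_
  refine setLIntegral_congr_fun measurableSet_Ioi fun r hr => ?_
  simp only [norm_smul_sphere hr]

theorem integrable_polar {F : Space → ℝ} (hF : Integrable F) :
    Integrable (fun q : Metric.sphere (0 : Space) 1 × ℝ => q.2 ^ 2 * F (q.2 • (q.1 : Space)))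
      (surface.prod (volume.restrict (Ioi (0 : ℝ)))) := by
  have h1 := measurePreserving_polar.integrable_comp_of_integrable hF
  rw [radialMeasure, prod_withDensity_right measurable_radial_density,
    integrable_withDensity_iff_integrable_smul' (by fun_prop) (by simp)] at h1
  refine h1.congr (ae_of_all _ fun q => ?_)
  simp [Function.comp, ENNReal.toReal_ofReal (sq_nonneg q.2)]

theorem integral_polar {F : Space → ℝ} (hF : Integrable F) :
    ∫ x, F x = ∫ q, q.2 ^ 2 * F (q.2 • (q.1 : Space))
      ∂(surface.prod (volume.restrict (Ioi (0 : ℝ)))) := by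
  have h : AEStronglyMeasurable F (Measure.map
      (fun q : Metric.sphere (0 : Space) 1 × ℝ => q.2 • (q.1 : Space)) (surface.prod radialMeasure)) := by
    rw [measurePreserving_polar.map_eq]; exact hF.aestronglyMeasurable
  conv_lhs => rw [← measurePreserving_polar.map_eq]
  rw [integral_map measurePreserving_polar.aemeasurable h, radialMeasure,
    prod_withDensity_right measurable_radial_density,
    integral_withDensity_eq_integral_toReal_smul (by fun_prop) (by simp)]
  refine integral_congr_ae (ae_of_all _ fun q => ?_)
  simp [ENNReal.toReal_ofReal (sq_nonneg q.2)]

theorem integrable_norm_iff {f : ℝ → ℝ} :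
    Integrable (fun x : Space => f ‖x‖) ↔ IntegrableOn (fun r => r ^ 2 * f r) (Ioi 0) := by
  rw [integrable_fun_norm_addHaar]; simp

theorem integral_norm (f : ℝ → ℝ) :
    ∫ x : Space, f ‖x‖ = sphereArea * ∫ r in Ioi (0 : ℝ), r ^ 2 * f r := by
  rw [integral_fun_norm_addHaar, sphereArea, Measure.toSphere_real_apply_univ]
  simp [mul_assoc]

/-! ### Radial test functions -/

theorem ae_ne_zero_space : ∀ᵐ x : Space, x ≠ 0 := compl_mem_ae_iff.2 (measure_singleton 0)

/-- The second factor matters only near the support of the first. This allows test functions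
supported in r > 0 to be divided by powers of r. -/
theorem contDiff_mul_of_tsupport {E : Type*} [NormedAddCommGroup E] [NormedSpace ℝ E] {k h : E → ℝ}
    {U : Set E} (hk : ContDiff ℝ ∞ k) (hU : tsupport k ⊆ U) (hh : ∀ x ∈ U, ContDiffAt ℝ ∞ h x) :
    ContDiff ℝ ∞ fun x => k x * h x := by
  rw [contDiff_iff_contDiffAt]
  intro x
  by_cases hx : x ∈ tsupport k
  · exact hk.contDiffAt.mul (hh x (hU hx))
  · refine (contDiffAt_const (c := (0 : ℝ))).congr_of_eventuallyEq ?_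
    filter_upwards [notMem_tsupport_iff_eventuallyEq.1 hx] with y hy
    simp [hy]

theorem tsupport_mul_subset {E : Type*} [TopologicalSpace E] (k h : E → ℝ) :
    tsupport (fun x => k x * h x) ⊆ tsupport k :=
  closure_mono fun x hx h0 => hx (by simp [h0])

theorem hasFDerivAt_norm_space {x : Space} (hx : x ≠ 0) :
    HasFDerivAt (fun y : Space => ‖y‖) (‖x‖⁻¹ • innerSL ℝ x) x := by
  have h1 : ‖x‖ ^ 2 ≠ 0 := by positivity
  have h2 := (hasStrictFDerivAt_norm_sq x).hasFDerivAt.sqrt h1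
  have h3 : (fun y : Space => √(‖y‖ ^ 2)) = fun y => ‖y‖ := funext fun y => Real.sqrt_sq (norm_nonneg y)
  rw [h3] at h2
  convert! h2 using 1
  rw [Real.sqrt_sq (norm_nonneg x)]
  ext v
  simp
  field_simp

section Static

variable {k : ℝ → ℝ}

theorem radial_test_contDiff (hk : ContDiff ℝ ∞ k) (hs : tsupport k ⊆ Ioi 0) :
    ContDiff ℝ ∞ fun x : Space => k ‖x‖ := by
  rw [contDiff_iff_contDiffAt]
  intro x
  by_cases hx : x = 0
  · subst hx
    have h0 : (0 : ℝ) ∉ tsupport k := fun h => lt_irrefl (0 : ℝ) (hs h)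
    refine (contDiffAt_const (c := (0 : ℝ))).congr_of_eventuallyEq ?_
    have : Tendsto (fun y : Space => ‖y‖) (𝓝 0) (𝓝 0) := by
      simpa using (continuous_norm (E := Space)).tendsto 0
    exact this.eventually (notMem_tsupport_iff_eventuallyEq.1 h0)
  · exact hk.contDiffAt.comp x (contDiffAt_norm ℝ hx)

theorem radial_test_hasCompactSupport (hc : HasCompactSupport k) :
    HasCompactSupport fun x : Space => k ‖x‖ := by
  obtain ⟨R, hR⟩ := hc.isCompact.isBounded.subset_closedBall 0
  refine HasCompactSupport.of_support_subset_isCompact (isCompact_closedBall (0 : Space) R) ?_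
  intro x hx
  have := hR (subset_tsupport _ (show ‖x‖ ∈ Function.support k from hx))
  simpa using this

theorem radial_test_fderiv (hk : ContDiff ℝ ∞ k) {x : Space} (hx : x ≠ 0) (v : Space) :
    fderiv ℝ (fun x : Space => k ‖x‖) x v = deriv k ‖x‖ * (‖x‖⁻¹ * inner ℝ x v) := by
  have h1 : HasDerivAt k (deriv k ‖x‖) ‖x‖ := (hk.differentiable (by simp) _).hasDerivAt
  have h2 := h1.comp_hasFDerivAt x (hasFDerivAt_norm_space hx)
  have h3 : fderiv ℝ (fun x : Space => k ‖x‖) x = _ := h2.fderiv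
  rw [h3]; simp

end Static

section SpaceTime

variable {k : ℝ × ℝ → ℝ}

theorem radialTime_test_contDiff (hk : ContDiff ℝ ∞ k) (hs : tsupport k ⊆ {z | 0 < z.1}) :
    ContDiff ℝ ∞ fun z : Space × ℝ => k (‖z.1‖, z.2) := by
  rw [contDiff_iff_contDiffAt]
  rintro ⟨x, t⟩
  by_cases hx : x = 0
  · subst hx
    have h0 : ((0 : ℝ), t) ∉ tsupport k := fun h => lt_irrefl (0 : ℝ) (hs h)
    refine (contDiffAt_const (c := (0 : ℝ))).congr_of_eventuallyEq ?_
    have : Tendsto (fun z : Space × ℝ => (‖z.1‖, z.2)) (𝓝 (0, t)) (𝓝 (0, t)) := by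
      have : Continuous (fun z : Space × ℝ => (‖z.1‖, z.2)) := by fun_prop
      simpa using this.tendsto (0, t)
    exact this.eventually (notMem_tsupport_iff_eventuallyEq.1 h0)
  · refine hk.contDiffAt.comp (x, t) (ContDiffAt.prodMk ?_ contDiffAt_snd)
    exact (contDiffAt_norm ℝ hx).comp (x, t) contDiffAt_fst

theorem radialTime_test_hasCompactSupport (hc : HasCompactSupport k) :
    HasCompactSupport fun z : Space × ℝ => k (‖z.1‖, z.2) := by
  obtain ⟨R, hR⟩ := hc.isCompact.isBounded.subset_closedBall 0
  refine HasCompactSupport.of_support_subset_isCompact (isCompact_closedBall (0 : Space × ℝ) R) ?_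
  rintro ⟨x, t⟩ hx
  have := hR (subset_tsupport _ (show (‖x‖, t) ∈ Function.support k from hx))
  simpa [Prod.norm_def] using this

theorem radialTime_test_hasFDerivAt (hk : ContDiff ℝ ∞ k) {x : Space} (hx : x ≠ 0) (t : ℝ) :
    HasFDerivAt (fun z : Space × ℝ => k (‖z.1‖, z.2))
      ((fderiv ℝ k (‖x‖, t)).comp (((‖x‖⁻¹ • innerSL ℝ x).comp
        (ContinuousLinearMap.fst ℝ Space ℝ)).prod (ContinuousLinearMap.snd ℝ Space ℝ))) (x, t) := by
  have h1 : HasFDerivAt k (fderiv ℝ k (‖x‖, t)) (‖x‖, t) :=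
    (hk.differentiable (by simp) _).hasFDerivAt
  have h2 : HasFDerivAt (fun z : Space × ℝ => (‖z.1‖, z.2))
      (((‖x‖⁻¹ • innerSL ℝ x).comp (ContinuousLinearMap.fst ℝ Space ℝ)).prod
        (ContinuousLinearMap.snd ℝ Space ℝ)) (x, t) :=
    HasFDerivAt.prodMk ((hasFDerivAt_norm_space hx).comp (x, t) hasFDerivAt_fst) hasFDerivAt_snd
  exact h1.comp (x, t) h2

theorem radialTime_test_fderiv_time (hk : ContDiff ℝ ∞ k) {x : Space} (hx : x ≠ 0) (t : ℝ) :
    fderiv ℝ (fun z : Space × ℝ => k (‖z.1‖, z.2)) (x, t) (0, 1) = fderiv ℝ k (‖x‖, t) (0, 1) := by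
  rw [(radialTime_test_hasFDerivAt hk hx t).fderiv]; simp

theorem radialTime_test_fderiv_space (hk : ContDiff ℝ ∞ k) {x : Space} (hx : x ≠ 0) (t : ℝ) (v : Space) :
    fderiv ℝ (fun z : Space × ℝ => k (‖z.1‖, z.2)) (x, t) (v, 0)
      = fderiv ℝ k (‖x‖, t) (1, 0) * (‖x‖⁻¹ * inner ℝ x v) := by
  rw [(radialTime_test_hasFDerivAt hk hx t).fderiv]
  have : ((‖x‖⁻¹ * inner ℝ x v, 0) : ℝ × ℝ) = (‖x‖⁻¹ * inner ℝ x v) • ((1, 0) : ℝ × ℝ) := by simp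
  simp only [ContinuousLinearMap.comp_apply, ContinuousLinearMap.prod_apply,
    ContinuousLinearMap.coe_fst', ContinuousLinearMap.coe_snd', smul_apply,
    innerSL_apply_apply, smul_eq_mul, this, map_smul]
  ring

end SpaceTime

/-! ### The weak gradient of a radial function -/

theorem MemLp.mul_integrable_of_compact {f φ : Space → ℝ} (hf : LocallyIntegrable f)
    (hφ : Continuous φ) (hc : HasCompactSupport φ) : Integrable fun x => f x * φ x := by
  simpa [mul_comm] using hf.integrable_smul_left_of_hasCompactSupport hφ hc

/-- The weak gradient tested against the radial vector field `η(x) x`. -/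
theorem weak_radial_identity {F : Space → ℝ} {D : Space → Space} (hF : LocallyIntegrable F)
    (hD : LocallyIntegrable D)
    (hw : ∀ φ : Space → ℝ, ContDiff ℝ ∞ φ → HasCompactSupport φ → ∀ e : Space,
      ∫ x, F x * fderiv ℝ φ x e = - ∫ x, inner ℝ (D x) e * φ x)
    {η : Space → ℝ} (hη : ContDiff ℝ ∞ η) (hc : HasCompactSupport η) :
    ∫ x, F x * (3 * η x + fderiv ℝ η x x) = - ∫ x, inner ℝ (D x) x * η x := by
  let e : Fin 3 → Space := fun i => EuclideanSpace.basisFun (Fin 3) ℝ i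
  have hsum : ∀ x : Space, ∑ i, (inner ℝ (e i) x) • e i = x := fun x =>
    (EuclideanSpace.basisFun (Fin 3) ℝ).sum_repr' x
  -- The test functions x_i η in the directions e_i are the components of the field η x. Summing
  -- over i produces its divergence 3 η + x·∇η.
  have hφ : ∀ i, ContDiff ℝ ∞ fun x : Space => inner ℝ (e i) x * η x := fun i =>
    (innerSL ℝ (e i)).contDiff.mul hη
  have hφc : ∀ i, HasCompactSupport fun x : Space => inner ℝ (e i) x * η x := fun i => hc.mul_left
  have hfd : ∀ i x, fderiv ℝ (fun x : Space => inner ℝ (e i) x * η x) x (e i)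
      = η x + inner ℝ (e i) x * fderiv ℝ η x (e i) := by
    intro i x
    have h1 : HasFDerivAt (fun x : Space => inner ℝ (e i) x) (innerSL ℝ (e i)) x :=
      (innerSL ℝ (e i)).hasFDerivAt
    have h2 := h1.mul (hη.differentiable (by simp) x).hasFDerivAt
    have h3 : inner ℝ (e i) (e i) = (1 : ℝ) := by
      rw [real_inner_self_eq_norm_sq]; simp [e]
    have h4 : fderiv ℝ (fun x : Space => inner ℝ (e i) x * η x) x = _ := h2.fderiv
    rw [h4]
    simp only [add_apply, smul_apply, innerSL_apply_apply, h3,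
      smul_eq_mul]
    ring
  have hL : ∀ x, F x * (3 * η x + fderiv ℝ η x x)
      = ∑ i, F x * fderiv ℝ (fun x : Space => inner ℝ (e i) x * η x) x (e i) := by
    intro x
    rw [← Finset.mul_sum]
    congr 1
    simp only [hfd, Finset.sum_add_distrib]
    conv_lhs => rw [← hsum x]
    rw [map_sum]
    simp only [map_smul, smul_eq_mul, hsum]
    simp
  have hR : ∀ x, inner ℝ (D x) x * η x = ∑ i, inner ℝ (D x) (e i) * (inner ℝ (e i) x * η x) := by
    intro x
    conv_lhs => rw [← hsum x]
    rw [inner_sum, Finset.sum_mul]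
    refine Finset.sum_congr rfl fun i _ => ?_
    rw [real_inner_smul_right, hsum]; ring
  simp only [hL, hR]
  rw [integral_finsetSum, integral_finsetSum, ← Finset.sum_neg_distrib]
  · exact Finset.sum_congr rfl fun i _ => hw _ (hφ i) (hφc i) (e i)
  · intro i _
    refine MemLp.mul_integrable_of_compact ?_ (hφ i).continuous (hφc i)
    exact fun x => let ⟨s, hs, hi⟩ := hD x; ⟨s, hs, hi.inner_const _⟩
  · intro i _
    refine MemLp.mul_integrable_of_compact hF ?_ ?_
    · exact ((hφ i).continuous_fderiv (by simp)).clm_apply continuous_const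
    · exact (hφc i).fderiv_apply (𝕜 := ℝ) _

theorem exists_annulus_of_compact {K : Set Space} (hK : IsCompact K) (h0 : (0 : Space) ∉ K) :
    ∃ a b : ℝ, 0 < a ∧ a < b ∧ ∀ x ∈ K, a < ‖x‖ ∧ ‖x‖ < b := by
  rcases K.eq_empty_or_nonempty with h | h
  · exact ⟨1, 2, by norm_num, by norm_num, by simp [h]⟩
  · obtain ⟨y, hy, hmin⟩ := hK.exists_isMinOn h continuous_norm.continuousOn
    obtain ⟨z, hz, hmax⟩ := hK.exists_isMaxOn h continuous_norm.continuousOn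
    have hy0 : 0 < ‖y‖ := norm_pos_iff.2 fun h => h0 (h ▸ hy)
    have hyz : ‖y‖ ≤ ‖z‖ := hmin hz
    refine ⟨‖y‖ / 2, ‖z‖ + 1, by positivity, by linarith, fun x hx => ⟨?_, ?_⟩⟩
    · have : ‖y‖ ≤ ‖x‖ := hmin hx
      linarith
    · have : ‖x‖ ≤ ‖z‖ := hmax hx
      linarith

section

variable {D : Space → Space}

/-- The factor |x|⁻³ cancels the weight r² and the length of the vector r e. It is bounded for |x| ≥
a, so local integrability of D is enough. -/
theorem integrableOn_radialComponent (hD : LocallyIntegrable D) {a b : ℝ} (ha : 0 < a) :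
    IntegrableOn (fun q : Metric.sphere (0 : Space) 1 × ℝ => inner ℝ (D (q.2 • (q.1 : Space))) (q.1 : Space))
      (univ ×ˢ Icc a b) (surface.prod (volume.restrict (Ioi (0 : ℝ)))) := by
  set N : Space → ℝ := {x : Space | a ≤ ‖x‖ ∧ ‖x‖ ≤ b}.indicator
    (fun x => inner ℝ (D x) x * (‖x‖ ^ 3)⁻¹) with hN
  have hms : MeasurableSet {x : Space | a ≤ ‖x‖ ∧ ‖x‖ ≤ b} :=
    (measurableSet_le measurable_const measurable_norm).inter
      (measurableSet_le measurable_norm measurable_const)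
  have hNi : Integrable N := by
    rw [hN, integrable_indicator_iff hms]
    have hDi : IntegrableOn (fun x => (a ^ 2)⁻¹ * ‖D x‖) {x : Space | a ≤ ‖x‖ ∧ ‖x‖ ≤ b} := by
      refine Integrable.const_mul ?_ _
      have := hD.integrableOn_isCompact (isCompact_closedBall (0 : Space) b)
      exact (this.mono_set fun x hx => by simpa using hx.2).norm
    refine hDi.mono' ?_ ?_
    · refine AEStronglyMeasurable.mul ?_ (by fun_prop)
      exact (hD.aestronglyMeasurable.inner aestronglyMeasurable_id).restrict
    · filter_upwards [ae_restrict_mem hms] with x hx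
      have hx0 : 0 < ‖x‖ := ha.trans_le hx.1
      rw [norm_mul, norm_inv, norm_pow, norm_norm]
      calc ‖inner ℝ (D x) x‖ * (‖x‖ ^ 3)⁻¹ ≤ (‖D x‖ * ‖x‖) * (‖x‖ ^ 3)⁻¹ := by
            gcongr; exact norm_inner_le_norm _ _
        _ = (‖x‖ ^ 2)⁻¹ * ‖D x‖ := by field_simp
        _ ≤ (a ^ 2)⁻¹ * ‖D x‖ := by gcongr; exact hx.1
  rw [← integrable_indicator_iff (MeasurableSet.univ.prod measurableSet_Icc)]
  refine (integrable_polar hNi).congr ?_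
  have : ∀ᵐ q : Metric.sphere (0 : Space) 1 × ℝ ∂(surface.prod (volume.restrict (Ioi (0 : ℝ)))), 0 < q.2 :=
    Measure.quasiMeasurePreserving_snd.ae (ae_restrict_mem measurableSet_Ioi)
  filter_upwards [this] with q hq
  by_cases hm : q.2 ∈ Icc a b
  · rw [indicator_of_mem (show q ∈ univ ×ˢ Icc a b from ⟨mem_univ _, hm⟩), hN, indicator_of_mem]
    · rw [norm_smul_sphere hq, real_inner_smul_right]; field_simp
    · simp only [mem_ofPred_eq, norm_smul_sphere hq]; exact hm
  · rw [indicator_of_notMem (fun h => hm h.2), hN, indicator_of_notMem, mul_zero]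
    simp only [mem_ofPred_eq, norm_smul_sphere hq]; exact hm

/-- The spherical mean of the radial component of `D`. -/
noncomputable def radialMean (D : Space → Space) (r : ℝ) : ℝ :=
  sphereArea⁻¹ * ∫ e : Metric.sphere (0 : Space) 1, inner ℝ (D (r • (e : Space))) (e : Space) ∂surface

theorem integrableOn_radialMean (hD : LocallyIntegrable D) {a b : ℝ} (ha : 0 < a) :
    IntegrableOn (radialMean D) (Icc a b) := by
  have h1 := integrableOn_radialComponent hD (b := b) ha
  rw [IntegrableOn, ← Measure.prod_restrict, Measure.restrict_univ,
    Measure.restrict_restrict measurableSet_Icc, inter_eq_left.2 (show Icc a b ⊆ Ioi 0 from fun x hx => ha.trans_le hx.1)] at h1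
  exact h1.integral_prod_right.const_mul _

theorem locallyIntegrableOn_radialMean (hD : LocallyIntegrable D) :
    LocallyIntegrableOn (radialMean D) (Ioi 0) := by
  intro x hx
  have hx : 0 < x := hx
  exact ⟨Icc (x / 2) (2 * x), mem_nhdsWithin_of_mem_nhds (Icc_mem_nhds (by linarith) (by linarith)),
    integrableOn_radialMean hD (by positivity)⟩

theorem integrable_inner_mul (hD : LocallyIntegrable D) {η : Space → ℝ} (hη : Continuous η)
    (hc : HasCompactSupport η) : Integrable fun x => inner ℝ (D x) x * η x := by
  have h1 : Integrable fun x => ‖D x‖ * (‖x‖ * |η x|) := by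
    refine MemLp.mul_integrable_of_compact (fun x => let ⟨s, hs, hi⟩ := hD x; ⟨s, hs, hi.norm⟩) (by fun_prop) ?_
    exact HasCompactSupport.mul_left (hc.comp_left abs_zero)
  refine h1.mono' ((hD.aestronglyMeasurable.inner aestronglyMeasurable_id).mul
    hη.aestronglyMeasurable) (ae_of_all _ fun x => ?_)
  rw [norm_mul, ← mul_assoc, Real.norm_eq_abs (η x)]
  gcongr
  exact norm_inner_le_norm _ _

/-- The field θ(|x|) |x|⁻³ x has divergence θ'(|x|) / |x|². In polar coordinates the weights cancel,
the weak gradient becomes a one-dimensional weak derivative equal to the spherical mean, and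
`du_bois_reymond` applies. -/
theorem radial_profile_primitive {f : ℝ → ℝ} (hf : ContinuousOn f (Ioi 0))
    (hF : LocallyIntegrable fun x : Space => f ‖x‖) (hD : LocallyIntegrable D)
    (hw : ∀ φ : Space → ℝ, ContDiff ℝ ∞ φ → HasCompactSupport φ → ∀ e : Space,
      ∫ x, f ‖x‖ * fderiv ℝ φ x e = - ∫ x, inner ℝ (D x) e * φ x) {a b : ℝ} (ha : 0 < a) (hb : 0 < b) :
    f b - f a = ∫ r in a..b, radialMean D r := by
  refine du_bois_reymond isOpen_Ioi ordConnected_Ioi hf (locallyIntegrableOn_radialMean hD) ?_ ha hb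
  intro θ hθ hc hs
  set k : ℝ → ℝ := fun r => θ r * (r ^ 3)⁻¹ with hk
  have hk1 : ContDiff ℝ ∞ k := contDiff_mul_of_tsupport hθ hs fun x hx =>
    (contDiff_id.pow 3).contDiffAt.inv (pow_ne_zero 3 (ne_of_gt hx))
  have hks : tsupport k ⊆ tsupport θ := tsupport_mul_subset _ _
  have hkc : HasCompactSupport k := hc.mul_right
  have hη := radial_test_contDiff hk1 (hks.trans hs)
  have hηc := radial_test_hasCompactSupport hkc
  have key := weak_radial_identity hF hD hw hη hηc
  have hL : ∫ x : Space, f ‖x‖ * (3 * k ‖x‖ + fderiv ℝ (fun x : Space => k ‖x‖) x x)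
      = sphereArea * ∫ r, f r * deriv θ r := by
    rw [← setIntegral_eq_integral_of_forall_compl_eq_zero (s := Ioi (0 : ℝ)) (f := fun r => f r * deriv θ r)]
    · rw [show (∫ r in Ioi (0 : ℝ), f r * deriv θ r)
        = ∫ r in Ioi (0 : ℝ), r ^ 2 * (f r * deriv θ r * (r ^ 2)⁻¹) from
        setIntegral_congr_fun measurableSet_Ioi fun r hr => by
          have : r ≠ 0 := ne_of_gt hr
          field_simp, ← integral_norm (fun r => f r * deriv θ r * (r ^ 2)⁻¹)]
      refine integral_congr_ae ?_
      filter_upwards [ae_ne_zero_space] with x hx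
      have hx0 : ‖x‖ ≠ 0 := norm_ne_zero_iff.2 hx
      rw [radial_test_fderiv hk1 hx, real_inner_self_eq_norm_sq]
      have h1 : HasDerivAt k (deriv θ ‖x‖ * (‖x‖ ^ 3)⁻¹ + θ ‖x‖ * (-(3 * ‖x‖ ^ 2) / (‖x‖ ^ 3) ^ 2)) ‖x‖ := by
        have h2 := (hθ.differentiable (by simp) ‖x‖).hasDerivAt
        have h3 := ((hasDerivAt_pow 3 ‖x‖).inv (pow_ne_zero 3 hx0))
        have h4 := h2.mul h3
        exact h4.congr_deriv (by simp)
      rw [h1.deriv, hk]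
      field_simp
      ring
    · intro r hr
      have : r ∉ tsupport θ := fun h => hr (hs h)
      have h0 : deriv θ r = 0 := by
        by_contra hne
        exact this (support_deriv_subset hne)
      simp [h0]
  have hR : ∫ x : Space, inner ℝ (D x) x * k ‖x‖ = sphereArea * ∫ r, radialMean D r * θ r := by
    have hi := integrable_inner_mul hD hη.continuous hηc
    have hip := integrable_polar hi
    rw [integral_polar hi]
    have hcongr : (fun q : Metric.sphere (0 : Space) 1 × ℝ => q.2 ^ 2 * (inner ℝ (D (q.2 • (q.1 : Space)))
          (q.2 • (q.1 : Space)) * k ‖q.2 • (q.1 : Space)‖))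
        =ᵐ[surface.prod (volume.restrict (Ioi (0 : ℝ)))]
        fun q => inner ℝ (D (q.2 • (q.1 : Space))) (q.1 : Space) * θ q.2 := by
      have : ∀ᵐ q : Metric.sphere (0 : Space) 1 × ℝ ∂(surface.prod (volume.restrict (Ioi (0 : ℝ)))),
          0 < q.2 := Measure.quasiMeasurePreserving_snd.ae (ae_restrict_mem measurableSet_Ioi)
      filter_upwards [this] with q hq
      rw [norm_smul_sphere hq, real_inner_smul_right, hk]
      field_simp
    rw [integral_congr_ae hcongr, integral_prod_symm _ (hip.congr hcongr),
      ← setIntegral_eq_integral_of_forall_compl_eq_zero (s := Ioi (0 : ℝ)) (f := fun r => radialMean D r * θ r)]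
    · rw [← integral_const_mul]
      refine setIntegral_congr_fun measurableSet_Ioi fun r hr => ?_
      simp only [radialMean]
      rw [integral_mul_const, ← mul_assoc, mul_inv_cancel_left₀ sphereArea_pos.ne']
    · intro r hr
      have : r ∉ tsupport θ := fun h => hr (hs h)
      simp [image_eq_zero_of_notMem_tsupport this]
  rw [hL, hR] at key
  have h0 := sphereArea_pos.ne'
  apply mul_left_cancel₀ h0
  rw [key]; ring

end

/-- The previous lemma sees only a spherical mean. Integration by parts along every single ray shows
that the function on the right has the same integral as ⟨D, x⟩ against each test function vanishing
near the origin, not only against radial ones. So the radial component equals its mean. -/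
theorem ae_inner_eq_radialMean {D : Space → Space} {f : ℝ → ℝ} (hf : ContinuousOn f (Ioi 0))
    (hF : LocallyIntegrable fun x : Space => f ‖x‖) (hD : LocallyIntegrable D)
    (hw : ∀ φ : Space → ℝ, ContDiff ℝ ∞ φ → HasCompactSupport φ → ∀ e : Space,
      ∫ x, f ‖x‖ * fderiv ℝ φ x e = - ∫ x, inner ℝ (D x) e * φ x) :
    ∀ᵐ x : Space, inner ℝ (D x) x = ‖x‖ * radialMean D ‖x‖ := by
  have hGi : ∀ a b : ℝ, 0 < a → Integrable fun x : Space =>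
      (Icc a b).indicator (fun r => r * radialMean D r) ‖x‖ := by
    intro a b ha
    rw [integrable_norm_iff, show (fun r => r ^ 2 * (Icc a b).indicator (fun r => r * radialMean D r) r)
      = (Icc a b).indicator fun r => r ^ 2 * (r * radialMean D r) from by
        ext r; by_cases hr : r ∈ Icc a b <;> simp [hr]]
    refine Integrable.integrableOn ?_
    rw [integrable_indicator_iff measurableSet_Icc]
    refine IntegrableOn.continuousOn_mul (by fun_prop) ?_ isCompact_Icc
    exact IntegrableOn.continuousOn_mul (by fun_prop) (integrableOn_radialMean hD ha) isCompact_Icc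
  have hinner : LocallyIntegrable fun x => inner ℝ (D x) x := by
    rw [locallyIntegrable_iff]
    intro K hK
    obtain ⟨R, hR⟩ := hK.isBounded.subset_closedBall 0
    refine ((hD.integrableOn_isCompact hK).norm.mul_const R).mono'
      (hD.aestronglyMeasurable.inner aestronglyMeasurable_id).restrict ?_
    filter_upwards [ae_restrict_mem hK.measurableSet] with x hx
    have hxR : ‖x‖ ≤ R := by simpa using hR hx
    exact (norm_inner_le_norm _ _).trans (by gcongr)
  have hloc : LocallyIntegrableOn (fun x : Space => inner ℝ (D x) x - ‖x‖ * radialMean D ‖x‖) {0}ᶜ := by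
    intro x hx
    have hx0 : 0 < ‖x‖ := norm_pos_iff.2 hx
    obtain ⟨s, hs, hsi⟩ := hinner x
    refine ⟨s ∩ {y | ‖y‖ ∈ Icc (‖x‖ / 2) (2 * ‖x‖)}, mem_nhdsWithin_of_mem_nhds (inter_mem hs ?_), ?_⟩
    · exact continuous_norm.continuousAt (Icc_mem_nhds (by linarith) (by linarith))
    · refine (hsi.mono_set inter_subset_left).sub ?_
      have hm : MeasurableSet {y : Space | ‖y‖ ∈ Icc (‖x‖ / 2) (2 * ‖x‖)} :=
        measurable_norm measurableSet_Icc
      have h1 : IntegrableOn (fun y : Space => ‖y‖ * radialMean D ‖y‖)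
          {y : Space | ‖y‖ ∈ Icc (‖x‖ / 2) (2 * ‖x‖)} := by
        refine (hGi (‖x‖ / 2) (2 * ‖x‖) (by positivity)).integrableOn.congr_fun ?_ hm
        intro y hy
        exact indicator_of_mem (s := Icc (‖x‖ / 2) (2 * ‖x‖)) hy _
      exact h1.mono_set inter_subset_right
  have key : ∀ η : Space → ℝ, ContDiff ℝ ∞ η → HasCompactSupport η → tsupport η ⊆ {0}ᶜ →
      ∫ x, η x • (inner ℝ (D x) x - ‖x‖ * radialMean D ‖x‖) = 0 := by
    intro η hη hc hs
    obtain ⟨a, b, ha, hab, hann⟩ := exists_annulus_of_compact hc.isCompact (fun h => hs h rfl)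
    have hη0 : ∀ x : Space, ‖x‖ ∉ Ioo a b → η x = 0 := fun x hx =>
      image_eq_zero_of_notMem_tsupport fun h => hx (hann x h)
    have hdη0 : ∀ x : Space, ‖x‖ ∉ Ioo a b → fderiv ℝ η x = 0 := fun x hx =>
      fderiv_of_notMem_tsupport ℝ fun h => hx (hann x h)
    have hηd : Continuous (fderiv ℝ η) := hη.continuous_fderiv (by simp)
    have i1 : Integrable fun x : Space => f ‖x‖ * (3 * η x + fderiv ℝ η x x) := by
      refine MemLp.mul_integrable_of_compact hF ?_ ?_
      · exact (continuous_const.mul hη.continuous).add (hηd.clm_apply continuous_id)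
      · refine HasCompactSupport.of_support_subset_isCompact hc.isCompact fun x hx => ?_
        by_contra h
        exact hx (by simp [image_eq_zero_of_notMem_tsupport h, fderiv_of_notMem_tsupport ℝ h])
    have i2 : Integrable fun x : Space => ‖x‖ * radialMean D ‖x‖ * η x := by
      refine (MemLp.mul_integrable_of_compact (hGi a b ha).locallyIntegrable hη.continuous hc).congr
        (ae_of_all _ fun x => ?_)
      by_cases hx : ‖x‖ ∈ Icc a b
      · simp only [indicator_of_mem hx]
      · simp only [hη0 x fun h => hx (Ioo_subset_Icc_self h), mul_zero]
    -- On the ray through e the integrand with its weight r² is the derivative of r³ η(r e) f(r),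
    -- which vanishes at both ends of the annulus.
    have hzero : ∫ x : Space, (f ‖x‖ * (3 * η x + fderiv ℝ η x x) + ‖x‖ * radialMean D ‖x‖ * η x) = 0 := by
      have i3 : Integrable fun x : Space => f ‖x‖ * (3 * η x + fderiv ℝ η x x)
          + ‖x‖ * radialMean D ‖x‖ * η x := i1.add i2
      rw [integral_polar i3, integral_prod _ (integrable_polar i3)]
      refine integral_eq_zero_of_ae (ae_of_all _ fun e => ?_)
      set ρ : ℝ → ℝ := fun r => r ^ 3 * η (r • (e : Space)) with hρ
      set ρ' : ℝ → ℝ := fun r => 3 * r ^ 2 * η (r • (e : Space))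
        + r ^ 3 * fderiv ℝ η (r • (e : Space)) (e : Space) with hρ'
      have hρd : ∀ r, HasDerivAt ρ (ρ' r) r := by
        intro r
        have h1 : HasDerivAt (fun r : ℝ => r • (e : Space)) (e : Space) r := by
          simpa using (hasDerivAt_id r).smul_const (e : Space)
        have h2 := ((hη.differentiable (by simp) (r • (e : Space))).hasFDerivAt).comp_hasDerivAt r h1
        have h3 := (hasDerivAt_pow 3 r).mul h2
        exact h3.congr_deriv (by simp [hρ'])
      have hρ'c : Continuous ρ' := by
        have h1 : Continuous fun r : ℝ => r • (e : Space) := by fun_prop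
        exact ((by fun_prop : Continuous fun r : ℝ => 3 * r ^ 2).mul (hη.continuous.comp h1)).add
          ((by fun_prop : Continuous fun r : ℝ => r ^ 3).mul
            ((hηd.comp h1).clm_apply continuous_const))
      have hfi : IntervalIntegrable (radialMean D) volume a b := by
        rw [intervalIntegrable_iff_integrableOn_Icc_of_le hab.le]
        exact integrableOn_radialMean hD ha
      have hprim : ∀ x ∈ uIcc a b, f x - f a = ∫ y in a..x, radialMean D y := by
        intro x hx
        rw [uIcc_of_le hab.le] at hx
        exact radial_profile_primitive hf hF hD hw ha (ha.trans_le hx.1)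
      have hparts := integral_mul_deriv_of_integral hfi hprim hρd hρ'c
      have hηa : η (a • (e : Space)) = 0 := hη0 _ (by rw [norm_smul_sphere ha]; simp)
      have hηb : η (b • (e : Space)) = 0 := hη0 _ (by rw [norm_smul_sphere (ha.trans hab)]; simp)
      rw [show ρ a = 0 by simp [hρ, hηa], show ρ b = 0 by simp [hρ, hηb], mul_zero, mul_zero, sub_zero,
        intervalIntegral.integral_of_le hab.le] at hparts
      refine Eq.trans ?_ hparts
      beta_reduce
      dsimp only
      have hsub : Ioc a b ⊆ Ioi 0 := fun x hx => ha.trans hx.1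
      rw [setIntegral_eq_of_subset_of_forall_sdiff_eq_zero measurableSet_Ioi hsub (f := fun r : ℝ =>
        r ^ 2 * (f ‖r • (e : Space)‖ * (3 * η (r • (e : Space)) + fderiv ℝ η (r • (e : Space)) (r • (e : Space)))
          + ‖r • (e : Space)‖ * radialMean D ‖r • (e : Space)‖ * η (r • (e : Space))))]
      · refine setIntegral_congr_fun measurableSet_Ioc fun r hr => ?_
        simp only [norm_smul_sphere (hsub hr), map_smul, smul_eq_mul, hρ, hρ']
        ring
      · intro r hr
        have hr0 : 0 < r := hr.1
        have hout : ‖r • (e : Space)‖ ∉ Ioo a b := by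
          rw [norm_smul_sphere hr0]; exact fun h => hr.2 (Ioo_subset_Ioc_self h)
        simp [hη0 _ hout, hdη0 _ hout]
    have h3 := weak_radial_identity hF hD hw hη hc
    rw [integral_add i1 i2, h3] at hzero
    rw [show (fun x => η x • (inner ℝ (D x) x - ‖x‖ * radialMean D ‖x‖))
      = fun x => inner ℝ (D x) x * η x - ‖x‖ * radialMean D ‖x‖ * η x from by
        ext x; simp only [smul_eq_mul]; ring,
      integral_sub (integrable_inner_mul hD hη.continuous hc) i2]
    linarith
  have := IsOpen.ae_eq_zero_of_integral_contDiff_smul_eq_zero isOpen_compl_singleton hloc key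
  filter_upwards [this, ae_ne_zero_space] with x hx hx0
  exact sub_eq_zero.1 (hx hx0)

/-- The radial derivative of the profile of a radial function with square integrable weak gradient. -/
theorem exists_radial_derivative {D : Space → Space} {f : ℝ → ℝ} (hf : ContinuousOn f (Ioi 0))
    (hF : LocallyIntegrable fun x : Space => f ‖x‖) (hD : LocallyIntegrable D)
    (hw : ∀ φ : Space → ℝ, ContDiff ℝ ∞ φ → HasCompactSupport φ → ∀ e : Space,
      ∫ x, f ‖x‖ * fderiv ℝ φ x e = - ∫ x, inner ℝ (D x) e * φ x) :
    ∃ g : ℝ → ℝ, Measurable g ∧ (∀ᵐ x : Space, inner ℝ (D x) x = ‖x‖ * g ‖x‖) ∧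
      (∀ a b : ℝ, 0 < a → 0 < b → IntervalIntegrable g volume a b ∧ f b - f a = ∫ r in a..b, g r) ∧
      ∫⁻ r in Ioi (0 : ℝ), ENNReal.ofReal (r ^ 2) * ENNReal.ofReal (g r ^ 2)
        ≤ ENNReal.ofReal sphereArea⁻¹ * ∫⁻ x, ENNReal.ofReal (‖D x‖ ^ 2) := by
  have hm := (locallyIntegrableOn_radialMean hD).aestronglyMeasurable
  set g := hm.aemeasurable.mk (radialMean D) with hg
  have hae : ∀ᵐ r ∂(volume.restrict (Ioi (0 : ℝ))), radialMean D r = g r := hm.aemeasurable.ae_eq_mk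
  have hgm : Measurable g := hm.aemeasurable.measurable_mk
  have hinner : ∀ᵐ x : Space, inner ℝ (D x) x = ‖x‖ * g ‖x‖ := by
    filter_upwards [ae_inner_eq_radialMean hf hF hD hw, ae_norm_iff.2 hae] with x h1 h2
    rw [h1, h2]
  refine ⟨g, hgm, hinner, fun a b ha hb => ?_, ?_⟩
  · have hsub : uIoc a b ⊆ Ioi 0 := fun x hx => (lt_min ha hb).trans hx.1
    have hae' : ∀ᵐ r ∂(volume.restrict (uIoc a b)), radialMean D r = g r :=
      ae_restrict_of_ae_restrict_of_subset hsub hae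
    constructor
    · refine IntervalIntegrable.congr_ae ?_ hae'
      rw [intervalIntegrable_iff]
      exact (integrableOn_radialMean hD (lt_min ha hb)).mono_set Ioc_subset_Icc_self
    · rw [radial_profile_primitive hf hF hD hw ha hb]
      exact intervalIntegral.integral_congr_ae ((ae_restrict_iff' measurableSet_uIoc).1 hae')
  · have h1 := lintegral_norm (φ := fun r => ENNReal.ofReal (g r ^ 2)) (by fun_prop)
    have h2 : ∫⁻ x : Space, ENNReal.ofReal (g ‖x‖ ^ 2) ≤ ∫⁻ x, ENNReal.ofReal (‖D x‖ ^ 2) := by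
      refine lintegral_mono_ae ?_
      filter_upwards [hinner, ae_ne_zero_space] with x hx hx0
      refine ENNReal.ofReal_le_ofReal ?_
      have hn : 0 < ‖x‖ := norm_pos_iff.2 hx0
      -- Cauchy-Schwarz: the radial component of D is no larger than D.
      have h3 : |‖x‖ * g ‖x‖| ≤ ‖D x‖ * ‖x‖ := by rw [← hx]; exact abs_real_inner_le_norm _ _
      rw [abs_mul, abs_norm, mul_comm] at h3
      have h4 : |g ‖x‖| ≤ ‖D x‖ := le_of_mul_le_mul_right h3 hn
      rw [← sq_abs (g ‖x‖)]
      gcongr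
    rw [h1] at h2
    have hs := sphereArea_pos
    calc _ = ENNReal.ofReal sphereArea⁻¹ * (ENNReal.ofReal sphereArea *
          ∫⁻ r in Ioi (0 : ℝ), ENNReal.ofReal (r ^ 2) * ENNReal.ofReal (g r ^ 2)) := by
          rw [← mul_assoc, ← ENNReal.ofReal_mul (by positivity), inv_mul_cancel₀ hs.ne',
            ENNReal.ofReal_one, one_mul]
      _ ≤ _ := by gcongr

/-! ### Decay and Hardy-type estimates for profiles -/

section Profile

variable {f g : ℝ → ℝ}

/-- Cauchy-Schwarz with the weights r and 1/r, since ∫_a^b r⁻² dr ≤ 1/a. -/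
theorem sq_sub_le_of_primitive {a b A : ℝ} (ha : 0 < a) (hab : a < b)
    (hg : IntervalIntegrable g volume a b) (hFTC : f b - f a = ∫ r in a..b, g r)
    (hg2 : IntervalIntegrable (fun r => r ^ 2 * g r ^ 2) volume a b)
    (hA : ∫ r in a..b, r ^ 2 * g r ^ 2 ≤ A) : a * (f b - f a) ^ 2 ≤ A := by
  have hA0 : 0 ≤ A := le_trans (intervalIntegral.integral_nonneg hab.le fun x _ => by positivity) hA
  set B : ℝ := a⁻¹ - b⁻¹ with hB
  have hB0 : 0 < B := by
    rw [hB, sub_pos]; exact inv_strictAnti₀ ha hab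
  have hBi : IntervalIntegrable (fun r : ℝ => (r ^ 2)⁻¹) volume a b := by
    refine ContinuousOn.intervalIntegrable ?_
    rw [uIcc_of_le hab.le]
    exact (continuousOn_pow 2).inv₀ fun x hx => pow_ne_zero 2 (ha.trans_le hx.1).ne'
  have hBint : ∫ r in a..b, (r ^ 2)⁻¹ = B := by
    rw [intervalIntegral.integral_eq_sub_of_hasDerivAt (f := fun r => -r⁻¹) _ hBi]
    · rw [hB]; ring
    · intro x hx
      rw [uIcc_of_le hab.le] at hx
      exact (hasDerivAt_inv (ha.trans_le hx.1).ne').neg.congr_deriv (by simp)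
  set Δ := f b - f a with hΔ
  -- This c minimises the nonnegative quadratic ∫ (r g - c/r)², whose minimum is the Cauchy-Schwarz
  -- inequality.
  set c : ℝ := Δ / B with hc
  have hnn : 0 ≤ ∫ r in a..b, (r * g r - c * r⁻¹) ^ 2 :=
    intervalIntegral.integral_nonneg hab.le fun x _ => sq_nonneg _
  have hexp : ∫ r in a..b, (r * g r - c * r⁻¹) ^ 2
      = (∫ r in a..b, r ^ 2 * g r ^ 2) - 2 * c * Δ + c ^ 2 * B := by
    rw [hFTC, ← hBint, ← intervalIntegral.integral_const_mul, ← intervalIntegral.integral_const_mul,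
      ← intervalIntegral.integral_sub hg2 (hg.const_mul _),
      ← intervalIntegral.integral_add (hg2.sub (hg.const_mul _)) (hBi.const_mul _)]
    refine intervalIntegral.integral_congr fun r hr => ?_
    rw [uIcc_of_le hab.le] at hr
    have : r ≠ 0 := (ha.trans_le hr.1).ne'
    field_simp
    ring
  have h1 : Δ ^ 2 ≤ A * B := by
    have h2 : 0 ≤ A - Δ ^ 2 / B := by
      have : (∫ r in a..b, r ^ 2 * g r ^ 2) - 2 * c * Δ + c ^ 2 * B
          = (∫ r in a..b, r ^ 2 * g r ^ 2) - Δ ^ 2 / B := by rw [hc]; field_simp; ring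
      linarith
    rwa [sub_nonneg, div_le_iff₀ hB0] at h2
  have h3 : a * B ≤ 1 := by
    rw [hB, mul_sub, mul_inv_cancel₀ ha.ne']
    have : 0 < a * b⁻¹ := by have := ha.trans hab; positivity
    linarith
  nlinarith

variable (hFTC : ∀ a b : ℝ, 0 < a → 0 < b → IntervalIntegrable g volume a b ∧ f b - f a = ∫ r in a..b, g r)
  (hg2 : IntegrableOn (fun r => r ^ 2 * g r ^ 2) (Ioi 0))

include hg2 in
theorem intervalIntegrable_profile {a b : ℝ} (ha : 0 < a) (hb : 0 < b) :
    IntervalIntegrable (fun r => r ^ 2 * g r ^ 2) volume a b := by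
  rw [intervalIntegrable_iff]
  exact hg2.mono_set fun x hx => (lt_min ha hb).trans hx.1

-- The increment of f from R to R' is controlled by the tail of the energy. Membership in L⁶(r² dr)
-- supplies radii R' at which f is as small as desired: otherwise the integrand would be bounded
-- below by a positive constant on (R, ∞).
include hFTC hg2 in
theorem profile_decay (h6 : IntegrableOn (fun r => r ^ 2 * |f r| ^ 6) (Ioi 0)) {R : ℝ} (hR : 0 < R) :
    R * f R ^ 2 ≤ ∫ r in Ioi R, r ^ 2 * g r ^ 2 := by
  set A := ∫ r in Ioi R, r ^ 2 * g r ^ 2 with hA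
  have hA0 : 0 ≤ A := setIntegral_nonneg measurableSet_Ioi fun r _ => by positivity
  have hsmall : ∀ ε > 0, ∃ R' > R, |f R'| < ε := by
    intro ε hε
    by_contra! hcon
    have h1 : IntegrableOn (fun _ : ℝ => R ^ 2 * ε ^ 6) (Ioi R) := by
      refine (h6.mono_set (Ioi_subset_Ioi hR.le)).mono' aestronglyMeasurable_const ?_
      filter_upwards [ae_restrict_mem measurableSet_Ioi] with r hr
      rw [Real.norm_of_nonneg (by positivity)]
      have := hcon r hr
      have hr' : R < r := hr
      gcongr
    rw [integrableOn_const_iff] at h1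
    simp [hR.ne', hε.ne'] at h1
  have hle : ∀ ε > 0, |f R| ≤ √(A / R) + ε := by
    intro ε hε
    obtain ⟨R', hRR', hf'⟩ := hsmall ε hε
    obtain ⟨h1, h2⟩ := hFTC R R' hR (hR.trans hRR')
    have h3 : R * (f R' - f R) ^ 2 ≤ A := by
      refine sq_sub_le_of_primitive hR hRR' h1 h2 (intervalIntegrable_profile hg2 hR (hR.trans hRR')) ?_
      rw [intervalIntegral.integral_of_le hRR'.le]
      refine setIntegral_mono_set (hg2.mono_set (Ioi_subset_Ioi hR.le)) ?_ ?_
      · exact ae_of_all _ fun r => by positivity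
      · exact Ioc_subset_Ioi_self.eventuallyLE
    have h4 : |f R' - f R| ≤ √(A / R) := by
      apply Real.abs_le_sqrt
      rw [le_div_iff₀ hR]; linarith
    calc |f R| = |f R' - (f R' - f R)| := by congr 1; ring
      _ ≤ |f R'| + |f R' - f R| := abs_sub _ _
      _ ≤ _ := by linarith
  have h5 : |f R| ≤ √(A / R) := le_of_forall_pos_le_add hle
  have h6 : f R ^ 2 ≤ A / R := by
    rw [← sq_abs, ← Real.sq_sqrt (show 0 ≤ A / R by positivity)]
    gcongr
  rw [le_div_iff₀ hR] at h6
  linarith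

include hFTC in
theorem reduced_profile_primitive {a b : ℝ} (ha : 0 < a) (hb : 0 < b) :
    IntervalIntegrable (fun r => f r + r * g r) volume a b ∧
      b * f b - a * f a = ∫ r in a..b, (f r + r * g r) := by
  obtain ⟨h1, -⟩ := hFTC a b ha hb
  have hprim : ∀ x ∈ uIcc a b, f x - f a = ∫ y in a..x, g y := fun x hx =>
    (hFTC a x ha ((lt_min ha hb).trans_le hx.1)).2
  have h2 := AbsolutelyContinuousOnInterval.ftc (F := fun r => r * f r) (f := fun r => f r + r * g r)
    (a := a) (b := b)
    ((contDiff_id.contDiffOn.absolutelyContinuousOnInterval).mul (absolutelyContinuous_of_integral h1 hprim)) (by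
      filter_upwards [hasDerivAt_of_integral h1 hprim] with x hx hxm
      exact ((hasDerivAt_id x).mul (hx hxm)).congr_deriv (by simp))
  exact ⟨h2.1, h2.2.symm⟩

-- One has ((r f)')² = r² g² + (r f²)'. The boundary term b f(b)² is absorbed by the tail of ∫ r² g²
-- beyond b through `profile_decay`, so the constant is 1.
include hFTC hg2 in
theorem integral_reduced_deriv_sq_le (h6 : IntegrableOn (fun r => r ^ 2 * |f r| ^ 6) (Ioi 0)) {a b : ℝ}
    (ha : 0 < a) (hab : a ≤ b) :
    IntervalIntegrable (fun r => (f r + r * g r) ^ 2) volume a b ∧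
    ∫ r in a..b, (f r + r * g r) ^ 2 ≤ ∫ r in Ioi (0 : ℝ), r ^ 2 * g r ^ 2 := by
  have hb : 0 < b := ha.trans_le hab
  obtain ⟨h1, -⟩ := hFTC a b ha hb
  have hprim : ∀ x ∈ uIcc a b, f x - f a = ∫ y in a..x, g y := fun x hx =>
    (hFTC a x ha ((lt_min ha hb).trans_le hx.1)).2
  have hac := absolutelyContinuous_of_integral h1 hprim
  obtain ⟨i1, e1⟩ := AbsolutelyContinuousOnInterval.ftc (F := fun r => r * (f r * f r))
    (f := fun r => f r * f r + r * (g r * f r + f r * g r)) (a := a) (b := b)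
    ((contDiff_id.contDiffOn.absolutelyContinuousOnInterval).mul (hac.mul hac)) (by
      filter_upwards [hasDerivAt_of_integral h1 hprim] with x hx hxm
      exact ((hasDerivAt_id x).mul ((hx hxm).mul (hx hxm))).congr_deriv (by simp))
  have i2 := intervalIntegrable_profile hg2 ha hb
  have hexp : (fun r => (f r + r * g r) ^ 2)
      = fun r => (f r * f r + r * (g r * f r + f r * g r)) + r ^ 2 * g r ^ 2 := by ext r; ring
  rw [hexp]
  refine ⟨i1.add i2, ?_⟩
  rw [intervalIntegral.integral_add i1 i2, e1]
  have hd := profile_decay hFTC hg2 h6 hb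
  have hsplit : (∫ r in a..b, r ^ 2 * g r ^ 2) + ∫ r in Ioi b, r ^ 2 * g r ^ 2
      ≤ ∫ r in Ioi (0 : ℝ), r ^ 2 * g r ^ 2 := by
    rw [intervalIntegral.integral_of_le hab, ← setIntegral_union _ measurableSet_Ioi
      (hg2.mono_set fun x hx => ha.trans hx.1) (hg2.mono_set (Ioi_subset_Ioi hb.le)),
      Ioc_union_Ioi_eq_Ioi hab]
    · refine setIntegral_mono_set hg2 (ae_of_all _ fun r => by positivity) ?_
      exact (Ioi_subset_Ioi ha.le).eventuallyLE
    · exact Set.disjoint_left.2 fun x hx hx' => not_lt.2 hx.2 hx'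
  have : 0 ≤ a * (f a * f a) := mul_nonneg ha.le (mul_self_nonneg _)
  nlinarith

theorem lintegral_Ioi_le_of_Ioc {h : ℝ → ENNReal} {A : ENNReal}
    (H : ∀ a b : ℝ, 0 < a → a ≤ b → ∫⁻ r in Ioc a b, h r ≤ A) : ∫⁻ r in Ioi (0 : ℝ), h r ≤ A := by
  have hU : Ioi (0 : ℝ) = ⋃ n : ℕ, Ioc (1 / ((n : ℝ) + 1)) ((n : ℝ) + 1) := by
    ext x
    simp only [mem_Ioi, mem_iUnion, mem_Ioc]
    constructor
    · intro hx
      obtain ⟨n, hn⟩ := exists_nat_gt (max (1 / x) x)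
      refine ⟨n, ?_, by linarith [le_max_right (1 / x) x]⟩
      rw [div_lt_iff₀ (by positivity)]
      have := (le_max_left (1 / x) x).trans_lt hn
      rw [div_lt_iff₀ hx] at this
      nlinarith
    · rintro ⟨n, hn, -⟩
      exact lt_trans (by positivity) hn
  rw [hU, setLIntegral_iUnion_of_directed]
  · refine iSup_le fun n => H _ _ (by positivity) ?_
    rw [div_le_iff₀ (by positivity)]
    nlinarith [n.cast_nonneg (α := ℝ)]
  · refine directed_of_isDirected_le fun m n hmn => ?_
    refine Ioc_subset_Ioc ?_ ?_
    · gcongr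
    · gcongr

include hFTC hg2 in
theorem lintegral_reduced_deriv_sq_le (h6 : IntegrableOn (fun r => r ^ 2 * |f r| ^ 6) (Ioi 0)) :
    ∫⁻ r in Ioi (0 : ℝ), ENNReal.ofReal ((f r + r * g r) ^ 2)
      ≤ ENNReal.ofReal (∫ r in Ioi (0 : ℝ), r ^ 2 * g r ^ 2) := by
  refine lintegral_Ioi_le_of_Ioc fun a b ha hab => ?_
  obtain ⟨h1, h2⟩ := integral_reduced_deriv_sq_le hFTC hg2 h6 ha hab
  rw [intervalIntegral.integral_of_le hab] at h2
  rw [intervalIntegrable_iff_integrableOn_Ioc_of_le hab] at h1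
  rw [← ofReal_integral_eq_lintegral_ofReal h1 (ae_of_all _ fun r => sq_nonneg _)]
  exact ENNReal.ofReal_le_ofReal h2

end Profile

/-! ### The profile of the solution and continuity of w up to the axis -/

/-- The profile of a radial function. -/
noncomputable def prof (u : Space → ℝ → ℝ) (r t : ℝ) : ℝ := u (EuclideanSpace.single 0 r) t

theorem continuous_toLp {E : Type*} [NormedAddCommGroup E] {F : ℝ → Space → E} (hF : ∀ t, MemLp (F t) 2 volume)
    (h : ∀ t, Tendsto (fun s => eLpNorm (fun x => F s x - F t x) 2 volume) (𝓝 t) (𝓝 0)) :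
    Continuous fun t => (hF t).toLp (F t) := by
  rw [continuous_iff_continuousAt]
  intro t
  rw [ContinuousAt, tendsto_iff_edist_tendsto_0]
  refine (h t).congr fun s => ?_
  rw [Lp.edist_toLp_toLp]
  rfl

namespace IsRadialSolution

variable {p : ℝ} {u : Space → ℝ → ℝ} {Du : Space → ℝ → Space} {ut : Space → ℝ → ℝ}

theorem eq_prof (h : IsRadialSolution p u Du ut) (x : Space) (t : ℝ) : u x t = prof u ‖x‖ t :=
  h.radial t _ _ (by simp)

theorem continuousOn_prof (h : IsRadialSolution p u Du ut) :
    ContinuousOn (fun z : ℝ × ℝ => prof u z.1 z.2) {z | 0 < z.1} := by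
  have h1 : Continuous fun z : ℝ × ℝ => ((EuclideanSpace.single 0 z.1 : Space), z.2) := by
    refine Continuous.prodMk ?_ continuous_snd
    have : (fun z : ℝ × ℝ => (EuclideanSpace.single 0 z.1 : Space))
        = fun z => z.1 • (EuclideanSpace.single 0 1 : Space) := by
      ext z i; simp
    rw [this]; fun_prop
  refine h.continuousOn.comp h1.continuousOn fun z hz => ?_
  have : (EuclideanSpace.single 0 z.1 : Space) ≠ 0 := by
    rw [← norm_ne_zero_iff]; simpa using (ne_of_gt hz : z.1 ≠ 0)
  exact this

theorem continuousOn_prof_slice (h : IsRadialSolution p u Du ut) (t : ℝ) :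
    ContinuousOn (fun r => prof u r t) (Ioi 0) :=
  h.continuousOn_prof.comp (by fun_prop : Continuous fun r : ℝ => (r, t)).continuousOn fun _ hr => hr

theorem locallyIntegrable_prof (h : IsRadialSolution p u Du ut) (t : ℝ) :
    LocallyIntegrable fun x : Space => prof u ‖x‖ t := by
  simp_rw [← h.eq_prof]
  exact (h.memLp_six t).locallyIntegrable (by norm_num)

theorem integrableOn_prof_six (h : IsRadialSolution p u Du ut) (t : ℝ) :
    IntegrableOn (fun r => r ^ 2 * |prof u r t| ^ 6) (Ioi 0) := by
  rw [← integrable_norm_iff (f := fun r => |prof u r t| ^ 6)]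
  have h1 := (h.memLp_six t).integrable_norm_pow (by norm_num)
  simpa [h.eq_prof] using h1

theorem exists_radial_deriv (h : IsRadialSolution p u Du ut) (t : ℝ) :
    ∃ g : ℝ → ℝ, Measurable g ∧ (∀ᵐ x : Space, inner ℝ (Du x t) x = ‖x‖ * g ‖x‖) ∧
      (∀ a b : ℝ, 0 < a → 0 < b → IntervalIntegrable g volume a b ∧
        prof u b t - prof u a t = ∫ r in a..b, g r) ∧
      IntegrableOn (fun r => r ^ 2 * g r ^ 2) (Ioi 0) ∧
      ∫ r in Ioi (0 : ℝ), r ^ 2 * g r ^ 2 ≤ sphereArea⁻¹ * ∫ x, ‖Du x t‖ ^ 2 := by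
  have hD : LocallyIntegrable fun x => Du x t := (h.memLp_gradient t).locallyIntegrable (by norm_num)
  obtain ⟨g, hgm, hin, hFTC, hL2⟩ := exists_radial_derivative (h.continuousOn_prof_slice t)
    (h.locallyIntegrable_prof t) hD (fun φ hφ hc e => by
      simp_rw [← h.eq_prof]; exact h.weak_gradient t φ hφ hc e)
  have hDi : Integrable fun x => ‖Du x t‖ ^ 2 := by
    simpa using (h.memLp_gradient t).integrable_norm_pow (by norm_num)
  have hs := sphereArea_pos
  rw [← ofReal_integral_eq_lintegral_ofReal hDi (ae_of_all _ fun x => sq_nonneg _),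
    ← ENNReal.ofReal_mul (by positivity)] at hL2
  simp_rw [← ENNReal.ofReal_mul (sq_nonneg _)] at hL2
  have hi : IntegrableOn (fun r => r ^ 2 * g r ^ 2) (Ioi 0) := by
    refine ⟨by fun_prop, ?_⟩
    rw [hasFiniteIntegral_iff_ofReal (ae_of_all _ fun r => by positivity)]
    exact hL2.trans_lt ENNReal.ofReal_lt_top
  refine ⟨g, hgm, hin, hFTC, hi, ?_⟩
  rw [← ofReal_integral_eq_lintegral_ofReal hi (ae_of_all _ fun r => by positivity)] at hL2
  exact (ENNReal.ofReal_le_ofReal_iff (mul_nonneg (by positivity) (integral_nonneg fun x => sq_nonneg _))).1 hL2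

theorem norm_gradient_toLp (h : IsRadialSolution p u Du ut) (t : ℝ) :
    ∫ x, ‖Du x t‖ ^ 2 = ‖(h.memLp_gradient t).toLp‖ ^ 2 := by
  rw [← real_inner_self_eq_norm_sq, L2.inner_def]
  refine integral_congr_ae ?_
  filter_upwards [(h.memLp_gradient t).coeFn_toLp] with x hx
  rw [hx, real_inner_self_eq_norm_sq]

theorem exists_gradient_bound (h : IsRadialSolution p u Du ut) (T : ℝ) :
    ∃ C, 0 ≤ C ∧ ∀ t ∈ Icc (-T) T, ∫ x, ‖Du x t‖ ^ 2 ≤ C := by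
  have h1 := continuous_toLp h.memLp_gradient h.continuous_gradient
  obtain ⟨C, hC⟩ := (isCompact_Icc (a := -T) (b := T)).exists_bound_of_continuousOn
    (f := fun t => ‖(h.memLp_gradient t).toLp‖ ^ 2) (h1.norm.pow 2).continuousOn
  refine ⟨max C 0, le_max_right _ _, fun t ht => ?_⟩
  rw [h.norm_gradient_toLp]
  exact (Real.le_norm_self _).trans ((hC t ht).trans (le_max_left _ _))

theorem prof_sq_le (h : IsRadialSolution p u Du ut) {r : ℝ} (hr : 0 < r) (t : ℝ) :
    r * prof u r t ^ 2 ≤ sphereArea⁻¹ * ∫ x, ‖Du x t‖ ^ 2 := by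
  obtain ⟨g, -, -, hFTC, hg2, hle⟩ := h.exists_radial_deriv t
  refine (profile_decay hFTC hg2 (h.integrableOn_prof_six t) hr).trans (le_trans ?_ hle)
  exact setIntegral_mono_set hg2 (ae_of_all _ fun r => by positivity) (Ioi_subset_Ioi hr.le).eventuallyLE

theorem reduced_eq (u : Space → ℝ → ℝ) (z : ℝ × ℝ) : reduced u z = z.1 * prof u z.1 z.2 := rfl

theorem prof_neg (h : IsRadialSolution p u Du ut) (r t : ℝ) : prof u (-r) t = prof u r t :=
  h.radial t _ _ (by simp)

/-- Here w² = |r| · |r| u², the factor |r| u² is bounded by the gradient norm, and this norm is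
bounded on compact time intervals by continuity. The absolute value appears because `reduced` also
takes negative r, where it is the odd extension. -/
theorem exists_reduced_sq_bound (h : IsRadialSolution p u Du ut) (T : ℝ) :
    ∃ C, 0 ≤ C ∧ ∀ r : ℝ, ∀ t ∈ Icc (-T) T, reduced u (r, t) ^ 2 ≤ C * |r| := by
  obtain ⟨C, hC0, hC⟩ := h.exists_gradient_bound T
  have hs := sphereArea_pos
  refine ⟨sphereArea⁻¹ * C, by positivity, fun r t ht => ?_⟩
  rcases eq_or_ne r 0 with rfl | hr
  · simp [reduced_eq]
  · have h1 := h.prof_sq_le (abs_pos.2 hr) t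
    have h2 : prof u |r| t = prof u r t := by
      rcases abs_cases r with ⟨h, -⟩ | ⟨h, -⟩ <;> rw [h]
      exact (IsRadialSolution.prof_neg ‹_› r t)
    have h3 : sphereArea⁻¹ * ∫ x, ‖Du x t‖ ^ 2 ≤ sphereArea⁻¹ * C := by gcongr; exact hC t ht
    rw [h2] at h1
    rw [reduced_eq]
    simp only
    rw [mul_pow, ← sq_abs r]
    nlinarith [abs_pos.2 hr]

/-- Nothing is known about u at the origin; on the axis the bound w² ≤ C |r| forces w to tend to 0.
-/
theorem continuous_reduced (h : IsRadialSolution p u Du ut) : Continuous (reduced u) := by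
  rw [continuous_iff_continuousAt]
  rintro ⟨r, t⟩
  rcases lt_trichotomy r 0 with hr | rfl | hr
  · have h1 : ContinuousAt (fun z : ℝ × ℝ => prof u (-z.1) z.2) (r, t) := by
      have h2 : ContinuousAt (fun z : ℝ × ℝ => prof u z.1 z.2) (-r, t) :=
        h.continuousOn_prof.continuousAt
          ((isOpen_lt continuous_const continuous_fst).mem_nhds (by simpa using hr))
      exact ContinuousAt.comp (x := (r, t)) (f := fun z : ℝ × ℝ => (-z.1, z.2)) h2
        (by fun_prop : Continuous fun z : ℝ × ℝ => (-z.1, z.2)).continuousAt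
    simp_rw [h.prof_neg] at h1
    exact continuousAt_fst.mul h1
  · obtain ⟨C, hC0, hC⟩ := h.exists_reduced_sq_bound (|t| + 1)
    have h0 : reduced u (0, t) = 0 := by simp [reduced_eq]
    rw [ContinuousAt, h0]
    have hlim : Tendsto (fun z : ℝ × ℝ => √(C * |z.1|)) (𝓝 (0, t)) (𝓝 0) := by
      have : Continuous fun z : ℝ × ℝ => √(C * |z.1|) := by fun_prop
      simpa using this.tendsto (0, t)
    refine squeeze_zero_norm' ?_ hlim
    have : ∀ᶠ z : ℝ × ℝ in 𝓝 (0, t), z.2 ∈ Icc (-(|t| + 1)) (|t| + 1) := by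
      refine continuousAt_snd.eventually (Icc_mem_nhds ?_ ?_)
      · change -(|t| + 1) < t
        linarith [neg_abs_le t]
      · change t < |t| + 1
        linarith [le_abs_self t]
    filter_upwards [this] with z hz
    rw [Real.norm_eq_abs]
    exact Real.abs_le_sqrt (hC z.1 z.2 hz)
  · exact continuousAt_fst.mul (h.continuousOn_prof.continuousAt
      ((isOpen_lt continuous_const continuous_fst).mem_nhds hr))

end IsRadialSolution

/-! ### The time derivative of the solution -/

theorem continuous_mul_of_tsupport {X : Type*} [TopologicalSpace X] {F k : X → ℝ} {V : Set X}
    (hV : IsOpen V) (hF : ContinuousOn F V) (hk : Continuous k) (hs : tsupport k ⊆ V) :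
    Continuous fun x => F x * k x := by
  rw [continuous_iff_continuousAt]
  intro x
  by_cases hx : x ∈ V
  · exact (hF.continuousAt (hV.mem_nhds hx)).mul hk.continuousAt
  · refine (continuousAt_const (y := (0 : ℝ))).congr ?_
    filter_upwards [notMem_tsupport_iff_eventuallyEq.1 fun h => hx (hs h)] with y hy
    simp [hy]

namespace IsRadialSolution

variable {p : ℝ} {u : Space → ℝ → ℝ} {Du : Space → ℝ → Space} {ut : Space → ℝ → ℝ}

/-- The time derivative as a curve in `L²`. -/
noncomputable def timeDerivLp (h : IsRadialSolution p u Du ut) (t : ℝ) : Lp ℝ 2 (volume : Measure Space) :=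
  (h.memLp_timeDeriv t).toLp

theorem continuous_timeDerivLp (h : IsRadialSolution p u Du ut) : Continuous h.timeDerivLp :=
  continuous_toLp h.memLp_timeDeriv h.continuous_timeDeriv

theorem inner_timeDerivLp (h : IsRadialSolution p u Du ut) {χ : Space → ℝ} (hχ : MemLp χ 2 volume) (t : ℝ) :
    inner ℝ hχ.toLp (h.timeDerivLp t) = ∫ x, ut x t * χ x := by
  rw [L2.inner_def]
  refine integral_congr_ae ?_
  filter_upwards [hχ.coeFn_toLp, (h.memLp_timeDeriv t).coeFn_toLp] with x h1 h2
  rw [h1, timeDerivLp, h2]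
  simp

/-- This is `du_bois_reymond` in time, tested with products η(x) θ(t). Because η vanishes near the
origin, t ↦ ∫ u η is continuous by continuity of u off the origin. -/
theorem integral_mul_sub_eq (h : IsRadialSolution p u Du ut) {η : Space → ℝ} (hη : ContDiff ℝ ∞ η)
    (hc : HasCompactSupport η) (hs : tsupport η ⊆ {0}ᶜ) (a b : ℝ) :
    (∫ x, u x b * η x) - ∫ x, u x a * η x = ∫ t in a..b, ∫ x, ut x t * η x := by
  have hmem : MemLp η 2 volume := hη.continuous.memLp_of_hasCompactSupport hc
  refine du_bois_reymond (I := univ) isOpen_univ ordConnected_univ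
    (F := fun t => ∫ x, u x t * η x) (H := fun t => ∫ x, ut x t * η x) ?_ ?_ ?_ (mem_univ a) (mem_univ b)
  · refine continuousOn_integral_of_compact_support (f := fun t x => u x t * η x) hc.isCompact ?_ ?_
    · refine Continuous.continuousOn ?_
      have h1 : Continuous fun z : Space × ℝ => u z.1 z.2 * η z.1 := by
        refine continuous_mul_of_tsupport (V := {z : Space × ℝ | z.1 ≠ 0})
          (isOpen_ne_fun continuous_fst continuous_const) h.continuousOn
          (hη.continuous.comp continuous_fst) fun z hz => ?_
        exact hs (tsupport_comp_subset_preimage η continuous_fst hz)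
      exact h1.comp continuous_swap
    · intro t x _ hx
      rw [image_eq_zero_of_notMem_tsupport hx, mul_zero]
  · refine (Continuous.locallyIntegrable ?_).locallyIntegrableOn _
    simp_rw [← h.inner_timeDerivLp hmem]
    exact continuous_const.inner h.continuous_timeDerivLp
  · intro θ hθ hθc _
    have hφ : ContDiff ℝ ∞ fun z : Space × ℝ => η z.1 * θ z.2 :=
      (hη.comp contDiff_fst).mul (hθ.comp contDiff_snd)
    have hφc : HasCompactSupport fun z : Space × ℝ => η z.1 * θ z.2 := by
      refine HasCompactSupport.of_support_subset_isCompact (hc.isCompact.prod hθc.isCompact) fun z hz => ?_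
      exact ⟨subset_tsupport _ (left_ne_zero_of_mul hz), subset_tsupport _ (right_ne_zero_of_mul hz)⟩
    have hfd : ∀ (x : Space) (t : ℝ), fderiv ℝ (fun z : Space × ℝ => η z.1 * θ z.2) (x, t) (0, 1)
        = η x * deriv θ t := by
      intro x t
      have h1 : HasFDerivAt (fun z : Space × ℝ => η z.1)
          ((fderiv ℝ η x).comp (ContinuousLinearMap.fst ℝ Space ℝ)) (x, t) :=
        HasFDerivAt.comp (x, t) (hη.differentiable (by simp) x).hasFDerivAt hasFDerivAt_fst
      have h2 : HasFDerivAt (fun z : Space × ℝ => θ z.2)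
          ((fderiv ℝ θ t).comp (ContinuousLinearMap.snd ℝ Space ℝ)) (x, t) :=
        HasFDerivAt.comp (x, t) (hθ.differentiable (by simp) t).hasFDerivAt hasFDerivAt_snd
      have h3 := (h1.mul h2).fderiv
      have h4 : fderiv ℝ (fun z : Space × ℝ => η z.1 * θ z.2) (x, t) = _ := h3
      rw [h4]
      simp
    have key := h.weak_timeDeriv _ hφ hφc
    simp only [hfd] at key
    calc ∫ t, (∫ x, u x t * η x) * deriv θ t = ∫ t, ∫ x, u x t * (η x * deriv θ t) := by
          congr 1; ext t; rw [← integral_mul_const]; congr 1; ext x; ring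
      _ = - ∫ t, ∫ x, ut x t * (η x * θ t) := key
      _ = - ∫ t, (∫ x, ut x t * η x) * θ t := by
          congr 2; ext t; rw [← integral_mul_const]; congr 1; ext x; ring

theorem inner_integral_timeDerivLp (h : IsRadialSolution p u Du ut) {χ : Space → ℝ}
    (hχ : MemLp χ 2 volume) (a b : ℝ) :
    inner ℝ hχ.toLp (∫ t in a..b, h.timeDerivLp t) = ∫ t in a..b, ∫ x, ut x t * χ x := by
  simp_rw [← h.inner_timeDerivLp hχ]
  exact ((innerSL ℝ hχ.toLp).intervalIntegral_comp_comm
    (h.continuous_timeDerivLp.intervalIntegrable a b)).symm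

/-- Both sides have the same integrals against test functions vanishing near the origin. The
increments of u thus lie in L², although u(t) itself need not. -/
theorem ae_sub_eq_integral (h : IsRadialSolution p u Du ut) (a b : ℝ) :
    ∀ᵐ x, u x b - u x a = (∫ t in a..b, h.timeDerivLp t : Lp ℝ 2 (volume : Measure Space)) x := by
  set c : Lp ℝ 2 (volume : Measure Space) := ∫ t in a..b, h.timeDerivLp t with hc
  have hul : ∀ t, LocallyIntegrable fun x => u x t := fun t =>
    (h.memLp_six t).locallyIntegrable (by norm_num)
  have hcl : LocallyIntegrable c := (Lp.memLp c).locallyIntegrable (by norm_num)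
  have hloc : LocallyIntegrableOn (fun x => u x b - u x a - c x) {0}ᶜ :=
    (((hul b).sub (hul a)).sub hcl).locallyIntegrableOn _
  have := IsOpen.ae_eq_zero_of_integral_contDiff_smul_eq_zero (μ := volume) isOpen_compl_singleton hloc (by
    intro η hη hηc hs
    have hmem : MemLp η 2 volume := hη.continuous.memLp_of_hasCompactSupport hηc
    have i1 : ∀ t, Integrable fun x => u x t * η x := fun t =>
      MemLp.mul_integrable_of_compact (hul t) hη.continuous hηc
    have i2 := MemLp.mul_integrable_of_compact hcl hη.continuous hηc
    have i3 : Integrable fun x => u x b * η x - u x a * η x := (i1 b).sub (i1 a)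
    rw [show (fun x => η x • (u x b - u x a - c x)) = fun x => (u x b * η x - u x a * η x) - c x * η x from by
      ext x; simp only [smul_eq_mul]; ring, integral_sub i3 i2,
      integral_sub (i1 b) (i1 a), h.integral_mul_sub_eq hη hηc hs, ← h.inner_integral_timeDerivLp hmem,
      L2.inner_def, sub_eq_zero]
    refine integral_congr_ae ?_
    filter_upwards [hmem.coeFn_toLp] with x hx
    rw [hx]; simp [hc])
  filter_upwards [this, ae_ne_zero_space] with x hx hx0
  exact sub_eq_zero.1 (hx hx0)

theorem hasDerivAt_integral_timeDerivLp (h : IsRadialSolution p u Du ut) (a t : ℝ) :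
    HasDerivAt (fun b => ∫ s in a..b, h.timeDerivLp s) (h.timeDerivLp t) t :=
  intervalIntegral.integral_hasDerivAt_right (h.continuous_timeDerivLp.intervalIntegrable _ _)
    (h.continuous_timeDerivLp.stronglyMeasurableAtFilter _ _) h.continuous_timeDerivLp.continuousAt

/-- The time derivative of a radial function is radial. -/
theorem exists_timeDeriv_profile (h : IsRadialSolution p u Du ut) (t : ℝ) :
    ∃ k : ℝ → ℝ, Measurable k ∧ ∀ᵐ x, ut x t = k ‖x‖ := by
  have hd := h.hasDerivAt_integral_timeDerivLp t t
  let δ : ℕ → ℝ := fun n => 1 / ((n : ℝ) + 1)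
  have hδ0 : ∀ n, δ n ≠ 0 := fun n => by positivity
  have hδ : Tendsto δ atTop (𝓝 0) := tendsto_one_div_add_atTop_nhds_zero_nat
  have hlim : Tendsto (fun n => (δ n)⁻¹ • ∫ s in t..(t + δ n), h.timeDerivLp s) atTop
      (𝓝 (h.timeDerivLp t)) := by
    have h1 := hasDerivAt_iff_tendsto_slope_zero.1 hd
    simp only [intervalIntegral.integral_same, sub_zero] at h1
    refine h1.comp (tendsto_nhdsWithin_iff.2 ⟨hδ, ?_⟩)
    exact Eventually.of_forall fun n => hδ0 n
  -- L² convergence of the difference quotients gives convergence almost everywhere along a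
  -- subsequence. Each quotient depends only on |x|, hence so does the limit.
  obtain ⟨ns, -, hns⟩ := (tendstoInMeasure_of_tendsto_Lp hlim).exists_seq_tendsto_ae
  have hq : ∀ᵐ x : Space, Tendsto (fun i => (δ (ns i))⁻¹ * (prof u ‖x‖ (t + δ (ns i)) - prof u ‖x‖ t))
      atTop (𝓝 (ut x t)) := by
    have hall : ∀ᵐ x : Space, ∀ i, u x (t + δ (ns i)) - u x t
        = (∫ s in t..(t + δ (ns i)), h.timeDerivLp s : Lp ℝ 2 (volume : Measure Space)) x :=
      ae_all_iff.2 fun i => h.ae_sub_eq_integral _ _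
    have hsm : ∀ᵐ x : Space, ∀ i, ((δ (ns i))⁻¹ • ∫ s in t..(t + δ (ns i)), h.timeDerivLp s :
        Lp ℝ 2 (volume : Measure Space)) x
        = (δ (ns i))⁻¹ * (∫ s in t..(t + δ (ns i)), h.timeDerivLp s : Lp ℝ 2 (volume : Measure Space)) x :=
      ae_all_iff.2 fun i => Lp.coeFn_smul _ _
    filter_upwards [hns, hall, hsm, (h.memLp_timeDeriv t).coeFn_toLp] with x h1 h2 h3 h4
    rw [timeDerivLp, h4] at h1
    refine h1.congr fun i => ?_
    rw [h3, ← h2, h.eq_prof, h.eq_prof]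
  have hex : ∀ᵐ r ∂(volume.restrict (Ioi (0 : ℝ))), ∃ l, Tendsto
      (fun i => (δ (ns i))⁻¹ * (prof u r (t + δ (ns i)) - prof u r t)) atTop (𝓝 l) :=
    ae_norm_iff.1 (hq.mono fun x hx => ⟨_, hx⟩)
  -- By `ae_norm_iff` the limit exists for almost every radius, so it has a measurable version on
  -- the half line.
  obtain ⟨k, hkm, hk⟩ := measurable_limit_of_tendsto_metrizable_ae (fun i => by
    refine ContinuousOn.aemeasurable ?_ measurableSet_Ioi
    exact continuousOn_const.mul ((h.continuousOn_prof_slice _).sub (h.continuousOn_prof_slice _))) hex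
  refine ⟨k, hkm, ?_⟩
  filter_upwards [hq, ae_norm_iff.2 hk] with x h1 h2
  exact tendsto_nhds_unique h1 h2

theorem integrable_timeDeriv_sq (h : IsRadialSolution p u Du ut) (t : ℝ) :
    Integrable fun x => ut x t ^ 2 := by
  simpa using (h.memLp_timeDeriv t).integrable_norm_pow (by norm_num)

theorem timeDeriv_profile_sq (h : IsRadialSolution p u Du ut) {t : ℝ} {k : ℝ → ℝ}
    (hk : ∀ᵐ x, ut x t = k ‖x‖) :
    IntegrableOn (fun r => r ^ 2 * k r ^ 2) (Ioi 0) ∧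
      ∫ r in Ioi (0 : ℝ), r ^ 2 * k r ^ 2 = sphereArea⁻¹ * ∫ x, ut x t ^ 2 := by
  have hae : (fun x => ut x t ^ 2) =ᵐ[volume] fun x : Space => k ‖x‖ ^ 2 := by
    filter_upwards [hk] with x hx
    rw [hx]
  constructor
  · rw [← integrable_norm_iff (f := fun r => k r ^ 2)]
    exact (h.integrable_timeDeriv_sq t).congr hae
  · rw [integral_congr_ae hae, integral_norm (fun r => k r ^ 2), inv_mul_cancel_left₀ sphereArea_pos.ne']

/-- Up to the sphere area, ∫_a^b w dr pairs u with the function equal to 1/|x| on an annulus and 0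
elsewhere. That function is in L², so differentiability of the L²-valued increments of u carries
over. -/
theorem hasDerivAt_integral_reduced (h : IsRadialSolution p u Du ut) {t : ℝ} {k : ℝ → ℝ}
    (hk : ∀ᵐ x, ut x t = k ‖x‖) {a b : ℝ} (ha : 0 < a) (hab : a ≤ b) :
    IntervalIntegrable (fun r => r * k r) volume a b ∧
    HasDerivAt (fun s => ∫ r in a..b, reduced u (r, s)) (∫ r in a..b, r * k r) t := by
  set χ : Space → ℝ := fun x => (Ioc a b).indicator (fun r => r⁻¹) ‖x‖ with hχ
  have hχm : Measurable χ := (measurable_inv.indicator measurableSet_Ioc).comp measurable_norm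
  have hχ2 : MemLp χ 2 volume := by
    have hb : ∀ x, ‖χ x‖ ≤ a⁻¹ := by
      intro x
      by_cases hx : ‖x‖ ∈ Ioc a b
      · simp only [hχ, indicator_of_mem hx]
        rw [norm_inv, norm_norm]
        exact inv_anti₀ ha hx.1.le
      · simp only [hχ, indicator_of_notMem hx, norm_zero]; positivity
    have hbound : MemLp ((Metric.closedBall (0 : Space) b).indicator fun _ => a⁻¹) 2 volume :=
      memLp_indicator_const 2 measurableSet_closedBall _ (Or.inr measure_closedBall_lt_top.ne)
    refine hbound.mono hχm.aestronglyMeasurable (ae_of_all _ fun x => ?_)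
    by_cases hx : x ∈ Metric.closedBall (0 : Space) b
    · rw [indicator_of_mem hx]
      exact (hb x).trans (Real.le_norm_self _)
    · rw [indicator_of_notMem hx]
      simp only [hχ]
      rw [indicator_of_notMem fun h => hx (by simpa using h.2)]
  have hrad : ∀ f : ℝ → ℝ, ∫ x : Space, f ‖x‖ * χ x = sphereArea * ∫ r in a..b, r * f r := by
    intro f
    rw [integral_norm (fun r => f r * (Ioc a b).indicator (fun r => r⁻¹) r),
      intervalIntegral.integral_of_le hab]
    congr 1
    rw [show (fun r => r ^ 2 * (f r * (Ioc a b).indicator (fun r => r⁻¹) r))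
      = (Ioc a b).indicator fun r => r ^ 2 * (f r * r⁻¹) from by
        ext r; by_cases hr : r ∈ Ioc a b <;> simp [hr],
      setIntegral_indicator measurableSet_Ioc,
      inter_eq_right.2 (show Ioc a b ⊆ Ioi 0 from fun x hx => ha.trans hx.1)]
    refine setIntegral_congr_fun measurableSet_Ioc fun r hr => ?_
    have : r ≠ 0 := (ha.trans hr.1).ne'
    field_simp
  have hs := sphereArea_pos
  have hlin : ∀ s, ∫ r in a..b, reduced u (r, s) = (∫ r in a..b, reduced u (r, t))
      + sphereArea⁻¹ * inner ℝ hχ2.toLp (∫ s' in t..s, h.timeDerivLp s') := by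
    intro s
    have h1 : inner ℝ hχ2.toLp (∫ s' in t..s, h.timeDerivLp s')
        = ∫ x, (prof u ‖x‖ s - prof u ‖x‖ t) * χ x := by
      rw [L2.inner_def]
      refine integral_congr_ae ?_
      filter_upwards [hχ2.coeFn_toLp, h.ae_sub_eq_integral t s] with x h1 h2
      rw [h1, ← h2, h.eq_prof, h.eq_prof]; simp
    rw [h1, hrad fun r => prof u r s - prof u r t, inv_mul_cancel_left₀ hs.ne',
      ← intervalIntegral.integral_add]
    · refine intervalIntegral.integral_congr fun r _ => ?_
      simp only [reduced_eq]; ring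
    · exact (h.continuous_reduced.comp (by fun_prop : Continuous fun r : ℝ => (r, t))).intervalIntegrable _ _
    · refine IntervalIntegrable.congr (f := fun r => reduced u (r, s) - reduced u (r, t)) (fun r _ => ?_) ?_
      · simp only [reduced_eq]; ring
      · exact ((h.continuous_reduced.comp (by fun_prop : Continuous fun r : ℝ => (r, s))).sub
          (h.continuous_reduced.comp (by fun_prop : Continuous fun r : ℝ => (r, t)))).intervalIntegrable _ _
  constructor
  · have hi : Integrable fun x => ut x t * χ x := by
      have := (h.memLp_timeDeriv t).integrable_mul hχ2
      exact this
    have hi2 : Integrable fun x : Space => k ‖x‖ * (Ioc a b).indicator (fun r => r⁻¹) ‖x‖ :=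
      hi.congr (by filter_upwards [hk] with x hx; rw [hx])
    rw [integrable_norm_iff (f := fun r => k r * (Ioc a b).indicator (fun r => r⁻¹) r)] at hi2
    rw [intervalIntegrable_iff_integrableOn_Ioc_of_le hab]
    refine (hi2.mono_set (show Ioc a b ⊆ Ioi 0 from fun x hx => ha.trans hx.1)).congr_fun ?_ measurableSet_Ioc
    intro r hr
    have : r ≠ 0 := (ha.trans hr.1).ne'
    simp only [indicator_of_mem hr]
    field_simp
  · have h1 : ∫ r in a..b, r * k r = sphereArea⁻¹ * inner ℝ hχ2.toLp (h.timeDerivLp t) := by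
      rw [h.inner_timeDerivLp hχ2, integral_congr_ae (g := fun x : Space => k ‖x‖ * χ x), hrad,
        inv_mul_cancel_left₀ hs.ne']
      filter_upwards [hk] with x hx
      rw [hx]
    rw [h1, show (fun s => ∫ r in a..b, reduced u (r, s)) = fun s => (∫ r in a..b, reduced u (r, t))
      + sphereArea⁻¹ * inner ℝ hχ2.toLp (∫ s' in t..s, h.timeDerivLp s') from funext hlin]
    have h2 := (innerSL ℝ hχ2.toLp).hasFDerivAt.comp_hasDerivAt t (h.hasDerivAt_integral_timeDerivLp t t)
    exact (h2.const_mul _).const_add _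

end IsRadialSolution

/-! ### Characteristic coordinates -/

/-- The characteristic coordinates `(x, y) ↦ (x + y, σ (x - y))`, for a sign `σ`. -/
def charMap (σ : ℝ) (q : ℝ × ℝ) : ℝ × ℝ := (q.1 + q.2, σ * (q.1 - q.2))

theorem continuous_charMap (σ : ℝ) : Continuous (charMap σ) := by unfold charMap; fun_prop

/-- The inverse of `charMap`. -/
noncomputable def charInv (σ : ℝ) (z : ℝ × ℝ) : ℝ × ℝ := ((z.1 + σ * z.2) / 2, (z.1 - σ * z.2) / 2)

theorem continuous_charInv (σ : ℝ) : Continuous (charInv σ) := by unfold charInv; fun_prop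

theorem charInv_charMap {σ : ℝ} (hσ : σ ^ 2 = 1) (q : ℝ × ℝ) : charInv σ (charMap σ q) = q := by
  ext
  · simp only [charInv, charMap]; linear_combination ((q.1 - q.2) / 2) * hσ
  · simp only [charInv, charMap]; linear_combination (-(q.1 - q.2) / 2) * hσ

theorem charMap_charInv {σ : ℝ} (hσ : σ ^ 2 = 1) (z : ℝ × ℝ) : charMap σ (charInv σ z) = z := by
  ext
  · simp only [charInv, charMap]; ring
  · simp only [charInv, charMap]; linear_combination z.2 * hσ

/-- The determinant is -2σ. Both signs are kept because the two families of characteristics arise as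
the lines with fixed first coordinate for σ = 1 and for σ = -1. -/
theorem map_charMap {σ : ℝ} (hσ : σ ^ 2 = 1) :
    Measure.map (charMap σ) volume = (2⁻¹ : ENNReal) • (volume : Measure (ℝ × ℝ)) := by
  let L : (ℝ × ℝ) →ₗ[ℝ] (ℝ × ℝ) :=
    { toFun := charMap σ
      map_add' := fun a b => by ext <;> simp [charMap] <;> ring
      map_smul' := fun c a => by ext <;> simp [charMap] <;> ring }
  have hL : L = Matrix.toLin (Module.Basis.finTwoProd ℝ) (Module.Basis.finTwoProd ℝ) !![1, 1; σ, -σ] := by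
    refine LinearMap.ext fun q => ?_
    rw [Matrix.toLin_finTwoProd_apply]
    ext <;> simp [L, charMap] <;> ring
  have hdet : LinearMap.det L = -2 * σ := by
    rw [hL, LinearMap.det_toLin, Matrix.det_fin_two_of]; ring
  have hσ0 : σ ≠ 0 := by rintro rfl; norm_num at hσ
  have habs : |σ| = 1 := by
    have : |σ| ^ 2 = 1 := by rw [sq_abs, hσ]
    nlinarith [abs_nonneg σ]
  have h := Measure.map_linearMap_addHaar_eq_smul_addHaar (volume : Measure (ℝ × ℝ))
    (f := L) (by rw [hdet]; simpa using hσ0)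
  rw [hdet, abs_inv, abs_mul, habs] at h
  have h2 : ENNReal.ofReal (|(-2 : ℝ)| * 1)⁻¹ = 2⁻¹ := by
    rw [abs_neg, abs_two, mul_one, ENNReal.ofReal_inv_of_pos two_pos]; simp
  rw [h2] at h
  exact h

theorem measurableEmbedding_charMap {σ : ℝ} (hσ : σ ^ 2 = 1) : MeasurableEmbedding (charMap σ) := by
  let e : (ℝ × ℝ) ≃ₜ (ℝ × ℝ) :=
    { toFun := charMap σ
      invFun := charInv σ
      left_inv := charInv_charMap hσ
      right_inv := charMap_charInv hσ
      continuous_toFun := continuous_charMap σ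
      continuous_invFun := continuous_charInv σ }
  exact e.measurableEmbedding

theorem integrable_charMap_iff {σ : ℝ} (hσ : σ ^ 2 = 1) {F : ℝ × ℝ → ℝ} :
    Integrable (fun q => F (charMap σ q)) ↔ Integrable F := by
  have h := (measurableEmbedding_charMap hσ).integrable_map_iff (μ := volume) (g := F)
  rw [map_charMap hσ, integrable_smul_measure (by simp) (by simp)] at h
  exact h.symm

theorem integral_charMap {σ : ℝ} (hσ : σ ^ 2 = 1) (F : ℝ × ℝ → ℝ) :
    ∫ z, F z = 2 * ∫ q, F (charMap σ q) := by
  have h := (measurableEmbedding_charMap hσ).integral_map (μ := volume) F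
  rw [map_charMap hσ, integral_smul_measure] at h
  rw [← h]; simp

/-! ### The reduced equation in the sense of distributions -/

/-- The nonlinearity `|w|^(p-1) w / r^(p-1)`. -/
noncomputable def nonlin (p : ℝ) (w : ℝ × ℝ → ℝ) (z : ℝ × ℝ) : ℝ :=
  |w z| ^ (p - 1) * w z / z.1 ^ (p - 1)

theorem continuous_abs_rpow_mul {s : ℝ} (hs : 0 < s) : Continuous fun x : ℝ => |x| ^ s * x :=
  (continuous_abs.rpow_const fun _ => Or.inr hs.le).mul continuous_id

theorem continuousOn_nonlin {p : ℝ} (hp : 3 ≤ p) {w : ℝ × ℝ → ℝ} (hw : Continuous w) :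
    ContinuousOn (nonlin p w) {z | 0 < z.1} := by
  refine ContinuousOn.div ((continuous_abs_rpow_mul (by linarith : 0 < p - 1)).comp hw).continuousOn ?_ ?_
  · exact continuousOn_fst.rpow_const fun z hz => Or.inl (ne_of_gt hz)
  · intro z hz
    exact (Real.rpow_pos_of_pos hz _).ne'

theorem nonlin_reduced {p : ℝ} {u : Space → ℝ → ℝ} {r t : ℝ} (hr : 0 < r) :
    nonlin p (reduced u) (r, t) = r * (|prof u r t| ^ (p - 1) * prof u r t) := by
  have h1 : r ^ (p - 1) ≠ 0 := (Real.rpow_pos_of_pos hr _).ne'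
  rw [nonlin, IsRadialSolution.reduced_eq, abs_mul, abs_of_pos hr, Real.mul_rpow hr.le (abs_nonneg _)]
  field_simp

theorem continuous_toLp_of_compactSupport {φ : Space × ℝ → ℝ} (hφ : Continuous φ)
    (hc : HasCompactSupport φ) :
    ∃ hm : ∀ t, MemLp (fun x => φ (x, t)) 2 volume, Continuous fun t => (hm t).toLp := by
  set K : Set Space := Prod.fst '' tsupport φ with hK
  have hKc : IsCompact K := hc.isCompact.image continuous_fst
  have hz : ∀ x t, x ∉ K → φ (x, t) = 0 := fun x t hx =>
    image_eq_zero_of_notMem_tsupport fun h => hx ⟨(x, t), h, rfl⟩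
  have hcs : ∀ t, HasCompactSupport fun x => φ (x, t) := fun t =>
    HasCompactSupport.of_support_subset_isCompact hKc fun x hx => by
      by_contra h; exact hx (hz x t h)
  have hm : ∀ t, MemLp (fun x => φ (x, t)) 2 volume := fun t =>
    (by fun_prop : Continuous fun x => φ (x, t)).memLp_of_hasCompactSupport (hcs t)
  refine ⟨hm, continuous_toLp hm fun t => ?_⟩
  have h1 : ContinuousOn (fun s => ∫ x, (φ (x, s) - φ (x, t)) ^ 2) univ := by
    refine continuousOn_integral_of_compact_support (f := fun s x => (φ (x, s) - φ (x, t)) ^ 2) hKc ?_ ?_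
    · exact (by fun_prop : Continuous fun q : ℝ × Space => (φ (q.2, q.1) - φ (q.2, t)) ^ 2).continuousOn
    · intro s x _ hx
      rw [hz x s hx, hz x t hx]; simp
  have h2 : Tendsto (fun s => ENNReal.ofReal ((∫ x, (φ (x, s) - φ (x, t)) ^ 2) ^ (2⁻¹ : ℝ))) (𝓝 t) (𝓝 0) := by
    have h3 : Tendsto (fun s => ∫ x, (φ (x, s) - φ (x, t)) ^ 2) (𝓝 t) (𝓝 0) := by
      have := (continuousOn_univ.1 h1).tendsto t
      simpa using this
    have h4 := ENNReal.tendsto_ofReal (h3.rpow_const (p := (2⁻¹ : ℝ)) (Or.inr (by norm_num)))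
    simpa using h4
  refine h2.congr fun s => ?_
  have hd : MemLp (fun x => φ (x, s) - φ (x, t)) 2 volume := (hm s).sub (hm t)
  rw [MemLp.eLpNorm_eq_integral_rpow_norm (by norm_num) (by norm_num) hd]
  simp

theorem hasDerivAt_fst_slice {F : ℝ × ℝ → ℝ} (hF : ContDiff ℝ ∞ F) (r t : ℝ) :
    HasDerivAt (fun s => F (s, t)) (fderiv ℝ F (r, t) (1, 0)) r :=
  ((hF.differentiable (by simp) (r, t)).hasFDerivAt.comp_hasDerivAt r
    ((hasDerivAt_id r).prodMk (hasDerivAt_const r t)))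

theorem hasDerivAt_snd_slice {F : ℝ × ℝ → ℝ} (hF : ContDiff ℝ ∞ F) (r t : ℝ) :
    HasDerivAt (fun s => F (r, s)) (fderiv ℝ F (r, t) (0, 1)) t :=
  ((hF.differentiable (by simp) (r, t)).hasFDerivAt.comp_hasDerivAt t
    ((hasDerivAt_const t r).prodMk (hasDerivAt_id t)))

theorem contDiff_fderiv_apply_const {F : ℝ × ℝ → ℝ} (hF : ContDiff ℝ ∞ F) (v : ℝ × ℝ) :
    ContDiff ℝ ∞ fun z => fderiv ℝ F z v :=
  (hF.fderiv_right (m := ∞) (by simp)).clm_apply contDiff_const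

theorem tsupport_fderiv_apply_const (F : ℝ × ℝ → ℝ) (v : ℝ × ℝ) :
    tsupport (fun z => fderiv ℝ F z v) ⊆ tsupport F := tsupport_fderiv_apply_subset ℝ v

theorem contDiff_mul_inv_fst {F : ℝ × ℝ → ℝ} (hF : ContDiff ℝ ∞ F) (hs : tsupport F ⊆ {z | 0 < z.1}) :
    ContDiff ℝ ∞ fun z => F z * z.1⁻¹ :=
  contDiff_mul_of_tsupport hF hs fun _ hz => contDiffAt_fst.inv (ne_of_gt hz)

theorem tsupport_mul_inv_fst {F : ℝ × ℝ → ℝ} (hs : tsupport F ⊆ {z | 0 < z.1}) :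
    tsupport (fun z => F z * z.1⁻¹) ⊆ {z | 0 < z.1} := (tsupport_mul_subset F _).trans hs

/-- The function `(x, t) ↦ F (|x|, t) / |x|` on space-time. -/
noncomputable def radialTest (F : ℝ × ℝ → ℝ) (z : Space × ℝ) : ℝ := F (‖z.1‖, z.2) * ‖z.1‖⁻¹

theorem contDiff_radialTest {F : ℝ × ℝ → ℝ} (hF : ContDiff ℝ ∞ F) (hs : tsupport F ⊆ {z | 0 < z.1}) :
    ContDiff ℝ ∞ (radialTest F) :=
  radialTime_test_contDiff (contDiff_mul_inv_fst hF hs) (tsupport_mul_inv_fst hs)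

theorem hasCompactSupport_radialTest {F : ℝ × ℝ → ℝ} (hc : HasCompactSupport F) :
    HasCompactSupport (radialTest F) :=
  radialTime_test_hasCompactSupport (k := fun z => F z * z.1⁻¹) hc.mul_right

theorem fderiv_radialTest_time {F : ℝ × ℝ → ℝ} (hF : ContDiff ℝ ∞ F) (hs : tsupport F ⊆ {z | 0 < z.1})
    {x : Space} (hx : x ≠ 0) (t : ℝ) :
    fderiv ℝ (radialTest F) (x, t) (0, 1) = fderiv ℝ F (‖x‖, t) (0, 1) * ‖x‖⁻¹ :=
  (radialTime_test_fderiv_time (contDiff_mul_inv_fst hF hs) hx t).trans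
    ((hasDerivAt_snd_slice (contDiff_mul_inv_fst hF hs) ‖x‖ t).unique
      ((hasDerivAt_snd_slice hF ‖x‖ t).mul_const ‖x‖⁻¹))

theorem fderiv_radialTest_space {F : ℝ × ℝ → ℝ} (hF : ContDiff ℝ ∞ F) (hs : tsupport F ⊆ {z | 0 < z.1})
    {x : Space} (hx : x ≠ 0) (t : ℝ) (v : Space) :
    fderiv ℝ (radialTest F) (x, t) (v, 0)
      = fderiv ℝ (fun z => F z * z.1⁻¹) (‖x‖, t) (1, 0) * (‖x‖⁻¹ * inner ℝ x v) :=
  radialTime_test_fderiv_space (contDiff_mul_inv_fst hF hs) hx t v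

/-- The radial divergence of the field `(ψ/r)_r x/r`. -/
theorem radial_divergence {F : ℝ × ℝ → ℝ} (hF : ContDiff ℝ ∞ F) (hs : tsupport F ⊆ {z | 0 < z.1})
    {r : ℝ} (hr : 0 < r) (t : ℝ) :
    r * (3 * (fderiv ℝ (fun z => F z * z.1⁻¹) (r, t) (1, 0) * r⁻¹)
      + fderiv ℝ (fun y => fderiv ℝ (fun z => F z * z.1⁻¹) y (1, 0) * y.1⁻¹) (r, t) (1, 0) * r)
      = fderiv ℝ (fun y => fderiv ℝ F y (1, 0)) (r, t) (1, 0) := by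
  have hk := contDiff_mul_inv_fst hF hs
  have hks := tsupport_mul_inv_fst hs
  have hkr := contDiff_fderiv_apply_const hk (1, 0)
  have hkrs := (tsupport_fderiv_apply_const (fun z => F z * z.1⁻¹) (1, 0)).trans hks
  have hm := contDiff_mul_inv_fst hkr hkrs
  have hFr := contDiff_fderiv_apply_const hF (1, 0)
  have h1 : ∀ s : ℝ, 0 < s → fderiv ℝ (fun z => F z * z.1⁻¹) (s, t) (1, 0)
      = fderiv ℝ F (s, t) (1, 0) * s⁻¹ + F (s, t) * (-(s ^ 2)⁻¹) := fun s hs' =>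
    (hasDerivAt_fst_slice hk s t).unique ((hasDerivAt_fst_slice hF s t).mul (hasDerivAt_inv hs'.ne'))
  have h2 := hasDerivAt_fst_slice hm r t
  have h3 : HasDerivAt (fun s => (fderiv ℝ F (s, t) (1, 0) * s⁻¹ + F (s, t) * (-(s ^ 2)⁻¹)) * s⁻¹)
      ((fderiv ℝ (fun y => fderiv ℝ F y (1, 0)) (r, t) (1, 0) * r⁻¹
        + fderiv ℝ F (r, t) (1, 0) * (-(r ^ 2)⁻¹)
        + (fderiv ℝ F (r, t) (1, 0) * (-(r ^ 2)⁻¹) + F (r, t) * (2 * (r ^ 3)⁻¹))) * r⁻¹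
        + (fderiv ℝ F (r, t) (1, 0) * r⁻¹ + F (r, t) * (-(r ^ 2)⁻¹)) * (-(r ^ 2)⁻¹)) r := by
    have h4 : HasDerivAt (fun s : ℝ => -(s ^ 2)⁻¹) (2 * (r ^ 3)⁻¹) r :=
      (((hasDerivAt_pow 2 r).inv (by positivity)).neg).congr_deriv (by simp; field_simp)
    exact (((hasDerivAt_fst_slice hFr r t).mul (hasDerivAt_inv hr.ne')).add
      ((hasDerivAt_fst_slice hF r t).mul h4)).mul (hasDerivAt_inv hr.ne')
  have h5 := h2.unique (h3.congr_of_eventuallyEq (by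
    filter_upwards [lt_mem_nhds hr] with s hs'
    rw [h1 s hs']))
  rw [h5, h1 r hr]
  field_simp
  ring

theorem integrable_slice {F : ℝ × ℝ → ℝ} (hF : Continuous F) (hc : HasCompactSupport F)
    (hs : tsupport F ⊆ {z | 0 < z.1}) :
    Integrable (fun t => ∫ r in Ioi (0 : ℝ), F (r, t)) ∧
      ∫ t, ∫ r in Ioi (0 : ℝ), F (r, t) = ∫ z, F z := by
  have hi : Integrable F (volume.prod volume) := hF.integrable_of_hasCompactSupport hc
  have h1 : ∀ t, ∫ r in Ioi (0 : ℝ), F (r, t) = ∫ r, F (r, t) := fun t =>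
    setIntegral_eq_integral_of_forall_compl_eq_zero fun r hr =>
      image_eq_zero_of_notMem_tsupport fun hz => hr (hs hz)
  simp_rw [h1]
  exact ⟨hi.integral_prod_right, (integral_prod_symm F hi).symm⟩

namespace IsRadialSolution

variable {p : ℝ} {u : Space → ℝ → ℝ} {Du : Space → ℝ → Space} {ut : Space → ℝ → ℝ}

/-- The spatial gradient of F(|x|, t)/|x| is m x with m = (F/r)_r / r, so `weak_radial_identity`
applies. By `radial_divergence`, r times the divergence of m x is F_rr: the substitution w = r u
turns the three-dimensional Laplacian into ∂_r². -/
theorem integral_inner_gradient_test (h : IsRadialSolution p u Du ut) {F : ℝ × ℝ → ℝ} (hF : ContDiff ℝ ∞ F)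
    (hc : HasCompactSupport F) (hs : tsupport F ⊆ {z | 0 < z.1}) (t : ℝ) :
    Integrable (fun x => fderiv ℝ (radialTest F) (x, t) (Du x t, 0)) ∧
    ∫ x, fderiv ℝ (radialTest F) (x, t) (Du x t, 0)
      = -(sphereArea * ∫ r in Ioi (0 : ℝ), reduced u (r, t) *
          fderiv ℝ (fun y => fderiv ℝ F y (1, 0)) (r, t) (1, 0)) := by
  have hk := contDiff_mul_inv_fst hF hs
  have hks := tsupport_mul_inv_fst hs
  have hkr := contDiff_fderiv_apply_const hk (1, 0)
  have hkrs := (tsupport_fderiv_apply_const (fun z => F z * z.1⁻¹) (1, 0)).trans hks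
  have hm := contDiff_mul_inv_fst hkr hkrs
  have hms := tsupport_mul_inv_fst hkrs
  have hmc : HasCompactSupport fun y => fderiv ℝ (fun z : ℝ × ℝ => F z * z.1⁻¹) y (1, 0) * y.1⁻¹ :=
    have h1 : HasCompactSupport fun z : ℝ × ℝ => F z * z.1⁻¹ := hc.mul_right
    have h2 : HasCompactSupport fun y => fderiv ℝ (fun z : ℝ × ℝ => F z * z.1⁻¹) y (1, 0) :=
      h1.fderiv_apply (𝕜 := ℝ) (1, 0)
    h2.mul_right
  have hdiv := fun r (hr : (0 : ℝ) < r) => radial_divergence hF hs hr t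
  obtain ⟨m, hmdef⟩ : ∃ m : ℝ × ℝ → ℝ,
    m = fun y => fderiv ℝ (fun z : ℝ × ℝ => F z * z.1⁻¹) y (1, 0) * y.1⁻¹ := ⟨_, rfl⟩
  have hm1 : ∀ r, m (r, t) = fderiv ℝ (fun z : ℝ × ℝ => F z * z.1⁻¹) (r, t) (1, 0) * r⁻¹ := fun r => by
    rw [hmdef]
  rw [← hmdef] at hm hms hmc
  simp only [← hmdef, ← hm1] at hdiv
  have hη0 : ContDiff ℝ ∞ fun z : Space × ℝ => m (‖z.1‖, z.2) := radialTime_test_contDiff hm hms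
  have hη1 : ContDiff ℝ ∞ fun x : Space => (x, t) := contDiff_prodMk_left t
  have hη : ContDiff ℝ ∞ fun x : Space => m (‖x‖, t) := by
    have h1 := hη0.comp hη1
    exact h1
  have hηc : HasCompactSupport fun x : Space => m (‖x‖, t) := by
    have h1 : HasCompactSupport fun z : Space × ℝ => m (‖z.1‖, z.2) := radialTime_test_hasCompactSupport hmc
    have h2 : IsCompact (Prod.fst '' tsupport fun z : Space × ℝ => m (‖z.1‖, z.2)) :=
      h1.isCompact.image continuous_fst
    refine HasCompactSupport.of_support_subset_isCompact h2 ?_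
    intro x hx
    exact ⟨(x, t), subset_tsupport (fun z : Space × ℝ => m (‖z.1‖, z.2)) hx, rfl⟩
  have hDl : LocallyIntegrable fun x => Du x t := (h.memLp_gradient t).locallyIntegrable (by norm_num)
  have hul : LocallyIntegrable fun x => u x t := (h.memLp_six t).locallyIntegrable (by norm_num)
  have e1 : (fun x => fderiv ℝ (radialTest F) (x, t) (Du x t, 0))
      =ᵐ[volume] fun x => inner ℝ (Du x t) x * m (‖x‖, t) := by
    filter_upwards [ae_ne_zero_space] with x hx
    rw [fderiv_radialTest_space hF hs hx t, real_inner_comm, hm1]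
    ring
  have hI : Integrable fun x : Space => inner ℝ (Du x t) x * m (‖x‖, t) :=
    integrable_inner_mul hDl hη.continuous hηc
  constructor
  · exact (integrable_congr e1).2 hI
  rw [integral_congr_ae e1, ← neg_eq_iff_eq_neg, ← weak_radial_identity hul hDl (h.weak_gradient t) hη hηc]
  have e2 : ∀ᵐ x : Space, u x t * (3 * m (‖x‖, t) + fderiv ℝ (fun x : Space => m (‖x‖, t)) x x)
      = (fun r => prof u r t * (3 * m (r, t) + fderiv ℝ m (r, t) (1, 0) * r)) ‖x‖ := by
    filter_upwards [ae_ne_zero_space] with x hx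
    have h1 : HasFDerivAt (fun x : Space => m (‖x‖, t)) _ x :=
      (hasDerivAt_fst_slice hm ‖x‖ t).comp_hasFDerivAt x (hasFDerivAt_norm_space hx)
    have hn : ‖x‖ ≠ 0 := norm_ne_zero_iff.2 hx
    rw [h1.fderiv, h.eq_prof]
    simp only [smul_apply, innerSL_apply_apply, smul_eq_mul, real_inner_self_eq_norm_sq]
    field_simp
  rw [integral_congr_ae e2,
    integral_norm (fun r => prof u r t * (3 * m (r, t) + fderiv ℝ m (r, t) (1, 0) * r))]
  congr 1
  refine setIntegral_congr_fun measurableSet_Ioi fun r hr => ?_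
  simp only [reduced_eq, ← hdiv r hr]
  ring

theorem integral_nonlin_test (h : IsRadialSolution p u Du ut) (hp : 3 ≤ p) {F : ℝ × ℝ → ℝ} (hF : ContDiff ℝ ∞ F)
    (hc : HasCompactSupport F) (hs : tsupport F ⊆ {z | 0 < z.1}) (t : ℝ) :
    Integrable (fun x => |u x t| ^ (p - 1) * u x t * (F (‖x‖, t) * ‖x‖⁻¹)) ∧
    ∫ x, |u x t| ^ (p - 1) * u x t * (F (‖x‖, t) * ‖x‖⁻¹)
      = sphereArea * ∫ r in Ioi (0 : ℝ), nonlin p (reduced u) (r, t) * F (r, t) := by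
  have hcont : Continuous fun z => nonlin p (reduced u) z * F z :=
    continuous_mul_of_tsupport (isOpen_lt continuous_const continuous_fst)
      (continuousOn_nonlin hp h.continuous_reduced) hF.continuous hs
  have hcs : HasCompactSupport fun r => nonlin p (reduced u) (r, t) * F (r, t) := by
    have h1 : HasCompactSupport fun z => nonlin p (reduced u) z * F z := hc.mul_left
    refine HasCompactSupport.of_support_subset_isCompact (h1.isCompact.image continuous_fst) fun x hx => ?_
    exact ⟨(x, t), subset_tsupport _ hx, rfl⟩
  have hi : Integrable fun r => nonlin p (reduced u) (r, t) * F (r, t) :=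
    (hcont.comp (by fun_prop : Continuous fun r : ℝ => (r, t))).integrable_of_hasCompactSupport hcs
  have e1 : ∀ r ∈ Ioi (0 : ℝ), r ^ 2 * (|prof u r t| ^ (p - 1) * prof u r t * (F (r, t) * r⁻¹))
      = nonlin p (reduced u) (r, t) * F (r, t) := fun r hr => by
    have hr : 0 < r := hr
    rw [nonlin_reduced hr]; field_simp
  simp_rw [h.eq_prof]
  constructor
  · rw [integrable_norm_iff (f := fun r => |prof u r t| ^ (p - 1) * prof u r t * (F (r, t) * r⁻¹))]
    exact hi.integrableOn.congr_fun (fun r hr => (e1 r hr).symm) measurableSet_Ioi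
  · rw [integral_norm (fun r => |prof u r t| ^ (p - 1) * prof u r t * (F (r, t) * r⁻¹))]
    rw [setIntegral_congr_fun measurableSet_Ioi e1]

/-- The time derivative of the radial test function is itself admissible in `weak_timeDeriv`, which
moves the remaining derivative onto the test function. Continuity in L² gives the integrability in t
needed to split the weak equation. -/
theorem integral_integral_timeDeriv_test (h : IsRadialSolution p u Du ut) {F : ℝ × ℝ → ℝ} (hF : ContDiff ℝ ∞ F)
    (hc : HasCompactSupport F) (hs : tsupport F ⊆ {z | 0 < z.1}) :
    (∀ t, Integrable fun x => ut x t * fderiv ℝ (radialTest F) (x, t) (0, 1)) ∧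
    Integrable (fun t => ∫ x, ut x t * fderiv ℝ (radialTest F) (x, t) (0, 1)) ∧
    ∫ t, ∫ x, ut x t * fderiv ℝ (radialTest F) (x, t) (0, 1)
      = -(sphereArea * ∫ t, ∫ r in Ioi (0 : ℝ), reduced u (r, t) *
          fderiv ℝ (fun y => fderiv ℝ F y (0, 1)) (r, t) (0, 1)) := by
  have hφ := contDiff_radialTest hF hs
  have hψ : ContDiff ℝ ∞ fun z => fderiv ℝ (radialTest F) z (0, 1) :=
    (hφ.fderiv_right (m := ∞) (by simp)).clm_apply contDiff_const
  have hψc : HasCompactSupport fun z => fderiv ℝ (radialTest F) z (0, 1) :=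
    (hasCompactSupport_radialTest hc).fderiv_apply (𝕜 := ℝ) _
  obtain ⟨hm, hmc⟩ := continuous_toLp_of_compactSupport hψ.continuous hψc
  have e0 : ∀ t, ∫ x, ut x t * fderiv ℝ (radialTest F) (x, t) (0, 1)
      = inner ℝ (hm t).toLp (h.timeDerivLp t) := fun t => (h.inner_timeDerivLp (hm t) t).symm
  refine ⟨fun t => (h.memLp_timeDeriv t).integrable_mul (hm t), ?_, ?_⟩
  · simp_rw [e0]
    refine (hmc.inner h.continuous_timeDerivLp).integrable_of_hasCompactSupport ?_
    refine HasCompactSupport.of_support_subset_isCompact (hψc.isCompact.image continuous_snd) fun t ht => ?_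
    by_contra hn
    refine ht ?_
    change inner ℝ (hm t).toLp (h.timeDerivLp t) = 0
    rw [h.inner_timeDerivLp]
    have : ∀ x, fderiv ℝ (radialTest F) (x, t) (0, 1) = 0 := fun x =>
      image_eq_zero_of_notMem_tsupport (f := fun z => fderiv ℝ (radialTest F) z (0, 1))
        fun hx => hn ⟨(x, t), hx, rfl⟩
    simp [this]
  · have h1 := h.weak_timeDeriv _ hψ hψc
    rw [← neg_eq_iff_eq_neg, ← h1, ← integral_const_mul]
    refine integral_congr_ae (ae_of_all _ fun t => ?_)
    have e2 : ∀ᵐ x : Space, u x t * fderiv ℝ (fun z => fderiv ℝ (radialTest F) z (0, 1)) (x, t) (0, 1)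
        = (fun r => prof u r t * (fderiv ℝ (fun y => fderiv ℝ F y (0, 1)) (r, t) (0, 1) * r⁻¹)) ‖x‖ := by
      filter_upwards [ae_ne_zero_space] with x hx
      have h3 : HasDerivAt (fun s => fderiv ℝ (radialTest F) (x, s) (0, 1))
          (fderiv ℝ (fun z => fderiv ℝ (radialTest F) z (0, 1)) (x, t) (0, 1)) t :=
        ((hψ.differentiable (by simp) (x, t)).hasFDerivAt.comp_hasDerivAt t
          ((hasDerivAt_const t x).prodMk (hasDerivAt_id t)))
      simp_rw [fderiv_radialTest_time hF hs hx] at h3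
      rw [h3.unique ((hasDerivAt_snd_slice (contDiff_fderiv_apply_const hF (0, 1)) ‖x‖ t).mul_const _), h.eq_prof]
    beta_reduce
    rw [integral_congr_ae e2,
      integral_norm (fun r => prof u r t * (fderiv ℝ (fun y => fderiv ℝ F y (0, 1)) (r, t) (0, 1) * r⁻¹))]
    congr 1
    refine setIntegral_congr_fun measurableSet_Ioi fun r hr => ?_
    have hr : r ≠ 0 := ne_of_gt hr
    simp only [reduced_eq]
    field_simp

/-- The equation `w_rr - w_tt = |w|^(p-1) w / r^(p-1)` in the open half plane, in the sense of
distributions. -/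
theorem weak_reduced_equation (h : IsRadialSolution p u Du ut) (hp : 3 ≤ p) {F : ℝ × ℝ → ℝ}
    (hF : ContDiff ℝ ∞ F) (hc : HasCompactSupport F) (hs : tsupport F ⊆ {z | 0 < z.1}) :
    ∫ z, reduced u z * (fderiv ℝ (fun y => fderiv ℝ F y (1, 0)) z (1, 0)
        - fderiv ℝ (fun y => fderiv ℝ F y (0, 1)) z (0, 1))
      = ∫ z, nonlin p (reduced u) z * F z := by
  obtain ⟨a1, a2, a3⟩ := h.integral_integral_timeDeriv_test hF hc hs
  have b := h.integral_inner_gradient_test hF hc hs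
  have c := h.integral_nonlin_test hp hF hc hs
  have heq := h.equation _ (contDiff_radialTest hF hs) (hasCompactSupport_radialTest hc)
  have hw := h.continuous_reduced
  have key : ∀ v : ℝ × ℝ, Continuous (fun z => reduced u z * fderiv ℝ (fun y => fderiv ℝ F y v) z v) ∧
      HasCompactSupport (fun z => reduced u z * fderiv ℝ (fun y => fderiv ℝ F y v) z v) ∧
      tsupport (fun z => reduced u z * fderiv ℝ (fun y => fderiv ℝ F y v) z v) ⊆ {z | 0 < z.1} := by
    intro v
    refine ⟨hw.mul (contDiff_fderiv_apply_const (contDiff_fderiv_apply_const hF v) v).continuous, ?_, ?_⟩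
    · exact HasCompactSupport.mul_left ((hc.fderiv_apply (𝕜 := ℝ) v).fderiv_apply (𝕜 := ℝ) v)
    · refine (closure_mono ?_).trans
        (((tsupport_fderiv_apply_const (fun y => fderiv ℝ F y v) v).trans (tsupport_fderiv_apply_const F v)).trans hs)
      exact Function.support_mul_subset_right _ _
  obtain ⟨r1, r2, r3⟩ := key (1, 0)
  obtain ⟨t1, t2, t3⟩ := key (0, 1)
  have n1 : Continuous fun z => nonlin p (reduced u) z * F z :=
    continuous_mul_of_tsupport (isOpen_lt continuous_const continuous_fst)
      (continuousOn_nonlin hp hw) hF.continuous hs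
  have n2 : HasCompactSupport fun z => nonlin p (reduced u) z * F z := hc.mul_left
  have n3 : tsupport (fun z => nonlin p (reduced u) z * F z) ⊆ {z | 0 < z.1} :=
    (closure_mono (Function.support_mul_subset_right _ _)).trans hs
  obtain ⟨R1, R2⟩ := integrable_slice r1 r2 r3
  obtain ⟨T1, T2⟩ := integrable_slice t1 t2 t3
  obtain ⟨N1, N2⟩ := integrable_slice n1 n2 n3
  have hsplit : ∀ t, ∫ x, (ut x t * fderiv ℝ (radialTest F) (x, t) (0, 1)
        - fderiv ℝ (radialTest F) (x, t) (Du x t, 0)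
        - |u x t| ^ (p - 1) * u x t * (F (‖x‖, t) * ‖x‖⁻¹))
      = (∫ x, ut x t * fderiv ℝ (radialTest F) (x, t) (0, 1))
        + sphereArea * (∫ r in Ioi (0 : ℝ), reduced u (r, t) *
          fderiv ℝ (fun y => fderiv ℝ F y (1, 0)) (r, t) (1, 0))
        - sphereArea * ∫ r in Ioi (0 : ℝ), nonlin p (reduced u) (r, t) * F (r, t) := by
    intro t
    have i1 : Integrable fun x => ut x t * fderiv ℝ (radialTest F) (x, t) (0, 1)
        - fderiv ℝ (radialTest F) (x, t) (Du x t, 0) := (a1 t).sub (b t).1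
    rw [integral_sub i1 (c t).1, integral_sub (a1 t) (b t).1, (b t).2, (c t).2]
    ring
  have heq := (integral_congr_ae (ae_of_all _ fun t => (hsplit t).symm)).trans heq
  have j1 : Integrable fun t => (∫ x, ut x t * fderiv ℝ (radialTest F) (x, t) (0, 1))
        + sphereArea * (∫ r in Ioi (0 : ℝ), reduced u (r, t) *
          fderiv ℝ (fun y => fderiv ℝ F y (1, 0)) (r, t) (1, 0)) := a2.add (R1.const_mul _)
  rw [integral_sub j1 (N1.const_mul _), integral_add a2 (R1.const_mul _), integral_const_mul,
    integral_const_mul, a3, R2, T2, N2] at heq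
  simp_rw [mul_sub]
  rw [integral_sub (r1.integrable_of_hasCompactSupport r2) (t1.integrable_of_hasCompactSupport t2)]
  have hpos := sphereArea_pos
  have : sphereArea * (((∫ z, reduced u z * fderiv ℝ (fun y => fderiv ℝ F y (1, 0)) z (1, 0))
      - ∫ z, reduced u z * fderiv ℝ (fun y => fderiv ℝ F y (0, 1)) z (0, 1))
      - ∫ z, nonlin p (reduced u) z * F z) = 0 := by linarith
  have := (mul_eq_zero.1 this).resolve_left hpos.ne'
  linarith

end IsRadialSolution

/-! ### From the distributional equation to second differences -/

theorem tsupport_tensor_subset {θ₁ θ₂ : ℝ → ℝ} :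
    tsupport (fun q : ℝ × ℝ => θ₁ q.1 * θ₂ q.2) ⊆ tsupport θ₁ ×ˢ tsupport θ₂ := by
  refine closure_minimal (fun q hq => ?_) ((isClosed_tsupport _).prod (isClosed_tsupport _))
  exact ⟨subset_tsupport _ (left_ne_zero_of_mul hq), subset_tsupport _ (right_ne_zero_of_mul hq)⟩

theorem hasCompactSupport_tensor {θ₁ θ₂ : ℝ → ℝ} (h₁ : HasCompactSupport θ₁) (h₂ : HasCompactSupport θ₂) :
    HasCompactSupport fun q : ℝ × ℝ => θ₁ q.1 * θ₂ q.2 :=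
  (h₁.isCompact.prod h₂.isCompact).of_isClosed_subset (isClosed_tsupport _) tsupport_tensor_subset

theorem continuousOn_mul_test {H : ℝ × ℝ → ℝ} {I J : Set ℝ} (hI : IsOpen I) (hJ : IsOpen J)
    (hH : ContinuousOn H (I ×ˢ J)) {θ : ℝ → ℝ} (hθ : Continuous θ) (hs : tsupport θ ⊆ I) :
    ContinuousOn (fun q : ℝ × ℝ => H (q.2, q.1) * θ q.2) (J ×ˢ univ) := by
  rintro ⟨b, a⟩ ⟨hb, -⟩
  refine ContinuousAt.continuousWithinAt ?_
  by_cases ha : a ∈ I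
  · have h1 : ContinuousAt H (a, b) := hH.continuousAt ((hI.prod hJ).mem_nhds ⟨ha, hb⟩)
    have h2 : ContinuousAt (fun q : ℝ × ℝ => H (q.2, q.1)) (b, a) :=
      ContinuousAt.comp (f := fun q : ℝ × ℝ => (q.2, q.1)) h1 (by fun_prop)
    exact h2.mul (by fun_prop)
  · refine (continuousAt_const (y := (0 : ℝ))).congr ?_
    have h1 := notMem_tsupport_iff_eventuallyEq.1 fun h => ha (hs h)
    have h2 : Tendsto (fun q : ℝ × ℝ => q.2) (𝓝 (b, a)) (𝓝 a) := continuous_snd.tendsto (b, a)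
    filter_upwards [h2.eventually h1] with q hq
    rw [hq]; simp

theorem continuousOn_intervalIntegral {H : ℝ × ℝ → ℝ} {I J : Set ℝ} (hI : IsOpen I) (hJ : OrdConnected J)
    (hH : ContinuousOn H (I ×ˢ J)) {b₁ b₂ : ℝ} (hb₁ : b₁ ∈ J) (hb₂ : b₂ ∈ J) :
    ContinuousOn (fun a => ∫ b in b₁..b₂, H (a, b)) I := by
  intro a₀ ha₀
  refine ContinuousAt.continuousWithinAt ?_
  obtain ⟨ε, hε, hεI⟩ := Metric.nhds_basis_closedBall.mem_iff.1 (hI.mem_nhds ha₀)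
  rw [Real.closedBall_eq_Icc] at hεI
  -- Clamping both variables to a compact rectangle inside the domain gives a globally continuous
  -- integrand without changing the integral near a₀.
  let c : ℝ → ℝ := fun a => projIcc (a₀ - ε) (a₀ + ε) (by linarith) a
  let d : ℝ → ℝ := fun b => projIcc (min b₁ b₂) (max b₁ b₂) min_le_max b
  have hc : Continuous c := continuous_subtype_val.comp continuous_projIcc
  have hd : Continuous d := continuous_subtype_val.comp continuous_projIcc
  have hcont : Continuous fun q : ℝ × ℝ => H (c q.1, d q.2) :=
    hH.comp_continuous (by fun_prop) fun q =>
      ⟨hεI (projIcc (a₀ - ε) (a₀ + ε) (by linarith) q.1).2,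
        hJ.uIcc_subset hb₁ hb₂ (projIcc (min b₁ b₂) (max b₁ b₂) min_le_max q.2).2⟩
  have h1 : Continuous fun a => ∫ b in b₁..b₂, H (c a, d b) :=
    intervalIntegral.continuous_parametric_intervalIntegral_of_continuous' (f := fun a b => H (c a, d b)) hcont _ _
  refine h1.continuousAt.congr ?_
  filter_upwards [Icc_mem_nhds (show a₀ - ε < a₀ by linarith) (show a₀ < a₀ + ε by linarith)] with a ha
  refine intervalIntegral.integral_congr fun b hb => ?_
  have e1 : c a = a := by simp only [c]; rw [projIcc_of_mem _ ha]
  have e2 : d b = b := by simp only [d]; rw [projIcc_of_mem _ hb]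
  simp only [e1, e2]

/-- A function whose mixed second derivative is `H`, in the sense of distributions. -/
theorem mixed_difference {W H : ℝ × ℝ → ℝ} {I J : Set ℝ} (hW : Continuous W) (hI : IsOpen I) (hJ : IsOpen J)
    (hIc : OrdConnected I) (hJc : OrdConnected J) (hH : ContinuousOn H (I ×ˢ J))
    (h : ∀ θ₁ θ₂ : ℝ → ℝ, ContDiff ℝ ∞ θ₁ → HasCompactSupport θ₁ → tsupport θ₁ ⊆ I →
      ContDiff ℝ ∞ θ₂ → HasCompactSupport θ₂ → tsupport θ₂ ⊆ J →
      ∫ q, W q * (deriv θ₁ q.1 * deriv θ₂ q.2) = ∫ q, H q * (θ₁ q.1 * θ₂ q.2))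
    {a₁ a₂ b₁ b₂ : ℝ} (ha₁ : a₁ ∈ I) (ha₂ : a₂ ∈ I) (hb₁ : b₁ ∈ J) (hb₂ : b₂ ∈ J) :
    W (a₂, b₂) - W (a₂, b₁) - (W (a₁, b₂) - W (a₁, b₁))
      = ∫ a in a₁..a₂, ∫ b in b₁..b₂, H (a, b) := by
  have hsub : uIcc b₁ b₂ ⊆ J := hJc.uIcc_subset hb₁ hb₂
  -- First use of `du_bois_reymond`, in the variable b with the test function of a frozen.
  have step : ∀ θ : ℝ → ℝ, ContDiff ℝ ∞ θ → HasCompactSupport θ → tsupport θ ⊆ I →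
      (∫ a, W (a, b₂) * deriv θ a) - ∫ a, W (a, b₁) * deriv θ a
        = ∫ b in b₁..b₂, -∫ a, H (a, b) * θ a := by
    intro θ hθ hc hs
    have hd : Continuous (deriv θ) := hθ.continuous_deriv (by simp)
    have hdc : HasCompactSupport (deriv θ) := hc.deriv
    refine du_bois_reymond (F := fun b => ∫ a, W (a, b) * deriv θ a)
      (H := fun b => -∫ a, H (a, b) * θ a) hJ hJc ?_ ?_ ?_ hb₁ hb₂
    · refine continuousOn_integral_of_compact_support (k := tsupport (deriv θ))
        (f := fun b a => W (a, b) * deriv θ a) hdc.isCompact ?_ ?_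
      · exact (by fun_prop : Continuous fun q : ℝ × ℝ => W (q.2, q.1) * deriv θ q.2).continuousOn
      · intro b a _ ha
        rw [image_eq_zero_of_notMem_tsupport ha, mul_zero]
    · refine ContinuousOn.locallyIntegrableOn ?_ hJ.measurableSet
      refine (continuousOn_integral_of_compact_support (k := tsupport θ)
        (f := fun b a => H (a, b) * θ a) hc.isCompact ?_ ?_).neg
      · exact continuousOn_mul_test hI hJ hH hθ.continuous hs
      · intro b a _ ha
        rw [image_eq_zero_of_notMem_tsupport ha, mul_zero]
    · intro η hη hηc hηs
      have e1 : ∫ b, (∫ a, W (a, b) * deriv θ a) * deriv η b = ∫ q, W q * (deriv θ q.1 * deriv η q.2) := by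
        have hi : Integrable (fun q : ℝ × ℝ => W q * (deriv θ q.1 * deriv η q.2)) (volume.prod volume) := by
          have hηd : Continuous (deriv η) := hη.continuous_deriv (by simp)
          exact (by fun_prop : Continuous fun q : ℝ × ℝ => W q * (deriv θ q.1 * deriv η q.2)).integrable_of_hasCompactSupport
            (hasCompactSupport_tensor hdc hηc.deriv).mul_left
        rw [Measure.volume_eq_prod, integral_prod_symm _ hi]
        refine integral_congr_ae (ae_of_all _ fun b => ?_)
        simp only [← integral_mul_const, mul_assoc]
      have e2 : ∫ b, (-∫ a, H (a, b) * θ a) * η b = -∫ q, H q * (θ q.1 * η q.2) := by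
        have hi : Integrable (fun q : ℝ × ℝ => H q * (θ q.1 * η q.2)) (volume.prod volume) := by
          refine (continuous_mul_of_tsupport (hI.prod hJ) hH (by fun_prop) ?_).integrable_of_hasCompactSupport
            (hasCompactSupport_tensor hc hηc).mul_left
          exact tsupport_tensor_subset.trans (prod_mono hs hηs)
        rw [Measure.volume_eq_prod, integral_prod_symm _ hi, ← integral_neg]
        refine integral_congr_ae (ae_of_all _ fun b => ?_)
        simp only [neg_mul, ← integral_mul_const, mul_assoc]
      rw [e1, e2, neg_neg]
      exact h θ η hθ hc hs hη hηc hηs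
  have hHc := continuousOn_intervalIntegral hI hJc hH hb₁ hb₂
  -- Second use, in the variable a, for the difference of W at the two fixed values of b.
  have key := du_bois_reymond (F := fun a => W (a, b₂) - W (a, b₁))
    (H := fun a => ∫ b in b₁..b₂, H (a, b)) hI hIc (by fun_prop)
    (hHc.locallyIntegrableOn hI.measurableSet) ?_ ha₁ ha₂
  · exact key
  · intro θ hθ hc hs
    have hd : Continuous (deriv θ) := hθ.continuous_deriv (by simp)
    have hWi : ∀ b, Integrable fun a => W (a, b) * deriv θ a := fun b =>
      (by fun_prop : Continuous fun a => W (a, b) * deriv θ a).integrable_of_hasCompactSupport hc.deriv.mul_left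
    have h1 := step θ hθ hc hs
    simp only [sub_mul]
    rw [integral_sub (hWi b₂) (hWi b₁), h1, intervalIntegral.integral_neg]
    congr 1
    rw [intervalIntegral_integral_swap]
    · simp only [intervalIntegral.integral_mul_const]
    · have h2 : IntegrableOn (fun q : ℝ × ℝ => H (q.2, q.1) * θ q.2) (uIcc b₁ b₂ ×ˢ tsupport θ)
          (volume.prod volume) :=
        ((continuousOn_mul_test hI hJ hH hθ.continuous hs).mono (prod_mono hsub (subset_univ _))).integrableOn_compact
          (isCompact_uIcc.prod hc.isCompact)
      have h3 : IntegrableOn (fun q : ℝ × ℝ => H (q.2, q.1) * θ q.2) (uIcc b₁ b₂ ×ˢ univ)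
          (volume.prod volume) := by
        refine h2.of_forall_sdiff_eq_zero (measurableSet_uIcc.prod MeasurableSet.univ) fun q hq => ?_
        have : q.2 ∉ tsupport θ := fun hm => hq.2 ⟨hq.1.1, hm⟩
        rw [image_eq_zero_of_notMem_tsupport this, mul_zero]
      rw [IntegrableOn, ← Measure.prod_restrict, Measure.restrict_univ] at h3
      exact h3.mono_measure (Measure.prod_mono (Measure.restrict_mono uIoc_subset_uIcc le_rfl) le_rfl)

/-- With a = (r+t)/2 and b = (r-t)/2 the wave operator is ∂_a ∂_b, so product test functions in (a,
b) separate. -/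
theorem wave_operator_tensor {f g : ℝ → ℝ} (hf : ContDiff ℝ ∞ f) (hg : ContDiff ℝ ∞ g) (z : ℝ × ℝ) :
    fderiv ℝ (fun y => fderiv ℝ (fun z : ℝ × ℝ => f ((z.1 + z.2) / 2) * g ((z.1 - z.2) / 2)) y (1, 0)) z (1, 0)
      - fderiv ℝ (fun y => fderiv ℝ (fun z : ℝ × ℝ => f ((z.1 + z.2) / 2) * g ((z.1 - z.2) / 2)) y (0, 1)) z (0, 1)
      = deriv f ((z.1 + z.2) / 2) * deriv g ((z.1 - z.2) / 2) := by
  have smooth : ∀ {f g : ℝ → ℝ}, ContDiff ℝ ∞ f → ContDiff ℝ ∞ g →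
      ContDiff ℝ ∞ fun z : ℝ × ℝ => f ((z.1 + z.2) / 2) * g ((z.1 - z.2) / 2) := fun hf hg =>
    (hf.comp (by fun_prop)).mul (hg.comp (by fun_prop))
  have hd : ∀ {f : ℝ → ℝ}, ContDiff ℝ ∞ f → ContDiff ℝ ∞ (deriv f) := fun hf => by
    have := hf.iterate_deriv 1
    simpa using this
  have fst : ∀ {f g : ℝ → ℝ}, ContDiff ℝ ∞ f → ContDiff ℝ ∞ g → ∀ r t : ℝ,
      HasDerivAt (fun s : ℝ => f ((s + t) / 2) * g ((s - t) / 2))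
        ((deriv f ((r + t) / 2) * g ((r - t) / 2) + f ((r + t) / 2) * deriv g ((r - t) / 2)) / 2) r := by
    intro f g hf hg r t
    have h1 : HasDerivAt (fun s : ℝ => f ((s + t) / 2)) (deriv f ((r + t) / 2) * (1 / 2)) r :=
      HasDerivAt.comp (h₂ := f) r (hf.differentiable (by simp) _).hasDerivAt (((hasDerivAt_id r).add_const t).div_const 2)
    have h2 : HasDerivAt (fun s : ℝ => g ((s - t) / 2)) (deriv g ((r - t) / 2) * (1 / 2)) r :=
      HasDerivAt.comp (h₂ := g) r (hg.differentiable (by simp) _).hasDerivAt (((hasDerivAt_id r).sub_const t).div_const 2)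
    exact (h1.mul h2).congr_deriv (by ring)
  have snd : ∀ {f g : ℝ → ℝ}, ContDiff ℝ ∞ f → ContDiff ℝ ∞ g → ∀ r t : ℝ,
      HasDerivAt (fun s : ℝ => f ((r + s) / 2) * g ((r - s) / 2))
        ((deriv f ((r + t) / 2) * g ((r - t) / 2) - f ((r + t) / 2) * deriv g ((r - t) / 2)) / 2) t := by
    intro f g hf hg r t
    have h1 : HasDerivAt (fun s : ℝ => f ((r + s) / 2)) (deriv f ((r + t) / 2) * (1 / 2)) t :=
      HasDerivAt.comp (h₂ := f) t (hf.differentiable (by simp) _).hasDerivAt (((hasDerivAt_id t).const_add r).div_const 2)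
    have h2 : HasDerivAt (fun s : ℝ => g ((r - s) / 2)) (deriv g ((r - t) / 2) * (-1 / 2)) t :=
      HasDerivAt.comp (h₂ := g) t (hg.differentiable (by simp) _).hasDerivAt (((hasDerivAt_id t).const_sub r).div_const 2)
    exact (h1.mul h2).congr_deriv (by ring)
  have e1 : (fun y => fderiv ℝ (fun z : ℝ × ℝ => f ((z.1 + z.2) / 2) * g ((z.1 - z.2) / 2)) y (1, 0))
      = fun z => (deriv f ((z.1 + z.2) / 2) * g ((z.1 - z.2) / 2) + f ((z.1 + z.2) / 2) * deriv g ((z.1 - z.2) / 2)) / 2 :=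
    funext fun y => (hasDerivAt_fst_slice (smooth hf hg) y.1 y.2).unique (fst hf hg y.1 y.2)
  have e2 : (fun y => fderiv ℝ (fun z : ℝ × ℝ => f ((z.1 + z.2) / 2) * g ((z.1 - z.2) / 2)) y (0, 1))
      = fun z => (deriv f ((z.1 + z.2) / 2) * g ((z.1 - z.2) / 2) - f ((z.1 + z.2) / 2) * deriv g ((z.1 - z.2) / 2)) / 2 :=
    funext fun y => (hasDerivAt_snd_slice (smooth hf hg) y.1 y.2).unique (snd hf hg y.1 y.2)
  have hf' := hd hf
  have hg' := hd hg
  rw [e1, e2]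
  have s1 := ((smooth hf' hg).add (smooth hf hg')).div_const 2
  have s2 := ((smooth hf' hg).sub (smooth hf hg')).div_const 2
  have f1 := (hasDerivAt_fst_slice s1 z.1 z.2).unique
    (((fst hf' hg z.1 z.2).add (fst hf hg' z.1 z.2)).div_const 2)
  have f2 := (hasDerivAt_snd_slice s2 z.1 z.2).unique
    (((snd hf' hg z.1 z.2).sub (snd hf hg' z.1 z.2)).div_const 2)
  simp only [Prod.mk.eta] at f1 f2
  rw [f1, f2]
  ring

theorem reduced_mixed_difference {p : ℝ} {u : Space → ℝ → ℝ} {Du : Space → ℝ → Space} {ut : Space → ℝ → ℝ}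
    (h : IsRadialSolution p u Du ut) (hp : 3 ≤ p) {a₁ a₂ b₁ b₂ : ℝ}
    (h₁₁ : 0 < a₁ + b₁) (h₁₂ : 0 < a₁ + b₂) (h₂₁ : 0 < a₂ + b₁) (h₂₂ : 0 < a₂ + b₂) :
    reduced u (charMap 1 (a₂, b₂)) - reduced u (charMap 1 (a₂, b₁))
      - (reduced u (charMap 1 (a₁, b₂)) - reduced u (charMap 1 (a₁, b₁)))
      = ∫ a in a₁..a₂, ∫ b in b₁..b₂, nonlin p (reduced u) (charMap 1 (a, b)) := by
  -- The margin ε makes the four corners inner points of a product of open half lines on which a + b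
  -- > 0 still holds.
  obtain ⟨ε, hε, hε'⟩ : ∃ ε : ℝ, 0 < ε ∧ 2 * ε < min a₁ a₂ + min b₁ b₂ := by
    have : 0 < min a₁ a₂ + min b₁ b₂ := by
      rcases min_choice a₁ a₂ with e | e <;> rcases min_choice b₁ b₂ with e' | e' <;> rw [e, e'] <;> assumption
    exact ⟨(min a₁ a₂ + min b₁ b₂) / 4, by linarith, by linarith⟩
  have hpos : ∀ q ∈ Ioi (min a₁ a₂ - ε) ×ˢ Ioi (min b₁ b₂ - ε), 0 < (charMap 1 q).1 := by
    rintro ⟨a, b⟩ ⟨ha, hb⟩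
    simp only [mem_Ioi, charMap] at *
    linarith
  have hw := h.continuous_reduced
  refine mixed_difference (W := fun q => reduced u (charMap 1 q))
    (H := fun q => nonlin p (reduced u) (charMap 1 q)) (hw.comp (continuous_charMap 1))
    (isOpen_Ioi (a := min a₁ a₂ - ε)) (isOpen_Ioi (a := min b₁ b₂ - ε)) ordConnected_Ioi ordConnected_Ioi
    ((continuousOn_nonlin hp hw).comp (continuous_charMap 1).continuousOn hpos) ?_ ?_ ?_ ?_ ?_
  · intro θ₁ θ₂ h₁ c₁ s₁ h₂ c₂ s₂
    let F : ℝ × ℝ → ℝ := fun z => θ₁ ((z.1 + z.2) / 2) * θ₂ ((z.1 - z.2) / 2)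
    have hF : ContDiff ℝ ∞ F := (h₁.comp (by fun_prop)).mul (h₂.comp (by fun_prop))
    have hinv : F = fun z => (fun q : ℝ × ℝ => θ₁ q.1 * θ₂ q.2) (charInv 1 z) := by
      funext z; simp [F, charInv]
    have hsub : tsupport F ⊆ charInv 1 ⁻¹' (tsupport θ₁ ×ˢ tsupport θ₂) := by
      refine closure_minimal (fun z hz => ?_)
        (((isClosed_tsupport _).prod (isClosed_tsupport _)).preimage (continuous_charInv 1))
      rw [hinv] at hz
      exact tsupport_tensor_subset (subset_tsupport _ hz)
    have hFc : HasCompactSupport F := by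
      refine ((c₁.isCompact.prod c₂.isCompact).image (continuous_charMap 1)).of_isClosed_subset
        (isClosed_tsupport _) fun z hz => ⟨charInv 1 z, hsub hz, charMap_charInv (by norm_num) z⟩
    have hFs : tsupport F ⊆ {z | 0 < z.1} := fun z hz => by
      have h3 := hpos _ ⟨s₁ (hsub hz).1, s₂ (hsub hz).2⟩
      rwa [charMap_charInv (by norm_num)] at h3
    have key := h.weak_reduced_equation hp hF hFc hFs
    simp only [F, wave_operator_tensor h₁ h₂] at key
    rw [integral_charMap (σ := 1) (by norm_num)
        (fun z => reduced u z * (deriv θ₁ ((z.1 + z.2) / 2) * deriv θ₂ ((z.1 - z.2) / 2))),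
      integral_charMap (σ := 1) (by norm_num)
        (fun z => nonlin p (reduced u) z * (θ₁ ((z.1 + z.2) / 2) * θ₂ ((z.1 - z.2) / 2)))] at key
    have e : ∀ q : ℝ × ℝ, (((charMap 1 q).1 + (charMap 1 q).2) / 2, ((charMap 1 q).1 - (charMap 1 q).2) / 2) = q := by
      intro q; ext <;> simp [charMap]
    have e1 : ∀ q : ℝ × ℝ, ((charMap 1 q).1 + (charMap 1 q).2) / 2 = q.1 := fun q => congrArg Prod.fst (e q)
    have e2 : ∀ q : ℝ × ℝ, ((charMap 1 q).1 - (charMap 1 q).2) / 2 = q.2 := fun q => congrArg Prod.snd (e q)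
    simp only [e1, e2] at key
    exact mul_left_cancel₀ two_ne_zero key
  · exact mem_Ioi.2 (by linarith [min_le_left a₁ a₂])
  · exact mem_Ioi.2 (by linarith [min_le_right a₁ a₂])
  · exact mem_Ioi.2 (by linarith [min_le_left b₁ b₂])
  · exact mem_Ioi.2 (by linarith [min_le_right b₁ b₂])

/-! ### The reduced wave, its time slices and time reversal -/

/-- `f` and `g` are the `r`- and `t`-derivative of `w` at time `t`. -/
structure IsSlice (w : ℝ × ℝ → ℝ) (t : ℝ) (f g : ℝ → ℝ) : Prop where
  measurable_fst : Measurable f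
  measurable_snd : Measurable g
  sq_fst : IntegrableOn (fun r => f r ^ 2) (Ioi 0)
  sq_snd : IntegrableOn (fun r => g r ^ 2) (Ioi 0)
  primitive : ∀ a b : ℝ, 0 < a → 0 < b → IntervalIntegrable f volume a b ∧
    w (b, t) - w (a, t) = ∫ r in a..b, f r
  hasDerivAt : ∀ a b : ℝ, 0 < a → a ≤ b → IntervalIntegrable g volume a b ∧
    HasDerivAt (fun s => ∫ r in a..b, w (r, s)) (∫ r in a..b, g r) t

/-- The properties of `w = r u` used below: a solution of `w_rr - w_tt = |w|^(p-1) w / r^(p-1)` in the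
half plane with `w = 0` on the axis, in the class of the well-posedness theory. -/
structure IsWave (p : ℝ) (w : ℝ × ℝ → ℝ) : Prop where
  continuous : Continuous w
  zero : ∀ t, w (0, t) = 0
  sq_bound : ∀ T, ∃ C, 0 ≤ C ∧ ∀ r : ℝ, ∀ t ∈ Icc (-T) T, w (r, t) ^ 2 ≤ C * |r|
  mixed : ∀ a₁ a₂ b₁ b₂ : ℝ, 0 < a₁ + b₁ → 0 < a₁ + b₂ → 0 < a₂ + b₁ → 0 < a₂ + b₂ →
    w (charMap 1 (a₂, b₂)) - w (charMap 1 (a₂, b₁)) - (w (charMap 1 (a₁, b₂)) - w (charMap 1 (a₁, b₁)))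
      = ∫ a in a₁..a₂, ∫ b in b₁..b₂, nonlin p w (charMap 1 (a, b))
  slice : ∀ t, ∃ f g, IsSlice w t f g
  strichartz : ∀ T : ℝ, ∫⁻ t in Icc (-T) T,
    (∫⁻ r in Ioi (0 : ℝ), ENNReal.ofReal (nonlin p w (r, t) ^ 2)) ^ (2⁻¹ : ℝ) < ⊤

/-- Time reversal. -/
def timeReverse (w : ℝ × ℝ → ℝ) (z : ℝ × ℝ) : ℝ := w (z.1, -z.2)

theorem IsSlice.timeReverse {w : ℝ × ℝ → ℝ} {t : ℝ} {f g : ℝ → ℝ} (h : IsSlice w t f g) :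
    IsSlice (timeReverse w) (-t) f (fun r => -g r) where
  measurable_fst := h.measurable_fst
  measurable_snd := h.measurable_snd.neg
  sq_fst := h.sq_fst
  sq_snd := by simpa using h.sq_snd
  primitive a b ha hb := by simpa [RadialWave.timeReverse] using h.primitive a b ha hb
  hasDerivAt a b ha hab := by
    obtain ⟨h1, h2⟩ := h.hasDerivAt a b ha hab
    refine ⟨h1.neg, ?_⟩
    have h3 : HasDerivAt (fun s : ℝ => -s) (-1) (-t) := hasDerivAt_neg (-t)
    have h4 := HasDerivAt.comp (h₂ := fun s => ∫ r in a..b, w (r, s)) (-t) (by simpa using h2) h3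
    exact h4.congr_deriv (by simp)

theorem nonlin_timeReverse (p : ℝ) (w : ℝ × ℝ → ℝ) (z : ℝ × ℝ) :
    nonlin p (timeReverse w) z = nonlin p w (z.1, -z.2) := rfl

theorem timeReverse_charMap (w : ℝ × ℝ → ℝ) (a b : ℝ) :
    timeReverse w (charMap 1 (a, b)) = w (charMap 1 (b, a)) := by
  simp only [timeReverse, charMap]; congr 2 <;> ring

theorem continuousOn_nonlin_charMap {p : ℝ} (hp : 3 ≤ p) {w : ℝ × ℝ → ℝ} (hw : Continuous w) :
    ContinuousOn (fun q => nonlin p w (charMap 1 q)) {q | 0 < q.1 + q.2} :=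
  (continuousOn_nonlin hp hw).comp (continuous_charMap 1).continuousOn fun _ hq => hq

/-- Reversing time exchanges the two characteristic coordinates, and the second difference is
symmetric under this exchange by Fubini. Statements on w_r - w_t are thereby reduced to statements
on w_r + w_t. -/
theorem IsWave.timeReverse {p : ℝ} (hp : 3 ≤ p) {w : ℝ × ℝ → ℝ} (h : IsWave p w) :
    IsWave p (timeReverse w) where
  continuous := h.continuous.comp (by fun_prop)
  zero t := h.zero (-t)
  sq_bound T := by
    obtain ⟨C, hC, H⟩ := h.sq_bound T
    exact ⟨C, hC, fun r t ht => H r (-t) ⟨by linarith [ht.2], by linarith [ht.1]⟩⟩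
  mixed a₁ a₂ b₁ b₂ h₁ h₂ h₃ h₄ := by
    have h0 := h.mixed b₁ b₂ a₁ a₂ (by linarith) (by linarith) (by linarith) (by linarith)
    have e : ∀ a b, nonlin p (RadialWave.timeReverse w) (charMap 1 (a, b)) = nonlin p w (charMap 1 (b, a)) := by
      intro a b
      rw [nonlin_timeReverse]; simp only [charMap]; congr 2 <;> ring
    simp only [timeReverse_charMap, e]
    rw [intervalIntegral_intervalIntegral_swap]
    · linarith
    · have hsub : uIcc a₁ a₂ ×ˢ uIcc b₁ b₂ ⊆ {q : ℝ × ℝ | 0 < q.2 + q.1} := by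
        rintro ⟨a, b⟩ ⟨ha, hb⟩
        have ha' : min a₁ a₂ ≤ a := ha.1
        have hb' : min b₁ b₂ ≤ b := hb.1
        change 0 < b + a
        rcases min_choice a₁ a₂ with e | e <;> rcases min_choice b₁ b₂ with e' | e' <;>
          rw [e] at ha' <;> rw [e'] at hb' <;> linarith
      refine (ContinuousOn.integrableOn_compact (isCompact_uIcc.prod isCompact_uIcc) ?_).mono_set
        (prod_mono uIoc_subset_uIcc uIoc_subset_uIcc)
      exact ((continuousOn_nonlin_charMap hp h.continuous).comp continuous_swap.continuousOn fun q hq => hq).mono hsub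
  slice t := by
    obtain ⟨f, g, hfg⟩ := h.slice (-t)
    exact ⟨_, _, by simpa using hfg.timeReverse⟩
  strichartz T := by
    have h0 := h.strichartz T
    simp only [nonlin_timeReverse]
    have := (Measure.measurePreserving_neg (volume : Measure ℝ)).setLIntegral_comp_preimage_emb
      (MeasurableEquiv.neg ℝ).measurableEmbedding
      (fun t => (∫⁻ r in Ioi (0 : ℝ), ENNReal.ofReal (nonlin p w (r, t) ^ 2)) ^ (2⁻¹ : ℝ)) (Icc (-T) T)
    rw [show (Neg.neg ⁻¹' Icc (-T) T : Set ℝ) = Icc (-T) T by ext x; simp [and_comm]] at this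
    exact this ▸ h0

namespace IsRadialSolution

variable {p : ℝ} {u : Space → ℝ → ℝ} {Du : Space → ℝ → Space} {ut : Space → ℝ → ℝ}

/-- The derivative of r u in r is u + r g. It is written with w/r in place of u because w is
continuous everywhere, which makes the expression measurable on the whole line. Its square
integrability is the Hardy-type estimate above. -/
theorem exists_isSlice (h : IsRadialSolution p u Du ut) (t : ℝ) :
    ∃ g k : ℝ → ℝ, (∀ᵐ x, inner ℝ (Du x t) x = ‖x‖ * g ‖x‖) ∧ (∀ᵐ x, ut x t = k ‖x‖) ∧
      IsSlice (reduced u) t (fun r => reduced u (r, t) / r + r * g r) (fun r => r * k r) ∧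
      ∫⁻ r in Ioi (0 : ℝ), ENNReal.ofReal ((reduced u (r, t) / r + r * g r) ^ 2)
        ≤ ENNReal.ofReal (sphereArea⁻¹ * ∫ x, ‖Du x t‖ ^ 2) := by
  obtain ⟨g, hgm, hg, hFTC, hg2, hgle⟩ := h.exists_radial_deriv t
  obtain ⟨k, hkm, hk⟩ := h.exists_timeDeriv_profile t
  have hcont : Continuous fun r => reduced u (r, t) := h.continuous_reduced.comp (by fun_prop)
  have e : ∀ r : ℝ, 0 < r → reduced u (r, t) / r + r * g r = prof u r t + r * g r := fun r hr => by
    rw [reduced_eq, mul_div_cancel_left₀ _ hr.ne']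
  have hle : ∫⁻ r in Ioi (0 : ℝ), ENNReal.ofReal ((reduced u (r, t) / r + r * g r) ^ 2)
        ≤ ENNReal.ofReal (sphereArea⁻¹ * ∫ x, ‖Du x t‖ ^ 2) := by
    rw [setLIntegral_congr_fun (g := fun r => ENNReal.ofReal ((prof u r t + r * g r) ^ 2)) measurableSet_Ioi
      fun r hr => by simp only [e r hr]]
    exact (lintegral_reduced_deriv_sq_le hFTC hg2 (h.integrableOn_prof_six t)).trans (ENNReal.ofReal_le_ofReal hgle)
  have hm : Measurable fun r => reduced u (r, t) / r + r * g r :=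
    (hcont.measurable.div measurable_id).add (measurable_id.mul hgm)
  refine ⟨g, k, hg, hk, ⟨hm, measurable_id.mul hkm, ?_, ?_, fun a b ha hb => ?_, fun a b ha hab => ?_⟩, hle⟩
  · refine ⟨(hm.pow_const 2).aestronglyMeasurable, ?_⟩
    rw [hasFiniteIntegral_iff_ofReal (ae_of_all _ fun r => sq_nonneg _)]
    exact hle.trans_lt ENNReal.ofReal_lt_top
  · simpa [mul_pow] using (h.timeDeriv_profile_sq hk).1
  · obtain ⟨h1, h2⟩ := reduced_profile_primitive hFTC ha hb
    have hpos : ∀ r ∈ uIcc a b, 0 < r := fun r hr => (lt_min ha hb).trans_le hr.1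
    refine ⟨h1.congr fun r hr => (e r (hpos r (uIoc_subset_uIcc hr))).symm, ?_⟩
    rw [intervalIntegral.integral_congr fun r hr => e r (hpos r hr)]
    exact h2
  · exact h.hasDerivAt_integral_reduced hk ha hab

/-- For r > 0 one has N² = r² |u|^(2p), so the L^(2p) norm of u to the power p is a constant times
the L²(dr) norm of N. -/
theorem strichartz_nonlin (h : IsRadialSolution p u Du ut) (hp : 3 ≤ p) (T : ℝ) :
    ∫⁻ t in Icc (-T) T,
      (∫⁻ r in Ioi (0 : ℝ), ENNReal.ofReal (nonlin p (reduced u) (r, t) ^ 2)) ^ (2⁻¹ : ℝ) < ⊤ := by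
  have key : ∀ t, eLpNorm (fun x => u x t) (ENNReal.ofReal (2 * p)) volume ^ p
      = ENNReal.ofReal sphereArea ^ (2⁻¹ : ℝ) *
        (∫⁻ r in Ioi (0 : ℝ), ENNReal.ofReal (nonlin p (reduced u) (r, t) ^ 2)) ^ (2⁻¹ : ℝ) := by
    intro t
    have hcont : Continuous fun r => reduced u (r, t) := h.continuous_reduced.comp (by fun_prop)
    rw [eLpNorm_eq_lintegral_rpow_enorm_toReal (by simp; linarith) ENNReal.ofReal_ne_top,
      ENNReal.toReal_ofReal (by linarith), ← ENNReal.rpow_mul,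
      show 1 / (2 * p) * p = (2⁻¹ : ℝ) by field_simp]
    have e1 : ∫⁻ x : Space, ‖u x t‖ₑ ^ (2 * p)
        = ∫⁻ x : Space, (fun r => ‖reduced u (r, t) / r‖ₑ ^ (2 * p)) ‖x‖ := by
      refine lintegral_congr_ae ?_
      filter_upwards [ae_ne_zero_space] with x hx
      rw [h.eq_prof, reduced_eq, mul_div_cancel_left₀ _ (norm_ne_zero_iff.2 hx)]
    rw [e1, lintegral_norm (φ := fun r => ‖reduced u (r, t) / r‖ₑ ^ (2 * p)) ((hcont.measurable.div measurable_id).enorm.pow_const _),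
      ENNReal.mul_rpow_of_nonneg _ _ (by norm_num)]
    congr 2
    refine setLIntegral_congr_fun measurableSet_Ioi fun r hr => ?_
    have hr : 0 < r := hr
    simp only [nonlin_reduced hr]
    rw [reduced_eq, mul_div_cancel_left₀ _ hr.ne', Real.enorm_eq_ofReal_abs,
      ENNReal.ofReal_rpow_of_nonneg (abs_nonneg _) (by linarith), ← ENNReal.ofReal_mul (by positivity)]
    congr 1
    rw [mul_pow, mul_pow, ← sq_abs (prof u r t), ← mul_pow, ← Real.rpow_add_one' (abs_nonneg _) (by linarith),
      ← Real.rpow_mul_natCast (abs_nonneg _)]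
    congr 2
    push_cast; ring
  have h0 := h.strichartz T
  simp_rw [key] at h0
  have hs : ENNReal.ofReal sphereArea ^ (2⁻¹ : ℝ) ≠ 0 := by
    simp [sphereArea_pos]
  have hs' : ENNReal.ofReal sphereArea ^ (2⁻¹ : ℝ) ≠ ⊤ := by simp
  rw [lintegral_const_mul' _ _ hs'] at h0
  by_contra hcon
  rw [not_lt, top_le_iff] at hcon
  rw [hcon, ENNReal.mul_top hs] at h0
  exact lt_irrefl _ h0

theorem isWave (h : IsRadialSolution p u Du ut) (hp : 3 ≤ p) : IsWave p (reduced u) where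
  continuous := h.continuous_reduced
  zero t := by simp [reduced_eq]
  sq_bound := h.exists_reduced_sq_bound
  mixed _ _ _ _ h₁ h₂ h₃ h₄ := reduced_mixed_difference h hp h₁ h₂ h₃ h₄
  slice t := let ⟨_, _, _, _, hs, _⟩ := h.exists_isSlice t; ⟨_, _, hs⟩
  strichartz := h.strichartz_nonlin hp

end IsRadialSolution

-- Derivatives along characteristics from the data on a time slice

attribute [fun_prop] continuous_charMap

/-- F is merely continuous, so the integrand is not differentiated: on the short interval from 0 to
h it is F(0,0) + o(1). -/
theorem hasDerivAt_integral_zero {F : ℝ × ℝ → ℝ} (hF : Continuous F) :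
    HasDerivAt (fun h => ∫ x in (0 : ℝ)..h, F (x, h)) (F (0, 0)) 0 := by
  rw [hasDerivAt_iff_isLittleO_nhds_zero, Asymptotics.isLittleO_iff]
  intro ε hε
  obtain ⟨δ, hδ, H⟩ := Metric.continuousAt_iff.1 (hF.continuousAt (x := ((0 : ℝ), (0 : ℝ)))) ε hε
  filter_upwards [Metric.ball_mem_nhds (0 : ℝ) hδ] with h hh
  have hh' : |h| < δ := by simpa using hh
  have hi : IntervalIntegrable (fun x => F (x, h)) volume 0 h :=
    (hF.comp (by fun_prop : Continuous fun x : ℝ => (x, h))).intervalIntegrable _ _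
  have e : (∫ x in (0 : ℝ)..(0 + h), F (x, 0 + h)) - (∫ x in (0 : ℝ)..0, F (x, 0)) - h • F (0, 0)
      = ∫ x in (0 : ℝ)..h, (F (x, h) - F (0, 0)) := by
    rw [intervalIntegral.integral_sub hi intervalIntegrable_const]
    simp
  rw [e]
  have := intervalIntegral.norm_integral_le_of_norm_le_const (a := 0) (b := h) (C := ε)
    (f := fun x => F (x, h) - F (0, 0)) (fun x hx => by
      refine (H ?_).le
      have hx' : |x| ≤ |h| := by simpa using abs_sub_left_of_mem_uIcc (uIoc_subset_uIcc hx)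
      rw [Prod.dist_eq]
      simpa using ⟨hx'.trans_lt hh', hh'⟩)
  simpa using this

theorem integral_translate {F : ℝ → ℝ} (hF : Continuous F) (a b h : ℝ) :
    ∫ x in a..b, F (x + h) = (∫ x in a..b, F x) + (∫ x in (0 : ℝ)..h, F (b + x)) - ∫ x in (0 : ℝ)..h, F (a + x) := by
  have hi : ∀ x y, IntervalIntegrable F volume x y := fun x y => hF.intervalIntegrable x y
  rw [intervalIntegral.integral_comp_add_right, intervalIntegral.integral_comp_add_left,
    intervalIntegral.integral_comp_add_left]
  simp only [add_zero]
  rw [← intervalIntegral.integral_add_adjacent_intervals (hi (a + h) a) (hi a (b + h)),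
    ← intervalIntegral.integral_add_adjacent_intervals (hi a b) (hi b (b + h)),
    intervalIntegral.integral_symm a (a + h)]
  ring

/-- A shift along (1,1) is a time shift together with a shift of the end points. The former
contributes ∫ g, the latter w(b,t) - w(a,t) = ∫ f. So w_r + w_t is obtained in integrated form
before any pointwise derivative is known. -/
theorem IsSlice.hasDerivAt_diagonal {w : ℝ × ℝ → ℝ} (hw : Continuous w) {t : ℝ} {f g : ℝ → ℝ}
    (h : IsSlice w t f g) {a b : ℝ} (ha : 0 < a) (hab : a ≤ b) :
    HasDerivAt (fun s => ∫ r in a..b, w (r + s, t + s)) (∫ r in a..b, (f r + g r)) 0 := by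
  obtain ⟨g1, g2⟩ := h.hasDerivAt a b ha hab
  obtain ⟨f1, f2⟩ := h.primitive a b ha (ha.trans_le hab)
  have e : (fun s => ∫ r in a..b, w (r + s, t + s)) = fun s => (∫ r in a..b, w (r, t + s))
      + (∫ x in (0 : ℝ)..s, w (b + x, t + s)) - ∫ x in (0 : ℝ)..s, w (a + x, t + s) := by
    funext s
    exact integral_translate (F := fun r => w (r, t + s)) (by fun_prop) a b s
  have d1 : HasDerivAt (fun s => ∫ r in a..b, w (r, t + s)) (∫ r in a..b, g r) 0 := by
    have h1 : HasDerivAt (fun s : ℝ => t + s) 1 0 := (hasDerivAt_id (0 : ℝ)).const_add t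
    have h2 := HasDerivAt.comp (h₂ := fun s => ∫ r in a..b, w (r, s)) 0 (by simpa using g2) h1
    exact h2.congr_deriv (by simp)
  have d2 : ∀ c, HasDerivAt (fun s => ∫ x in (0 : ℝ)..s, w (c + x, t + s)) (w (c, t)) 0 := fun c => by
    simpa using hasDerivAt_integral_zero (F := fun z => w (c + z.1, t + z.2)) (by fun_prop)
  rw [e]
  refine ((d1.add (d2 b)).sub (d2 a)).congr_deriv ?_
  rw [intervalIntegral.integral_add f1 g1, ← f2]
  ring

/-- On the slice at time t the point with first coordinate x has second coordinate x - t and radius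
2 x - t. -/
theorem IsSlice.hasDerivAt_char {w : ℝ × ℝ → ℝ} (hw : Continuous w) {t : ℝ} {f g : ℝ → ℝ}
    (h : IsSlice w t f g) {a b : ℝ} (ha : t < 2 * a) (hab : a ≤ b) :
    HasDerivAt (fun s => ∫ x in a..b, w (charMap 1 (x + s, x - t)))
      (∫ x in a..b, (f (2 * x - t) + g (2 * x - t))) 0 := by
  have h1 := h.hasDerivAt_diagonal hw (a := 2 * a - t) (b := 2 * b - t) (by linarith) (by linarith)
  have h2 := h1.const_mul (2⁻¹ : ℝ)
  have e : ∀ F : ℝ → ℝ, ∫ x in a..b, F (2 * x - t) = 2⁻¹ * ∫ r in (2 * a - t)..(2 * b - t), F r := fun F => by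
    rw [intervalIntegral.integral_comp_mul_sub _ two_ne_zero, smul_eq_mul]
  rw [← e fun r => f r + g r] at h2
  refine h2.congr_of_eventuallyEq (Eventually.of_forall fun s => ?_)
  simp only
  rw [← e fun r => w (r + s, t + s)]
  refine intervalIntegral.integral_congr fun x _ => ?_
  simp only [charMap]; congr 2 <;> ring

namespace IsWave

variable {p : ℝ} {w : ℝ × ℝ → ℝ}

/-- The nonlinearity in characteristic coordinates, made continuous near the axis. -/
noncomputable def cutNonlin (p : ℝ) (w : ℝ × ℝ → ℝ) (ε : ℝ) (q : ℝ × ℝ) : ℝ :=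
  nonlin p (fun z => w (z.2, q.1 - q.2)) (max (q.1 + q.2) ε, q.1 + q.2)

theorem cutNonlin_eq {ε : ℝ} {q : ℝ × ℝ} (h : ε ≤ q.1 + q.2) :
    cutNonlin p w ε q = nonlin p w (charMap 1 q) := by
  simp [cutNonlin, nonlin, charMap, max_eq_left h]

theorem continuous_cutNonlin (hp : 3 ≤ p) (hw : Continuous w) {ε : ℝ} (hε : 0 < ε) :
    Continuous (cutNonlin p w ε) := by
  refine Continuous.div ((continuous_abs_rpow_mul (by linarith : 0 < p - 1)).comp
    (by fun_prop : Continuous fun q : ℝ × ℝ => w (q.1 + q.2, q.1 - q.2))) ?_ ?_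
  · exact (by fun_prop : Continuous fun q : ℝ × ℝ => max (q.1 + q.2) ε).rpow_const
      fun q => Or.inl (hε.trans_le (le_max_right _ _)).ne'
  · exact fun q => (Real.rpow_pos_of_pos (hε.trans_le (le_max_right _ _)) _).ne'

/-- The increments of `w` along the characteristics `b = b₀` in terms of the data at time `t`. -/
theorem char_difference (h : IsWave p w) (hp : 3 ≤ p) {t : ℝ} {f g : ℝ → ℝ} (hs : IsSlice w t f g)
    {a₁ a₂ b₀ : ℝ} (h₁ : t < 2 * a₁) (h₂ : 0 < a₁ + b₀) (ha : a₁ ≤ a₂) :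
    w (charMap 1 (a₂, b₀)) - w (charMap 1 (a₁, b₀))
      = ∫ a in a₁..a₂, (f (2 * a - t) + g (2 * a - t) + ∫ y in (a - t)..b₀, nonlin p w (charMap 1 (a, y))) := by
  have hw := h.continuous
  -- The cut at r = ε must leave the nonlinearity unchanged on all points used, including those
  -- shifted by |s| < ε; hence the factor 2.
  obtain ⟨ε, hε, hε₁, hε₂⟩ : ∃ ε : ℝ, 0 < ε ∧ 2 * ε ≤ 2 * a₁ - t ∧ 2 * ε ≤ a₁ + b₀ :=
    ⟨min (2 * a₁ - t) (a₁ + b₀) / 2, by have := lt_min (show 0 < 2 * a₁ - t by linarith) h₂; linarith,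
      by linarith [min_le_left (2 * a₁ - t) (a₁ + b₀)], by linarith [min_le_right (2 * a₁ - t) (a₁ + b₀)]⟩
  have hcut := continuous_cutNonlin hp hw hε
  let n : ℝ × ℝ → ℝ := fun z => ∫ y in (z.2 - t)..b₀, cutNonlin p w ε (z.1, y)
  have hn : Continuous n := by
    have h1 : Continuous fun z : ℝ × ℝ => ∫ y in b₀..(z.2 - t), cutNonlin p w ε (z.1, y) :=
      intervalIntegral.continuous_parametric_intervalIntegral_of_continuous
        (f := fun (z : ℝ × ℝ) y => cutNonlin p w ε (z.1, y)) (by fun_prop) (by fun_prop)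
    refine h1.neg.congr fun z => ?_
    exact (intervalIntegral.integral_symm _ _).symm
  have hN : ∀ x a, a₁ ≤ a → a - ε ≤ x → ∫ y in (a - t)..b₀, nonlin p w (charMap 1 (x, y)) = n (x, a) := by
    intro x a hax hx
    refine intervalIntegral.integral_congr fun y hy => ?_
    have hy' : min (a - t) b₀ ≤ y := hy.1
    refine (cutNonlin_eq ?_).symm
    change ε ≤ x + y
    rcases min_choice (a - t) b₀ with e | e <;> rw [e] at hy' <;> linarith
  have hWc : Continuous fun q : ℝ × ℝ => w (charMap 1 q) := hw.comp (continuous_charMap 1)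
  -- The second difference on the rectangle spanned by a, a + s and by a - t, b₀ trades a shift of w
  -- on the slice for a shift on the line b = b₀, up to a double integral of N. After integration
  -- over a, every term can be differentiated at s = 0.
  have e : ∀ s ∈ Ioo (-ε) ε, ∫ x in a₁..a₂, w (charMap 1 (x + s, x - t))
      = (∫ x in a₁..a₂, w (charMap 1 (x, x - t))) + ((∫ x in (0 : ℝ)..s, w (charMap 1 (a₂ + x, b₀)))
        - ∫ x in (0 : ℝ)..s, w (charMap 1 (a₁ + x, b₀)))
        - ∫ x in (0 : ℝ)..s, ∫ a in a₁..a₂, n (a + x, a) := by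
    intro s hs'
    have hpt : ∀ a ∈ uIcc a₁ a₂, w (charMap 1 (a + s, a - t)) = w (charMap 1 (a, a - t))
        + (w (charMap 1 (a + s, b₀)) - w (charMap 1 (a, b₀))) - ∫ x in (0 : ℝ)..s, n (a + x, a) := by
      intro a haa
      rw [uIcc_of_le ha] at haa
      have h1 := h.mixed a (a + s) (a - t) b₀ (by linarith [haa.1]) (by linarith [haa.1])
        (by linarith [haa.1, hs'.1]) (by linarith [haa.1, hs'.1])
      have h2 : ∫ x in a..(a + s), ∫ y in (a - t)..b₀, nonlin p w (charMap 1 (x, y))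
          = ∫ x in (0 : ℝ)..s, n (a + x, a) := by
        rw [intervalIntegral.integral_comp_add_left (fun x => n (x, a)), add_zero]
        refine intervalIntegral.integral_congr fun x hx => hN x a haa.1 ?_
        have hx' : min a (a + s) ≤ x := hx.1
        rcases min_choice a (a + s) with e | e <;> rw [e] at hx' <;> linarith [hs'.1]
      rw [h2] at h1
      linarith
    rw [intervalIntegral.integral_congr hpt]
    have i1 : IntervalIntegrable (fun a => w (charMap 1 (a, a - t))) volume a₁ a₂ :=
      (by fun_prop : Continuous fun a => w (charMap 1 (a, a - t))).intervalIntegrable _ _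
    have i2 : IntervalIntegrable (fun a => w (charMap 1 (a + s, b₀))) volume a₁ a₂ :=
      (by fun_prop : Continuous fun a => w (charMap 1 (a + s, b₀))).intervalIntegrable _ _
    have i3 : IntervalIntegrable (fun a => w (charMap 1 (a, b₀))) volume a₁ a₂ :=
      (by fun_prop : Continuous fun a => w (charMap 1 (a, b₀))).intervalIntegrable _ _
    have c4 : Continuous fun a => ∫ x in (0 : ℝ)..s, n (a + x, a) :=
      intervalIntegral.continuous_parametric_intervalIntegral_of_continuous'
        (f := fun a x => n (a + x, a)) (by fun_prop) _ _
    rw [intervalIntegral.integral_sub (i1.add (i2.sub i3)) (c4.intervalIntegrable _ _),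
      intervalIntegral.integral_add i1 (i2.sub i3), intervalIntegral.integral_sub i2 i3,
      integral_translate (F := fun a => w (charMap 1 (a, b₀))) (by fun_prop) a₁ a₂ s,
      intervalIntegral_intervalIntegral_swap (F := fun a x => n (a + x, a))]
    · ring
    · exact ((by fun_prop : Continuous fun q : ℝ × ℝ => n (q.1 + q.2, q.1)).continuousOn.integrableOn_compact
        (isCompact_uIcc.prod isCompact_uIcc)).mono_set (prod_mono uIoc_subset_uIcc uIoc_subset_uIcc)
  have hm : Continuous fun x => ∫ a in a₁..a₂, n (a + x, a) :=
    intervalIntegral.continuous_parametric_intervalIntegral_of_continuous'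
      (f := fun x a => n (a + x, a)) (by fun_prop) _ _
  have d : ∀ {F : ℝ → ℝ}, Continuous F → HasDerivAt (fun s => ∫ x in (0 : ℝ)..s, F x) (F 0) 0 := fun hF =>
    hasDerivAt_integral_zero (F := fun z => _) (hF.comp continuous_fst)
  have D : HasDerivAt (fun s => ∫ x in a₁..a₂, w (charMap 1 (x + s, x - t)))
      (w (charMap 1 (a₂, b₀)) - w (charMap 1 (a₁, b₀)) - ∫ a in a₁..a₂, n (a, a)) 0 := by
    have d2 := d (F := fun x => w (charMap 1 (a₂ + x, b₀))) (by fun_prop)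
    have d1 := d (F := fun x => w (charMap 1 (a₁ + x, b₀))) (by fun_prop)
    have d3 := d hm
    simp only [add_zero] at d1 d2 d3
    refine (((d2.sub d1).const_add (∫ x in a₁..a₂, w (charMap 1 (x, x - t)))).sub d3).congr_of_eventuallyEq ?_
    filter_upwards [Ioo_mem_nhds (neg_lt_zero.2 hε) hε] with s hs'
    exact e s hs'
  -- The same derivative has been computed from the data in `hasDerivAt_char`; comparing the two
  -- gives the formula.
  have key := D.unique (hs.hasDerivAt_char hw h₁ ha)
  have iP : IntervalIntegrable (fun a => f (2 * a - t) + g (2 * a - t)) volume a₁ a₂ := by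
    have f1 := (hs.primitive (2 * a₁ - t) (2 * a₂ - t) (by linarith) (by linarith)).1
    have g1 := (hs.hasDerivAt (2 * a₁ - t) (2 * a₂ - t) (by linarith) (by linarith)).1
    have h1 := ((f1.add g1).comp_sub_right t).comp_mul_left (c := 2)
    have e1 : (2 * a₁ - t + t) / 2 = a₁ := by ring
    have e2 : (2 * a₂ - t + t) / 2 = a₂ := by ring
    rw [e1, e2] at h1
    exact h1
  rw [intervalIntegral.integral_congr (g := fun a => f (2 * a - t) + g (2 * a - t) + n (a, a)),
    intervalIntegral.integral_add iP ((by fun_prop : Continuous fun a => n (a, a)).intervalIntegrable _ _), ← key]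
  · ring
  · intro a haa
    rw [uIcc_of_le ha] at haa
    simp only
    rw [hN a a haa.1 (by linarith)]

end IsWave

theorem ae_affine {Q : ℝ → Prop} {c : ℝ} (hc : c ≠ 0) (d : ℝ) (h : ∀ᵐ a, Q a) : ∀ᵐ s, Q (c * s + d) :=
  ((measurePreserving_add_right (volume : Measure ℝ) d).quasiMeasurePreserving.comp
    (Measure.quasiMeasurePreserving_smul volume hc)).ae h

theorem hasLineDerivAt_charMap {w : ℝ × ℝ → ℝ} {c a b : ℝ} (h : HasDerivAt (fun x => w (charMap 1 (x, b))) c a) :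
    HasLineDerivAt ℝ w c (charMap 1 (a, b)) (1, 1) := by
  have h1 : HasDerivAt (fun s => w (charMap 1 (a + s, b))) c 0 :=
    HasDerivAt.comp_const_add (f := fun x => w (charMap 1 (x, b))) a 0 (by simpa using h)
  refine h1.congr_of_eventuallyEq (Eventually.of_forall fun s => ?_)
  refine congrArg w ?_
  refine Prod.ext ?_ ?_ <;> simp [charMap] <;> ring

namespace IsSlice

theorem intervalIntegrable_char {w : ℝ × ℝ → ℝ} {t : ℝ} {f g : ℝ → ℝ} (hs : IsSlice w t f g) {a₁ a₂ : ℝ}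
    (h₁ : t < 2 * a₁) (h₂ : a₁ ≤ a₂) :
    IntervalIntegrable (fun a => f (2 * a - t) + g (2 * a - t)) volume a₁ a₂ := by
  have f1 := (hs.primitive (2 * a₁ - t) (2 * a₂ - t) (by linarith) (by linarith)).1
  have g1 := (hs.hasDerivAt (2 * a₁ - t) (2 * a₂ - t) (by linarith) (by linarith)).1
  have h1 := ((f1.add g1).comp_sub_right t).comp_mul_left (c := 2)
  have e1 : (2 * a₁ - t + t) / 2 = a₁ := by ring
  have e2 : (2 * a₂ - t + t) / 2 = a₂ := by ring
  rw [e1, e2] at h1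
  exact h1

end IsSlice

namespace IsWave

variable {p : ℝ} {w : ℝ × ℝ → ℝ}

theorem exists_continuous_charIntegral (hp : 3 ≤ p) (hw : Continuous w) (t b : ℝ) {c : ℝ}
    (h₁ : t < 2 * c) (h₂ : 0 < c + b) :
    ∃ n : ℝ → ℝ, Continuous n ∧ ∀ a, c ≤ a → ∫ y in (a - t)..b, nonlin p w (charMap 1 (a, y)) = n a := by
  have hε : 0 < min (2 * c - t) (c + b) := lt_min (by linarith) h₂
  have hcut := continuous_cutNonlin hp hw hε
  refine ⟨fun a => ∫ y in (a - t)..b, cutNonlin p w (min (2 * c - t) (c + b)) (a, y), ?_, fun a ha => ?_⟩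
  · have h1 : Continuous fun a : ℝ => ∫ y in b..(a - t), cutNonlin p w (min (2 * c - t) (c + b)) (a, y) :=
      intervalIntegral.continuous_parametric_intervalIntegral_of_continuous
        (f := fun (a : ℝ) y => cutNonlin p w (min (2 * c - t) (c + b)) (a, y)) (by fun_prop) (by fun_prop)
    exact h1.neg.congr fun z => (intervalIntegral.integral_symm _ _).symm
  · refine intervalIntegral.integral_congr fun y hy => (cutNonlin_eq ?_).symm
    have hy' : min (a - t) b ≤ y := hy.1
    have := min_le_left (2 * c - t) (c + b)
    have := min_le_right (2 * c - t) (c + b)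
    change min (2 * c - t) (c + b) ≤ a + y
    rcases min_choice (a - t) b with e | e <;> rw [e] at hy' <;> linarith

/-- For almost every `a` the derivative of `w` along `b = const` exists on the whole characteristic
`a = const`, and is given by the data at time `t`. -/
theorem hasLineDerivAt_char (h : IsWave p w) (hp : 3 ≤ p) {t : ℝ} {f g : ℝ → ℝ} (hs : IsSlice w t f g) :
    ∀ᵐ a : ℝ, t < 2 * a → ∀ b, -a < b → HasLineDerivAt ℝ w
      (f (2 * a - t) + g (2 * a - t) + ∫ y in (a - t)..b, nonlin p w (charMap 1 (a, y)))
      (charMap 1 (a, b)) (1, 1) := by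
  -- Only the data f + g need a Lebesgue point, and this condition does not involve b; the integral
  -- of N is continuous in a. Therefore one null set of a serves all b. The half line 2a > t is
  -- exhausted by countably many compact intervals.
  have h1 : ∀ᵐ a : ℝ, ∀ n : ℕ, a ∈ uIcc (t / 2 + 1 / ((n : ℝ) + 1)) (t / 2 + 1 / ((n : ℝ) + 1) + n) →
      ∀ c ∈ uIcc (t / 2 + 1 / ((n : ℝ) + 1)) (t / 2 + 1 / ((n : ℝ) + 1) + n),
      HasDerivAt (fun y => ∫ x in c..y, (f (2 * x - t) + g (2 * x - t))) (f (2 * a - t) + g (2 * a - t)) a := by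
    rw [ae_all_iff]
    intro n
    have hn : 0 < 1 / ((n : ℝ) + 1) := Nat.one_div_pos_of_nat
    exact (hs.intervalIntegrable_char (a₁ := t / 2 + 1 / ((n : ℝ) + 1)) (by linarith)
      (le_add_of_nonneg_right n.cast_nonneg)).ae_hasDerivAt_integral
  filter_upwards [h1] with a ha hta b hb
  obtain ⟨n, hn⟩ : ∃ n : ℕ, 1 / ((n : ℝ) + 1) < a - t / 2 ∧ a - t / 2 < n := by
    obtain ⟨n₁, h₁⟩ := exists_nat_one_div_lt (show 0 < a - t / 2 by linarith)
    obtain ⟨n₂, h₂⟩ := exists_nat_gt (a - t / 2)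
    refine ⟨max n₁ n₂, (Nat.one_div_le_one_div (le_max_left _ _)).trans_lt h₁, h₂.trans_le ?_⟩
    exact_mod_cast le_max_right _ _
  have hn0 : 0 < 1 / ((n : ℝ) + 1) := Nat.one_div_pos_of_nat
  obtain ⟨c, hc1, hc2⟩ := exists_between (max_lt (show -b < a by linarith)
    (show t / 2 + 1 / ((n : ℝ) + 1) < a by linarith))
  have hcb : -b < c := (le_max_left _ _).trans_lt hc1
  have hcn : t / 2 + 1 / ((n : ℝ) + 1) < c := (le_max_right _ _).trans_lt hc1
  have hle : t / 2 + 1 / ((n : ℝ) + 1) ≤ t / 2 + 1 / ((n : ℝ) + 1) + n := le_add_of_nonneg_right n.cast_nonneg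
  have d1 := ha n (by rw [uIcc_of_le hle]; exact ⟨by linarith, by linarith⟩) c
    (by rw [uIcc_of_le hle]; exact ⟨by linarith, by linarith⟩)
  obtain ⟨m, hm, hmeq⟩ := exists_continuous_charIntegral hp h.continuous t b (c := c) (by linarith) (by linarith)
  have d2 : HasDerivAt (fun y => ∫ x in c..y, m x) (m a) a := hm.integral_hasStrictDerivAt c a |>.hasDerivAt
  refine hasLineDerivAt_charMap ?_
  rw [hmeq a hc2.le]
  refine ((d1.add d2).const_add (w (charMap 1 (c, b)))).congr_of_eventuallyEq ?_
  filter_upwards [lt_mem_nhds hc2] with y hy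
  have e := h.char_difference hp hs (a₁ := c) (a₂ := y) (b₀ := b) (by linarith) (by linarith) hy.le
  have e2 : ∫ x in c..y, (f (2 * x - t) + g (2 * x - t) + ∫ y in (x - t)..b, nonlin p w (charMap 1 (x, y)))
      = ∫ x in c..y, (f (2 * x - t) + g (2 * x - t) + m x) := by
    refine intervalIntegral.integral_congr fun x hx => ?_
    rw [uIcc_of_le hy.le] at hx
    rw [hmeq x hx.1]
  rw [e2, intervalIntegral.integral_add (hs.intervalIntegrable_char (by linarith) hy.le)
    (hm.intervalIntegrable _ _)] at e
  change _ = w (charMap 1 (c, b)) + ((∫ x in c..y, _) + ∫ x in c..y, _)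
  linarith

/-- On the slice itself b = a - t, so the integral in `hasLineDerivAt_char` is over an empty
interval. -/
theorem hasLineDerivAt_slice (h : IsWave p w) (hp : 3 ≤ p) {t : ℝ} {f g : ℝ → ℝ} (hs : IsSlice w t f g) :
    ∀ᵐ r : ℝ, 0 < r → HasLineDerivAt ℝ w (f r + g r) (r, t) (1, 1) := by
  have h1 := h.hasLineDerivAt_char hp hs
  have h2 : ∀ᵐ r : ℝ, t < 2 * ((r + t) / 2) → ∀ b, -((r + t) / 2) < b → HasLineDerivAt ℝ w
      (f (2 * ((r + t) / 2) - t) + g (2 * ((r + t) / 2) - t)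
        + ∫ y in ((r + t) / 2 - t)..b, nonlin p w (charMap 1 ((r + t) / 2, y)))
      (charMap 1 ((r + t) / 2, b)) (1, 1) := by
    simpa only [show ∀ r : ℝ, 2⁻¹ * r + t / 2 = (r + t) / 2 from fun r => by ring]
      using ae_affine (c := 2⁻¹) (by norm_num) (t / 2) h1
  filter_upwards [h2] with r hr hr0
  have h3 := hr (by linarith) ((r - t) / 2) (by linarith)
  have e1 : (r + t) / 2 - t = (r - t) / 2 := by ring
  have e2 : 2 * ((r + t) / 2) - t = r := by ring
  have e3 : charMap 1 ((r + t) / 2, (r - t) / 2) = (r, t) := by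
    ext <;> simp only [charMap] <;> ring
  rw [e1, e2, e3] at h3
  simpa using h3

/-- For almost every `a` the derivative `w_r + w_t` exists on the whole characteristic `a = const`,
and satisfies the transport equation there. -/
theorem transport (h : IsWave p w) (hp : 3 ≤ p) :
    ∀ᵐ a : ℝ, (∀ b, -a < b → LineDifferentiableAt ℝ w (charMap 1 (a, b)) (1, 1)) ∧
      ∀ b₁ b₂, -a < b₁ → -a < b₂ → lineDeriv ℝ w (charMap 1 (a, b₂)) (1, 1)
        - lineDeriv ℝ w (charMap 1 (a, b₁)) (1, 1) = ∫ y in b₁..b₂, nonlin p w (charMap 1 (a, y)) := by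
  -- The slice at time t reaches only the characteristics with 2a > t, so the slices at the times -n
  -- are used for all n.
  have h1 : ∀ᵐ a : ℝ, ∀ n : ℕ, -(n : ℝ) < 2 * a → (∀ b, -a < b → LineDifferentiableAt ℝ w (charMap 1 (a, b)) (1, 1)) ∧
      ∀ b₁ b₂, -a < b₁ → -a < b₂ → lineDeriv ℝ w (charMap 1 (a, b₂)) (1, 1)
        - lineDeriv ℝ w (charMap 1 (a, b₁)) (1, 1) = ∫ y in b₁..b₂, nonlin p w (charMap 1 (a, y)) := by
    rw [ae_all_iff]
    intro n
    obtain ⟨f, g, hs⟩ := h.slice (-(n : ℝ))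
    filter_upwards [h.hasLineDerivAt_char hp hs] with a ha hna
    refine ⟨fun b hb => (ha hna b hb).lineDifferentiableAt, fun b₁ b₂ hb₁ hb₂ => ?_⟩
    rw [(ha hna b₁ hb₁).lineDeriv, (ha hna b₂ hb₂).lineDeriv]
    have hi : ∀ x, -a < x → ∀ y, -a < y → IntervalIntegrable (fun y => nonlin p w (charMap 1 (a, y))) volume x y := by
      intro x hx y hy
      refine ContinuousOn.intervalIntegrable ?_
      refine (continuousOn_nonlin_charMap hp h.continuous).comp (by fun_prop : Continuous fun y : ℝ => (a, y)).continuousOn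
        fun z hz => ?_
      have : min x y ≤ z := hz.1
      have := lt_min hx hy
      change 0 < a + z
      linarith
    rw [← intervalIntegral.integral_add_adjacent_intervals (hi (a - -(n : ℝ)) (by linarith) b₁ hb₁) (hi b₁ hb₁ b₂ hb₂)]
    ring
  filter_upwards [h1] with a ha
  obtain ⟨n, hn⟩ := exists_nat_gt (-(2 * a))
  exact ha n (by linarith)

end IsWave

/-! ### A majorant that is independent of b -/

/-- Minkowski's integral inequality in `L²`. -/
theorem lintegral_lintegral_sq_le {α β : Type*} [MeasurableSpace α] [MeasurableSpace β] {μ : Measure α}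
    {ν : Measure β} [SFinite μ] [SFinite ν] {F : α × β → ENNReal} (hF : Measurable F) :
    ∫⁻ a, (∫⁻ t, F (a, t) ∂ν) ^ 2 ∂μ ≤ (∫⁻ t, (∫⁻ a, F (a, t) ^ 2 ∂μ) ^ (2⁻¹ : ℝ) ∂ν) ^ 2 := by
  have hN : Measurable fun t => (∫⁻ a, F (a, t) ^ 2 ∂μ) ^ (2⁻¹ : ℝ) :=
    (Measurable.lintegral_prod_left' (f := fun z => F z ^ 2) (hF.pow_const 2)).pow_const _
  -- Both squares are written as double integrals over (s, t); after exchanging integrals the claim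
  -- is Cauchy-Schwarz in a for each pair.
  have e1 : ∀ a, (∫⁻ t, F (a, t) ∂ν) ^ 2 = ∫⁻ s, ∫⁻ t, F (a, s) * F (a, t) ∂ν ∂ν := by
    intro a
    have hm : Measurable fun t => F (a, t) := hF.comp measurable_prodMk_left
    simp_rw [lintegral_const_mul _ hm]
    rw [lintegral_mul_const _ hm, sq]
  have e2 : (∫⁻ t, (∫⁻ a, F (a, t) ^ 2 ∂μ) ^ (2⁻¹ : ℝ) ∂ν) ^ 2
      = ∫⁻ s, ∫⁻ t, (∫⁻ a, F (a, s) ^ 2 ∂μ) ^ (2⁻¹ : ℝ) * (∫⁻ a, F (a, t) ^ 2 ∂μ) ^ (2⁻¹ : ℝ) ∂ν ∂ν := by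
    simp_rw [lintegral_const_mul _ hN]
    rw [lintegral_mul_const _ hN, sq]
  simp_rw [e1]
  rw [e2, lintegral_lintegral_swap]
  · refine lintegral_mono fun s => ?_
    rw [lintegral_lintegral_swap]
    · refine lintegral_mono fun t => ?_
      have h1 : AEMeasurable (fun a => F (a, s)) μ := (hF.comp measurable_prodMk_right).aemeasurable
      have h2 : AEMeasurable (fun a => F (a, t)) μ := (hF.comp measurable_prodMk_right).aemeasurable
      simpa using ENNReal.lintegral_mul_le_Lp_mul_Lq μ Real.HolderConjugate.two_two h1 h2
    · exact ((hF.comp (measurable_fst.prodMk measurable_const)).mul hF).aemeasurable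
  · refine Measurable.aemeasurable ?_
    refine Measurable.lintegral_prod_right' (f := fun q : (α × β) × β => F (q.1.1, q.1.2) * F (q.1.1, q.2)) ?_
    exact (hF.comp measurable_fst).mul (hF.comp (by fun_prop))

theorem lintegral_comp_affine (F : ℝ → ENNReal) (t : ℝ) : ∫⁻ a, F (2 * a - t) = 2⁻¹ * ∫⁻ r, F r := by
  have h1 := lintegral_sub_right_eq_self (μ := volume) (fun r => F r) t
  have h2 := (measurableEmbedding_mulLeft₀ (two_ne_zero (α := ℝ))).lintegral_map (μ := volume) fun x => F (x - t)
  rw [Real.map_volume_mul_left two_ne_zero, lintegral_smul_measure, h1] at h2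
  rw [← h2]
  simp [ENNReal.ofReal_inv_of_pos]

/-- `w_r + w_t`. -/
noncomputable def inDeriv (w : ℝ × ℝ → ℝ) (z : ℝ × ℝ) : ℝ := lineDeriv ℝ w z (1, 1)

theorem measurable_inDeriv {w : ℝ × ℝ → ℝ} (hw : Continuous w) : Measurable (inDeriv w) :=
  measurable_lineDeriv hw

theorem measurable_nonlin {p : ℝ} {w : ℝ × ℝ → ℝ} (hw : Continuous w) : Measurable (nonlin p w) := by
  have := hw.measurable
  unfold nonlin
  fun_prop

namespace IsWave

variable {p : ℝ} {w : ℝ × ℝ → ℝ}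

/-- The points of the line a = const are (2a - t, t). Minkowski moves the L² norm in a inside the
integral over t, where it is at most the L²(dr) norm of N(·, t). What remains is the quantity
bounded by `strichartz`. -/
theorem lintegral_sq_lintegral_nonlin (h : IsWave p w) (A B : ℝ) :
    ∫⁻ a in Icc (-A) A, (∫⁻ y in Ioi (-a) ∩ Iic B, ‖nonlin p w (charMap 1 (a, y))‖ₑ) ^ 2 < ⊤ := by
  -- For |a| ≤ |A| and -a < y ≤ B the time a - y lies between -|A| - |B| and 2|A|.
  set T := 2 * |A| + |B| with hT
  have hm := measurable_nonlin (p := p) h.continuous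
  let F : ℝ × ℝ → ENNReal := fun q => (Ioi (0 : ℝ)).indicator (fun r => ‖nonlin p w (r, q.2)‖ₑ) (2 * q.1 - q.2)
  have hF : Measurable F := by
    have : F = {q : ℝ × ℝ | 0 < 2 * q.1 - q.2}.indicator fun q => ‖nonlin p w (2 * q.1 - q.2, q.2)‖ₑ := by
      funext q; simp [F, indicator]
    rw [this]
    refine Measurable.indicator (by fun_prop) ?_
    exact measurableSet_lt measurable_const (by fun_prop)
  have h1 : ∀ a ∈ Icc (-A) A, ∫⁻ y in Ioi (-a) ∩ Iic B, ‖nonlin p w (charMap 1 (a, y))‖ₑ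
      ≤ ∫⁻ t in Icc (-T) T, F (a, t) := by
    intro a ha
    rw [← lintegral_indicator (measurableSet_Ioi.inter measurableSet_Iic), ← lintegral_indicator measurableSet_Icc,
      ← lintegral_sub_left_eq_self (fun t => (Icc (-T) T).indicator (fun t => F (a, t)) t) a]
    refine lintegral_mono fun y => ?_
    by_cases hy : y ∈ Ioi (-a) ∩ Iic B
    · obtain ⟨hy1, hy2⟩ := hy
      simp only [mem_Ioi, mem_Iic] at hy1 hy2
      have h3 : a - y ∈ Icc (-T) T := by
        have := le_abs_self A; have := le_abs_self B
        exact ⟨by linarith [ha.1, abs_nonneg A], by linarith [ha.2, abs_nonneg B]⟩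
      rw [indicator_of_mem (show y ∈ Ioi (-a) ∩ Iic B from ⟨hy1, hy2⟩), indicator_of_mem h3]
      simp only [F]
      rw [indicator_of_mem (show 2 * a - (a - y) ∈ Ioi (0 : ℝ) by simp only [mem_Ioi]; linarith)]
      rw [show charMap 1 (a, y) = (2 * a - (a - y), a - y) by simp only [charMap]; refine Prod.ext ?_ ?_ <;> simp; ring]
    · rw [indicator_of_notMem hy]; exact zero_le
  have h2 : ∀ t, ∫⁻ a in Icc (-A) A, F (a, t) ^ 2
      ≤ ∫⁻ r in Ioi (0 : ℝ), ENNReal.ofReal (nonlin p w (r, t) ^ 2) := by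
    intro t
    calc ∫⁻ a in Icc (-A) A, F (a, t) ^ 2 ≤ ∫⁻ a, F (a, t) ^ 2 := setLIntegral_le_lintegral _ _
      _ = 2⁻¹ * ∫⁻ r, ((Ioi (0 : ℝ)).indicator (fun r => ‖nonlin p w (r, t)‖ₑ) r) ^ 2 :=
        lintegral_comp_affine (fun r => ((Ioi (0 : ℝ)).indicator (fun r => ‖nonlin p w (r, t)‖ₑ) r) ^ 2) t
      _ ≤ 1 * ∫⁻ r, ((Ioi (0 : ℝ)).indicator (fun r => ‖nonlin p w (r, t)‖ₑ) r) ^ 2 :=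
        mul_le_mul_left (by simp) _
      _ = _ := by
        rw [one_mul, ← lintegral_indicator measurableSet_Ioi]
        refine lintegral_congr fun r => ?_
        by_cases hr : r ∈ Ioi (0 : ℝ)
        · rw [indicator_of_mem hr, indicator_of_mem hr, Real.enorm_eq_ofReal_abs, ← ENNReal.ofReal_pow (abs_nonneg _),
            sq_abs]
        · rw [indicator_of_notMem hr, indicator_of_notMem hr]; simp
  calc _ ≤ ∫⁻ a in Icc (-A) A, (∫⁻ t in Icc (-T) T, F (a, t)) ^ 2 :=
        setLIntegral_mono' measurableSet_Icc fun a ha => pow_le_pow_left₀ (zero_le) (h1 a ha) 2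
    _ ≤ (∫⁻ t in Icc (-T) T, (∫⁻ a in Icc (-A) A, F (a, t) ^ 2) ^ (2⁻¹ : ℝ)) ^ 2 := lintegral_lintegral_sq_le hF
    _ ≤ (∫⁻ t in Icc (-T) T, (∫⁻ r in Ioi (0 : ℝ), ENNReal.ofReal (nonlin p w (r, t) ^ 2)) ^ (2⁻¹ : ℝ)) ^ 2 := by
        exact pow_le_pow_left₀ zero_le (lintegral_mono fun t => ENNReal.rpow_le_rpow (h2 t) (by norm_num)) 2
    _ < ⊤ := ENNReal.pow_lt_top (h.strichartz T)

theorem measurable_lintegral_nonlin (h : IsWave p w) (B : ℝ) :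
    Measurable fun a => ∫⁻ y in Ioi (-a) ∩ Iic B, ‖nonlin p w (charMap 1 (a, y))‖ₑ := by
  have hm := measurable_nonlin (p := p) h.continuous
  have e : (fun a => ∫⁻ y in Ioi (-a) ∩ Iic B, ‖nonlin p w (charMap 1 (a, y))‖ₑ)
      = fun a => ∫⁻ y, {q : ℝ × ℝ | -q.1 < q.2 ∧ q.2 ≤ B}.indicator (fun q => ‖nonlin p w (charMap 1 q)‖ₑ) (a, y) := by
    funext a
    rw [← lintegral_indicator (measurableSet_Ioi.inter measurableSet_Iic)]
    refine lintegral_congr fun y => ?_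
    simp [indicator]
  rw [e]
  refine Measurable.lintegral_prod_right' (Measurable.indicator ?_ ?_)
  · exact (hm.comp (continuous_charMap 1).measurable).enorm
  · exact (measurableSet_lt measurable_fst.neg measurable_snd).inter (measurableSet_le measurable_snd measurable_const)

/-- By the formula of `hasLineDerivAt_char`, |D| is at most the modulus of the data at the foot of
the characteristic plus the integral of |N| over the characteristic. Both bounds are free of b and
square integrable in a. -/
theorem exists_majorant (h : IsWave p w) (hp : 3 ≤ p) (A B : ℝ) :
    ∃ M : ℝ → ℝ, Measurable M ∧ (∀ a, 0 ≤ M a) ∧ IntegrableOn (fun a => M a ^ 2) (Icc (-A) A) ∧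
      ∀ᵐ a, a ∈ Icc (-A) A → IntegrableOn (fun y => nonlin p w (charMap 1 (a, y))) (Ioc (-a) B) ∧
        ∫ y in Ioc (-a) B, |nonlin p w (charMap 1 (a, y))| ≤ M a ∧
        ∀ b ∈ Ioc (-a) B, |inDeriv w (charMap 1 (a, b))| ≤ M a := by
  -- At this time the slice meets every characteristic with |a| ≤ A at positive radius. The enlarged
  -- bound B' includes the height a - t of the meeting point.
  set t : ℝ := -(2 * |A| + 1) with ht
  set B' : ℝ := |B| + 3 * |A| + 1 with hB'
  obtain ⟨f, g, hs⟩ := h.slice t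
  let K : ℝ → ENNReal := fun a => ∫⁻ y in Ioi (-a) ∩ Iic B', ‖nonlin p w (charMap 1 (a, y))‖ₑ
  have hK : Measurable K := h.measurable_lintegral_nonlin B'
  have hKint : ∫⁻ a in Icc (-A) A, K a ^ 2 < ⊤ := h.lintegral_sq_lintegral_nonlin A B'
  have hKfin : ∀ᵐ a, a ∈ Icc (-A) A → K a < ⊤ := by
    rw [← ae_restrict_iff' measurableSet_Icc]
    filter_upwards [ae_lt_top (hK.pow_const 2) hKint.ne] with a ha
    by_contra hcon
    rw [not_lt, top_le_iff] at hcon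
    simp [hcon] at ha
  have hP : IntegrableOn (fun a => (f (2 * a - t) + g (2 * a - t)) ^ 2) (Icc (-A) A) := by
    have h1 : IntegrableOn (fun r => (f r + g r) ^ 2) (Ioi 0) := by
      refine ((hs.sq_fst.add hs.sq_snd).const_mul 2).mono'
        ((hs.measurable_fst.add hs.measurable_snd).pow_const 2).aestronglyMeasurable (ae_of_all _ fun r => ?_)
      rw [Real.norm_of_nonneg (sq_nonneg _)]
      simp only [Pi.add_apply]
      nlinarith [sq_nonneg (f r - g r)]
    have h2 := ((integrable_indicator_iff measurableSet_Ioi).2 h1)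
    have h3 := (h2.comp_sub_right t).comp_mul_left' (R := 2) two_ne_zero
    refine (h3.integrableOn (s := Icc (-A) A)).congr_fun (fun a ha => ?_) measurableSet_Icc
    have : 2 * a - t ∈ Ioi (0 : ℝ) := by
      have := le_abs_self A
      simp only [mem_Ioi, ht]; linarith [ha.1]
    simp only [indicator_of_mem this]
  have hK2 : IntegrableOn (fun a => (K a).toReal ^ 2) (Icc (-A) A) := by
    have := integrable_toReal_of_lintegral_ne_top (hK.pow_const 2).aemeasurable hKint.ne
    simpa [IntegrableOn] using this
  have hMm : Measurable fun a => |f (2 * a - t) + g (2 * a - t)| + (K a).toReal := by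
    have := hs.measurable_fst; have := hs.measurable_snd
    have := hK.ennreal_toReal
    have h1 : Measurable fun a => f (2 * a - t) + g (2 * a - t) := by fun_prop
    exact h1.abs.add this
  refine ⟨fun a => |f (2 * a - t) + g (2 * a - t)| + (K a).toReal, hMm, fun a => by positivity, ?_, ?_⟩
  · refine ((hP.add hK2).const_mul 2).mono' (hMm.pow_const 2).aestronglyMeasurable (ae_of_all _ fun a => ?_)
    rw [Real.norm_of_nonneg (sq_nonneg _)]
    simp only [Pi.add_apply]
    nlinarith [sq_nonneg (|f (2 * a - t) + g (2 * a - t)| - (K a).toReal), sq_abs (f (2 * a - t) + g (2 * a - t))]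
  filter_upwards [hKfin, h.hasLineDerivAt_char hp hs] with a hKa hda haA
  have hA1 := le_abs_self A
  have hB1 := le_abs_self B
  have haA1 := haA.1
  have haA2 := haA.2
  have hm : Measurable fun y => nonlin p w (charMap 1 (a, y)) :=
    (measurable_nonlin h.continuous).comp (by fun_prop)
  have hset : Ioi (-a) ∩ Iic B' = Ioc (-a) B' := rfl
  have hint : IntegrableOn (fun y => nonlin p w (charMap 1 (a, y))) (Ioc (-a) B') := by
    refine ⟨hm.aestronglyMeasurable, ?_⟩
    rw [hasFiniteIntegral_iff_enorm]
    exact hKa haA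
  have hKeq : ∫ y in Ioc (-a) B', |nonlin p w (charMap 1 (a, y))| = (K a).toReal := by
    have := integral_norm_eq_lintegral_enorm hint.aestronglyMeasurable
    simp only [Real.norm_eq_abs] at this
    exact this
  have hsub : Ioc (-a) B ⊆ Ioc (-a) B' := Ioc_subset_Ioc_right (by linarith [abs_nonneg A])
  refine ⟨hint.mono_set hsub, ?_, fun b hb => ?_⟩
  · have h1 := setIntegral_mono_set hint.abs (ae_of_all _ fun y => abs_nonneg _) hsub.eventuallyLE
    rw [hKeq] at h1
    exact h1.trans (le_add_of_nonneg_left (abs_nonneg _))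
  · rw [inDeriv, (hda (by linarith) b hb.1).lineDeriv]
    refine (abs_add_le _ _).trans (add_le_add le_rfl ?_)
    rw [← hKeq]
    refine (intervalIntegral.norm_integral_le_integral_norm_uIoc
      (f := fun y => nonlin p w (charMap 1 (a, y))) (a := a - t) (b := b) (μ := volume)).trans ?_
    refine setIntegral_mono_set hint.abs (ae_of_all _ fun y => abs_nonneg _) (LE.le.eventuallyLE ?_)
    intro y hy
    have h1 : min (a - t) b < y := hy.1
    have h2 : y ≤ max (a - t) b := hy.2
    have h3 : -a < min (a - t) b := lt_min (by linarith) hb.1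
    have h4 : max (a - t) b ≤ B' := max_le (by linarith [abs_nonneg B]) (hb.2.trans (by linarith [abs_nonneg A]))
    exact ⟨by linarith, by linarith⟩

/-- Along the characteristics `b = const`, `w` is the primitive of `w_r + w_t`. -/
theorem intervalIntegral_inDeriv (h : IsWave p w) (hp : 3 ≤ p) {a₁ a₂ b : ℝ} (h₁ : 0 < a₁ + b) (ha : a₁ ≤ a₂) :
    IntervalIntegrable (fun a => inDeriv w (charMap 1 (a, b))) volume a₁ a₂ ∧
      w (charMap 1 (a₂, b)) - w (charMap 1 (a₁, b)) = ∫ a in a₁..a₂, inDeriv w (charMap 1 (a, b)) := by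
  obtain ⟨f, g, hs⟩ := h.slice (2 * a₁ - 1)
  have hae : ∀ᵐ a, a ∈ uIoc a₁ a₂ → f (2 * a - (2 * a₁ - 1)) + g (2 * a - (2 * a₁ - 1))
      + ∫ y in (a - (2 * a₁ - 1))..b, nonlin p w (charMap 1 (a, y)) = inDeriv w (charMap 1 (a, b)) := by
    filter_upwards [h.hasLineDerivAt_char hp hs] with a hda haI
    rw [uIoc_of_le ha] at haI
    exact ((hda (by linarith [haI.1]) b (by linarith [haI.1])).lineDeriv).symm
  obtain ⟨n, hn, hneq⟩ := exists_continuous_charIntegral hp h.continuous (2 * a₁ - 1) b (c := a₁) (by linarith) h₁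
  have hi : IntervalIntegrable (fun a => f (2 * a - (2 * a₁ - 1)) + g (2 * a - (2 * a₁ - 1))
      + ∫ y in (a - (2 * a₁ - 1))..b, nonlin p w (charMap 1 (a, y))) volume a₁ a₂ := by
    refine ((hs.intervalIntegrable_char (by linarith) ha).add (hn.intervalIntegrable a₁ a₂)).congr fun a haI => ?_
    rw [uIoc_of_le ha] at haI
    rw [hneq a haI.1.le]
  refine ⟨hi.congr_ae ((ae_restrict_iff' measurableSet_uIoc).2 hae), ?_⟩
  rw [h.char_difference hp hs (by linarith) h₁ ha]
  exact intervalIntegral.integral_congr_ae hae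

end IsWave

/-! ### The trace on the axis and transport of the two squares -/

/-- `2/(p+1) |w|^(p+1) / r^(p-1)`. -/
noncomputable def wavePotential (p : ℝ) (w : ℝ × ℝ → ℝ) (z : ℝ × ℝ) : ℝ :=
  2 / (p + 1) * (|w z| ^ (p + 1) / z.1 ^ (p - 1))

/-- `|w|^(p+1) / r^p`. -/
noncomputable def waveBulk (p : ℝ) (w : ℝ × ℝ → ℝ) (z : ℝ × ℝ) : ℝ := |w z| ^ (p + 1) / z.1 ^ p

/-- The limit of `w_r + w_t` on the axis along the characteristic with parameter `a`. -/
noncomputable def trace (p : ℝ) (w : ℝ × ℝ → ℝ) (a : ℝ) : ℝ :=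
  inDeriv w (charMap 1 (a, 1 - a)) - ∫ y in (-a)..(1 - a), nonlin p w (charMap 1 (a, y))

/-- `w_r + w_t`, extended to the axis by its trace. -/
noncomputable def closedInDeriv (p : ℝ) (w : ℝ × ℝ → ℝ) (z : ℝ × ℝ) : ℝ :=
  if z.1 = 0 then trace p w (z.2 / 2) else inDeriv w z

theorem ae_of_ae_Icc {Q : ℝ → Prop} (h : ∀ n : ℕ, ∀ᵐ a, a ∈ Icc (-(n : ℝ)) n → Q a) : ∀ᵐ a, Q a := by
  filter_upwards [ae_all_iff.2 h] with a ha
  obtain ⟨n, hn⟩ := exists_nat_gt |a|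
  exact ha n (abs_le.1 hn.le)

theorem lipschitzOnWith_abs_rpow {s : ℝ} (hs : 1 < s) (R : ℝ) :
    ∃ K, LipschitzOnWith K (fun x : ℝ => |x| ^ s) (Icc (-R) R) := by
  refine ⟨Real.toNNReal (s * |R| ^ (s - 1)), ?_⟩
  refine (convex_Icc (-R) R).lipschitzOnWith_of_nnnorm_hasDerivWithin_le
    (f' := fun x => s * |x| ^ (s - 2) * x) (fun x _ => (hasDerivAt_abs_rpow x hs).hasDerivWithinAt) fun x hx => ?_
  rw [← NNReal.coe_le_coe, coe_nnnorm, Real.coe_toNNReal _ (by positivity), Real.norm_eq_abs]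
  rcases eq_or_ne x 0 with rfl | hx0
  · simp; positivity
  have hxR : |x| ≤ |R| := (abs_le.2 hx).trans (le_abs_self R)
  rw [abs_mul, abs_mul, abs_of_pos (by linarith : 0 < s), abs_of_nonneg (Real.rpow_nonneg (abs_nonneg x) _), mul_assoc,
    ← Real.rpow_add_one (abs_ne_zero.2 hx0)]
  refine mul_le_mul_of_nonneg_left ?_ (by linarith)
  rw [show s - 2 + 1 = s - 1 by ring]
  exact Real.rpow_le_rpow (abs_nonneg _) hxR (by linarith)

namespace IsWave

variable {p : ℝ} {w : ℝ × ℝ → ℝ}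

theorem integrableOn_nonlin_char (h : IsWave p w) (hp : 3 ≤ p) :
    ∀ᵐ a, ∀ B, IntegrableOn (fun y => nonlin p w (charMap 1 (a, y))) (Ioc (-a) B) := by
  refine ae_of_ae_Icc fun n => ?_
  have h1 : ∀ᵐ a, ∀ m : ℕ, a ∈ Icc (-(n : ℝ)) n →
      IntegrableOn (fun y => nonlin p w (charMap 1 (a, y))) (Ioc (-a) m) := by
    rw [ae_all_iff]
    intro m
    obtain ⟨M, -, -, -, hM⟩ := h.exists_majorant hp n m
    filter_upwards [hM] with a ha haI
    exact (ha haI).1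
  filter_upwards [h1] with a ha haI B
  obtain ⟨m, hm⟩ := exists_nat_gt B
  exact (ha m haI).mono_set (Ioc_subset_Ioc_right hm.le)

/-- N is integrable down to the axis, so the transport equation from the reference point r = 1 used
in `trace` extends to b = -a. The choice of reference point does not matter. -/
theorem closedInDeriv_eq (h : IsWave p w) (hp : 3 ≤ p) :
    ∀ᵐ a, (∀ B, IntegrableOn (fun y => nonlin p w (charMap 1 (a, y))) (Ioc (-a) B)) ∧
      (∀ b, -a < b → LineDifferentiableAt ℝ w (charMap 1 (a, b)) (1, 1)) ∧
      ∀ b, -a ≤ b → closedInDeriv p w (charMap 1 (a, b))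
        = trace p w a + ∫ y in (-a)..b, nonlin p w (charMap 1 (a, y)) := by
  filter_upwards [h.integrableOn_nonlin_char hp, h.transport hp] with a hi ht
  refine ⟨hi, ht.1, fun b hb => ?_⟩
  rcases hb.eq_or_lt with rfl | hb
  · simp only [closedInDeriv, charMap, add_neg_cancel, if_true, intervalIntegral.integral_same, add_zero]
    congr 1; ring
  · have hne : (charMap 1 (a, b)).1 ≠ 0 := by simp only [charMap]; linarith
    have hii : ∀ b, -a ≤ b → IntervalIntegrable (fun y => nonlin p w (charMap 1 (a, y))) volume (-a) b :=
      fun b hb => (intervalIntegrable_iff_integrableOn_Ioc_of_le hb).2 (hi b)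
    have h1 := ht.2 (1 - a) b (by linarith) hb
    rw [closedInDeriv, if_neg hne, trace]
    simp only [inDeriv]
    rw [← intervalIntegral.integral_add_adjacent_intervals ((hii (1 - a) (by linarith)).symm)
      (hii b hb.le), intervalIntegral.integral_symm (-a) (1 - a)] at h1
    linarith

/-- On almost every line a = const, D is absolutely continuous in b with derivative N. The axis is a
single point of the line, so the integrand may use the unextended derivative. -/
theorem closedInDeriv_sq (h : IsWave p w) (hp : 3 ≤ p) :
    ∀ᵐ a, ∀ b₁ b₂, -a ≤ b₁ → b₁ ≤ b₂ →
      IntervalIntegrable (fun y => 2 * inDeriv w (charMap 1 (a, y)) * nonlin p w (charMap 1 (a, y))) volume b₁ b₂ ∧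
      closedInDeriv p w (charMap 1 (a, b₂)) ^ 2 - closedInDeriv p w (charMap 1 (a, b₁)) ^ 2
        = ∫ y in b₁..b₂, 2 * inDeriv w (charMap 1 (a, y)) * nonlin p w (charMap 1 (a, y)) := by
  filter_upwards [h.closedInDeriv_eq hp] with a ha b₁ b₂ hb₁ hb
  obtain ⟨hi, -, he⟩ := ha
  have hii : ∀ b, -a ≤ b → IntervalIntegrable (fun y => nonlin p w (charMap 1 (a, y))) volume (-a) b :=
    fun b hb => (intervalIntegrable_iff_integrableOn_Ioc_of_le hb).2 (hi b)
  have hN : IntervalIntegrable (fun y => nonlin p w (charMap 1 (a, y))) volume b₁ b₂ :=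
    (hii b₁ hb₁).symm.trans (hii b₂ (hb₁.trans hb))
  have hF : ∀ x ∈ uIcc b₁ b₂, closedInDeriv p w (charMap 1 (a, x)) - closedInDeriv p w (charMap 1 (a, b₁))
      = ∫ y in b₁..x, nonlin p w (charMap 1 (a, y)) := by
    intro x hx
    rw [uIcc_of_le hb] at hx
    rw [he x (hb₁.trans hx.1), he b₁ hb₁, ← intervalIntegral.integral_add_adjacent_intervals (hii b₁ hb₁)
      ((hii b₁ hb₁).symm.trans (hii x (hb₁.trans hx.1)))]
    ring
  have hac := absolutelyContinuous_of_integral hN hF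
  have hd := hasDerivAt_of_integral hN hF
  have key := AbsolutelyContinuousOnInterval.ftc (hac.mul hac)
    (f := fun y => 2 * closedInDeriv p w (charMap 1 (a, y)) * nonlin p w (charMap 1 (a, y))) (by
      filter_upwards [hd] with y hy hyI
      exact ((hy hyI).mul (hy hyI)).congr_deriv (by ring))
  have hcongr : ∀ y ∈ uIoc b₁ b₂, 2 * closedInDeriv p w (charMap 1 (a, y)) * nonlin p w (charMap 1 (a, y))
      = 2 * inDeriv w (charMap 1 (a, y)) * nonlin p w (charMap 1 (a, y)) := by
    intro y hy
    rw [uIoc_of_le hb] at hy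
    have hne : (charMap 1 (a, y)).1 ≠ 0 := by simp only [charMap]; linarith [hy.1]
    rw [closedInDeriv, if_neg hne]
  refine ⟨key.1.congr hcongr, ?_⟩
  rw [← intervalIntegral.integral_congr_ae (ae_of_all _ hcongr), key.2]
  simp only [Pi.mul_apply]
  ring

/-- Chain rule for absolutely continuous functions: |·|^(p+1) is Lipschitz on bounded sets and w is
a primitive of D. Differentiating the weight r^(-(p-1)) produces the bulk density. -/
theorem wavePotential_sub (h : IsWave p w) (hp : 3 ≤ p) {a₁ a₂ b : ℝ} (h₁ : 0 < a₁ + b) (ha : a₁ ≤ a₂) :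
    IntervalIntegrable (fun x => 2 * inDeriv w (charMap 1 (x, b)) * nonlin p w (charMap 1 (x, b))
        - 2 * (p - 1) / (p + 1) * waveBulk p w (charMap 1 (x, b))) volume a₁ a₂ ∧
      wavePotential p w (charMap 1 (a₂, b)) - wavePotential p w (charMap 1 (a₁, b))
        = ∫ x in a₁..a₂, (2 * inDeriv w (charMap 1 (x, b)) * nonlin p w (charMap 1 (x, b))
        - 2 * (p - 1) / (p + 1) * waveBulk p w (charMap 1 (x, b))) := by
  obtain ⟨hi, -⟩ := h.intervalIntegral_inDeriv hp h₁ ha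
  have hW : ∀ x ∈ uIcc a₁ a₂, w (charMap 1 (x, b)) - w (charMap 1 (a₁, b))
      = ∫ a in a₁..x, inDeriv w (charMap 1 (a, b)) := fun x hx => by
    rw [uIcc_of_le ha] at hx
    exact (h.intervalIntegral_inDeriv hp h₁ hx.1).2
  have hac := absolutelyContinuous_of_integral hi hW
  have hd := hasDerivAt_of_integral hi hW
  have hw := h.continuous
  have hWc : Continuous fun x => w (charMap 1 (x, b)) := by fun_prop
  obtain ⟨R, hR⟩ := (isCompact_uIcc (a := a₁) (b := a₂)).exists_bound_of_continuousOn hWc.continuousOn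
  obtain ⟨K, hK⟩ := lipschitzOnWith_abs_rpow (s := p + 1) (by linarith) R
  have hac1 := AbsolutelyContinuousOnInterval.lipschitz_comp hac hK fun x hx => abs_le.1 (hR x hx)
  have hpos : ∀ x ∈ uIcc a₁ a₂, 0 < x + b := fun x hx => by
    rw [uIcc_of_le ha] at hx; linarith [hx.1]
  have hac2 : AbsolutelyContinuousOnInterval (fun x => (x + b) ^ (-(p - 1))) a₁ a₂ := by
    refine ContDiffOn.absolutelyContinuousOnInterval fun x hx => ?_
    exact (ContDiffAt.rpow_const_of_ne (contDiffAt_id.add contDiffAt_const) (hpos x hx).ne').contDiffWithinAt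
  have key := AbsolutelyContinuousOnInterval.ftc ((hac1.mul hac2).const_mul (2 / (p + 1)))
    (f := fun x => 2 * inDeriv w (charMap 1 (x, b)) * nonlin p w (charMap 1 (x, b))
        - 2 * (p - 1) / (p + 1) * waveBulk p w (charMap 1 (x, b))) (by
      filter_upwards [hd] with x hx hxI
      have hx0 : 0 < x + b := hpos x (Ioo_subset_Icc_self hxI)
      have d1 := (hasDerivAt_abs_rpow (w (charMap 1 (x, b))) (show 1 < p + 1 by linarith)).comp x (hx hxI)
      have d2 : HasDerivAt (fun x => (x + b) ^ (-(p - 1))) (-(p - 1) * (x + b) ^ (-p)) x := by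
        refine ((Real.hasDerivAt_rpow_const (Or.inl hx0.ne')).comp x ((hasDerivAt_id x).add_const b)).congr_deriv ?_
        rw [show -(p - 1) - 1 = -p by ring]; simp
      refine ((d1.mul d2).const_mul (2 / (p + 1))).congr_deriv ?_
      simp only [waveBulk, nonlin, charMap, Real.rpow_neg hx0.le, Function.comp]
      rw [show p + 1 - 2 = p - 1 by ring]
      have : p + 1 ≠ 0 := by linarith
      field_simp
      ring)
  refine ⟨key.1, ?_⟩
  rw [key.2]
  have e : ∀ x, 0 < x + b → wavePotential p w (charMap 1 (x, b))
      = 2 / (p + 1) * (|w (charMap 1 (x, b))| ^ (p + 1) * (x + b) ^ (-(p - 1))) := fun x hx => by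
    rw [wavePotential, Real.rpow_neg hx.le, div_eq_mul_inv (_ ^ _)]; rfl
  rw [e a₂ (by linarith), e a₁ h₁]
  rfl

end IsWave

/-! ### The potential and the bulk density near the axis -/

/-- Division by zero returns 0, and this agrees with the limit found in `tendsto_wavePotential`. -/
theorem wavePotential_axis {p : ℝ} (hp : 3 ≤ p) (w : ℝ × ℝ → ℝ) {z : ℝ × ℝ} (hz : z.1 = 0) :
    wavePotential p w z = 0 := by
  rw [wavePotential, hz, Real.zero_rpow (by linarith), div_zero, mul_zero]

theorem integrableOn_of_sq {M : ℝ → ℝ} (hm : Measurable M) {s : Set ℝ} (hs : volume s ≠ ⊤)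
    (h2 : IntegrableOn (fun a => M a ^ 2) s) : IntegrableOn M s := by
  refine ((integrableOn_const hs (C := (1 : ℝ))).add h2).mono' hm.aestronglyMeasurable (ae_of_all _ fun a => ?_)
  rw [Real.norm_eq_abs]
  simp only [Pi.add_apply]
  nlinarith [sq_nonneg (|M a| - 1), sq_abs (M a)]

namespace IsWave

variable {p : ℝ} {w : ℝ × ℝ → ℝ}

/-- Since w = 0 on the axis, w is bounded by the integral of |D| along b = const. The primitive
formula holds only for r > 0, so the starting point is let tend to the axis. -/
theorem abs_le_integral_majorant (h : IsWave p w) (hp : 3 ≤ p) {n : ℝ} {M : ℝ → ℝ}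
    (hMi : IntegrableOn M (Icc (-n) n)) (hM0 : ∀ a, 0 ≤ M a)
    (hM : ∀ᵐ a, a ∈ Icc (-n) n → ∀ b ∈ Ioc (-a) n, |inDeriv w (charMap 1 (a, b))| ≤ M a) {a b : ℝ}
    (hb : b ≤ n) (hab : -b < a) (ha : a ≤ n) :
    |w (charMap 1 (a, b))| ≤ ∫ x in (-b)..a, M x := by
  have hMI : ∀ c, -b ≤ c → c ≤ a → IntervalIntegrable M volume c a := fun c hc hca => by
    rw [intervalIntegrable_iff_integrableOn_Icc_of_le hca]
    exact hMi.mono_set (Icc_subset_Icc (by linarith) ha)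
  have h1 : ∀ c ∈ Ioo (-b) a, |w (charMap 1 (a, b)) - w (charMap 1 (c, b))| ≤ ∫ x in (-b)..a, M x := by
    intro c hc
    obtain ⟨hi, he⟩ := h.intervalIntegral_inDeriv hp (a₁ := c) (a₂ := a) (b := b) (by linarith [hc.1]) hc.2.le
    rw [he]
    have h2 : |∫ x in c..a, inDeriv w (charMap 1 (x, b))| ≤ ∫ x in c..a, M x := by
      refine intervalIntegral.norm_integral_le_of_norm_le
        (f := fun x => inDeriv w (charMap 1 (x, b))) (μ := volume) hc.2.le ?_ (hMI c hc.1.le hc.2.le)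
      filter_upwards [hM] with x hx hxI
      exact hx ⟨by linarith [hxI.1, hc.1], by linarith [hxI.2]⟩ b ⟨by linarith [hxI.1, hc.1], hb⟩
    refine h2.trans ?_
    refine intervalIntegral.integral_mono_interval hc.1.le hc.2.le le_rfl (ae_of_all _ fun x => hM0 x)
      (hMI (-b) le_rfl hab.le)
  have hw := h.continuous
  have h2 : Tendsto (fun c => |w (charMap 1 (a, b)) - w (charMap 1 (c, b))|) (𝓝[>] (-b))
      (𝓝 |w (charMap 1 (a, b)) - w (charMap 1 (-b, b))|) :=
    ((by fun_prop : Continuous fun c => |w (charMap 1 (a, b)) - w (charMap 1 (c, b))|).tendsto (-b)).mono_left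
      nhdsWithin_le_nhds
  have h3 : w (charMap 1 (-b, b)) = 0 := by
    have := h.zero (1 * (-b - b))
    simpa [charMap] using this
  rw [h3, sub_zero] at h2
  exact le_of_tendsto h2 (by filter_upwards [Ioo_mem_nhdsGT hab] with c hc using h1 c hc)

/-- Where the primitive of M is differentiable at -b, the previous lemma gives |w| ≤ C r near the
axis and hence V ≤ C r². The bound w² ≤ C r alone would give only V ≤ C r^((3-p)/2), which need not
tend to 0 for p ≥ 3. -/
theorem tendsto_wavePotential (h : IsWave p w) (hp : 3 ≤ p) :
    ∀ᵐ b, Tendsto (fun a => wavePotential p w (charMap 1 (a, b))) (𝓝[>] (-b)) (𝓝 0) := by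
  refine ae_of_ae_Icc fun n => ?_
  obtain ⟨M, hMm, hM0, hM2, hM⟩ := h.exists_majorant hp (n + 1) (n + 1)
  have hMi := integrableOn_of_sq hMm measure_Icc_lt_top.ne hM2
  have hle : -((n : ℝ) + 1) ≤ n + 1 := by have : (0 : ℝ) ≤ n := n.cast_nonneg; linarith
  have hMI : IntervalIntegrable M volume (-((n : ℝ) + 1)) (n + 1) :=
    (intervalIntegrable_iff_integrableOn_Icc_of_le hle).2 hMi
  have hd := ae_affine (c := -1) (by norm_num) 0 hMI.ae_hasDerivAt_integral
  filter_upwards [hd] with b hdb hbI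
  rw [neg_one_mul, add_zero, uIcc_of_le hle] at hdb
  have hd1 := hdb ⟨by linarith [hbI.2], by linarith [hbI.1]⟩ (-((n : ℝ) + 1)) ⟨le_rfl, hle⟩
  obtain ⟨C, hC⟩ := hd1.isBigO_sub.bound
  have hbound : ∀ᶠ a in 𝓝[>] (-b), wavePotential p w (charMap 1 (a, b))
      ≤ 2 / (p + 1) * (|C| ^ (p + 1) * (a + b) ^ (2 : ℕ)) := by
    have hlt : -b < n + 1 := by linarith [hbI.1]
    filter_upwards [hC.filter_mono nhdsWithin_le_nhds, Ioo_mem_nhdsGT hlt] with a ha haI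
    have h1 := h.abs_le_integral_majorant hp hMi hM0 (by
      filter_upwards [hM] with x hx hxI using (hx hxI).2.2) (a := a) (b := b) (by linarith [hbI.2]) haI.1 haI.2.le
    have hr : 0 < a + b := by linarith [haI.1]
    have hsub : (∫ x in (-((n : ℝ) + 1))..a, M x) - ∫ x in (-((n : ℝ) + 1))..(-b), M x = ∫ x in (-b)..a, M x := by
      refine intervalIntegral.integral_interval_sub_left ?_ ?_
      · exact hMI.mono_set (by
          rw [uIcc_of_le hle, uIcc_of_le (by linarith [hbI.2, haI.1])]; exact Icc_subset_Icc le_rfl haI.2.le)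
      · exact hMI.mono_set (by
          rw [uIcc_of_le hle, uIcc_of_le (by linarith [hbI.2])]; exact Icc_subset_Icc le_rfl hlt.le)
    rw [hsub] at ha
    have h2 : |w (charMap 1 (a, b))| ≤ |C| * (a + b) := by
      refine h1.trans ((le_abs_self _).trans (ha.trans ?_))
      rw [sub_neg_eq_add, Real.norm_eq_abs, abs_of_pos hr]
      exact mul_le_mul_of_nonneg_right (le_abs_self C) hr.le
    have hp1 : 0 < p + 1 := by linarith
    refine mul_le_mul_of_nonneg_left ?_ (by positivity)
    change |w (charMap 1 (a, b))| ^ (p + 1) / (a + b) ^ (p - 1) ≤ _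
    rw [div_le_iff₀ (Real.rpow_pos_of_pos hr _), mul_assoc, ← Real.rpow_natCast (a + b) 2, ← Real.rpow_add hr,
      show ((2 : ℕ) : ℝ) + (p - 1) = p + 1 by push_cast; ring, ← Real.mul_rpow (abs_nonneg _) hr.le]
    exact Real.rpow_le_rpow (abs_nonneg _) h2 hp1.le
  have hlim : Tendsto (fun a : ℝ => 2 / (p + 1) * (|C| ^ (p + 1) * (a + b) ^ (2 : ℕ))) (𝓝[>] (-b)) (𝓝 0) := by
    have : Tendsto (fun a : ℝ => 2 / (p + 1) * (|C| ^ (p + 1) * (a + b) ^ (2 : ℕ))) (𝓝 (-b)) (𝓝 _) :=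
      (by fun_prop : Continuous fun a : ℝ => 2 / (p + 1) * (|C| ^ (p + 1) * (a + b) ^ (2 : ℕ))).tendsto (-b)
    simp only [neg_add_cancel, ne_eq, OfNat.ofNat_ne_zero, not_false_eq_true, zero_pow, mul_zero] at this
    exact this.mono_left nhdsWithin_le_nhds
  refine squeeze_zero' ?_ hbound hlim
  filter_upwards [self_mem_nhdsWithin] with a ha
  have hr : 0 < a + b := by have : -b < a := ha; linarith
  have : 0 < p + 1 := by linarith
  simp only [wavePotential, charMap]
  positivity

/-- For almost every a the integral of |D N| over b is at most M(a) ∫ |N| db ≤ M(a)². -/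
theorem integrableOn_inDeriv_mul_nonlin (h : IsWave p w) (hp : 3 ≤ p) (n : ℝ) :
    IntegrableOn (fun q => inDeriv w (charMap 1 q) * nonlin p w (charMap 1 q))
      {q : ℝ × ℝ | q.1 ∈ Icc (-n) n ∧ q.2 ∈ Ioc (-q.1) n} := by
  obtain ⟨M, hMm, hM0, hM2, hM⟩ := h.exists_majorant hp n n
  have hw := h.continuous
  have hm : Measurable fun q => inDeriv w (charMap 1 q) * nonlin p w (charMap 1 q) :=
    ((measurable_inDeriv hw).comp (continuous_charMap 1).measurable).mul
      ((measurable_nonlin hw).comp (continuous_charMap 1).measurable)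
  have hS : MeasurableSet {q : ℝ × ℝ | q.1 ∈ Icc (-n) n ∧ q.2 ∈ Ioc (-q.1) n} :=
    (measurableSet_Icc.preimage measurable_fst).inter
      ((measurableSet_lt measurable_fst.neg measurable_snd).inter (measurableSet_le measurable_snd measurable_const))
  refine ⟨hm.aestronglyMeasurable, ?_⟩
  rw [hasFiniteIntegral_iff_enorm, ← lintegral_indicator hS, Measure.volume_eq_prod,
    lintegral_prod _ (hm.enorm.indicator hS).aemeasurable]
  have hfin : ∫⁻ a in Icc (-n) n, ENNReal.ofReal (M a ^ 2) < ⊤ := by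
    have := hM2.2
    rwa [hasFiniteIntegral_iff_ofReal (ae_of_all _ fun a => sq_nonneg _)] at this
  refine lt_of_le_of_lt ?_ hfin
  rw [← lintegral_indicator measurableSet_Icc]
  refine lintegral_mono_ae ?_
  filter_upwards [hM] with a ha
  by_cases haI : a ∈ Icc (-n) n
  · obtain ⟨h1, h2, h3⟩ := ha haI
    rw [indicator_of_mem haI]
    have e : ∀ b, {q : ℝ × ℝ | q.1 ∈ Icc (-n) n ∧ q.2 ∈ Ioc (-q.1) n}.indicator
        (fun q => ‖inDeriv w (charMap 1 q) * nonlin p w (charMap 1 q)‖ₑ) (a, b)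
        = (Ioc (-a) n).indicator (fun b => ‖inDeriv w (charMap 1 (a, b)) * nonlin p w (charMap 1 (a, b))‖ₑ) b := by
      intro b
      simp only [indicator, mem_ofPred_eq, haI, true_and]
    simp_rw [e]
    rw [lintegral_indicator measurableSet_Ioc]
    calc ∫⁻ b in Ioc (-a) n, ‖inDeriv w (charMap 1 (a, b)) * nonlin p w (charMap 1 (a, b))‖ₑ
        ≤ ∫⁻ b in Ioc (-a) n, ENNReal.ofReal (M a) * ‖nonlin p w (charMap 1 (a, b))‖ₑ := by
          refine setLIntegral_mono' measurableSet_Ioc fun b hb => ?_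
          rw [enorm_mul]
          refine mul_le_mul_left ?_ _
          rw [Real.enorm_eq_ofReal_abs]
          exact ENNReal.ofReal_le_ofReal (h3 b hb)
      _ = ENNReal.ofReal (M a) * ENNReal.ofReal (∫ b in Ioc (-a) n, |nonlin p w (charMap 1 (a, b))|) := by
          rw [lintegral_const_mul' _ _ ENNReal.ofReal_ne_top,
            ofReal_integral_eq_lintegral_ofReal h1.abs (ae_of_all _ fun _ => abs_nonneg _)]
          simp_rw [Real.enorm_eq_ofReal_abs]
      _ ≤ ENNReal.ofReal (M a) * ENNReal.ofReal (M a) := mul_le_mul_right (ENNReal.ofReal_le_ofReal h2) _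
      _ = _ := by rw [sq, ENNReal.ofReal_mul (hM0 a)]
  · rw [indicator_of_notMem haI]
    have e : ∀ b, {q : ℝ × ℝ | q.1 ∈ Icc (-n) n ∧ q.2 ∈ Ioc (-q.1) n}.indicator
        (fun q => ‖inDeriv w (charMap 1 q) * nonlin p w (charMap 1 q)‖ₑ) (a, b) = 0 := by
      intro b
      exact indicator_of_notMem (fun hq => haI hq.1) _
    rw [lintegral_congr e]; simp

end IsWave

theorem continuousOn_waveBulk {p : ℝ} (hp : 3 ≤ p) {w : ℝ × ℝ → ℝ} (hw : Continuous w) :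
    ContinuousOn (waveBulk p w) {z | 0 < z.1} := by
  refine ContinuousOn.div ((hw.abs).rpow_const fun _ => Or.inr (by linarith)).continuousOn ?_ ?_
  · exact continuousOn_fst.rpow_const fun z hz => Or.inl (ne_of_gt hz)
  · exact fun z hz => (Real.rpow_pos_of_pos hz _).ne'

theorem waveBulk_nonneg {p : ℝ} {w : ℝ × ℝ → ℝ} {z : ℝ × ℝ} (hz : 0 ≤ z.1) : 0 ≤ waveBulk p w z :=
  div_nonneg (Real.rpow_nonneg (abs_nonneg _) _) (Real.rpow_nonneg hz _)

theorem wavePotential_nonneg {p : ℝ} (hp : 3 ≤ p) {w : ℝ × ℝ → ℝ} {z : ℝ × ℝ} (hz : 0 ≤ z.1) :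
    0 ≤ wavePotential p w z := by
  have : 0 < p + 1 := by linarith
  have := div_nonneg (Real.rpow_nonneg (abs_nonneg (w z)) (p + 1)) (Real.rpow_nonneg hz (p - 1))
  unfold wavePotential
  positivity

theorem measurable_waveBulk {p : ℝ} {w : ℝ × ℝ → ℝ} (hw : Continuous w) : Measurable (waveBulk p w) := by
  have := hw.measurable
  unfold waveBulk
  fun_prop

theorem measurable_wavePotential {p : ℝ} {w : ℝ × ℝ → ℝ} (hw : Continuous w) : Measurable (wavePotential p w) := by
  have := hw.measurable
  unfold wavePotential
  fun_prop

namespace IsWave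

variable {p : ℝ} {w : ℝ × ℝ → ℝ}

/-- Fubini in the other order: the preceding integrability was obtained on lines a = const, while V
is transported along lines b = const. -/
theorem integrableOn_transverse (h : IsWave p w) (hp : 3 ≤ p) :
    ∀ᵐ b, ∀ A, IntegrableOn (fun a => inDeriv w (charMap 1 (a, b)) * nonlin p w (charMap 1 (a, b))) (Ioc (-b) A) := by
  refine ae_of_ae_Icc fun n => ?_
  have h1 : ∀ᵐ b, ∀ m : ℕ, n ≤ m → b ∈ Icc (-(n : ℝ)) n →
      IntegrableOn (fun a => inDeriv w (charMap 1 (a, b)) * nonlin p w (charMap 1 (a, b))) (Ioc (-b) m) := by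
    rw [ae_all_iff]
    intro m
    have h2 := h.integrableOn_inDeriv_mul_nonlin hp m
    have hS : MeasurableSet {q : ℝ × ℝ | q.1 ∈ Icc (-(m : ℝ)) m ∧ q.2 ∈ Ioc (-q.1) m} :=
      (measurableSet_Icc.preimage measurable_fst).inter
        ((measurableSet_lt measurable_fst.neg measurable_snd).inter (measurableSet_le measurable_snd measurable_const))
    rw [← integrable_indicator_iff hS, Measure.volume_eq_prod] at h2
    filter_upwards [h2.prod_left_ae] with b hb hnm hbI
    have hnm' : (n : ℝ) ≤ m := by exact_mod_cast hnm
    rw [← integrable_indicator_iff measurableSet_Ioc]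
    refine hb.congr (ae_of_all _ fun a => ?_)
    by_cases ha : a ∈ Ioc (-b) m
    · rw [indicator_of_mem ha]
      refine indicator_of_mem (a := (a, b)) ?_ _
      exact ⟨⟨by linarith [ha.1, hbI.2], ha.2⟩, ⟨by have := ha.1; simp only; linarith, by simp only; linarith [hbI.2]⟩⟩
    · rw [indicator_of_notMem ha]
      refine indicator_of_notMem (a := (a, b)) ?_ _
      rintro ⟨h3, h4⟩
      have := h4.1
      exact ha ⟨by simp only at this; linarith, h3.2⟩
  filter_upwards [h1] with b hb hbI A
  obtain ⟨m, hm⟩ := exists_nat_gt A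
  refine (hb (max m n) (le_max_right _ _) hbI).mono_set (Ioc_subset_Ioc_right (hm.le.trans ?_))
  exact_mod_cast le_max_left m n

/-- The transport equation for the potential up to the axis. -/
theorem wavePotential_primitive (h : IsWave p w) (hp : 3 ≤ p) :
    ∀ᵐ b, (∀ A, IntegrableOn (fun a => waveBulk p w (charMap 1 (a, b))) (Ioc (-b) A)) ∧
      ∀ a₁ a₂, -b ≤ a₁ → a₁ ≤ a₂ →
      IntervalIntegrable (fun x => 2 * inDeriv w (charMap 1 (x, b)) * nonlin p w (charMap 1 (x, b))
        - 2 * (p - 1) / (p + 1) * waveBulk p w (charMap 1 (x, b))) volume a₁ a₂ ∧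
      wavePotential p w (charMap 1 (a₂, b)) - wavePotential p w (charMap 1 (a₁, b))
        = ∫ x in a₁..a₂, (2 * inDeriv w (charMap 1 (x, b)) * nonlin p w (charMap 1 (x, b))
        - 2 * (p - 1) / (p + 1) * waveBulk p w (charMap 1 (x, b))) := by
  have hw := h.continuous
  have hc : 0 < 2 * (p - 1) / (p + 1) := div_pos (by linarith) (by linarith)
  filter_upwards [h.integrableOn_transverse hp, h.tendsto_wavePotential hp] with b hI hT
  have hI2 : ∀ A, IntegrableOn (fun a => 2 * inDeriv w (charMap 1 (a, b)) * nonlin p w (charMap 1 (a, b))) (Ioc (-b) A) :=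
    fun A => by
      have h1 := (hI A).const_mul 2
      simp only [← mul_assoc] at h1
      exact h1
  have hbulkc : ContinuousOn (fun a => waveBulk p w (charMap 1 (a, b))) (Ioi (-b)) :=
    (continuousOn_waveBulk hp hw).comp (by fun_prop : Continuous fun a => charMap 1 (a, b)).continuousOn
      fun a ha => by have : -b < a := ha; simp only [charMap, mem_ofPred_eq]; linarith
  -- On [c, A] the equation for V bounds the bulk integral by ∫ |2 D N| plus V at c, because V at A
  -- is nonnegative. As c tends to the axis V there is eventually below 1, so the bound is uniform
  -- in c.
  have hbulk : ∀ A, IntegrableOn (fun a => waveBulk p w (charMap 1 (a, b))) (Ioc (-b) A) := by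
    intro A
    rcases le_or_gt A (-b) with hA | hA
    · simp [Ioc_eq_empty (not_lt.2 hA)]
    have hloc : ∀ c, -b < c → IntegrableOn (fun a => waveBulk p w (charMap 1 (a, b))) (Ioc c A) := fun c hc =>
      ((hbulkc.mono fun x hx => hc.trans_le hx.1).integrableOn_Icc).mono_set Ioc_subset_Icc_self
    refine integrableOn_Ioc_of_intervalIntegral_norm_bounded_left (l := atTop)
      (a := fun k : ℕ => -b + 1 / ((k : ℝ) + 1))
      (I := (2 * (p - 1) / (p + 1))⁻¹ * ((∫ a in Ioc (-b) A, ‖2 * inDeriv w (charMap 1 (a, b)) * nonlin p w (charMap 1 (a, b))‖) + 1))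
      (fun k => hloc _ (lt_add_of_pos_right _ Nat.one_div_pos_of_nat)) ?_ ?_
    · simpa using (tendsto_const_nhds (x := -b)).add (tendsto_one_div_add_atTop_nhds_zero_nat (𝕜 := ℝ))
    · have hseq : Tendsto (fun k : ℕ => -b + 1 / ((k : ℝ) + 1)) atTop (𝓝[>] (-b)) := by
        refine tendsto_nhdsWithin_iff.2 ⟨?_, Eventually.of_forall fun k => mem_Ioi.2 (lt_add_of_pos_right _ Nat.one_div_pos_of_nat)⟩
        simpa using (tendsto_const_nhds (x := -b)).add (tendsto_one_div_add_atTop_nhds_zero_nat (𝕜 := ℝ))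
      filter_upwards [hseq.eventually (hT.eventually (gt_mem_nhds one_pos)),
        hseq.eventually (Ioo_mem_nhdsGT hA)] with k hk1 hk2
      set c := -b + 1 / ((k : ℝ) + 1)
      obtain ⟨hi, he⟩ := h.wavePotential_sub hp (a₁ := c) (a₂ := A) (b := b) (by linarith [hk2.1]) hk2.2.le
      have hi2 : IntervalIntegrable (fun a => 2 * inDeriv w (charMap 1 (a, b)) * nonlin p w (charMap 1 (a, b))) volume c A :=
        (intervalIntegrable_iff_integrableOn_Ioc_of_le hk2.2.le).2 ((hI2 A).mono_set (Ioc_subset_Ioc_left hk2.1.le))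
      have hi3 : IntervalIntegrable (fun a => waveBulk p w (charMap 1 (a, b))) volume c A :=
        (intervalIntegrable_iff_integrableOn_Ioc_of_le hk2.2.le).2 (hloc c hk2.1)
      rw [intervalIntegral.integral_sub hi2 (hi3.const_mul _), intervalIntegral.integral_const_mul] at he
      have hn : 0 ≤ wavePotential p w (charMap 1 (A, b)) := wavePotential_nonneg hp (by simp only [charMap]; linarith)
      have hle : ∫ a in c..A, 2 * inDeriv w (charMap 1 (a, b)) * nonlin p w (charMap 1 (a, b))
          ≤ ∫ a in Ioc (-b) A, ‖2 * inDeriv w (charMap 1 (a, b)) * nonlin p w (charMap 1 (a, b))‖ := by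
        rw [intervalIntegral.integral_of_le hk2.2.le]
        refine (Real.le_norm_self _).trans ((norm_integral_le_integral_norm _).trans ?_)
        exact setIntegral_mono_set (hI2 A).norm (ae_of_all _ fun _ => norm_nonneg _)
          (LE.le.eventuallyLE (Ioc_subset_Ioc_left hk2.1.le))
      have e : ∫ x in Ioc c A, ‖waveBulk p w (charMap 1 (x, b))‖ = ∫ x in c..A, waveBulk p w (charMap 1 (x, b)) := by
        rw [intervalIntegral.integral_of_le hk2.2.le]
        refine setIntegral_congr_fun measurableSet_Ioc fun x hx => ?_
        exact Real.norm_of_nonneg (waveBulk_nonneg (by simp only [charMap]; linarith [hx.1, hk2.1]))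
      rw [e, ← div_eq_inv_mul, le_div_iff₀ hc, mul_comm]
      linarith
  refine ⟨hbulk, fun a₁ a₂ ha₁ ha => ?_⟩
  have hint : ∀ c, -b ≤ c → c ≤ a₂ → IntervalIntegrable (fun x => 2 * inDeriv w (charMap 1 (x, b)) * nonlin p w (charMap 1 (x, b))
        - 2 * (p - 1) / (p + 1) * waveBulk p w (charMap 1 (x, b))) volume c a₂ := fun c hc hca => by
    rw [intervalIntegrable_iff_integrableOn_Ioc_of_le hca]
    exact ((hI2 a₂).sub ((hbulk a₂).const_mul _)).mono_set (Ioc_subset_Ioc_left hc)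
  refine ⟨hint a₁ ha₁ ha, ?_⟩
  rcases ha₁.eq_or_lt with rfl | ha₁
  · rcases ha.eq_or_lt with rfl | ha
    · simp
    -- For a₁ on the axis both sides are limits of the identity at interior points; the value of V
    -- tends to 0.
    have hcont := intervalIntegral.continuousOn_primitive_interval_left (μ := volume)
      (((intervalIntegrable_iff_integrableOn_Icc_of_le ha.le).1 (hint _ le_rfl ha.le)).mono_set
        (by rw [uIcc_of_le ha.le]))
    have h1 := (hcont (-b) left_mem_uIcc).tendsto
    rw [uIcc_of_le ha.le] at h1
    have h2 := h1.mono_left (nhdsWithin_mono _ (Ioo_subset_Icc_self (a := -b) (b := a₂)))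
    rw [nhdsWithin_Ioo_eq_nhdsGT ha] at h2
    have h3 := (tendsto_const_nhds (x := wavePotential p w (charMap 1 (a₂, b)))).sub hT
    refine (tendsto_nhds_unique (h3.congr' ?_) h2).symm ▸ ?_
    · filter_upwards [Ioo_mem_nhdsGT ha] with c hc
      exact (h.wavePotential_sub hp (by linarith [hc.1]) hc.2.le).2
    · rw [wavePotential_axis hp w (z := charMap 1 (-b, b)) (by simp [charMap])]
  · exact (h.wavePotential_sub hp (by linarith) ha).2

/-- Starting on the axis, where V = 0, the equation for V and V ≥ 0 bound the bulk integral on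
almost every line b = const by that of |2 D N|. Integration over b concludes. -/
theorem integrableOn_waveBulk_char (h : IsWave p w) (hp : 3 ≤ p) (n : ℝ) :
    IntegrableOn (fun q => waveBulk p w (charMap 1 q)) {q : ℝ × ℝ | q.1 ∈ Icc (-n) n ∧ q.2 ∈ Ioc (-q.1) n} := by
  have hw := h.continuous
  have hc : 0 < 2 * (p - 1) / (p + 1) := div_pos (by linarith) (by linarith)
  have hm : Measurable fun q => waveBulk p w (charMap 1 q) :=
    (measurable_waveBulk hw).comp (continuous_charMap 1).measurable
  have hS : MeasurableSet {q : ℝ × ℝ | q.1 ∈ Icc (-n) n ∧ q.2 ∈ Ioc (-q.1) n} :=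
    (measurableSet_Icc.preimage measurable_fst).inter
      ((measurableSet_lt measurable_fst.neg measurable_snd).inter (measurableSet_le measurable_snd measurable_const))
  have hmem : ∀ b a, (a, b) ∈ {q : ℝ × ℝ | q.1 ∈ Icc (-n) n ∧ q.2 ∈ Ioc (-q.1) n} ↔
      b ∈ Iic n ∧ a ∈ Ioc (-b) n := by
    intro b a
    simp only [mem_ofPred_eq, mem_Icc, mem_Ioc, mem_Iic]
    constructor
    · rintro ⟨⟨h1, h2⟩, h3, h4⟩; exact ⟨h4, by linarith, h2⟩
    · rintro ⟨h1, h2, h3⟩; exact ⟨⟨by linarith, h3⟩, by linarith, h1⟩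
  have hint := (h.integrableOn_inDeriv_mul_nonlin hp n).const_mul 2
  have hfin := hint.2
  have hm1 : Measurable fun q => 2 * (inDeriv w (charMap 1 q) * nonlin p w (charMap 1 q)) :=
    (((measurable_inDeriv hw).comp (continuous_charMap 1).measurable).mul
      ((measurable_nonlin hw).comp (continuous_charMap 1).measurable)).const_mul 2
  rw [hasFiniteIntegral_iff_enorm, ← lintegral_indicator hS, Measure.volume_eq_prod,
    lintegral_prod_symm _ (hm1.enorm.indicator hS).aemeasurable] at hfin
  refine ⟨hm.aestronglyMeasurable, ?_⟩
  rw [hasFiniteIntegral_iff_enorm, ← lintegral_indicator hS, Measure.volume_eq_prod,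
    lintegral_prod_symm _ (hm.enorm.indicator hS).aemeasurable]
  have key : ∀ᵐ b, ENNReal.ofReal (2 * (p - 1) / (p + 1)) *
      ∫⁻ a, {q : ℝ × ℝ | q.1 ∈ Icc (-n) n ∧ q.2 ∈ Ioc (-q.1) n}.indicator (fun q => ‖waveBulk p w (charMap 1 q)‖ₑ) (a, b)
      ≤ ∫⁻ a, {q : ℝ × ℝ | q.1 ∈ Icc (-n) n ∧ q.2 ∈ Ioc (-q.1) n}.indicator
        (fun q => ‖2 * (inDeriv w (charMap 1 q) * nonlin p w (charMap 1 q))‖ₑ) (a, b) := by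
    filter_upwards [h.integrableOn_transverse hp, h.wavePotential_primitive hp] with b hI hP
    have e : ∀ F : ℝ × ℝ → ENNReal, ∫⁻ a, {q : ℝ × ℝ | q.1 ∈ Icc (-n) n ∧ q.2 ∈ Ioc (-q.1) n}.indicator F (a, b)
        = if b ∈ Iic n then ∫⁻ a in Ioc (-b) n, F (a, b) else 0 := by
      intro F
      split_ifs with hb
      · rw [← lintegral_indicator measurableSet_Ioc]
        refine lintegral_congr fun a => ?_
        simp only [indicator, hmem, hb, true_and]
      · exact (lintegral_congr fun a => indicator_of_notMem (fun hq => hb ((hmem b a).1 hq).1) _).trans (by simp)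
    rw [e, e]
    split_ifs with hb
    · rcases lt_or_ge n (-b) with hn | hn
      · simp [Ioc_eq_empty (not_lt.2 hn.le)]
      obtain ⟨hi, he⟩ := hP.2 (-b) n le_rfl hn
      have hI2 : IntegrableOn (fun a => 2 * (inDeriv w (charMap 1 (a, b)) * nonlin p w (charMap 1 (a, b)))) (Ioc (-b) n) :=
        (hI n).const_mul 2
      have e1 : ∫⁻ a in Ioc (-b) n, ‖waveBulk p w (charMap 1 (a, b))‖ₑ
          = ENNReal.ofReal (∫ a in Ioc (-b) n, waveBulk p w (charMap 1 (a, b))) := by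
        rw [ofReal_integral_eq_lintegral_ofReal (hP.1 n)]
        · refine setLIntegral_congr_fun measurableSet_Ioc fun a ha => ?_
          exact Real.enorm_of_nonneg (waveBulk_nonneg (by simp only [charMap]; linarith [ha.1]))
        · refine (ae_restrict_iff' measurableSet_Ioc).2 (ae_of_all _ fun a ha => ?_)
          exact waveBulk_nonneg (by simp only [charMap]; linarith [ha.1])
      have e2 : ∫⁻ a in Ioc (-b) n, ‖2 * (inDeriv w (charMap 1 (a, b)) * nonlin p w (charMap 1 (a, b)))‖ₑ
          = ENNReal.ofReal (∫ a in Ioc (-b) n, ‖2 * (inDeriv w (charMap 1 (a, b)) * nonlin p w (charMap 1 (a, b)))‖) := by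
        rw [ofReal_integral_norm_eq_lintegral_enorm hI2]
      rw [e1, e2, ← ENNReal.ofReal_mul hc.le]
      refine ENNReal.ofReal_le_ofReal ?_
      rw [wavePotential_axis hp w (z := charMap 1 (-b, b)) (by simp [charMap]), sub_zero,
        intervalIntegral.integral_of_le hn] at he
      have hI2' : IntegrableOn (fun a => 2 * inDeriv w (charMap 1 (a, b)) * nonlin p w (charMap 1 (a, b))) (Ioc (-b) n) := by
        simp only [← mul_assoc] at hI2
        exact hI2
      rw [integral_sub hI2' ((hP.1 n).const_mul _), integral_const_mul] at he
      have hpos : 0 ≤ wavePotential p w (charMap 1 (n, b)) := wavePotential_nonneg hp (by simp only [charMap]; linarith)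
      have hle := norm_integral_le_integral_norm (μ := volume.restrict (Ioc (-b) n))
        (fun a => 2 * inDeriv w (charMap 1 (a, b)) * nonlin p w (charMap 1 (a, b)))
      have := Real.le_norm_self (∫ a in Ioc (-b) n, 2 * inDeriv w (charMap 1 (a, b)) * nonlin p w (charMap 1 (a, b)))
      simp only [mul_assoc (2 : ℝ) (inDeriv _ _)] at *
      linarith
    · simp
  have h1 := (lintegral_mono_ae key).trans_lt hfin
  rw [lintegral_const_mul' _ _ ENNReal.ofReal_ne_top] at h1
  by_contra hcon
  rw [not_lt, top_le_iff] at hcon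
  rw [hcon, ENNReal.mul_top (by simpa using hc)] at h1
  exact lt_irrefl _ h1

end IsWave

/-! ### Local structure of polygonal regions -/

/-- A function that is constant on both sides near each point with the same value, and vanishes
near `-∞`, vanishes near each point. -/
theorem eventually_eq_zero_of_punctured {G : ℝ → ℝ} (h : ∀ y, ∃ c, ∀ᶠ y' in 𝓝[≠] y, G y' = c)
    (h0 : ∀ᶠ y in atBot, G y = 0) (y : ℝ) : ∀ᶠ y' in 𝓝[≠] y, G y' = 0 := by
  choose c hc using h
  -- Near y, outside y itself, G equals c(y) on an open set; so the values c agree at neighbouring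
  -- points, and connectedness of the line makes c constant.
  have hloc : IsLocallyConstant c := by
    rw [IsLocallyConstant.iff_eventually_eq]
    intro y
    obtain ⟨U, hUG, hU, hyU⟩ := eventually_nhds_iff.1 (eventually_nhdsWithin_iff.1 (hc y))
    filter_upwards [hU.mem_nhds hyU] with x hx
    by_cases hxy : x = y
    · rw [hxy]
    have h1 : ∀ᶠ x' in 𝓝[≠] x, G x' = c y := by
      refine eventually_nhdsWithin_of_eventually_nhds ?_
      filter_upwards [hU.mem_nhds hx, isOpen_ne.mem_nhds hxy] with x' h1 h2 using hUG x' h1 h2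
    obtain ⟨x', h2, h3⟩ := ((hc x).and h1).exists
    exact h2.symm.trans h3
  obtain ⟨m, hm⟩ := eventually_atBot.1 h0
  have hcm : c (m - 1) = 0 := by
    have h1 : ∀ᶠ x' in 𝓝[≠] (m - 1), G x' = 0 := by
      refine eventually_nhdsWithin_of_eventually_nhds ?_
      filter_upwards [Iio_mem_nhds (sub_one_lt m)] with x hx using hm x hx.le
    obtain ⟨x', h2, h3⟩ := ((hc (m - 1)).and h1).exists
    exact h2.symm.trans h3
  have := hloc.apply_eq_of_isPreconnected isPreconnected_univ (mem_univ y) (mem_univ (m - 1))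
  filter_upwards [hc y] with x hx
  rw [hx, this, hcm]

/-- The left normal of the segment `e` as a linear functional. -/
def leftNormal (e : (ℝ × ℝ) × (ℝ × ℝ)) (z : ℝ × ℝ) : ℝ :=
  -(e.2.2 - e.1.2) * z.1 + (e.2.1 - e.1.1) * z.2

theorem leftNormal_lineMap (e : (ℝ × ℝ) × (ℝ × ℝ)) (s : ℝ) :
    leftNormal e (AffineMap.lineMap e.1 e.2 s) = leftNormal e e.1 := by
  simp only [leftNormal, AffineMap.lineMap_apply, vsub_eq_sub, vadd_eq_add, Prod.fst_add, Prod.snd_add,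
    Prod.smul_fst, Prod.smul_snd, Prod.fst_sub, Prod.snd_sub, smul_eq_mul]
  ring

theorem leftNormal_of_mem_segment {e : (ℝ × ℝ) × (ℝ × ℝ)} {z : ℝ × ℝ} (hz : z ∈ segment ℝ e.1 e.2) :
    leftNormal e z = leftNormal e e.1 := by
  rw [segment_eq_image_lineMap] at hz
  obtain ⟨s, -, rfl⟩ := hz
  exact leftNormal_lineMap e s

theorem convex_leftNormal_lt (e : (ℝ × ℝ) × (ℝ × ℝ)) (c : ℝ) : Convex ℝ {z | c < leftNormal e z} := by
  refine convex_halfSpace_gt ⟨fun x y => ?_, fun c x => ?_⟩ c <;> simp [leftNormal] <;> ring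

theorem convex_leftNormal_gt (e : (ℝ × ℝ) × (ℝ × ℝ)) (c : ℝ) : Convex ℝ {z | leftNormal e z < c} := by
  refine convex_halfSpace_lt ⟨fun x y => ?_, fun c x => ?_⟩ c <;> simp [leftNormal] <;> ring

/-- A connected set that misses the frontier lies either in the interior of s or in the interior of
its complement. -/
theorem subset_of_disjoint_frontier {X : Type*} [TopologicalSpace X] {s t : Set X} (ht : IsPreconnected t)
    (hd : Disjoint t (frontier s)) {x : X} (hxt : x ∈ t) (hxs : x ∈ s) : t ⊆ s := by
  have hu : ∀ y ∈ t, y ∈ interior s ∨ y ∈ interior sᶜ := by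
    intro y hy
    by_contra! hcon
    refine disjoint_left.1 hd hy ⟨?_, hcon.1⟩
    rw [interior_compl] at hcon
    exact not_not.1 hcon.2
  refine (ht.subset_left_of_subset_union isOpen_interior isOpen_interior
    (disjoint_compl_right.mono interior_subset interior_subset) hu ⟨x, hxt, ?_⟩).trans interior_subset
  exact (hu x hxt).resolve_right fun h => interior_subset h hxs

namespace IsPolygonalRegion

variable {Ω : Set (ℝ × ℝ)} {Γ : Finset ((ℝ × ℝ) × (ℝ × ℝ))}

theorem segment_subset (h : IsPolygonalRegion Ω Γ) {e : (ℝ × ℝ) × (ℝ × ℝ)} (he : e ∈ Γ) :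
    segment ℝ e.1 e.2 ⊆ Ω := by
  refine Subset.trans ?_ h.isCompact.isClosed.frontier_subset
  rw [h.frontier_eq]
  exact fun z hz => mem_biUnion he hz

/-- Near an inner point of an edge that lies on no other edge, the region is the left half plane. -/
theorem eventually_mem (h : IsPolygonalRegion Ω Γ) {e : (ℝ × ℝ) × (ℝ × ℝ)} (he : e ∈ Γ) {z₀ : ℝ × ℝ}
    (hz₀ : z₀ ∈ openSegment ℝ e.1 e.2) (ho : ∀ e' ∈ Γ, e' ≠ e → z₀ ∉ segment ℝ e'.1 e'.2) :
    ∀ᶠ z in 𝓝 z₀, (leftNormal e z₀ < leftNormal e z → z ∈ Ω) ∧ (leftNormal e z < leftNormal e z₀ → z ∉ Ω) := by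
  have h1 : ∀ᶠ z in 𝓝 z₀, ∀ e' ∈ Γ, e' ≠ e → z ∉ segment ℝ e'.1 e'.2 := by
    rw [Finset.eventually_all]
    intro e' he'
    by_cases hee : e' = e
    · exact Eventually.of_forall fun z hne => absurd hee hne
    have hcl : IsClosed (segment ℝ e'.1 e'.2) := by
      rw [segment_eq_image_lineMap]
      exact (isCompact_Icc.image AffineMap.lineMap_continuous).isClosed
    filter_upwards [hcl.isOpen_compl.mem_nhds (ho e' he' hee)] with z hz _ using hz
  obtain ⟨δ, hδ, hball⟩ := Metric.eventually_nhds_iff_ball.1 h1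
  have hsegz : leftNormal e z₀ = leftNormal e e.1 := leftNormal_of_mem_segment (openSegment_subset_segment _ _ _ hz₀)
  have hfr : ∀ z ∈ Metric.ball z₀ δ, leftNormal e z ≠ leftNormal e z₀ → z ∉ frontier Ω := by
    intro z hz hne hzf
    rw [h.frontier_eq, mem_iUnion₂] at hzf
    obtain ⟨e', he', hz'⟩ := hzf
    by_cases hee : e' = e
    · subst hee
      exact hne ((leftNormal_of_mem_segment hz').trans hsegz.symm)
    · exact hball z hz e' he' hee hz'
  set n : ℝ × ℝ := (-(e.2.2 - e.1.2), e.2.1 - e.1.1) with hn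
  have hnpos : 0 < n.1 ^ 2 + n.2 ^ 2 := by
    by_contra hcon
    have h1 : n.1 = 0 := by nlinarith [sq_nonneg n.1, sq_nonneg n.2]
    have h2 : n.2 = 0 := by nlinarith [sq_nonneg n.1, sq_nonneg n.2]
    simp only [hn] at h1 h2
    exact (h.admissible e he).1 (Prod.ext (by linarith) (by linarith))
  have hln : ∀ s : ℝ, leftNormal e (z₀ + s • n) = leftNormal e z₀ + s * (n.1 ^ 2 + n.2 ^ 2) := by
    intro s; simp only [leftNormal, hn, Prod.fst_add, Prod.snd_add, Prod.smul_fst, Prod.smul_snd, smul_eq_mul]; ring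
  have hlm : ∀ s : ℝ, leftNormal e (z₀ - s • n) = leftNormal e z₀ - s * (n.1 ^ 2 + n.2 ^ 2) := by
    intro s; simp only [leftNormal, hn, Prod.fst_sub, Prod.snd_sub, Prod.smul_fst, Prod.smul_snd, smul_eq_mul]; ring
  have hin : ∀ᶠ s : ℝ in 𝓝[>] 0, z₀ + s • n ∈ Metric.ball z₀ δ ∧ z₀ - s • n ∈ Metric.ball z₀ δ := by
    refine eventually_nhdsWithin_of_eventually_nhds (Eventually.and ?_ ?_)
    · have : Tendsto (fun s : ℝ => z₀ + s • n) (𝓝 0) (𝓝 z₀) := by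
        have : Continuous fun s : ℝ => z₀ + s • n := by fun_prop
        simpa using this.tendsto 0
      exact this.eventually (Metric.ball_mem_nhds z₀ hδ)
    · have : Tendsto (fun s : ℝ => z₀ - s • n) (𝓝 0) (𝓝 z₀) := by
        have : Continuous fun s : ℝ => z₀ - s • n := by fun_prop
        simpa using this.tendsto 0
      exact this.eventually (Metric.ball_mem_nhds z₀ hδ)
  -- The orientation condition provides one point of Ω on the left and one point outside Ω on the
  -- right. Each open half ball is convex and avoids the frontier, so one point decides for the
  -- whole half ball.
  obtain ⟨s, ⟨hs1, hs2⟩, ⟨hs3, hs4⟩, hs⟩ := ((h.left e he z₀ hz₀).and (hin.and self_mem_nhdsWithin)).exists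
  have hs : 0 < s := hs
  filter_upwards [Metric.ball_mem_nhds z₀ hδ] with z hz
  constructor
  · intro hlt
    refine subset_of_disjoint_frontier (t := Metric.ball z₀ δ ∩ {z | leftNormal e z₀ < leftNormal e z})
      ((convex_ball _ _).inter (convex_leftNormal_lt e _)).isPreconnected ?_ ⟨hs3, ?_⟩ hs1 ⟨hz, hlt⟩
    · exact disjoint_left.2 fun z hz hz' => hfr z hz.1 (ne_of_gt hz.2) hz'
    · rw [mem_ofPred_eq, hln]; exact lt_add_of_pos_right _ (mul_pos hs hnpos)
  · intro hlt
    refine subset_of_disjoint_frontier (s := Ωᶜ) (t := Metric.ball z₀ δ ∩ {z | leftNormal e z < leftNormal e z₀})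
      ((convex_ball _ _).inter (convex_leftNormal_gt e _)).isPreconnected ?_ ⟨hs4, ?_⟩ hs2 ⟨hz, hlt⟩
    · rw [frontier_compl]
      exact disjoint_left.2 fun z hz hz' => hfr z hz.1 (ne_of_lt hz.2) hz'
    · rw [mem_ofPred_eq, hlm]; exact sub_lt_self _ (mul_pos hs hnpos)

end IsPolygonalRegion

/-! ### Slicing by characteristics and Green's formula -/

/-- The point of the line through the edge `e` with first characteristic coordinate `x`. -/
noncomputable def edgePoint (σ : ℝ) (e : (ℝ × ℝ) × (ℝ × ℝ)) (x : ℝ) : ℝ × ℝ :=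
  AffineMap.lineMap e.1 e.2
    ((x - (charInv σ e.1).1) / ((charInv σ e.2).1 - (charInv σ e.1).1))

/-- The edge `e` crosses the characteristic with first coordinate `x`. -/
def Crosses (σ : ℝ) (e : (ℝ × ℝ) × (ℝ × ℝ)) (x : ℝ) : Prop :=
  x ∈ Ioo (min (charInv σ e.1).1 (charInv σ e.2).1) (max (charInv σ e.1).1 (charInv σ e.2).1)

/-- `+1` if the region is entered through `e` when the second characteristic coordinate grows,
`-1` if it is left. -/
noncomputable def crossSign (σ : ℝ) (e : (ℝ × ℝ) × (ℝ × ℝ)) : ℝ :=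
  if (charInv σ e.1).1 < (charInv σ e.2).1 then -σ else σ

theorem charInv_lineMap (σ : ℝ) (a b : ℝ × ℝ) (s : ℝ) :
    charInv σ (AffineMap.lineMap a b s) = AffineMap.lineMap (charInv σ a) (charInv σ b) s := by
  ext <;> simp [charInv, AffineMap.lineMap_apply] <;> ring

theorem Crosses.exists_param {σ : ℝ} {e : (ℝ × ℝ) × (ℝ × ℝ)} {x : ℝ} (h : Crosses σ e x) :
    (x - (charInv σ e.1).1) / ((charInv σ e.2).1 - (charInv σ e.1).1) ∈ Ioo (0 : ℝ) 1 := by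
  unfold Crosses at h
  rcases lt_trichotomy (charInv σ e.1).1 (charInv σ e.2).1 with hl | hl | hl
  · rw [min_eq_left hl.le, max_eq_right hl.le] at h
    exact ⟨div_pos (by linarith [h.1]) (by linarith), (div_lt_one (by linarith)).2 (by linarith [h.2])⟩
  · rw [hl] at h; simp at h
  · rw [min_eq_right hl.le, max_eq_left hl.le] at h
    exact ⟨div_pos_of_neg_of_neg (by linarith [h.2]) (by linarith), (div_lt_one_of_neg (by linarith)).2 (by linarith [h.1])⟩

theorem Crosses.ne {σ : ℝ} {e : (ℝ × ℝ) × (ℝ × ℝ)} {x : ℝ} (h : Crosses σ e x) :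
    (charInv σ e.1).1 ≠ (charInv σ e.2).1 := by
  intro hl
  unfold Crosses at h
  rw [hl] at h; simp at h

theorem Crosses.edgePoint_mem {σ : ℝ} {e : (ℝ × ℝ) × (ℝ × ℝ)} {x : ℝ} (h : Crosses σ e x) :
    edgePoint σ e x ∈ openSegment ℝ e.1 e.2 := by
  rw [openSegment_eq_image_lineMap]
  exact ⟨_, h.exists_param, rfl⟩

theorem Crosses.charInv_edgePoint {σ : ℝ} {e : (ℝ × ℝ) × (ℝ × ℝ)} {x : ℝ} (h : Crosses σ e x) :
    (charInv σ (edgePoint σ e x)).1 = x := by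
  rw [edgePoint, charInv_lineMap]
  have := sub_ne_zero.2 h.ne.symm
  simp only [AffineMap.lineMap_apply, vsub_eq_sub, vadd_eq_add, Prod.fst_add, Prod.smul_fst, Prod.fst_sub, smul_eq_mul]
  field_simp
  ring

theorem Crosses.charMap_edgePoint {σ : ℝ} (hσ : σ ^ 2 = 1) {e : (ℝ × ℝ) × (ℝ × ℝ)} {x : ℝ} (h : Crosses σ e x) :
    charMap σ (x, (charInv σ (edgePoint σ e x)).2) = edgePoint σ e x := by
  conv_rhs => rw [← charMap_charInv hσ (edgePoint σ e x)]
  congr 1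
  exact Prod.ext h.charInv_edgePoint.symm rfl

theorem crosses_of_mem_segment {σ : ℝ} {e : (ℝ × ℝ) × (ℝ × ℝ)} {x : ℝ} {z : ℝ × ℝ}
    (hz : z ∈ segment ℝ e.1 e.2) (hx : (charInv σ z).1 = x) (h1 : x ≠ (charInv σ e.1).1)
    (h2 : x ≠ (charInv σ e.2).1) : Crosses σ e x ∧ z = edgePoint σ e x := by
  rw [segment_eq_image_lineMap] at hz
  obtain ⟨s, hs, rfl⟩ := hz
  rw [charInv_lineMap] at hx
  simp only [AffineMap.lineMap_apply, vsub_eq_sub, vadd_eq_add, Prod.fst_add, Prod.smul_fst, Prod.fst_sub, smul_eq_mul] at hx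
  set a := (charInv σ e.1).1
  set b := (charInv σ e.2).1
  have hab : b - a ≠ 0 := by
    intro hab; rw [hab] at hx; exact h1 (by linarith)
  have hs0 : s ≠ 0 := by rintro rfl; exact h1 (by linarith)
  have hs1 : s ≠ 1 := by rintro rfl; exact h2 (by linarith)
  have hs0' : 0 < s := lt_of_le_of_ne hs.1 hs0.symm
  have hs1' : s < 1 := lt_of_le_of_ne hs.2 hs1
  constructor
  · unfold Crosses
    change x ∈ Ioo (min a b) (max a b)
    rcases lt_or_gt_of_ne (sub_ne_zero.1 hab) with hl | hl
    · rw [min_eq_right hl.le, max_eq_left hl.le]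
      constructor <;> nlinarith
    · rw [min_eq_left hl.le, max_eq_right hl.le]
      constructor <;> nlinarith
  · have : s = (x - a) / (b - a) := by
      rw [eq_div_iff hab]; linarith
    rw [edgePoint, this]

/-- This decides on which side of an edge the characteristic runs above a crossing, and is the
source of the sign in `crossSign`. -/
theorem leftNormal_charMap {σ : ℝ} (hσ : σ ^ 2 = 1) (e : (ℝ × ℝ) × (ℝ × ℝ)) (x y y' : ℝ) :
    leftNormal e (charMap σ (x, y')) - leftNormal e (charMap σ (x, y))
      = -σ * (2 * ((charInv σ e.2).1 - (charInv σ e.1).1)) * (y' - y) := by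
  simp only [leftNormal, charMap, charInv]
  linear_combination (e.2.2 - e.1.2) * (y' - y) * hσ

theorem eventually_lt_iff_of_ne {c y : ℝ} (h : c ≠ y) : ∀ᶠ y' in 𝓝 y, (c < y' ↔ c < y) := by
  rcases lt_or_gt_of_ne h with h | h
  · filter_upwards [Ioi_mem_nhds h] with y' hy' using ⟨fun _ => h, fun _ => hy'⟩
  · filter_upwards [Iio_mem_nhds h] with y' hy'
    exact ⟨fun h1 => absurd (lt_trans h1 hy') (lt_irrefl _), fun h1 => absurd (h1.trans h) (lt_irrefl _)⟩

namespace IsPolygonalRegion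

variable {Ω : Set (ℝ × ℝ)} {Γ : Finset ((ℝ × ℝ) × (ℝ × ℝ))}

-- Let G be the indicator minus the sum of signed steps. Off the crossings G is locally constant. At
-- a crossing both terms jump by the same amount, because Ω lies on the left of the edge. Below the
-- bounded set Ω it vanishes. Hence G = 0 away from the crossings, and neither an ordering of the
-- edges nor a global description of the boundary is needed.
open Classical in
theorem indicator_slice (h : IsPolygonalRegion Ω Γ) {σ : ℝ} (hσ : σ ^ 2 = 1) {x : ℝ}
    (hx : ∀ e ∈ Γ, x ≠ (charInv σ e.1).1 ∧ x ≠ (charInv σ e.2).1) {y : ℝ}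
    (hy : ∀ e ∈ Γ, Crosses σ e x → (charInv σ (edgePoint σ e x)).2 ≠ y) :
    Ω.indicator (fun _ => (1 : ℝ)) (charMap σ (x, y))
      = ∑ e ∈ Γ with Crosses σ e x, if (charInv σ (edgePoint σ e x)).2 < y then crossSign σ e else 0 := by
  set hgt : (ℝ × ℝ) × (ℝ × ℝ) → ℝ := fun e => (charInv σ (edgePoint σ e x)).2 with hhgt
  set A := Γ.filter fun e => Crosses σ e x with hA
  have hmemA : ∀ e, e ∈ A ↔ e ∈ Γ ∧ Crosses σ e x := fun e => Finset.mem_filter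
  have hcm : Continuous fun y => charMap σ (x, y) := (continuous_charMap σ).comp (by fun_prop)
  have hzx : ∀ y, (charInv σ (charMap σ (x, y))).1 = x := fun y => by rw [charInv_charMap hσ]
  have hfront : ∀ y, charMap σ (x, y) ∈ frontier Ω → ∃ e ∈ A, hgt e = y ∧ charMap σ (x, y) ∈ openSegment ℝ e.1 e.2 := by
    intro y hf
    rw [h.frontier_eq, mem_iUnion₂] at hf
    obtain ⟨e, he, hze⟩ := hf
    obtain ⟨hc, hp⟩ := crosses_of_mem_segment hze (hzx y) (hx e he).1 (hx e he).2
    refine ⟨e, (hmemA e).2 ⟨he, hc⟩, ?_, ?_⟩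
    · rw [hhgt]; simp only; rw [← hp, charInv_charMap hσ]
    · rw [hp]; exact hc.edgePoint_mem
  have hon : ∀ e ∈ A, ∀ y, hgt e = y → charMap σ (x, y) ∈ openSegment ℝ e.1 e.2 := by
    rintro e he y rfl
    rw [hhgt]; simp only
    rw [((hmemA e).1 he).2.charMap_edgePoint hσ]
    exact ((hmemA e).1 he).2.edgePoint_mem
  have hind : ∀ y, charMap σ (x, y) ∉ frontier Ω → ∀ᶠ y' in 𝓝 y,
      Ω.indicator (fun _ => (1 : ℝ)) (charMap σ (x, y')) = Ω.indicator (fun _ => (1 : ℝ)) (charMap σ (x, y)) := by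
    intro y hy
    by_cases hm : charMap σ (x, y) ∈ Ω
    · have : charMap σ (x, y) ∈ interior Ω := by
        by_contra hcon; exact hy ⟨subset_closure hm, hcon⟩
      filter_upwards [hcm.continuousAt.preimage_mem_nhds (mem_interior_iff_mem_nhds.1 this)] with y' hy'
      rw [indicator_of_mem hm, indicator_of_mem (show charMap σ (x, y') ∈ Ω from hy')]
    · filter_upwards [hcm.continuousAt.preimage_mem_nhds (h.isCompact.isClosed.isOpen_compl.mem_nhds hm)] with y' hy'
      rw [indicator_of_notMem hm, indicator_of_notMem (show charMap σ (x, y') ∉ Ω from hy')]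
  set G : ℝ → ℝ := fun y => Ω.indicator (fun _ => (1 : ℝ)) (charMap σ (x, y))
    - ∑ e ∈ A, if hgt e < y then crossSign σ e else 0 with hG
  have hconst : ∀ y, (∀ e ∈ A, hgt e ≠ y) → ∀ᶠ y' in 𝓝 y, G y' = G y := by
    intro y hy
    have h1 : ∀ᶠ y' in 𝓝 y, ∀ e ∈ A, (hgt e < y' ↔ hgt e < y) := by
      rw [Finset.eventually_all]
      exact fun e he => eventually_lt_iff_of_ne (hy e he)
    filter_upwards [h1, hind y fun hf => by obtain ⟨e, he, h1, -⟩ := hfront y hf; exact hy e he h1] with y' h2 h3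
    simp only [hG, h3]
    congr 1
    exact Finset.sum_congr rfl fun e he => if_congr (h2 e he) rfl rfl
  have hpunct : ∀ y, ∃ c, ∀ᶠ y' in 𝓝[≠] y, G y' = c := by
    intro y
    by_cases hy : ∀ e ∈ A, hgt e ≠ y
    · exact ⟨_, eventually_nhdsWithin_of_eventually_nhds (hconst y hy)⟩
    push Not at hy
    obtain ⟨e, he, hey⟩ := hy
    have heΓ := ((hmemA e).1 he).1
    have huniq : ∀ e' ∈ A, e' ≠ e → hgt e' ≠ y := fun e' he' hne hy' =>
      disjoint_left.1 (h.disjoint e' ((hmemA e').1 he').1 e heΓ hne) (hon e' he' y hy') (hon e he y hey)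
    have hev := hcm.continuousAt.eventually (h.eventually_mem heΓ (hon e he y hey) (by
      intro e' he' hne hz
      obtain ⟨hc, hp⟩ := crosses_of_mem_segment hz (hzx y) (hx e' he').1 (hx e' he').2
      refine huniq e' ((hmemA e').2 ⟨he', hc⟩) hne ?_
      rw [hhgt]; simp only; rw [← hp, charInv_charMap hσ]))
    have h1 : ∀ᶠ y' in 𝓝 y, ∀ e' ∈ A.erase e, (hgt e' < y' ↔ hgt e' < y) := by
      rw [Finset.eventually_all]
      exact fun e' he' => eventually_lt_iff_of_ne (huniq e' (Finset.mem_of_mem_erase he') (Finset.ne_of_mem_erase he'))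
    have hne := ((hmemA e).1 he).2.ne
    have hσ' : σ = 1 ∨ σ = -1 := sq_eq_one_iff.1 hσ
    -- This is the value of G on both sides of the crossing. Below it the indicator is 1 exactly
    -- when the region is left through e; above it the step of e compensates the change.
    refine ⟨(if crossSign σ e < 0 then 1 else 0) - ∑ e' ∈ A.erase e, if hgt e' < y then crossSign σ e' else 0, ?_⟩
    filter_upwards [eventually_nhdsWithin_of_eventually_nhds h1, eventually_nhdsWithin_of_eventually_nhds hev,
      self_mem_nhdsWithin] with y' h2 h3 h4
    have h4 : y' ≠ y := h4
    simp only [hG]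
    rw [← Finset.add_sum_erase A _ he, ← sub_sub,
      Finset.sum_congr rfl (fun e' he' => if_congr (h2 e' he') rfl rfl : ∀ e' ∈ A.erase e,
        (if hgt e' < y' then crossSign σ e' else 0) = if hgt e' < y then crossSign σ e' else 0)]
    congr 1
    have hl := leftNormal_charMap hσ e x y y'
    rw [hey]
    set d := (charInv σ e.2).1 - (charInv σ e.1).1 with hd
    have hpos : 0 < -σ * (2 * d) * (y' - y) → Ω.indicator (fun _ => (1 : ℝ)) (charMap σ (x, y')) = 1 := fun hp =>
      indicator_of_mem (h3.1 (by linarith)) _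
    have hneg : -σ * (2 * d) * (y' - y) < 0 → Ω.indicator (fun _ => (1 : ℝ)) (charMap σ (x, y')) = 0 := fun hp =>
      indicator_of_notMem (h3.2 (by linarith)) _
    unfold crossSign
    rcases lt_or_gt_of_ne hne with hlt | hlt <;> rcases lt_or_gt_of_ne h4 with hyy | hyy <;>
      rcases hσ' with rfl | rfl
    · rw [hpos (by nlinarith)]; norm_num [hlt, hyy.not_gt]
    · rw [hneg (by nlinarith)]; norm_num [hlt, hyy.not_gt]
    · rw [hneg (by nlinarith)]; norm_num [hlt, hyy]
    · rw [hpos (by nlinarith)]; norm_num [hlt, hyy]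
    · rw [hneg (by nlinarith)]; norm_num [hlt.not_gt, hyy.not_gt]
    · rw [hpos (by nlinarith)]; norm_num [hlt.not_gt, hyy.not_gt]
    · rw [hpos (by nlinarith)]; norm_num [hlt.not_gt, hyy]
    · rw [hneg (by nlinarith)]; norm_num [hlt.not_gt, hyy]
  have hbot : ∀ᶠ y in atBot, G y = 0 := by
    have h1 : ∀ᶠ y in atBot, ∀ e ∈ A, y < hgt e := by
      rw [Finset.eventually_all]
      exact fun e _ => eventually_lt_atBot _
    obtain ⟨R, hR⟩ := h.isCompact.isBounded.subset_closedBall 0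
    filter_upwards [h1, eventually_lt_atBot (-R - x)] with y hy1 hy2
    simp only [hG]
    rw [indicator_of_notMem, Finset.sum_eq_zero, sub_zero]
    · exact fun e he => if_neg (not_lt.2 (hy1 e he).le)
    · intro hm
      have h2 := (norm_fst_le _).trans (mem_closedBall_zero_iff.1 (hR hm))
      simp only [charMap, Real.norm_eq_abs] at h2
      linarith [neg_abs_le (x + y)]
  have h1 := (eventually_eq_zero_of_punctured hpunct hbot y).and (eventually_nhdsWithin_of_eventually_nhds
    (hconst y fun e he => hy e ((hmemA e).1 he).1 ((hmemA e).1 he).2))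
  obtain ⟨y', h2, h3⟩ := h1.exists
  exact sub_eq_zero.1 (h3.symm.trans h2)

end IsPolygonalRegion

/-- The substitution from the parameter s to the coordinate x has the signed factor b - a, and
-`crossSign` is σ times its sign. Integrating over the unoriented interval of x therefore recovers
the oriented line integral. -/
theorem crossSign_integral {σ : ℝ} {e : (ℝ × ℝ) × (ℝ × ℝ)} (hne : (charInv σ e.1).1 ≠ (charInv σ e.2).1)
    {Q : ℝ × ℝ → ℝ} (hQ : IntervalIntegrable (fun s => Q (AffineMap.lineMap e.1 e.2 s)) volume 0 1) :
    IntegrableOn (fun x => -crossSign σ e * Q (edgePoint σ e x)) {x | Crosses σ e x} ∧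
    ∫ x in {x | Crosses σ e x}, -crossSign σ e * Q (edgePoint σ e x)
      = σ * (((charInv σ e.2).1 - (charInv σ e.1).1) * ∫ s in (0 : ℝ)..1, Q (AffineMap.lineMap e.1 e.2 s)) := by
  set a := (charInv σ e.1).1 with ha
  set b := (charInv σ e.2).1 with hb
  have hba : b - a ≠ 0 := sub_ne_zero.2 hne.symm
  have hQ' : IntervalIntegrable (fun x => Q (edgePoint σ e x)) volume a b := by
    have h1 := (hQ.comp_mul_left (c := (b - a)⁻¹)).comp_sub_right a
    rw [zero_div, zero_add, one_div, inv_inv, sub_add_cancel] at h1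
    refine h1.congr fun x _ => ?_
    simp only [edgePoint]
    rw [← ha, ← hb, div_eq_inv_mul]
  have hI : ∫ x in a..b, Q (edgePoint σ e x) = (b - a) * ∫ s in (0 : ℝ)..1, Q (AffineMap.lineMap e.1 e.2 s) := by
    have h1 := intervalIntegral.mul_integral_comp_add_mul (f := fun x => Q (edgePoint σ e x)) (a := 0) (b := 1) (b - a) a
    rw [mul_zero, mul_one, add_zero, add_sub_cancel] at h1
    rw [← h1]
    congr 1
    refine intervalIntegral.integral_congr fun s _ => ?_
    simp only [edgePoint]
    rw [← ha, ← hb, add_sub_cancel_left, mul_div_cancel_left₀ _ hba]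
  rw [← hI]
  have hset : {x | Crosses σ e x} = Ioo (min a b) (max a b) := rfl
  rw [hset]
  refine ⟨?_, ?_⟩
  · refine Integrable.const_mul ?_ _
    exact (intervalIntegrable_iff.1 hQ').mono_set Ioo_subset_Ioc_self
  · rw [integral_const_mul, ← integral_Ioc_eq_integral_Ioo]
    unfold crossSign
    rw [← ha, ← hb]
    rcases lt_or_gt_of_ne hne with hl | hl
    · rw [if_pos hl, min_eq_left hl.le, max_eq_right hl.le, intervalIntegral.integral_of_le hl.le]; ring
    · rw [if_neg hl.not_gt, min_eq_right hl.le, max_eq_left hl.le, intervalIntegral.integral_of_ge hl.le]; ring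

open Classical in
/-- Green's formula along one family of characteristics. -/
theorem IsPolygonalRegion.integral_eq {Ω : Set (ℝ × ℝ)} {Γ : Finset ((ℝ × ℝ) × (ℝ × ℝ))}
    (h : IsPolygonalRegion Ω Γ) (hΩ : ∀ z ∈ Ω, 0 ≤ z.1) {σ : ℝ} (hσ : σ ^ 2 = 1) {Q k : ℝ × ℝ → ℝ}
    (hQk : ∀ᵐ x : ℝ, ∀ y₁ y₂, -x ≤ y₁ → y₁ ≤ y₂ →
      IntervalIntegrable (fun y => k (charMap σ (x, y))) volume y₁ y₂ ∧
      Q (charMap σ (x, y₂)) - Q (charMap σ (x, y₁)) = ∫ y in y₁..y₂, k (charMap σ (x, y)))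
    (hQ : ∀ e ∈ Γ, (charInv σ e.1).1 ≠ (charInv σ e.2).1 →
      IntervalIntegrable (fun s => Q (AffineMap.lineMap e.1 e.2 s)) volume 0 1)
    (hk : IntegrableOn k Ω) :
    ∫ z in Ω, k z = σ * ∑ e ∈ Γ, ((e.2.1 - e.1.1) + σ * (e.2.2 - e.1.2)) *
      ∫ s in (0 : ℝ)..1, Q (AffineMap.lineMap e.1 e.2 s) := by
  have hmΩ : MeasurableSet Ω := h.isCompact.measurableSet
  rw [← integral_indicator hmΩ, integral_charMap hσ, Measure.volume_eq_prod, integral_prod]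
  swap
  · rw [← integrable_indicator_iff hmΩ, ← integrable_charMap_iff hσ] at hk
    exact hk
  have hx : ∀ᵐ x : ℝ, ∀ e ∈ Γ, x ≠ (charInv σ e.1).1 ∧ x ≠ (charInv σ e.2).1 := by
    rw [Finset.eventually_all]
    intro e _
    exact (Measure.ae_ne volume _).and (Measure.ae_ne volume _)
  have hslice : ∀ᵐ x : ℝ, ∫ y, Ω.indicator k (charMap σ (x, y))
      = ∑ e ∈ Γ, {x | Crosses σ e x}.indicator (fun x => -crossSign σ e * Q (edgePoint σ e x)) x := by
    filter_upwards [hQk, hx] with x hk hx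
    set A := Γ.filter fun e => Crosses σ e x with hA
    set hgt : (ℝ × ℝ) × (ℝ × ℝ) → ℝ := fun e => (charInv σ (edgePoint σ e x)).2 with hhgt
    obtain ⟨R, hR⟩ := h.isCompact.isBounded.subset_closedBall 0
    have hub : ∀ y, charMap σ (x, y) ∈ Ω → -x ≤ y ∧ y ≤ R - x := by
      intro y hy
      have h1 := hΩ _ hy
      have h2 := (norm_fst_le _).trans (mem_closedBall_zero_iff.1 (hR hy))
      simp only [charMap, Real.norm_eq_abs] at h1 h2
      exact ⟨by linarith, by linarith [le_abs_self (x + y)]⟩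
    have hedge : ∀ e ∈ A, charMap σ (x, hgt e) = edgePoint σ e x ∧ -x ≤ hgt e ∧ hgt e ≤ R - x := by
      intro e he
      have hc := (Finset.mem_filter.1 he).2
      have h1 := hc.charMap_edgePoint hσ
      refine ⟨h1, hub _ ?_⟩
      rw [h1]
      exact h.segment_subset (Finset.mem_filter.1 he).1 (openSegment_subset_segment _ _ _ hc.edgePoint_mem)
    set B := max (R - x) (-x) + 1 with hB
    have hBR : R - x < B := (le_max_left _ _).trans_lt (lt_add_one _)
    have hint : ∀ e ∈ A, IntegrableOn (fun y => crossSign σ e * k (charMap σ (x, y))) (Ioc (hgt e) B) := fun e he =>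
      ((intervalIntegrable_iff_integrableOn_Ioc_of_le ((hedge e he).2.2.trans hBR.le)).1
        (hk (hgt e) B (hedge e he).2.1 ((hedge e he).2.2.trans hBR.le)).1).const_mul _
    -- At the height B above the region the indicator vanishes, so entries and exits balance. This
    -- removes the auxiliary value of Q at B from the sum below.
    have hsum0 : ∑ e ∈ A, crossSign σ e = 0 := by
      have h1 := h.indicator_slice hσ hx (y := B) (fun e he hc => ((hedge e (Finset.mem_filter.2 ⟨he, hc⟩)).2.2.trans_lt hBR).ne)
      rw [indicator_of_notMem fun hm => absurd (hub _ hm).2 (not_le.2 hBR)] at h1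
      rw [h1]
      exact Finset.sum_congr rfl fun e he => (if_pos ((hedge e he).2.2.trans_lt hBR)).symm
    have hy : ∀ᵐ y : ℝ, ∀ e ∈ A, hgt e ≠ y := by
      rw [Finset.eventually_all]
      intro e _
      filter_upwards [Measure.ae_ne volume (hgt e)] with y hy using hy.symm
    have hpt : ∀ᵐ y, Ω.indicator k (charMap σ (x, y))
        = ∑ e ∈ A, (Ioc (hgt e) B).indicator (fun y => crossSign σ e * k (charMap σ (x, y))) y := by
      filter_upwards [hy] with y hy
      have h1 := h.indicator_slice hσ hx (y := y) (fun e he hc => hy e (Finset.mem_filter.2 ⟨he, hc⟩))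
      have h2 : Ω.indicator k (charMap σ (x, y))
          = Ω.indicator (fun _ => (1 : ℝ)) (charMap σ (x, y)) * k (charMap σ (x, y)) := by
        by_cases hm : charMap σ (x, y) ∈ Ω <;> simp [hm]
      rcases le_or_gt y B with hyB | hyB
      · rw [h2, h1, Finset.sum_mul]
        refine Finset.sum_congr rfl fun e _ => ?_
        by_cases hlt : hgt e < y
        · rw [if_pos hlt, indicator_of_mem (mem_Ioc.2 ⟨hlt, hyB⟩)]
        · rw [if_neg hlt, indicator_of_notMem fun hm => hlt hm.1, zero_mul]
      · rw [indicator_of_notMem fun hm => absurd (hub _ hm).2 (not_le.2 (hBR.trans hyB))]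
        exact (Finset.sum_eq_zero fun e _ => indicator_of_notMem (fun hm => absurd hm.2 (not_le.2 hyB)) _).symm
    rw [integral_congr_ae hpt, integral_finsetSum _ fun e he => (integrable_indicator_iff measurableSet_Ioc).2 (hint e he)]
    have hterm : ∀ e ∈ A, ∫ y, (Ioc (hgt e) B).indicator (fun y => crossSign σ e * k (charMap σ (x, y))) y
        = crossSign σ e * Q (charMap σ (x, B)) + -crossSign σ e * Q (edgePoint σ e x) := by
      intro e he
      have hle := (hedge e he).2.2.trans hBR.le
      rw [integral_indicator measurableSet_Ioc, integral_const_mul, ← intervalIntegral.integral_of_le hle,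
        ← (hk (hgt e) B (hedge e he).2.1 hle).2, (hedge e he).1]
      ring
    rw [Finset.sum_congr rfl hterm, Finset.sum_add_distrib, ← Finset.sum_mul, hsum0, zero_mul, zero_add, hA,
      Finset.sum_filter]
    exact Finset.sum_congr rfl fun e _ => by simp only [indicator, mem_ofPred_eq]
  rw [integral_congr_ae hslice, Finset.mul_sum]
  have hmC : ∀ e, MeasurableSet {x | Crosses σ e x} := fun e => measurableSet_Ioo
  have hempty : ∀ e, ¬ (charInv σ e.1).1 ≠ (charInv σ e.2).1 → {x | Crosses σ e x} = ∅ := fun e he =>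
    eq_empty_iff_forall_notMem.2 fun x hx => he (Crosses.ne hx)
  rw [integral_finsetSum _ fun e he => ?_, Finset.mul_sum]
  · refine Finset.sum_congr rfl fun e he => ?_
    rw [integral_indicator (hmC e)]
    have hd : (charInv σ e.2).1 - (charInv σ e.1).1 = ((e.2.1 - e.1.1) + σ * (e.2.2 - e.1.2)) / 2 := by
      simp only [charInv]; ring
    by_cases hne : (charInv σ e.1).1 ≠ (charInv σ e.2).1
    · rw [(crossSign_integral hne (hQ e he hne)).2, hd]; ring
    · rw [hempty e hne, setIntegral_empty]
      rw [not_not.1 hne, sub_self] at hd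
      have : e.2.1 - e.1.1 + σ * (e.2.2 - e.1.2) = 0 := by linarith
      rw [this]; ring
  · rw [integrable_indicator_iff (hmC e)]
    by_cases hne : (charInv σ e.1).1 ≠ (charInv σ e.2).1
    · exact (crossSign_integral hne (hQ e he hne)).1
    · rw [hempty e hne]; exact integrableOn_empty

/-! ### Integrability along segments -/

theorem lineMap_eq (a b : ℝ × ℝ) (s : ℝ) :
    AffineMap.lineMap a b s = (a.1 + s * (b.1 - a.1), a.2 + s * (b.2 - a.2)) := by
  ext <;> simp [AffineMap.lineMap_apply] <;> ring

theorem lineMap_fst_nonneg {a b : ℝ × ℝ} (ha : 0 ≤ a.1) (hb : 0 ≤ b.1) {s : ℝ} (hs : s ∈ Icc (0 : ℝ) 1) :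
    0 ≤ (AffineMap.lineMap a b s : ℝ × ℝ).1 := by
  rw [lineMap_eq]
  simp only
  nlinarith [mul_nonneg hs.1 hb, mul_nonneg (sub_nonneg.2 hs.2) ha]

theorem lineMap_eq_charMap (a b : ℝ × ℝ) (s : ℝ) :
    AffineMap.lineMap a b s = charMap 1 (((b.1 + b.2) - (a.1 + a.2)) / 2 * s + (a.1 + a.2) / 2,
      ((b.1 - b.2) - (a.1 - a.2)) / 2 * s + (a.1 - a.2) / 2) := by
  rw [lineMap_eq]
  ext <;> simp [charMap] <;> ring

theorem intervalIntegrable_comp_affine {f : ℝ → ℝ} {c d : ℝ} (hc : c ≠ 0)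
    (hf : IntervalIntegrable f volume d (c + d)) : IntervalIntegrable (fun s => f (c * s + d)) volume 0 1 := by
  have h1 := (hf.comp_add_right d).comp_mul_left (c := c)
  simpa [hc] using h1

theorem measurable_closedInDeriv {p : ℝ} {w : ℝ × ℝ → ℝ} (hw : Continuous w) (ht : Measurable (trace p w)) :
    Measurable (closedInDeriv p w) :=
  Measurable.ite (measurableSet_eq_fun measurable_fst measurable_const)
    (ht.comp (measurable_snd.div_const 2)) (measurable_inDeriv hw)

theorem measurable_trace {p : ℝ} {w : ℝ × ℝ → ℝ} (hw : Continuous w) : Measurable (trace p w) := by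
  have h1 : ∀ a, ∫ y in (-a)..(1 - a), nonlin p w (charMap 1 (a, y))
      = ∫ y in Ioc (0 : ℝ) 1, nonlin p w (charMap 1 (a, y - a)) := by
    intro a
    rw [← intervalIntegral.integral_of_le zero_le_one,
      intervalIntegral.integral_comp_sub_right (fun y => nonlin p w (charMap 1 (a, y))), zero_sub]
  have h2 : Measurable fun q : ℝ × ℝ => nonlin p w (charMap 1 (q.1, q.2 - q.1)) :=
    (measurable_nonlin hw).comp (by fun_prop : Continuous fun q : ℝ × ℝ => charMap 1 (q.1, q.2 - q.1)).measurable
  have h3 : Measurable fun a => ∫ y in Ioc (0 : ℝ) 1, nonlin p w (charMap 1 (a, y - a)) :=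
    (h2.stronglyMeasurable.integral_prod_right (ν := volume.restrict (Ioc (0 : ℝ) 1))).measurable
  have h4 : Measurable fun a : ℝ => inDeriv w (charMap 1 (a, 1 - a)) :=
    (measurable_inDeriv hw).comp (by fun_prop : Continuous fun a : ℝ => charMap 1 (a, 1 - a)).measurable
  have h5 : trace p w = fun a => inDeriv w (charMap 1 (a, 1 - a))
      - ∫ y in Ioc (0 : ℝ) 1, nonlin p w (charMap 1 (a, y - a)) := funext fun a => by rw [trace, h1]
  rw [h5]
  exact h4.sub h3

theorem closedInDeriv_charMap_neg (p : ℝ) (w : ℝ × ℝ → ℝ) (a : ℝ) :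
    closedInDeriv p w (charMap 1 (a, -a)) = trace p w a := by
  rw [closedInDeriv, if_pos (by simp [charMap])]
  congr 1
  simp [charMap]

theorem closedInDeriv_of_ne (p : ℝ) (w : ℝ × ℝ → ℝ) {z : ℝ × ℝ} (hz : z.1 ≠ 0) :
    closedInDeriv p w z = inDeriv w z := if_neg hz

namespace IsWave

variable {p : ℝ} {w : ℝ × ℝ → ℝ}

/-- The trace is D at radius 1 minus an integral of N, and each is at most M(a); this explains the
factor 2. Enlarging B to A + 1 makes the reference height 1 - a available. -/
theorem exists_closed_majorant (h : IsWave p w) (hp : 3 ≤ p) (A B : ℝ) :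
    ∃ M : ℝ → ℝ, Measurable M ∧ (∀ a, 0 ≤ M a) ∧ IntegrableOn (fun a => M a ^ 2) (Icc (-A) A) ∧
      ∀ᵐ a, a ∈ Icc (-A) A → IntegrableOn (fun y => nonlin p w (charMap 1 (a, y))) (Ioc (-a) B) ∧
        ∫ y in Ioc (-a) B, |nonlin p w (charMap 1 (a, y))| ≤ M a ∧
        ∀ b ∈ Icc (-a) B, |closedInDeriv p w (charMap 1 (a, b))| ≤ M a := by
  obtain ⟨M, hMm, hM0, hM2, hM⟩ := h.exists_majorant hp A (max B (A + 1))
  refine ⟨fun a => 2 * M a, hMm.const_mul 2, fun a => mul_nonneg zero_le_two (hM0 a), ?_, ?_⟩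
  · simp only [mul_pow]
    exact hM2.const_mul _
  filter_upwards [hM] with a ha haA
  obtain ⟨hi, hle, hd⟩ := ha haA
  have hmono : ∀ {c}, c ≤ max B (A + 1) → ∫ y in Ioc (-a) c, |nonlin p w (charMap 1 (a, y))| ≤ M a := fun hc =>
    (setIntegral_mono_set hi.norm (ae_of_all _ fun _ => abs_nonneg _)
      (LE.le.eventuallyLE (Ioc_subset_Ioc_right hc))).trans hle
  refine ⟨hi.mono_set (Ioc_subset_Ioc_right (le_max_left _ _)), ?_, fun b hb => ?_⟩
  · linarith [hmono (le_max_left B (A + 1)), hM0 a]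
  · rcases hb.1.eq_or_lt with rfl | hb1
    · rw [closedInDeriv_charMap_neg, trace, intervalIntegral.integral_of_le (by linarith)]
      have hA1 : 1 - a ≤ max B (A + 1) := (by linarith [haA.1] : 1 - a ≤ A + 1).trans (le_max_right _ _)
      have h1 := hd (1 - a) ⟨by linarith, hA1⟩
      have h2 : |∫ y in Ioc (-a) (1 - a), nonlin p w (charMap 1 (a, y))| ≤ M a :=
        (norm_integral_le_integral_norm (fun y => nonlin p w (charMap 1 (a, y)))).trans (hmono hA1)
      exact (abs_sub _ _).trans (by linarith)
    · rw [closedInDeriv_of_ne p w (by simp only [charMap]; linarith)]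
      linarith [hd b ⟨hb1, hb.2.trans (le_max_left _ _)⟩, hM0 a]

theorem integrableOn_trace_sq (h : IsWave p w) (hp : 3 ≤ p) (n : ℝ) :
    IntegrableOn (fun a => trace p w a ^ 2) (Icc (-n) n) := by
  obtain ⟨M, hMm, hM0, hM2, hM⟩ := h.exists_closed_majorant hp n n
  refine hM2.mono' ((measurable_trace h.continuous).pow_const 2).aestronglyMeasurable ?_
  rw [ae_restrict_iff' measurableSet_Icc]
  filter_upwards [hM] with a ha haI
  have h1 := (ha haI).2.2 (-a) ⟨le_rfl, by linarith [haI.1]⟩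
  rw [closedInDeriv_charMap_neg] at h1
  rw [Real.norm_of_nonneg (sq_nonneg _)]
  exact sq_le_sq' (by linarith [neg_abs_le (trace p w a)]) ((le_abs_self _).trans h1)

theorem locallyIntegrable_trace (h : IsWave p w) (hp : 3 ≤ p) : LocallyIntegrable (trace p w) := by
  intro x
  obtain ⟨n, hn⟩ := exists_nat_gt |x|
  refine ⟨Icc (-(n : ℝ)) n, Icc_mem_nhds (by linarith [neg_abs_le x]) (by linarith [le_abs_self x]), ?_⟩
  exact integrableOn_of_sq (measurable_trace h.continuous) measure_Icc_lt_top.ne (h.integrableOn_trace_sq hp n)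

/-- If r + t is not constant on the segment, the segment is parametrised affinely by a, and D² is
dominated by the integrable function M(a)². -/
theorem intervalIntegrable_closedInDeriv_sq (h : IsWave p w) (hp : 3 ≤ p) {a b : ℝ × ℝ} (ha : 0 ≤ a.1) (hb : 0 ≤ b.1)
    (hab : a.1 + a.2 ≠ b.1 + b.2) :
    IntervalIntegrable (fun s => closedInDeriv p w (AffineMap.lineMap a b s) ^ 2) volume 0 1 := by
  set c := ((b.1 + b.2) - (a.1 + a.2)) / 2 with hc
  set d := (a.1 + a.2) / 2 with hd
  set c' := ((b.1 - b.2) - (a.1 - a.2)) / 2 with hc'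
  set d' := (a.1 - a.2) / 2 with hd'
  have hc0 : c ≠ 0 := div_ne_zero (sub_ne_zero.2 hab.symm) two_ne_zero
  obtain ⟨M, hMm, hM0, hM2, hM⟩ := h.exists_closed_majorant hp (|c| + |d|) (|c'| + |d'|)
  have hbound : ∀ c d s : ℝ, s ∈ Icc (0 : ℝ) 1 → c * s + d ∈ Icc (-(|c| + |d|)) (|c| + |d|) := by
    intro c d s hs
    have h1 : |c * s| ≤ |c| := by
      rw [abs_mul, abs_of_nonneg hs.1]; exact mul_le_of_le_one_right (abs_nonneg _) hs.2
    exact abs_le.1 ((abs_add_le _ _).trans (by linarith))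
  have hMi : IntervalIntegrable (fun a => M a ^ 2) volume d (c + d) := by
    rw [intervalIntegrable_iff']
    refine hM2.mono_set (ordConnected_Icc.uIcc_subset ?_ ?_)
    · simpa using hbound c d 0 (by simp)
    · simpa using hbound c d 1 (by simp)
  refine (intervalIntegrable_comp_affine hc0 hMi).mono_fun' ?_ ?_
  · have := measurable_closedInDeriv h.continuous (measurable_trace (p := p) h.continuous)
    exact ((this.comp AffineMap.lineMap_continuous.measurable).pow_const 2).aestronglyMeasurable
  · rw [uIoc_of_le zero_le_one]
    refine (ae_restrict_iff' measurableSet_Ioc).2 ?_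
    filter_upwards [ae_affine hc0 d hM] with s hs hsI
    have hsI' : s ∈ Icc (0 : ℝ) 1 := Ioc_subset_Icc_self hsI
    have h0 := lineMap_fst_nonneg ha hb hsI'
    have h1 := lineMap_eq_charMap a b s
    rw [← hc, ← hd, ← hc', ← hd'] at h1
    rw [h1] at h0 ⊢
    simp only [charMap] at h0
    have h2 := (hs (hbound c d s hsI')).2.2 (c' * s + d') ⟨by linarith, (hbound c' d' s hsI').2⟩
    rw [Real.norm_of_nonneg (sq_nonneg _)]
    exact sq_le_sq' (by linarith [neg_abs_le (closedInDeriv p w (charMap 1 (c * s + d, c' * s + d')))])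
      ((le_abs_self _).trans h2)

/-- The exceptional set of a is null and a is an affine coordinate on the segment, all of whose
inner points have positive radius. -/
theorem lineDifferentiableAt_segment (h : IsWave p w) (hp : 3 ≤ p) {a b : ℝ × ℝ} (ha : 0 ≤ a.1) (hb : 0 ≤ b.1)
    (hab : a.1 + a.2 ≠ b.1 + b.2) (h0 : ¬ (a.1 = 0 ∧ b.1 = 0)) :
    ∀ᵐ s ∂(volume.restrict (Icc (0 : ℝ) 1)), LineDifferentiableAt ℝ w (AffineMap.lineMap a b s) (1, 1) := by
  have hc0 : ((b.1 + b.2) - (a.1 + a.2)) / 2 ≠ 0 := div_ne_zero (sub_ne_zero.2 hab.symm) two_ne_zero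
  rw [← Measure.restrict_congr_set (Ioo_ae_eq_Icc (μ := volume))]
  refine (ae_restrict_iff' measurableSet_Ioo).2 ?_
  filter_upwards [ae_affine hc0 ((a.1 + a.2) / 2) (h.closedInDeriv_eq hp)] with s hs hsI
  have hpos : 0 < (AffineMap.lineMap a b s : ℝ × ℝ).1 := by
    rw [lineMap_eq]
    simp only
    rcases ha.eq_or_lt with ha0 | ha0
    · have : 0 < b.1 := lt_of_le_of_ne hb fun hb0 => h0 ⟨ha0.symm, hb0.symm⟩
      nlinarith [mul_pos hsI.1 this]
    · nlinarith [mul_nonneg hsI.1.le hb, mul_pos (sub_pos.2 hsI.2) ha0]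
  rw [lineMap_eq_charMap] at hpos ⊢
  simp only [charMap] at hpos
  exact hs.2.1 _ (by linarith)

theorem wavePotential_le (h : IsWave p w) (hp : 3 ≤ p) (T : ℝ) :
    ∃ C, 0 ≤ C ∧ ∀ r : ℝ, 0 ≤ r → ∀ t ∈ Icc (-T) T, wavePotential p w (r, t) ≤ C * r ^ ((3 - p) / 2) := by
  obtain ⟨C, hC0, hC⟩ := h.sq_bound T
  refine ⟨2 / (p + 1) * C ^ ((p + 1) / 2), by
    have : 0 < p + 1 := by linarith
    positivity, fun r hr t ht => ?_⟩
  have hp1 : 0 < 2 / (p + 1) := by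
    have : 0 < p + 1 := by linarith
    positivity
  rcases hr.eq_or_lt with rfl | hr
  · rw [wavePotential_axis hp w (by rfl)]
    have : (0:ℝ) ≤ 0 ^ ((3 - p) / 2) := Real.rpow_nonneg le_rfl _
    positivity
  have h1 : |w (r, t)| ^ (p + 1) ≤ (C * r) ^ ((p + 1) / 2) := by
    have h2 := hC r t ht
    rw [abs_of_pos hr] at h2
    have h3 : |w (r, t)| ^ (p + 1) = (w (r, t) ^ 2) ^ ((p + 1) / 2) := by
      rw [← sq_abs, ← Real.rpow_natCast, ← Real.rpow_mul (abs_nonneg _)]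
      congr 1
      push_cast
      ring
    rw [h3]
    exact Real.rpow_le_rpow (sq_nonneg _) h2 (by linarith)
  rw [wavePotential, mul_assoc]
  refine mul_le_mul_of_nonneg_left ?_ hp1.le
  simp only
  rw [div_le_iff₀ (Real.rpow_pos_of_pos hr _), mul_assoc, ← Real.rpow_add hr]
  refine h1.trans (le_of_eq ?_)
  rw [Real.mul_rpow hC0 hr.le]
  congr 2
  ring

/-- The dominating power r^((3-p)/2) is integrable at 0 because its exponent exceeds -1. This is
where p < 5 enters. -/
theorem intervalIntegrable_wavePotential (h : IsWave p w) (hp : 3 ≤ p) (hp5 : p < 5) {a b : ℝ × ℝ}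
    (ha : 0 ≤ a.1) (hb : 0 ≤ b.1) :
    IntervalIntegrable (fun s => wavePotential p w (AffineMap.lineMap a b s)) volume 0 1 := by
  obtain ⟨C, hC0, hC⟩ := h.wavePotential_le hp (|a.2| + |b.2|)
  have hint : IntervalIntegrable (fun s => C * ((b.1 - a.1) * s + a.1) ^ ((3 - p) / 2)) volume 0 1 := by
    refine IntervalIntegrable.const_mul ?_ C
    rcases eq_or_ne (b.1 - a.1) 0 with h0 | h0
    · simp [h0]
    · exact intervalIntegrable_comp_affine h0 (f := fun r => r ^ ((3 - p) / 2))
        (intervalIntegral.intervalIntegrable_rpow' (by linarith))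
  refine hint.mono_fun' ?_ ?_
  · exact ((measurable_wavePotential h.continuous).comp AffineMap.lineMap_continuous.measurable).aestronglyMeasurable
  · rw [uIoc_of_le zero_le_one]
    refine (ae_restrict_iff' measurableSet_Ioc).2 (ae_of_all _ fun s hs => ?_)
    have hs' := Ioc_subset_Icc_self hs
    have h0 := lineMap_fst_nonneg ha hb hs'
    beta_reduce
    rw [Real.norm_of_nonneg (wavePotential_nonneg hp h0)]
    rw [lineMap_eq] at h0 ⊢
    have e : (b.1 - a.1) * s + a.1 = a.1 + s * (b.1 - a.1) := by ring
    rw [e]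
    refine hC _ h0 _ (abs_le.1 ?_)
    have e2 : a.2 + s * (b.2 - a.2) = (1 - s) * a.2 + s * b.2 := by ring
    rw [e2]
    refine (abs_add_le _ _).trans (add_le_add ?_ ?_) <;> rw [abs_mul]
    · exact mul_le_of_le_one_left (abs_nonneg _) (by rw [abs_of_nonneg (sub_nonneg.2 hs'.2)]; linarith [hs'.1])
    · exact mul_le_of_le_one_left (abs_nonneg _) (by rw [abs_of_nonneg hs'.1]; exact hs'.2)

end IsWave

/-! ### Equality of the two traces -/

theorem ae_eq_of_intervalIntegral_eq {f g : ℝ → ℝ} (hf : LocallyIntegrable f) (hg : LocallyIntegrable g)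
    (h : ∀ a b, a < b → ∫ x in a..b, f x = ∫ x in a..b, g x) : f =ᵐ[volume] g := by
  filter_upwards [_root_.LocallyIntegrable.ae_hasDerivAt_integral hf, _root_.LocallyIntegrable.ae_hasDerivAt_integral hg] with x h1 h2
  refine (h1 (x - 1)).unique ((h2 (x - 1)).congr_of_eventuallyEq ?_)
  filter_upwards [Ioi_mem_nhds (sub_one_lt x)] with y hy using h _ _ hy

/-- The triangle `-b < x ≤ a`, `-x < y ≤ b` in characteristic coordinates. -/
def charTriangle (a b : ℝ) : Set (ℝ × ℝ) := {q | q.1 ≤ a ∧ q.2 ≤ b ∧ -q.1 < q.2}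

theorem measurableSet_charTriangle (a b : ℝ) : MeasurableSet (charTriangle a b) :=
  (measurableSet_le measurable_fst measurable_const).inter
    ((measurableSet_le measurable_snd measurable_const).inter (measurableSet_lt measurable_fst.neg measurable_snd))

theorem indicator_charTriangle (F : ℝ × ℝ → ℝ) (a b x : ℝ) :
    (fun y => (charTriangle a b).indicator F (x, y))
      = fun y => (Ioc (-b) a).indicator (fun x => (Ioc (-x) b).indicator (fun y => F (x, y)) y) x := by
  funext y
  by_cases hq : (x, y) ∈ charTriangle a b
  · obtain ⟨h1, h2, h3⟩ := id hq
    simp only at h1 h2 h3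
    rw [indicator_of_mem hq, indicator_of_mem (mem_Ioc.2 ⟨by linarith, h1⟩), indicator_of_mem (mem_Ioc.2 ⟨h3, h2⟩)]
  · rw [indicator_of_notMem hq]
    by_cases hx : x ∈ Ioc (-b) a
    · rw [indicator_of_mem hx, indicator_of_notMem fun hy => hq ⟨hx.2, hy.2, hy.1⟩]
    · rw [indicator_of_notMem hx]

theorem charTriangle_swap (F : ℝ × ℝ → ℝ) (a b : ℝ) (q : ℝ × ℝ) :
    (charTriangle a b).indicator F q = (charTriangle b a).indicator (fun q => F q.swap) q.swap := by
  have hiff : q ∈ charTriangle a b ↔ q.swap ∈ charTriangle b a := by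
    simp only [charTriangle, mem_ofPred_eq, Prod.fst_swap, Prod.snd_swap]
    exact ⟨fun h => ⟨h.2.1, h.1, by linarith [h.2.2]⟩, fun h => ⟨h.2.1, h.1, by linarith [h.2.2]⟩⟩
  by_cases hq : q ∈ charTriangle a b
  · rw [indicator_of_mem hq, indicator_of_mem (hiff.1 hq), Prod.swap_swap]
  · rw [indicator_of_notMem hq, indicator_of_notMem (mt hiff.2 hq)]

namespace IsWave

variable {p : ℝ} {w : ℝ × ℝ → ℝ}

theorem integrableOn_nonlin_charTriangle (h : IsWave p w) (hp : 3 ≤ p) (a b : ℝ) :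
    IntegrableOn (fun q => nonlin p w (charMap 1 q)) (charTriangle a b) := by
  have hm : Measurable fun q => nonlin p w (charMap 1 q) :=
    (measurable_nonlin h.continuous).comp (continuous_charMap 1).measurable
  rw [← integrable_indicator_iff (measurableSet_charTriangle a b), Measure.volume_eq_prod,
    integrable_prod_iff (hm.indicator (measurableSet_charTriangle a b)).aestronglyMeasurable]
  obtain ⟨M, hMm, hM0, hM2, hM⟩ := h.exists_closed_majorant hp (|a| + |b|) b
  have hMi := integrableOn_of_sq hMm measure_Icc_lt_top.ne hM2
  have hI : ∀ x ∈ Ioc (-b) a, x ∈ Icc (-(|a| + |b|)) (|a| + |b|) := fun x hx =>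
    ⟨by linarith [hx.1, le_abs_self b, abs_nonneg a], by linarith [hx.2, le_abs_self a, abs_nonneg b]⟩
  constructor
  · filter_upwards [hM] with x hx
    rw [indicator_charTriangle]
    by_cases hxI : x ∈ Ioc (-b) a
    · simp only [indicator_of_mem hxI]
      exact (integrable_indicator_iff measurableSet_Ioc).2 (hx (hI x hxI)).1
    · simp only [indicator_of_notMem hxI]
      exact integrable_zero _ _ _
  · refine Integrable.mono' (g := (Ioc (-b) a).indicator M)
      ((integrable_indicator_iff measurableSet_Ioc).2 (hMi.mono_set hI)) ?_ ?_
    · exact ((hm.indicator (measurableSet_charTriangle a b)).norm.stronglyMeasurable.integral_prod_right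
        (ν := volume)).aestronglyMeasurable
    · filter_upwards [hM] with x hx
      have h1 : (fun y => ‖(charTriangle a b).indicator (fun q => nonlin p w (charMap 1 q)) (x, y)‖)
          = fun y => (Ioc (-b) a).indicator (fun x => (Ioc (-x) b).indicator
            (fun y => |nonlin p w (charMap 1 (x, y))|) y) x := by
        rw [← indicator_charTriangle (fun q => |nonlin p w (charMap 1 q)|) a b x]
        funext y
        exact norm_indicator_eq_indicator_norm _ _
      rw [h1]
      by_cases hxI : x ∈ Ioc (-b) a
      · simp only [indicator_of_mem hxI]
        rw [integral_indicator measurableSet_Ioc, Real.norm_of_nonneg (integral_nonneg fun _ => abs_nonneg _)]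
        exact (hx (hI x hxI)).2.1
      · simp [indicator_of_notMem hxI]

theorem intervalIntegral_nonlin (h : IsWave p w) (hp : 3 ≤ p) {a b : ℝ} (hab : -b ≤ a) :
    ∫ x in (-b)..a, ∫ y in (-x)..b, nonlin p w (charMap 1 (x, y))
      = ∫ q in charTriangle a b, nonlin p w (charMap 1 q) := by
  have hi := h.integrableOn_nonlin_charTriangle hp a b
  rw [← integrable_indicator_iff (measurableSet_charTriangle a b), Measure.volume_eq_prod] at hi
  rw [← integral_indicator (measurableSet_charTriangle a b), Measure.volume_eq_prod, integral_prod _ hi,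
    intervalIntegral.integral_of_le hab, ← integral_indicator measurableSet_Ioc]
  refine integral_congr_ae (ae_of_all _ fun x => ?_)
  beta_reduce
  rw [indicator_charTriangle]
  by_cases hxI : x ∈ Ioc (-b) a
  · simp only [indicator_of_mem hxI]
    rw [integral_indicator measurableSet_Ioc, intervalIntegral.integral_of_le (by linarith [hxI.1])]
  · simp [indicator_of_notMem hxI]

/-- D along b = const is the trace plus an integral of N, and w is the integral of D from the axis,
where w = 0. Except for the trace, every term is symmetric in the two families of characteristics.
-/
theorem eq_integral_trace (h : IsWave p w) (hp : 3 ≤ p) {a b : ℝ} (hab : -b < a) :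
    w (charMap 1 (a, b)) = (∫ x in (-b)..a, trace p w x) + ∫ q in charTriangle a b, nonlin p w (charMap 1 q) := by
  obtain ⟨M, hMm, hM0, hM2, hM⟩ := h.exists_closed_majorant hp (|a| + |b|) b
  have hMi := integrableOn_of_sq hMm measure_Icc_lt_top.ne hM2
  have hI : ∀ x ∈ Ioc (-b) a, x ∈ Icc (-(|a| + |b|)) (|a| + |b|) := fun x hx =>
    ⟨by linarith [hx.1, le_abs_self b, abs_nonneg a], by linarith [hx.2, le_abs_self a, abs_nonneg b]⟩
  have hci : IntervalIntegrable (fun x => closedInDeriv p w (charMap 1 (x, b))) volume (-b) a := by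
    rw [intervalIntegrable_iff_integrableOn_Ioc_of_le hab.le]
    refine (hMi.mono_set hI).mono' ?_ ?_
    · exact ((measurable_closedInDeriv h.continuous (measurable_trace h.continuous)).comp
        (by fun_prop : Continuous fun x : ℝ => charMap 1 (x, b)).measurable).aestronglyMeasurable
    · refine (ae_restrict_iff' measurableSet_Ioc).2 ?_
      filter_upwards [hM] with x hx hxI
      exact (hx (hI x hxI)).2.2 b ⟨by linarith [hxI.1], le_rfl⟩
  have hti : IntervalIntegrable (trace p w) volume (-b) a :=
    intervalIntegrable_iff_integrableOn_Icc_of_le hab.le |>.2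
      (MeasureTheory.LocallyIntegrable.integrableOn_isCompact (h.locallyIntegrable_trace hp) isCompact_Icc)
  have hae : ∀ᵐ x, x ∈ uIoc (-b) a → ∫ y in (-x)..b, nonlin p w (charMap 1 (x, y))
      = closedInDeriv p w (charMap 1 (x, b)) - trace p w x := by
    filter_upwards [h.closedInDeriv_eq hp] with x hx hxI
    rw [uIoc_of_le hab.le] at hxI
    rw [hx.2.2 b (by linarith [hxI.1])]
    ring
  rw [← h.intervalIntegral_nonlin hp hab.le, intervalIntegral.integral_congr_ae hae,
    intervalIntegral.integral_sub hci hti, add_sub_cancel]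
  have hcont := intervalIntegral.continuousOn_primitive_interval_left (μ := volume)
    (((intervalIntegrable_iff_integrableOn_Icc_of_le hab.le).1 hci).mono_set (by rw [uIcc_of_le hab.le]))
  have h1 := (hcont (-b) left_mem_uIcc).tendsto
  rw [uIcc_of_le hab.le] at h1
  have h2 := h1.mono_left (nhdsWithin_mono _ (Ioo_subset_Icc_self (a := -b) (b := a)))
  rw [nhdsWithin_Ioo_eq_nhdsGT hab] at h2
  have hw := h.continuous
  have h3 : Tendsto (fun c => w (charMap 1 (a, b)) - w (charMap 1 (c, b))) (𝓝[>] (-b))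
      (𝓝 (w (charMap 1 (a, b)) - w (charMap 1 (-b, b)))) :=
    ((by fun_prop : Continuous fun c => w (charMap 1 (a, b)) - w (charMap 1 (c, b))).tendsto (-b)).mono_left
      nhdsWithin_le_nhds
  have h4 : w (charMap 1 (-b, b)) = 0 := by
    have := h.zero (1 * (-b - b))
    simpa [charMap] using this
  rw [h4, sub_zero] at h3
  refine tendsto_nhds_unique (h3.congr' ?_) h2
  filter_upwards [Ioo_mem_nhdsGT hab] with c hc
  rw [(h.intervalIntegral_inDeriv hp (a₁ := c) (a₂ := a) (b := b) (by linarith [hc.1]) hc.2.le).2]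
  refine intervalIntegral.integral_congr fun x hx => ?_
  rw [uIcc_of_le hc.2.le] at hx
  exact (closedInDeriv_of_ne p w (by simp only [charMap]; linarith [hx.1, hc.1])).symm

/-- Both families of characteristics induce the same trace on the axis. -/
theorem trace_timeReverse (h : IsWave p w) (hp : 3 ≤ p) :
    ∀ᵐ x, trace p (RadialWave.timeReverse w) (-x) = trace p w x := by
  have h' := h.timeReverse hp
  have hl' : LocallyIntegrable fun x => trace p (RadialWave.timeReverse w) (-x) := by
    intro x
    obtain ⟨U, hU, hUi⟩ := h'.locallyIntegrable_trace hp (-x)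
    refine ⟨Neg.neg ⁻¹' U, continuous_neg.continuousAt.preimage_mem_nhds hU, ?_⟩
    exact ((Measure.measurePreserving_neg volume).integrableOn_comp_preimage
      (Homeomorph.neg ℝ).measurableEmbedding).2 hUi
  refine ae_eq_of_intervalIntegral_eq hl' (h.locallyIntegrable_trace hp) fun c a hca => ?_
  obtain ⟨b, rfl⟩ : ∃ b, c = -b := ⟨-c, (neg_neg c).symm⟩
  -- The same value of w is represented once for w and once for its time reversal. The two double
  -- integrals agree by the reflection exchanging the coordinates, so the integrals of the traces
  -- agree on every interval.
  have e1 := h.eq_integral_trace hp hca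
  have e2 := h'.eq_integral_trace hp (a := b) (b := a) (by linarith)
  rw [timeReverse_charMap, e1] at e2
  have e3 : ∫ q in charTriangle b a, nonlin p (RadialWave.timeReverse w) (charMap 1 q)
      = ∫ q in charTriangle a b, nonlin p w (charMap 1 q) := by
    rw [← integral_indicator (measurableSet_charTriangle _ _), ← integral_indicator (measurableSet_charTriangle _ _)]
    have h1 : ∀ q, (charTriangle a b).indicator (fun q => nonlin p w (charMap 1 q)) q
        = (charTriangle b a).indicator (fun q => nonlin p (RadialWave.timeReverse w) (charMap 1 q)) q.swap := by
      intro q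
      rw [charTriangle_swap]
      congr 1
      funext q
      rw [nonlin_timeReverse]
      congr 1
      refine Prod.ext ?_ ?_ <;> simp [charMap, add_comm]
    simp_rw [h1]
    rw [Measure.volume_eq_prod]
    exact (integral_prod_swap (μ := volume) (ν := volume) ((charTriangle b a).indicator fun q =>
      nonlin p (RadialWave.timeReverse w) (charMap 1 q))).symm
  rw [e3, add_left_inj] at e2
  rw [intervalIntegral.integral_comp_neg (fun x => trace p (RadialWave.timeReverse w) x), neg_neg, ← e2]

end IsWave

/-! ### The flux identity in the closed half plane -/

/-- `(r, t) ↦ (r, τ t)`. -/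
def timeScale (τ : ℝ) (z : ℝ × ℝ) : ℝ × ℝ := (z.1, τ * z.2)

theorem continuous_timeScale (τ : ℝ) : Continuous (timeScale τ) := by unfold timeScale; fun_prop

theorem timeScale_timeScale {τ : ℝ} (hτ : τ ^ 2 = 1) (z : ℝ × ℝ) : timeScale τ (timeScale τ z) = z := by
  refine Prod.ext rfl ?_
  simp only [timeScale]
  linear_combination z.2 * hτ

theorem timeScale_charMap {τ : ℝ} (hτ : τ ^ 2 = 1) (x y : ℝ) :
    timeScale τ (charMap τ (x, y)) = charMap 1 (x, y) := by
  refine Prod.ext rfl ?_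
  simp only [timeScale, charMap]
  linear_combination (x - y) * hτ

theorem timeScale_charMap_neg {τ : ℝ} (hτ : τ ^ 2 = 1) (x y : ℝ) :
    timeScale τ (charMap (-τ) (x, y)) = charMap 1 (y, x) := by
  refine Prod.ext (add_comm _ _) ?_
  simp only [timeScale, charMap]
  linear_combination (y - x) * hτ

theorem timeScale_lineMap (τ : ℝ) (a b : ℝ × ℝ) (s : ℝ) :
    timeScale τ (AffineMap.lineMap a b s) = AffineMap.lineMap (timeScale τ a) (timeScale τ b) s := by
  simp only [lineMap_eq, timeScale]
  refine Prod.ext rfl ?_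
  simp only
  ring

theorem integrableOn_of_charMap {F : ℝ × ℝ → ℝ} (hF : ∀ n : ℝ, IntegrableOn (fun q => F (charMap 1 q))
    {q : ℝ × ℝ | q.1 ∈ Icc (-n) n ∧ q.2 ∈ Ioc (-q.1) n}) {Ω : Set (ℝ × ℝ)} (hc : IsCompact Ω)
    (h0 : ∀ z ∈ Ω, 0 ≤ z.1) : IntegrableOn F Ω := by
  obtain ⟨n, hn⟩ := (hc.image (continuous_charInv 1)).isBounded.subset_closedBall 0
  set S := {q : ℝ × ℝ | q.1 ∈ Icc (-n) n ∧ q.2 ∈ Ioc (-q.1) n} with hS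
  have hmS : MeasurableSet S := (measurableSet_Icc.preimage measurable_fst).inter
    ((measurableSet_lt measurable_fst.neg measurable_snd).inter (measurableSet_le measurable_snd measurable_const))
  have hmT : MeasurableSet (charInv 1 ⁻¹' S) := (continuous_charInv 1).measurable hmS
  have h1 : IntegrableOn F (charInv 1 ⁻¹' S) := by
    rw [← integrable_indicator_iff hmT, ← integrable_charMap_iff (σ := 1) (by norm_num)]
    refine ((integrable_indicator_iff hmS).2 (hF n)).congr (ae_of_all _ fun q => ?_)
    have : charMap 1 q ∈ charInv 1 ⁻¹' S ↔ q ∈ S := by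
      rw [mem_preimage, charInv_charMap (by norm_num)]
    by_cases hq : q ∈ S
    · exact (indicator_of_mem hq _).trans (indicator_of_mem (this.2 hq) F).symm
    · exact (indicator_of_notMem hq _).trans (indicator_of_notMem (mt this.1 hq) F).symm
  have hnull : volume {z : ℝ × ℝ | z.1 = 0} = 0 := by
    have : {z : ℝ × ℝ | z.1 = 0} = ({0} : Set ℝ) ×ˢ (univ : Set ℝ) := by ext z; simp
    rw [this, Measure.volume_eq_prod, Measure.prod_prod]
    simp
  have h2 : IntegrableOn F {z : ℝ × ℝ | z.1 = 0} := by
    rw [IntegrableOn, Measure.restrict_eq_zero.2 hnull]; exact integrable_zero_measure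
  refine (h1.union h2).mono_set fun z hz => ?_
  rcases (h0 z hz).eq_or_lt with h3 | h3
  · exact Or.inr h3.symm
  · left
    have h4 := mem_closedBall_zero_iff.1 (hn (mem_image_of_mem _ hz))
    have h5 := abs_le.1 ((norm_fst_le _).trans h4)
    have h6 := abs_le.1 ((norm_snd_le _).trans h4)
    refine ⟨h5, ?_, h6.2⟩
    simp only [charInv]
    linarith

/-- The pull-back of the energy flux form to a segment. -/
noncomputable def waveForm (p : ℝ) (w : ℝ × ℝ → ℝ) (τ : ℝ) (a b : ℝ × ℝ) (s : ℝ) : ℝ :=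
  inDeriv w (timeScale τ (AffineMap.lineMap a b s)) ^ 2 * ((b.1 - a.1) + τ * (b.2 - a.2))
    + wavePotential p w (timeScale τ (AffineMap.lineMap a b s)) * ((b.1 - a.1) - τ * (b.2 - a.2))

/-- As `waveForm`, with the trace on the axis. -/
noncomputable def closedForm (p : ℝ) (w : ℝ × ℝ → ℝ) (τ : ℝ) (a b : ℝ × ℝ) (s : ℝ) : ℝ :=
  closedInDeriv p w (timeScale τ (AffineMap.lineMap a b s)) ^ 2 * ((b.1 - a.1) + τ * (b.2 - a.2))
    + wavePotential p w (timeScale τ (AffineMap.lineMap a b s)) * ((b.1 - a.1) - τ * (b.2 - a.2))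

theorem waveForm_ae_eq (p : ℝ) (w : ℝ × ℝ → ℝ) (τ : ℝ) {a b : ℝ × ℝ} (h0 : ¬ (a.1 = 0 ∧ b.1 = 0)) :
    ∀ᵐ s, waveForm p w τ a b s = closedForm p w τ a b s := by
  have h1 : ∀ᵐ s : ℝ, a.1 + s * (b.1 - a.1) ≠ 0 := by
    filter_upwards [Measure.ae_ne volume (-a.1 / (b.1 - a.1))] with s hs h2
    rcases eq_or_ne (b.1 - a.1) 0 with h3 | h3
    · rw [h3, mul_zero, add_zero] at h2
      exact h0 ⟨h2, by linarith⟩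
    · exact hs (by rw [eq_div_iff h3]; linarith)
  filter_upwards [h1] with s hs
  rw [waveForm, closedForm, closedInDeriv_of_ne]
  rw [lineMap_eq]
  exact hs

namespace IsWave

variable {p : ℝ} {w : ℝ × ℝ → ℝ}

theorem intervalIntegrable_closedInDeriv_mul (h : IsWave p w) (hp : 3 ≤ p) (τ : ℝ) {a b : ℝ × ℝ}
    (ha : 0 ≤ a.1) (hb : 0 ≤ b.1) :
    IntervalIntegrable (fun s => closedInDeriv p w (timeScale τ (AffineMap.lineMap a b s)) ^ 2
      * ((b.1 - a.1) + τ * (b.2 - a.2))) volume 0 1 := by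
  rcases eq_or_ne ((b.1 - a.1) + τ * (b.2 - a.2)) 0 with h0 | h0
  · simp [h0]
  · simp only [timeScale_lineMap]
    refine (h.intervalIntegrable_closedInDeriv_sq (a := timeScale τ a) (b := timeScale τ b) hp ha hb
      fun h1 => h0 ?_).mul_const _
    simp only [timeScale] at h1
    linarith

theorem intervalIntegrable_wavePotential_timeScale (h : IsWave p w) (hp : 3 ≤ p) (hp5 : p < 5) (τ : ℝ) {a b : ℝ × ℝ}
    (ha : 0 ≤ a.1) (hb : 0 ≤ b.1) :
    IntervalIntegrable (fun s => wavePotential p w (timeScale τ (AffineMap.lineMap a b s))) volume 0 1 := by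
  simp only [timeScale_lineMap]
  exact h.intervalIntegrable_wavePotential hp hp5 ha hb

theorem intervalIntegrable_closedForm (h : IsWave p w) (hp : 3 ≤ p) (hp5 : p < 5) (τ : ℝ) {a b : ℝ × ℝ}
    (ha : 0 ≤ a.1) (hb : 0 ≤ b.1) : IntervalIntegrable (closedForm p w τ a b) volume 0 1 :=
  (h.intervalIntegrable_closedInDeriv_mul hp τ ha hb).add
    ((h.intervalIntegrable_wavePotential_timeScale hp hp5 τ ha hb).mul_const _)

/-- The energy flux identity, including regions that touch the axis. -/
theorem green (h : IsWave p w) (hp : 3 ≤ p) (hp5 : p < 5) {Ω : Set (ℝ × ℝ)} {Γ : Finset ((ℝ × ℝ) × (ℝ × ℝ))}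
    (hΓ : IsPolygonalRegion Ω Γ) (h0 : ∀ z ∈ Ω, 0 ≤ z.1) {τ : ℝ} (hτ : τ ^ 2 = 1) :
    IntegrableOn (fun z => waveBulk p w (timeScale τ z)) Ω ∧
    ∑ e ∈ Γ, ∫ s in (0 : ℝ)..1, closedForm p w τ e.1 e.2 s
      = τ * (2 * (p - 1) / (p + 1)) * ∫ z in Ω, waveBulk p w (timeScale τ z) := by
  set c := 2 * (p - 1) / (p + 1) with hc
  let ρ : (ℝ × ℝ) ≃ₜ (ℝ × ℝ) :=
    { toFun := timeScale τ
      invFun := timeScale τ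
      left_inv := timeScale_timeScale hτ
      right_inv := timeScale_timeScale hτ
      continuous_toFun := continuous_timeScale τ
      continuous_invFun := continuous_timeScale τ }
  have hρmp : MeasurePreserving (timeScale τ) volume volume := by
    have h1 : MeasurePreserving (fun t : ℝ => τ * t) volume volume := by
      rcases sq_eq_one_iff.1 hτ with rfl | rfl
      · simp only [one_mul]
        exact MeasurePreserving.id (volume : Measure ℝ)
      · simpa using Measure.measurePreserving_neg (volume : Measure ℝ)
    exact (MeasurePreserving.id volume).prod h1
  have hint : ∀ F : ℝ × ℝ → ℝ, (∀ n : ℝ, IntegrableOn (fun q => F (charMap 1 q))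
      {q : ℝ × ℝ | q.1 ∈ Icc (-n) n ∧ q.2 ∈ Ioc (-q.1) n}) → IntegrableOn (fun z => F (timeScale τ z)) Ω := by
    intro F hF
    have h1 : IntegrableOn F (timeScale τ '' Ω) := integrableOn_of_charMap hF (hΓ.isCompact.image (continuous_timeScale τ))
      (by rintro _ ⟨z, hz, rfl⟩; exact h0 z hz)
    exact (hρmp.integrableOn_image ρ.measurableEmbedding).1 h1
  have hbulk := hint (waveBulk p w) (h.integrableOn_waveBulk_char hp)
  have hk : IntegrableOn (fun z => 2 * inDeriv w (timeScale τ z) * nonlin p w (timeScale τ z)) Ω := by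
    refine hint (fun z => 2 * inDeriv w z * nonlin p w z) fun n => ?_
    have h1 := (h.integrableOn_inDeriv_mul_nonlin hp n).const_mul 2
    simp only [← mul_assoc] at h1
    exact h1
  have hedge : ∀ e ∈ Γ, 0 ≤ e.1.1 ∧ 0 ≤ e.2.1 := fun e he =>
    ⟨h0 _ (hΓ.segment_subset he (left_mem_segment ℝ _ _)), h0 _ (hΓ.segment_subset he (right_mem_segment ℝ _ _))⟩
  -- D² is transported along the lines on which the first coordinate of `charMap τ` is fixed.
  have g1 := hΓ.integral_eq h0 (σ := τ) hτ (Q := fun z => closedInDeriv p w (timeScale τ z) ^ 2)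
    (k := fun z => 2 * inDeriv w (timeScale τ z) * nonlin p w (timeScale τ z))
    (by simp only [timeScale_charMap hτ]; exact h.closedInDeriv_sq hp)
    (by
      intro e he hne
      simp only [timeScale_lineMap]
      refine h.intervalIntegrable_closedInDeriv_sq hp (hedge e he).1 (hedge e he).2 fun h1 => hne ?_
      simp only [timeScale] at h1
      simp only [charInv, h1]) hk
  -- The sign -τ exchanges the two coordinates, which gives the other family of characteristics,
  -- along which V is transported. The common term 2 D N cancels between the two formulas.
  have g2 := hΓ.integral_eq h0 (σ := -τ) (by rw [neg_sq, hτ]) (Q := fun z => wavePotential p w (timeScale τ z))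
    (k := fun z => 2 * inDeriv w (timeScale τ z) * nonlin p w (timeScale τ z) - c * waveBulk p w (timeScale τ z))
    (by
      simp only [timeScale_charMap_neg hτ]
      filter_upwards [h.wavePotential_primitive hp] with b hb using hb.2)
    (fun e he _ => h.intervalIntegrable_wavePotential_timeScale hp hp5 τ (hedge e he).1 (hedge e he).2)
    (hk.sub (hbulk.const_mul c))
  refine ⟨hbulk, ?_⟩
  rw [integral_sub hk (hbulk.const_mul c), integral_const_mul, g1] at g2
  have hsum : ∑ e ∈ Γ, ∫ s in (0 : ℝ)..1, closedForm p w τ e.1 e.2 s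
      = (∑ e ∈ Γ, ((e.2.1 - e.1.1) + τ * (e.2.2 - e.1.2)) *
          ∫ s in (0 : ℝ)..1, closedInDeriv p w (timeScale τ (AffineMap.lineMap e.1 e.2 s)) ^ 2)
        + ∑ e ∈ Γ, ((e.2.1 - e.1.1) + -τ * (e.2.2 - e.1.2)) *
          ∫ s in (0 : ℝ)..1, wavePotential p w (timeScale τ (AffineMap.lineMap e.1 e.2 s)) := by
    rw [← Finset.sum_add_distrib]
    refine Finset.sum_congr rfl fun e he => ?_
    unfold closedForm
    rw [intervalIntegral.integral_add (h.intervalIntegrable_closedInDeriv_mul hp τ (hedge e he).1 (hedge e he).2)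
      ((h.intervalIntegrable_wavePotential_timeScale hp hp5 τ (hedge e he).1 (hedge e he).2).mul_const _),
      intervalIntegral.integral_mul_const, intervalIntegral.integral_mul_const]
    ring
  rw [hsum]
  set X := ∑ e ∈ Γ, ((e.2.1 - e.1.1) + τ * (e.2.2 - e.1.2)) *
          ∫ s in (0 : ℝ)..1, closedInDeriv p w (timeScale τ (AffineMap.lineMap e.1 e.2 s)) ^ 2
  set Y := ∑ e ∈ Γ, ((e.2.1 - e.1.1) + -τ * (e.2.2 - e.1.2)) *
          ∫ s in (0 : ℝ)..1, wavePotential p w (timeScale τ (AffineMap.lineMap e.1 e.2 s))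
  have : τ * (τ * X) - τ * (c * ∫ z in Ω, waveBulk p w (timeScale τ z)) = τ * (-τ * Y) := by
    rw [← g2]; ring
  linear_combination this - (X + Y) * hτ

/-- On the axis the flux form is the density of the trace. -/
theorem integral_closedForm_axis (p : ℝ) (hp : 3 ≤ p) (w : ℝ × ℝ → ℝ) (τ : ℝ) {a b : ℝ × ℝ} (ha : a.1 = 0) (hb : b.1 = 0) :
    ∫ s in (0 : ℝ)..1, closedForm p w τ a b s = τ * ∫ t in a.2..b.2, trace p w (τ * t / 2) ^ 2 := by
  have h1 : ∀ s : ℝ, closedForm p w τ a b s = τ * ((b.2 - a.2) * trace p w (τ * (a.2 + (b.2 - a.2) * s) / 2) ^ 2) := by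
    intro s
    have h2 : (timeScale τ (AffineMap.lineMap a b s)).1 = 0 := by
      rw [lineMap_eq]; simp [timeScale, ha, hb]
    rw [closedForm, wavePotential_axis hp w h2, closedInDeriv, if_pos h2, ha, hb]
    rw [lineMap_eq]
    simp only [timeScale]
    ring_nf
  simp_rw [h1]
  rw [intervalIntegral.integral_const_mul, intervalIntegral.integral_const_mul,
    intervalIntegral.mul_integral_comp_add_mul (f := fun t => trace p w (τ * t / 2) ^ 2)]
  ring_nf

end IsWave

/-! ### Triangles with one side on the axis -/

/-- The closed triangle over `[0, R] × {t₀}` bounded by the axis and an incoming characteristic. -/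
def axisTriangle (t₀ R : ℝ) : Set (ℝ × ℝ) := {z | 0 ≤ z.1 ∧ t₀ ≤ z.2 ∧ z.1 + z.2 ≤ t₀ + R}

open Classical in
/-- The boundary of `axisTriangle`. -/
noncomputable def axisTriangleEdges (t₀ R : ℝ) : Finset ((ℝ × ℝ) × (ℝ × ℝ)) :=
  {((0, t₀), (R, t₀)), ((R, t₀), (0, t₀ + R)), ((0, t₀ + R), (0, t₀))}

open Classical in
theorem sum_axisTriangleEdges {t₀ R : ℝ} (hR : 0 < R) (F : (ℝ × ℝ) × (ℝ × ℝ) → ℝ) :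
    ∑ e ∈ axisTriangleEdges t₀ R, F e
      = F ((0, t₀), (R, t₀)) + F ((R, t₀), (0, t₀ + R)) + F ((0, t₀ + R), (0, t₀)) := by
  rw [axisTriangleEdges, Finset.sum_insert, Finset.sum_insert, Finset.sum_singleton, add_assoc]
  · simp [hR.ne']
  · simp [hR.ne, hR.ne']

theorem mem_axisTriangleEdges {t₀ R : ℝ} {e : (ℝ × ℝ) × (ℝ × ℝ)} : e ∈ axisTriangleEdges t₀ R ↔
    e = ((0, t₀), (R, t₀)) ∨ e = ((R, t₀), (0, t₀ + R)) ∨ e = ((0, t₀ + R), (0, t₀)) := by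
  simp [axisTriangleEdges]

theorem isClosed_axisTriangle (t₀ R : ℝ) : IsClosed (axisTriangle t₀ R) :=
  (isClosed_le continuous_const continuous_fst).inter ((isClosed_le continuous_const continuous_snd).inter
    (isClosed_le (continuous_fst.add continuous_snd) continuous_const))

theorem frontier_axisTriangle {t₀ R : ℝ} : frontier (axisTriangle t₀ R)
    = {z | z ∈ axisTriangle t₀ R ∧ (z.2 = t₀ ∨ z.1 + z.2 = t₀ + R ∨ z.1 = 0)} := by
  rw [(isClosed_axisTriangle t₀ R).frontier_eq]
  ext z
  constructor
  · rintro ⟨hz, hi⟩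
    refine ⟨hz, ?_⟩
    by_contra! hcon
    refine hi (mem_interior.2 ⟨{z | 0 < z.1 ∧ t₀ < z.2 ∧ z.1 + z.2 < t₀ + R}, fun y hy => ⟨hy.1.le, hy.2.1.le, hy.2.2.le⟩,
      ?_, lt_of_le_of_ne hz.1 hcon.2.2.symm, lt_of_le_of_ne hz.2.1 hcon.1.symm, lt_of_le_of_ne hz.2.2 hcon.2.1⟩)
    exact (isOpen_lt continuous_const continuous_fst).inter ((isOpen_lt continuous_const continuous_snd).inter
      (isOpen_lt (continuous_fst.add continuous_snd) continuous_const))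
  · rintro ⟨hz, h⟩
    refine ⟨hz, fun hi => ?_⟩
    have key : ∀ v : ℝ × ℝ, ∃ s : ℝ, 0 < s ∧ z + s • v ∈ axisTriangle t₀ R := by
      intro v
      have hc : Tendsto (fun s : ℝ => z + s • v) (𝓝 0) (𝓝 z) := by
        have : Continuous fun s : ℝ => z + s • v := by fun_prop
        simpa using this.tendsto 0
      obtain ⟨s, h1, h2⟩ := ((eventually_nhdsWithin_of_eventually_nhds (s := Ioi 0)
        (hc.eventually (mem_interior_iff_mem_nhds.1 hi))).and self_mem_nhdsWithin).exists
      exact ⟨s, h2, h1⟩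
    rcases h with h | h | h
    · obtain ⟨s, hs, h1⟩ := key (0, -1)
      have := h1.2.1
      simp at this
      linarith
    · obtain ⟨s, hs, h1⟩ := key (0, 1)
      have := h1.2.2
      simp at this
      linarith
    · obtain ⟨s, hs, h1⟩ := key (-1, 0)
      have := h1.1
      simp at this
      linarith

theorem isPolygonalRegion_axisTriangle (t₀ : ℝ) {R : ℝ} (hR : 0 < R) :
    IsPolygonalRegion (axisTriangle t₀ R) (axisTriangleEdges t₀ R) where
  isCompact := by
    refine Metric.isCompact_of_isClosed_isBounded (isClosed_axisTriangle t₀ R) ?_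
    refine ((isCompact_Icc (a := (0 : ℝ)) (b := R)).prod (isCompact_Icc (a := t₀) (b := t₀ + R))).isBounded.subset ?_
    rintro z ⟨h1, h2, h3⟩
    exact ⟨⟨h1, by linarith⟩, ⟨h2, by linarith⟩⟩
  admissible e he := by
    rcases mem_axisTriangleEdges.1 he with rfl | rfl | rfl
    · exact ⟨by simp [hR.ne], Or.inr (Or.inl rfl)⟩
    · exact ⟨by simp [hR.ne'], Or.inr (Or.inr (Or.inl (by simp)))⟩
    · exact ⟨by simp [hR.ne'], Or.inl rfl⟩
  frontier_eq := by
    rw [frontier_axisTriangle]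
    ext z
    simp only [mem_iUnion, exists_prop, mem_axisTriangleEdges, segment_eq_image_lineMap, mem_image, lineMap_eq]
    constructor
    · rintro ⟨⟨h1, h2, h3⟩, h | h | h⟩
      · refine ⟨_, Or.inl rfl, z.1 / R, ⟨div_nonneg h1 hR.le, (div_le_one hR).2 (by linarith)⟩, ?_⟩
        refine Prod.ext ?_ ?_ <;> simp only
        · field_simp; ring
        · rw [h]; ring
      · refine ⟨_, Or.inr (Or.inl rfl), (z.2 - t₀) / R, ⟨div_nonneg (by linarith) hR.le, (div_le_one hR).2 (by linarith)⟩, ?_⟩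
        refine Prod.ext ?_ ?_ <;> simp only
        · field_simp; linear_combination (-R) * h
        · field_simp; ring
      · refine ⟨_, Or.inr (Or.inr rfl), (t₀ + R - z.2) / R, ⟨div_nonneg (by linarith) hR.le, (div_le_one hR).2 (by linarith)⟩, ?_⟩
        refine Prod.ext ?_ ?_ <;> simp only
        · rw [h]; ring
        · field_simp; ring
    · rintro ⟨e, rfl | rfl | rfl, s, ⟨hs0, hs1⟩, rfl⟩
      · refine ⟨⟨?_, ?_, ?_⟩, Or.inl ?_⟩ <;> simp only <;> nlinarith
      · refine ⟨⟨?_, ?_, ?_⟩, Or.inr (Or.inl ?_)⟩ <;> simp only <;> nlinarith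
      · refine ⟨⟨?_, ?_, ?_⟩, Or.inr (Or.inr ?_)⟩ <;> simp only <;> nlinarith
  disjoint e he e' he' hne := by
    rw [disjoint_left]
    simp only [openSegment_eq_image_lineMap, lineMap_eq]
    rintro z ⟨s, ⟨hs0, hs1⟩, rfl⟩ ⟨s', ⟨hs0', hs1'⟩, h⟩
    rw [Prod.ext_iff] at h
    rcases mem_axisTriangleEdges.1 he with rfl | rfl | rfl <;> rcases mem_axisTriangleEdges.1 he' with rfl | rfl | rfl <;>
      first | exact hne rfl | (obtain ⟨h1, h2⟩ := h; simp only at h1 h2; nlinarith)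
  left e he z hz := by
    rw [openSegment_eq_image_lineMap] at hz
    obtain ⟨l, ⟨hl0, hl1⟩, rfl⟩ := hz
    -- The normals scale with R as the edges do, so a step shorter than the parameter distances l
    -- and 1 - l to the ends of the edge stays inside the triangle.
    filter_upwards [Ioo_mem_nhdsGT (lt_min hl0 (sub_pos.2 hl1))] with s hs
    have h1 := hs.1
    have h2 := (lt_min_iff.1 hs.2).1
    have h3 := (lt_min_iff.1 hs.2).2
    have hsR := mul_pos h1 hR
    have hlR := mul_pos (sub_pos.2 h2) hR
    have hmR := mul_pos (sub_pos.2 h3) hR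
    have hl1R := mul_pos (sub_pos.2 hl1) hR
    rw [lineMap_eq]
    simp only [axisTriangle, mem_ofPred_eq, Prod.fst_add, Prod.snd_add, Prod.smul_fst, Prod.smul_snd, Prod.fst_sub,
      Prod.snd_sub, smul_eq_mul]
    rcases mem_axisTriangleEdges.1 he with rfl | rfl | rfl
    · refine ⟨⟨?_, ?_, ?_⟩, fun h => ?_⟩ <;> simp only at * <;> nlinarith
    · refine ⟨⟨?_, ?_, ?_⟩, fun h => ?_⟩ <;> simp only at * <;> nlinarith
    · refine ⟨⟨?_, ?_, ?_⟩, fun h => ?_⟩ <;> simp only at * <;> nlinarith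

/-! ### The measure on the axis and its mass -/

/-- The measure with density `trace²` on the `t`-axis. -/
noncomputable def traceMeasure (p : ℝ) (w : ℝ × ℝ → ℝ) : Measure ℝ :=
  volume.withDensity fun t => ENNReal.ofReal (trace p w (t / 2) ^ 2)

namespace IsWave

variable {p : ℝ} {w : ℝ × ℝ → ℝ}

theorem intervalIntegrable_trace_sq (h : IsWave p w) (hp : 3 ≤ p) (a b : ℝ) :
    IntervalIntegrable (fun t => trace p w (t / 2) ^ 2) volume a b := by
  have h1 : IntervalIntegrable (fun t => trace p w t ^ 2) volume (2⁻¹ * a) (2⁻¹ * b) := by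
    rw [intervalIntegrable_iff']
    refine (h.integrableOn_trace_sq hp (|2⁻¹ * a| + |2⁻¹ * b|)).mono_set (ordConnected_Icc.uIcc_subset ?_ ?_)
    · exact abs_le.1 (le_add_of_nonneg_right (abs_nonneg _))
    · exact abs_le.1 (le_add_of_nonneg_left (abs_nonneg _))
  have h2 := h1.comp_mul_left (c := 2⁻¹)
  simpa [div_eq_inv_mul] using h2

theorem traceMeasure_Ioc (h : IsWave p w) (hp : 3 ≤ p) {a b : ℝ} (hab : a ≤ b) :
    traceMeasure p w (Ioc a b) = ENNReal.ofReal (∫ t in a..b, trace p w (t / 2) ^ 2) := by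
  rw [traceMeasure, withDensity_apply _ measurableSet_Ioc, intervalIntegral.integral_of_le hab,
    ofReal_integral_eq_lintegral_ofReal
      ((intervalIntegrable_iff_integrableOn_Ioc_of_le hab).1 (h.intervalIntegrable_trace_sq hp a b))
      (ae_of_all _ fun _ => sq_nonneg _)]

theorem intervalIntegral_traceMeasure (h : IsWave p w) (hp : 3 ≤ p) (a b : ℝ) :
    ∫ _ in a..b, (1 : ℝ) ∂(traceMeasure p w) = ∫ t in a..b, trace p w (t / 2) ^ 2 := by
  have key : ∀ {a b : ℝ}, a ≤ b → ∫ _ in a..b, (1 : ℝ) ∂(traceMeasure p w) = ∫ t in a..b, trace p w (t / 2) ^ 2 := by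
    intro a b hab
    rw [intervalIntegral.integral_of_le hab, setIntegral_const, smul_eq_mul, mul_one, measureReal_def,
      h.traceMeasure_Ioc hp hab, ENNReal.toReal_ofReal]
    exact intervalIntegral.integral_nonneg hab fun _ _ => sq_nonneg _
  rcases le_total a b with hab | hab
  · exact key hab
  · rw [intervalIntegral.integral_symm, key hab, ← intervalIntegral.integral_symm]

theorem continuous_traceMeasure (h : IsWave p w) (hp : 3 ≤ p) (hf : traceMeasure p w univ ≠ ⊤) :
    Continuous fun t : ℝ => (traceMeasure p w).real (Iic t) := by
  have hm : Measurable fun t => trace p w (t / 2) ^ 2 :=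
    ((measurable_trace h.continuous).comp (measurable_id.div_const 2)).pow_const 2
  have hint : Integrable fun t => trace p w (t / 2) ^ 2 := by
    refine ⟨hm.aestronglyMeasurable, ?_⟩
    rw [hasFiniteIntegral_iff_ofReal (ae_of_all _ fun _ => sq_nonneg _)]
    rwa [traceMeasure, withDensity_apply _ MeasurableSet.univ, Measure.restrict_univ, ← lt_top_iff_ne_top] at hf
  have h1 : ∀ t, (traceMeasure p w).real (Iic t) = (∫ s in Iic (0 : ℝ), trace p w (s / 2) ^ 2)
      + ∫ s in (0 : ℝ)..t, trace p w (s / 2) ^ 2 := by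
    intro t
    rw [← intervalIntegral.integral_Iic_sub_Iic hint.integrableOn hint.integrableOn, add_sub_cancel,
      measureReal_def, traceMeasure, withDensity_apply _ measurableSet_Iic,
      ← ofReal_integral_eq_lintegral_ofReal hint.integrableOn (ae_of_all _ fun _ => sq_nonneg _),
      ENNReal.toReal_ofReal (integral_nonneg fun _ => sq_nonneg _)]
  simp_rw [h1]
  exact continuous_const.add (intervalIntegral.continuous_primitive (fun a b => h.intervalIntegrable_trace_sq hp a b) 0)

/-- In the flux identity on the triangle over [0, R] the term D² drops out on the characteristic
side and V enters there with a negative sign. The bulk integral is nonnegative. So the flux through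
the axis is at most the flux through the base. -/
theorem integral_trace_sq_le (h : IsWave p w) (hp : 3 ≤ p) (hp5 : p < 5) {R : ℝ} (hR : 0 < R) :
    ∫ t in (0 : ℝ)..R, trace p w (t / 2) ^ 2
      ≤ ∫ r in (0 : ℝ)..R, (closedInDeriv p w (r, 0) ^ 2 + wavePotential p w (r, 0)) := by
  obtain ⟨-, hg⟩ := h.green hp hp5 (isPolygonalRegion_axisTriangle 0 hR) (fun z hz => hz.1) (τ := 1) (by norm_num)
  have hts : ∀ z, timeScale 1 z = z := fun z => by simp [timeScale]
  rw [sum_axisTriangleEdges hR] at hg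
  simp only at hg
  rw [integral_closedForm_axis p hp w 1 (a := (0, 0 + R)) (b := (0, 0)) rfl rfl] at hg
  have h1 : 0 ≤ ∫ z in axisTriangle 0 R, waveBulk p w (timeScale 1 z) :=
    setIntegral_nonneg (isClosed_axisTriangle 0 R).measurableSet fun z hz => waveBulk_nonneg hz.1
  have h2 : 0 ≤ 2 * (p - 1) / (p + 1) := div_nonneg (by linarith) (by linarith)
  have h3 : ∫ s in (0 : ℝ)..1, closedForm p w 1 (R, 0) (0, 0 + R) s ≤ 0 := by
    rw [intervalIntegral.integral_of_le zero_le_one]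
    refine setIntegral_nonpos measurableSet_Ioc fun s hs => ?_
    have hz := lineMap_fst_nonneg (a := (R, 0)) (b := (0, 0 + R)) hR.le le_rfl (Ioc_subset_Icc_self hs)
    rw [closedForm, hts]
    have := mul_nonneg (wavePotential_nonneg (w := w) hp hz) hR.le
    simp only
    linarith
  have h4 : ∫ s in (0 : ℝ)..1, closedForm p w 1 (0, 0) (R, 0) s
      = ∫ r in (0 : ℝ)..R, (closedInDeriv p w (r, 0) ^ 2 + wavePotential p w (r, 0)) := by
    have h5 := intervalIntegral.mul_integral_comp_mul_left (a := 0) (b := 1)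
      (f := fun r => closedInDeriv p w (r, 0) ^ 2 + wavePotential p w (r, 0)) R
    rw [mul_zero, mul_one] at h5
    rw [← h5, ← intervalIntegral.integral_const_mul]
    refine intervalIntegral.integral_congr fun s _ => ?_
    simp only [closedForm, hts, lineMap_eq]
    rw [show (0 : ℝ) + s * (R - 0) = R * s by ring, show (0 : ℝ) + s * (0 - 0) = 0 by ring]
    ring
  rw [h4, zero_add, intervalIntegral.integral_symm 0 R] at hg
  simp only [one_mul] at hg
  have h6 := mul_nonneg h2 h1
  rw [zero_add] at h3
  linarith

theorem integral_trace_sq_le_slice (h : IsWave p w) (hp : 3 ≤ p) (hp5 : p < 5) {f g : ℝ → ℝ} (hs : IsSlice w 0 f g)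
    (hpot : IntegrableOn (fun r => wavePotential p w (r, 0)) (Ioi 0)) {R : ℝ} (hR : 0 < R) :
    ∫ t in (0 : ℝ)..R, trace p w (t / 2) ^ 2
      ≤ 2 * (∫ r in Ioi (0 : ℝ), f r ^ 2) + 2 * (∫ r in Ioi (0 : ℝ), g r ^ 2)
        + ∫ r in Ioi (0 : ℝ), wavePotential p w (r, 0) := by
  refine (h.integral_trace_sq_le hp hp5 hR).trans ?_
  have hi : IntegrableOn (fun r => 2 * f r ^ 2 + 2 * g r ^ 2 + wavePotential p w (r, 0)) (Ioi 0) :=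
    ((hs.sq_fst.const_mul 2).add (hs.sq_snd.const_mul 2)).add hpot
  have hfg : IntegrableOn (fun r => 2 * f r ^ 2 + 2 * g r ^ 2) (Ioi 0) :=
    (hs.sq_fst.const_mul 2).add (hs.sq_snd.const_mul 2)
  rw [intervalIntegral.integral_of_le hR.le, ← integral_const_mul, ← integral_const_mul,
    ← integral_add (hs.sq_fst.const_mul 2) (hs.sq_snd.const_mul 2), ← integral_add hfg hpot]
  have hpos : ∀ r ∈ Ioi (0 : ℝ), 0 ≤ wavePotential p w (r, 0) := fun r hr => wavePotential_nonneg hp (le_of_lt hr)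
  refine (integral_mono_of_nonneg ?_ (hi.mono_set Ioc_subset_Ioi_self) ?_).trans
    (setIntegral_mono_set hi ?_ (LE.le.eventuallyLE Ioc_subset_Ioi_self))
  · refine (ae_restrict_iff' measurableSet_Ioc).2 (ae_of_all _ fun r hr => ?_)
    exact add_nonneg (sq_nonneg _) (hpos r hr.1)
  · refine (ae_restrict_iff' measurableSet_Ioc).2 ?_
    filter_upwards [h.hasLineDerivAt_slice hp hs] with r hr hrI
    have h1 : closedInDeriv p w (r, 0) = f r + g r := by
      rw [closedInDeriv_of_ne p w (z := (r, 0)) hrI.1.ne']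
      exact (hr hrI.1).lineDeriv
    simp only [h1]
    nlinarith [sq_nonneg (f r - g r)]
  · refine (ae_restrict_iff' measurableSet_Ioi).2 (ae_of_all _ fun r hr => ?_)
    have := hpos r hr
    simp only [Pi.zero_apply]
    positivity

/-- Positive times are covered by the first bound; negative times become positive under time
reversal, and `trace_timeReverse` identifies the two densities. -/
theorem traceMeasure_univ_le (h : IsWave p w) (hp : 3 ≤ p) {K : ℝ}
    (h1 : ∀ R, 0 < R → ∫ t in (0 : ℝ)..R, trace p w (t / 2) ^ 2 ≤ K)
    (h2 : ∀ R, 0 < R → ∫ t in (0 : ℝ)..R, trace p (RadialWave.timeReverse w) (t / 2) ^ 2 ≤ K) :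
    traceMeasure p w univ ≤ ENNReal.ofReal (2 * K) := by
  have hmono : Monotone fun n : ℕ => Ioc (-((n : ℝ) + 1)) ((n : ℝ) + 1) := by
    intro m n hmn
    have : (m : ℝ) ≤ n := by exact_mod_cast hmn
    exact Ioc_subset_Ioc (by linarith) (by linarith)
  have huniv : ⋃ n : ℕ, Ioc (-((n : ℝ) + 1)) ((n : ℝ) + 1) = univ := by
    refine eq_univ_of_forall fun x => ?_
    obtain ⟨n, hn⟩ := exists_nat_gt |x|
    exact mem_iUnion.2 ⟨n, by linarith [neg_abs_le x], by linarith [le_abs_self x]⟩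
  rw [← huniv, hmono.measure_iUnion]
  refine iSup_le fun n => ?_
  have hn : 0 < (n : ℝ) + 1 := Nat.cast_add_one_pos n
  rw [h.traceMeasure_Ioc hp (by linarith)]
  refine ENNReal.ofReal_le_ofReal ?_
  rw [← intervalIntegral.integral_add_adjacent_intervals (h.intervalIntegrable_trace_sq hp _ 0)
    (h.intervalIntegrable_trace_sq hp 0 _)]
  have e : ∫ t in (-((n : ℝ) + 1))..0, trace p w (t / 2) ^ 2
      = ∫ t in (0 : ℝ)..((n : ℝ) + 1), trace p (RadialWave.timeReverse w) (t / 2) ^ 2 := by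
    rw [← neg_zero, ← intervalIntegral.integral_comp_neg, neg_zero]
    refine intervalIntegral.integral_congr_ae ?_
    filter_upwards [ae_affine (c := -2⁻¹) (by norm_num) 0 (h.trace_timeReverse hp)] with t ht _
    rw [show -t / 2 = -2⁻¹ * t + 0 by ring, ← ht]
    congr 2
    ring
  rw [e]
  linarith [h1 _ hn, h2 _ hn]

end IsWave

/-! ### Translation to u and conclusion -/

theorem timeReverse_add_smul (w : ℝ × ℝ → ℝ) (z : ℝ × ℝ) :
    (fun s : ℝ => timeReverse w ((z.1, -z.2) + s • (1, 1))) = fun s : ℝ => w (z + s • (1, -1)) := by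
  funext s
  refine congrArg w (Prod.ext ?_ ?_) <;> simp
  ring

theorem hasLineDerivAt_timeReverse {w : ℝ × ℝ → ℝ} {z : ℝ × ℝ} {c : ℝ} :
    HasLineDerivAt ℝ (timeReverse w) c (z.1, -z.2) (1, 1) ↔ HasLineDerivAt ℝ w c z (1, -1) := by
  rw [HasLineDerivAt, HasLineDerivAt, timeReverse_add_smul]

theorem inDeriv_timeReverse (w : ℝ × ℝ → ℝ) (z : ℝ × ℝ) :
    inDeriv (timeReverse w) (z.1, -z.2) = lineDeriv ℝ w z (1, -1) := by
  rw [inDeriv, lineDeriv, lineDeriv, timeReverse_add_smul]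

theorem wavePotential_timeReverse (p : ℝ) (w : ℝ × ℝ → ℝ) (z : ℝ × ℝ) :
    wavePotential p (timeReverse w) (z.1, -z.2) = wavePotential p w z := by
  simp [wavePotential, timeReverse]

theorem waveBulk_timeReverse (p : ℝ) (w : ℝ × ℝ → ℝ) (z : ℝ × ℝ) :
    waveBulk p (timeReverse w) (z.1, -z.2) = waveBulk p w z := by
  simp [waveBulk, timeReverse]

theorem timeScale_one (z : ℝ × ℝ) : timeScale 1 z = z := by simp [timeScale]

theorem timeScale_neg_one (z : ℝ × ℝ) : timeScale (-1) z = (z.1, -z.2) := by simp [timeScale]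

theorem inwardForm_eq (p : ℝ) (u : Space → ℝ → ℝ) (a b : ℝ × ℝ) :
    inwardForm p u a b = waveForm p (reduced u) 1 a b := by
  funext s
  rw [waveForm, timeScale_one]
  change (inDeriv (reduced u) _ ^ 2 + wavePotential p (reduced u) _) * _
    + (inDeriv (reduced u) _ ^ 2 - wavePotential p (reduced u) _) * _ = _
  ring

theorem outwardForm_eq (p : ℝ) (u : Space → ℝ → ℝ) (a b : ℝ × ℝ) :
    outwardForm p u a b = waveForm p (timeReverse (reduced u)) (-1) a b := by
  funext s
  rw [waveForm, timeScale_neg_one, inDeriv_timeReverse, wavePotential_timeReverse]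
  change (lineDeriv ℝ (reduced u) _ _ ^ 2 + wavePotential p (reduced u) _) * _
    + (-lineDeriv ℝ (reduced u) _ _ ^ 2 + wavePotential p (reduced u) _) * _ = _
  ring

theorem inwardLineAxis_eq {p : ℝ} (hp : 3 ≤ p) {u : Space → ℝ → ℝ} (h : IsWave p (reduced u)) (a b : ℝ × ℝ) :
    inwardLineAxis p u (traceMeasure p (reduced u)) a b
      = ∫ s in (0 : ℝ)..1, closedForm p (reduced u) 1 a b s := by
  unfold inwardLineAxis
  split_ifs with h0
  · rw [IsWave.integral_closedForm_axis p hp _ _ h0.1 h0.2, h.intervalIntegral_traceMeasure hp]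
    simp only [one_mul]
  · rw [inwardLine, inwardForm_eq]
    refine intervalIntegral.integral_congr_ae ?_
    filter_upwards [waveForm_ae_eq p (reduced u) 1 h0] with s hs _ using hs

/-- On the axis the reversed function enters with its own trace. `trace_timeReverse` shows that its
square gives the same measure, which is why a single μ serves both identities. -/
theorem outwardLineAxis_eq {p : ℝ} (hp : 3 ≤ p) {u : Space → ℝ → ℝ} (h : IsWave p (reduced u)) (a b : ℝ × ℝ) :
    outwardLineAxis p u (traceMeasure p (reduced u)) a b
      = ∫ s in (0 : ℝ)..1, closedForm p (timeReverse (reduced u)) (-1) a b s := by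
  unfold outwardLineAxis
  split_ifs with h0
  · rw [IsWave.integral_closedForm_axis p hp _ _ h0.1 h0.2, h.intervalIntegral_traceMeasure hp, neg_one_mul, neg_inj]
    refine intervalIntegral.integral_congr_ae ?_
    filter_upwards [ae_affine (c := 2⁻¹) (by norm_num) 0 (h.trace_timeReverse hp)] with t ht _
    rw [show t / 2 = 2⁻¹ * t + 0 by ring, ← ht]
    congr 2
    ring
  · rw [outwardLine, outwardForm_eq]
    refine intervalIntegral.integral_congr_ae ?_
    filter_upwards [waveForm_ae_eq p (timeReverse (reduced u)) (-1) h0] with s hs _ using hs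

namespace IsRadialSolution

variable {p : ℝ} {u : Space → ℝ → ℝ} {Du : Space → ℝ → Space} {ut : Space → ℝ → ℝ}

theorem hasLineDerivAt (h : IsRadialSolution p u Du ut) (hp : 3 ≤ p) (t : ℝ) : ∀ᵐ x : Space,
    HasLineDerivAt ℝ (reduced u) (u x t + inner ℝ (Du x t) x + ‖x‖ * ut x t) (‖x‖, t) (1, 1) ∧
    HasLineDerivAt ℝ (reduced u) (u x t + inner ℝ (Du x t) x - ‖x‖ * ut x t) (‖x‖, t) (1, -1) := by
  obtain ⟨g, k, hg, hk, hs, -⟩ := h.exists_isSlice t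
  have hw := h.isWave hp
  have h1 : ∀ᵐ x : Space, HasLineDerivAt ℝ (reduced u) (reduced u (‖x‖, t) / ‖x‖ + ‖x‖ * g ‖x‖ + ‖x‖ * k ‖x‖)
      (‖x‖, t) (1, 1) := by
    refine (ae_norm_iff (Q := fun r => HasLineDerivAt ℝ (reduced u) (reduced u (r, t) / r + r * g r + r * k r)
      (r, t) (1, 1))).2 ((ae_restrict_iff' measurableSet_Ioi).2 ?_)
    filter_upwards [hw.hasLineDerivAt_slice hp hs] with r hr hr0 using hr hr0
  have h2 : ∀ᵐ x : Space, HasLineDerivAt ℝ (reduced u) (reduced u (‖x‖, t) / ‖x‖ + ‖x‖ * g ‖x‖ + -(‖x‖ * k ‖x‖))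
      (‖x‖, t) (1, -1) := by
    refine (ae_norm_iff (Q := fun r => HasLineDerivAt ℝ (reduced u) (reduced u (r, t) / r + r * g r + -(r * k r))
      (r, t) (1, -1))).2 ((ae_restrict_iff' measurableSet_Ioi).2 ?_)
    filter_upwards [(hw.timeReverse hp).hasLineDerivAt_slice hp hs.timeReverse] with r hr hr0
    exact (hasLineDerivAt_timeReverse (z := (r, t))).1 (hr hr0)
  filter_upwards [h1, h2, hg, hk, ae_ne_zero_space] with x h1 h2 hg hk hx
  have e : reduced u (‖x‖, t) / ‖x‖ = u x t := by
    rw [reduced_eq, h.eq_prof x t, mul_div_cancel_left₀ _ (norm_ne_zero_iff.2 hx)]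
  rw [e, ← hg, ← hk] at h1 h2
  exact ⟨h1, by rwa [sub_eq_add_neg]⟩

theorem integrable_abs_rpow (h : IsRadialSolution p u Du ut) (hp : 3 ≤ p) :
    Integrable fun x => |u x 0| ^ (p + 1) := by
  have hp1 : 0 < p + 1 := by linarith
  have := h.finite_energy.integrable_norm_rpow (by simpa using hp1) ENNReal.ofReal_ne_top
  rwa [ENNReal.toReal_ofReal hp1.le] at this

theorem energy_eq (h : IsRadialSolution p u Du ut) (hp : 3 ≤ p) :
    energy p u Du ut = 1 / 2 * (∫ x, ‖Du x 0‖ ^ 2) + 1 / 2 * (∫ x, ut x 0 ^ 2)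
      + 1 / (p + 1) * ∫ x, |u x 0| ^ (p + 1) := by
  have hD : Integrable fun x => ‖Du x 0‖ ^ 2 := (h.memLp_gradient 0).integrable_norm_pow (by norm_num)
  have hT := h.integrable_timeDeriv_sq 0
  have hU := h.integrable_abs_rpow hp
  have hDT : Integrable fun x => 1 / 2 * ‖Du x 0‖ ^ 2 + 1 / 2 * ut x 0 ^ 2 :=
    (hD.const_mul _).add (hT.const_mul _)
  simp only [energy, sq_abs]
  rw [integral_add hDT (hU.const_mul _), integral_add (hD.const_mul _) (hT.const_mul _), integral_const_mul,
    integral_const_mul, integral_const_mul]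

theorem wavePotential_eq {r : ℝ} (hr : 0 < r) (t : ℝ) (p : ℝ) (u : Space → ℝ → ℝ) :
    wavePotential p (reduced u) (r, t) = 2 / (p + 1) * (r ^ 2 * |prof u r t| ^ (p + 1)) := by
  rw [wavePotential, reduced_eq, abs_mul, abs_of_pos hr, Real.mul_rpow hr.le (abs_nonneg _)]
  have : r ^ (p + 1) = r ^ 2 * r ^ (p - 1) := by
    rw [← Real.rpow_natCast, ← Real.rpow_add hr]
    congr 1
    push_cast
    ring
  rw [this]
  have h1 := (Real.rpow_pos_of_pos hr (p - 1)).ne'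
  field_simp

theorem wavePotential_zero (h : IsRadialSolution p u Du ut) (hp : 3 ≤ p) :
    IntegrableOn (fun r => wavePotential p (reduced u) (r, 0)) (Ioi 0) ∧
      ∫ r in Ioi (0 : ℝ), wavePotential p (reduced u) (r, 0)
        = 2 / (p + 1) * (sphereArea⁻¹ * ∫ x, |u x 0| ^ (p + 1)) := by
  have hU := h.integrable_abs_rpow hp
  have e : (fun x => |u x 0| ^ (p + 1)) = fun x : Space => (fun r => |prof u r 0| ^ (p + 1)) ‖x‖ :=
    funext fun x => by rw [h.eq_prof x 0]
  rw [e] at hU ⊢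
  have hi := (integrable_norm_iff (f := fun r => |prof u r 0| ^ (p + 1))).1 hU
  constructor
  · refine (hi.const_mul (2 / (p + 1))).congr ((ae_restrict_iff' measurableSet_Ioi).2 (ae_of_all _ fun r hr => ?_))
    exact (wavePotential_eq hr 0 p u).symm
  · rw [integral_norm (fun r => |prof u r 0| ^ (p + 1)), inv_mul_cancel_left₀ sphereArea_pos.ne', ← integral_const_mul]
    exact setIntegral_congr_fun measurableSet_Ioi fun r hr => wavePotential_eq hr 0 p u

/-- The base of the triangle carries (f + g)² ≤ 2f² + 2g² and the potential. With the Hardy-type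
constant 1 this is at most 4/`sphereArea` times the energy, and the two time directions double it to
8. -/
theorem traceMeasure_univ_le (h : IsRadialSolution p u Du ut) (hp : 3 ≤ p) (hp5 : p < 5) :
    traceMeasure p (reduced u) univ ≤ ENNReal.ofReal (8 / sphereArea * energy p u Du ut) := by
  obtain ⟨g, k, hg, hk, hs, hle⟩ := h.exists_isSlice 0
  have hw := h.isWave hp
  have hw' := hw.timeReverse hp
  have hs' := hs.timeReverse
  rw [neg_zero] at hs'
  obtain ⟨hpi, hpe⟩ := h.wavePotential_zero hp
  have hpi' : (fun r => wavePotential p (timeReverse (reduced u)) (r, 0))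
      = fun r => wavePotential p (reduced u) (r, 0) := funext fun r => by
    simpa using wavePotential_timeReverse p (reduced u) (r, 0)
  have hf : ∫ r in Ioi (0 : ℝ), (reduced u (r, 0) / r + r * g r) ^ 2 ≤ sphereArea⁻¹ * ∫ x, ‖Du x 0‖ ^ 2 := by
    rw [← ofReal_integral_eq_lintegral_ofReal hs.sq_fst (ae_of_all _ fun _ => sq_nonneg _)] at hle
    exact (ENNReal.ofReal_le_ofReal_iff (mul_nonneg (inv_nonneg.2 sphereArea_pos.le)
      (integral_nonneg fun _ => sq_nonneg _))).1 hle
  have hkk : ∫ r in Ioi (0 : ℝ), (r * k r) ^ 2 = sphereArea⁻¹ * ∫ x, ut x 0 ^ 2 := by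
    simp only [mul_pow]
    exact (h.timeDeriv_profile_sq hk).2
  have hE : 2 * (sphereArea⁻¹ * ∫ x, ‖Du x 0‖ ^ 2) + 2 * (sphereArea⁻¹ * ∫ x, ut x 0 ^ 2)
      + 2 / (p + 1) * (sphereArea⁻¹ * ∫ x, |u x 0| ^ (p + 1)) ≤ 4 / sphereArea * energy p u Du ut := by
    have h1 : 0 ≤ 1 / (p + 1) * (sphereArea⁻¹ * ∫ x, |u x 0| ^ (p + 1)) :=
      mul_nonneg (div_nonneg zero_le_one (by linarith)) (mul_nonneg (inv_nonneg.2 sphereArea_pos.le)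
        (integral_nonneg fun _ => Real.rpow_nonneg (abs_nonneg _) _))
    rw [h.energy_eq hp]
    have h2 : 4 / sphereArea * (1 / 2 * (∫ x, ‖Du x 0‖ ^ 2) + 1 / 2 * (∫ x, ut x 0 ^ 2)
        + 1 / (p + 1) * ∫ x, |u x 0| ^ (p + 1))
        = 2 * (sphereArea⁻¹ * ∫ x, ‖Du x 0‖ ^ 2) + 2 * (sphereArea⁻¹ * ∫ x, ut x 0 ^ 2)
          + 4 * (1 / (p + 1) * (sphereArea⁻¹ * ∫ x, |u x 0| ^ (p + 1))) := by
      rw [div_eq_mul_inv 4 sphereArea]; ring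
    have h3 : 2 / (p + 1) * (sphereArea⁻¹ * ∫ x, |u x 0| ^ (p + 1))
        = 2 * (1 / (p + 1) * (sphereArea⁻¹ * ∫ x, |u x 0| ^ (p + 1))) := by ring
    rw [h2, h3]
    linarith
  have key := hw.traceMeasure_univ_le hp (K := 4 / sphereArea * energy p u Du ut)
    (fun R hR => (hw.integral_trace_sq_le_slice hp hp5 hs hpi hR).trans (by rw [hkk, hpe]; linarith))
    (fun R hR => (hw'.integral_trace_sq_le_slice hp hp5 hs' (by rwa [hpi']) hR).trans
      (by simp only [neg_sq]; rw [hkk, hpi', hpe]; linarith))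
  refine key.trans (le_of_eq ?_)
  congr 1
  ring

theorem green (h : IsRadialSolution p u Du ut) (hp : 3 ≤ p) (hp5 : p < 5) {Ω : Set (ℝ × ℝ)}
    {Γ : Finset ((ℝ × ℝ) × (ℝ × ℝ))} (hΓ : IsPolygonalRegion Ω Γ) (h0 : ∀ z ∈ Ω, 0 ≤ z.1) :
    IntegrableOn (bulk p u) Ω ∧
    Real.pi * ∑ e ∈ Γ, inwardLineAxis p u (traceMeasure p (reduced u)) e.1 e.2
      - 2 * Real.pi * (p - 1) / (p + 1) * ∫ z in Ω, bulk p u z = 0 ∧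
    Real.pi * ∑ e ∈ Γ, outwardLineAxis p u (traceMeasure p (reduced u)) e.1 e.2
      + 2 * Real.pi * (p - 1) / (p + 1) * ∫ z in Ω, bulk p u z = 0 := by
  have hw := h.isWave hp
  obtain ⟨hi, h1⟩ := hw.green hp hp5 hΓ h0 (τ := 1) (by norm_num)
  obtain ⟨-, h2⟩ := (hw.timeReverse hp).green hp hp5 hΓ h0 (τ := -1) (by norm_num)
  simp only [timeScale_one] at hi h1
  simp only [timeScale_neg_one, waveBulk_timeReverse] at h2
  simp only [inwardLineAxis_eq hp hw, outwardLineAxis_eq hp hw]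
  refine ⟨hi, ?_, ?_⟩
  · rw [h1]
    change _ - _ * ∫ z in Ω, waveBulk p (reduced u) z = 0
    ring
  · rw [h2]
    change _ + _ * ∫ z in Ω, waveBulk p (reduced u) z = 0
    ring

end IsRadialSolution

/-- The flux through the axis is determined by the flux identity on triangles. -/
theorem measure_eq_of_flux {p : ℝ} {u : Space → ℝ → ℝ} {μ ν : Measure ℝ} [IsFiniteMeasure μ] [IsFiniteMeasure ν]
    (h : ∀ t₀ R : ℝ, 0 < R → ∑ e ∈ axisTriangleEdges t₀ R, inwardLineAxis p u μ e.1 e.2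
      = ∑ e ∈ axisTriangleEdges t₀ R, inwardLineAxis p u ν e.1 e.2) : μ = ν := by
  refine Measure.ext_of_Ioc μ ν fun a b hab => ?_
  have h1 := h a (b - a) (sub_pos.2 hab)
  rw [sum_axisTriangleEdges (sub_pos.2 hab), sum_axisTriangleEdges (sub_pos.2 hab)] at h1
  -- The base and the characteristic side do not lie on the axis, so their contributions do not
  -- involve the measure and cancel. What remains is the mass of the interval.
  simp only [inwardLineAxis, (sub_pos.2 hab).ne', and_false, false_and, and_self, if_true, if_false,
    add_right_inj, add_sub_cancel, intervalIntegral.integral_of_ge hab.le, neg_inj, setIntegral_const, smul_eq_mul,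
    mul_one] at h1
  exact (measureReal_eq_measureReal_iff).1 h1

end RadialWave

open RadialWave in
theorem mainTheorem3 (p : ℝ) (hp3 : 3 ≤ p) (hp5 : p < 5) :
    ∃ C : ℝ, 0 < C ∧
    ∀ (u : Space → ℝ → ℝ) (Du : Space → ℝ → Space) (ut : Space → ℝ → ℝ),
      IsRadialSolution p u Du ut →
      -- the derivatives of `w` along the characteristic directions are `w_r ± w_t` at every time
      (∀ t : ℝ, ∀ᵐ x : Space,
        HasLineDerivAt ℝ (reduced u) (u x t + inner ℝ (Du x t) x + ‖x‖ * ut x t) (‖x‖, t) (1, 1) ∧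
        HasLineDerivAt ℝ (reduced u) (u x t + inner ℝ (Du x t) x - ‖x‖ * ut x t)
          (‖x‖, t) (1, -1)) ∧
      -- all line integrals off the `t`-axis are well defined
      (∀ a b : ℝ × ℝ, IsAdmissibleSegment a b → 0 ≤ a.1 → 0 ≤ b.1 → ¬ (a.1 = 0 ∧ b.1 = 0) →
        (a.2 + a.1 ≠ b.2 + b.1 → ∀ᵐ s ∂(volume.restrict (Icc (0 : ℝ) 1)),
          LineDifferentiableAt ℝ (reduced u) (AffineMap.lineMap a b s) (1, 1)) ∧
        (a.2 - a.1 ≠ b.2 - b.1 → ∀ᵐ s ∂(volume.restrict (Icc (0 : ℝ) 1)),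
          LineDifferentiableAt ℝ (reduced u) (AffineMap.lineMap a b s) (1, -1)) ∧
        IntervalIntegrable (inwardForm p u a b) volume 0 1 ∧
        IntervalIntegrable (outwardForm p u a b) volume 0 1) ∧
      -- regions in the open half plane
      (∀ (Ω : Set (ℝ × ℝ)) (Γ : Finset ((ℝ × ℝ) × (ℝ × ℝ))), IsPolygonalRegion Ω Γ →
        (∀ z ∈ Ω, 0 < z.1) →
        IntegrableOn (bulk p u) Ω ∧
        Real.pi * ∑ e ∈ Γ, inwardLine p u e.1 e.2
          - 2 * Real.pi * (p - 1) / (p + 1) * ∫ z in Ω, bulk p u z = 0 ∧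
        Real.pi * ∑ e ∈ Γ, outwardLine p u e.1 e.2
          + 2 * Real.pi * (p - 1) / (p + 1) * ∫ z in Ω, bulk p u z = 0) ∧
      -- the measure on the `t`-axis and regions in the closed half plane
      (∃! μ : Measure ℝ, IsFiniteMeasure μ ∧ Continuous (fun t : ℝ => μ.real (Iic t)) ∧
        μ univ ≤ ENNReal.ofReal (C * energy p u Du ut) ∧
        ∀ (Ω : Set (ℝ × ℝ)) (Γ : Finset ((ℝ × ℝ) × (ℝ × ℝ))), IsPolygonalRegion Ω Γ →
          (∀ z ∈ Ω, 0 ≤ z.1) →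
          IntegrableOn (bulk p u) Ω ∧
          Real.pi * ∑ e ∈ Γ, inwardLineAxis p u μ e.1 e.2
            - 2 * Real.pi * (p - 1) / (p + 1) * ∫ z in Ω, bulk p u z = 0 ∧
          Real.pi * ∑ e ∈ Γ, outwardLineAxis p u μ e.1 e.2
            + 2 * Real.pi * (p - 1) / (p + 1) * ∫ z in Ω, bulk p u z = 0) := by
  have hlin : ∀ {a b : ℝ × ℝ}, a.2 + a.1 ≠ b.2 + b.1 → a.1 + a.2 ≠ b.1 + b.2 := fun h h' => h (by linarith)
  refine ⟨8 / sphereArea, div_pos (by norm_num) sphereArea_pos, fun u Du ut h => ?_⟩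
  have hw := h.isWave hp3
  have hw' := hw.timeReverse hp3
  have hmass := h.traceMeasure_univ_le hp3 hp5
  have hfin : IsFiniteMeasure (traceMeasure p (reduced u)) := ⟨hmass.trans_lt ENNReal.ofReal_lt_top⟩
  refine ⟨h.hasLineDerivAt hp3, fun a b hab ha hb h0 => ⟨fun hne => ?_, fun hne => ?_, ?_, ?_⟩,
    fun Ω Γ hΓ hΩ => ?_, traceMeasure p (reduced u), ⟨hfin, ?_, hmass, fun Ω Γ hΓ hΩ => h.green hp3 hp5 hΓ hΩ⟩, ?_⟩
  · exact hw.lineDifferentiableAt_segment hp3 ha hb (hlin hne) h0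
  · have h1 := hw'.lineDifferentiableAt_segment hp3 (a := timeScale (-1) a) (b := timeScale (-1) b) ha hb
      (fun h1 => hne (by simp only [timeScale] at h1; linarith)) h0
    filter_upwards [h1] with s hs
    rw [← timeScale_lineMap, timeScale_neg_one] at hs
    exact (hasLineDerivAt_timeReverse.1 hs.hasLineDerivAt).lineDifferentiableAt
  · rw [inwardForm_eq]
    refine (hw.intervalIntegrable_closedForm hp3 hp5 1 ha hb).congr_ae (ae_restrict_of_ae ?_)
    filter_upwards [waveForm_ae_eq p (reduced u) 1 h0] with s hs using hs.symm
  · rw [outwardForm_eq]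
    refine (hw'.intervalIntegrable_closedForm hp3 hp5 (-1) ha hb).congr_ae (ae_restrict_of_ae ?_)
    filter_upwards [waveForm_ae_eq p (timeReverse (reduced u)) (-1) h0] with s hs using hs.symm
  -- A region in the open half plane has no edge on the axis, so this is the closed case with
  -- ordinary line integrals.
  · have h1 := h.green hp3 hp5 hΓ fun z hz => (hΩ z hz).le
    have hne : ∀ e ∈ Γ, ¬ (e.1.1 = 0 ∧ e.2.1 = 0) := fun e he h2 =>
      (hΩ _ (hΓ.segment_subset he (left_mem_segment ℝ _ _))).ne' h2.1
    have hin : ∑ e ∈ Γ, inwardLineAxis p u (traceMeasure p (reduced u)) e.1 e.2 = ∑ e ∈ Γ, inwardLine p u e.1 e.2 :=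
      Finset.sum_congr rfl fun e he => if_neg (hne e he)
    have hout : ∑ e ∈ Γ, outwardLineAxis p u (traceMeasure p (reduced u)) e.1 e.2 = ∑ e ∈ Γ, outwardLine p u e.1 e.2 :=
      Finset.sum_congr rfl fun e he => if_neg (hne e he)
    rwa [hin, hout] at h1
  · exact hw.continuous_traceMeasure hp3 (measure_ne_top _ _)
  · rintro ν ⟨hν, -, -, hνG⟩
    refine measure_eq_of_flux (p := p) (u := u) fun t₀ R hR => ?_
    have h1 := (hνG _ _ (isPolygonalRegion_axisTriangle t₀ hR) fun z hz => hz.1).2.1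
    have h2 := (h.green hp3 hp5 (isPolygonalRegion_axisTriangle t₀ hR) fun z hz => hz.1).2.1
    exact mul_left_cancel₀ Real.pi_ne_zero (sub_left_injective (h1.trans h2.symm))
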